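/- **Setting.** Let $G=\widetilde{\mathrm{SL}}(2,\mathbb R)\times\mathbb R$, the simply connected Lie group with Lie algebra $\mathfrak{sl}(2,\mathbb R)\times\mathbb R$. Put $H=\begin{pmatrix}1&0\\0&-1\end{pmatrix}$, $P=\begin{pmatrix}0&1\\1&0\end{pmatrix}$, $R=\begin{pmatrix}0&1\\-1&0\end{pmatrix}$, and let $T$ be the generator of the factor $\mathbb R$. For $\lambda\in\mathbb R$ let $J_\lambda$ be the left-invariant complex structure on $G$ with $J_\lambda H=P$ and $J_\lambda(R-\lambda T)=T$. Equivalently, $G$ has a left-invariant $(1,0)$-frame $Z_1,Z_2$ with $[Z_1,Z_2]=[Z_1,\bar Z_2]=\sqrt{-1}\,Z_1$, $[Z_2,\bar Z_2]=0$ and $[Z_1,\bar Z_1]=(-\lambda+\sqrt{-1})Z_2+(\lambda+\sqrt{-1})\bar Z_2$. Let $X=\Gamma\backslash(G,J_\lambda)$ be a compact quotient by a discrete subgroup $\Gamma\subset G$ (a non-Kähler properly elliptic surface), and let $\pi:X\to C$ be its elliptic fibration: a surjective holomorphic map with connected fibres onto a complex curve $C$, the base curve, whose smooth fibres are elliptic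 curves. A Hermitian metric on $X$ is called locally homogeneous if its pull-back to $G$ is left-invariant. The Hermitian curvature flow (HCF) is $\partial_t g=-S(g)+Q(g)$. Here $S_{i\bar j}=g^{\bar\ell k}\Omega_{k\bar\ell i\bar j}$ is the second Chern–Ricci curvature, $Q=\tfrac12Q^1-\tfrac14Q^2-\tfrac12Q^3+Q^4$, and, with $T$ now denoting the torsion of the Chern connection, $$Q^1_{i\bar j}=g^{\bar\ell k}g^{\bar qm}T_{ik\bar q}T_{\bar j\bar\ell m},\qquad Q^2_{i\bar j}=g^{\bar\ell k}g^{\bar qm}T_{km\bar j}T_{\bar\ell\bar qi},\qquad Q^3_{i\bar j}=g^{\bar\ell k}g^{\bar qm}T_{ik\bar\ell}T_{\bar j\bar qm},$$ $$Q^4_{i\bar j}=\tfrac12g^{\bar\ell k}g^{\bar qm}\bigl(T_{mk\bar\ell}T_{\bar q\bar ji}+T_{\bar q\bar\ell k}T_{mi\bar j}\bigr).$$ **Statement.** Let $g_0$ be a locally homogeneous Hermitian metric on $X$. Then there is a locally homogeneous solution $g(t)$ of the HCF with $g(0)=g_0$ that exists for all $t\ge 0$. The curve $C$ carries a unique Kähler–Einstein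 metric $g_{KE}$ with $\mathrm{Ric}(g_{KE})=-g_{KE}$. For every locally homogeneous solution $g(t)$, $t\in[0,\infty)$, of the HCF with $g(0)=g_0$, $$\bigl(X,(1+t)^{-1}g(t)\bigr)\longrightarrow (C,g_{KE})\quad\text{in the Gromov–Hausdorff sense as } t\to\infty .$$ If $\pi$ has no multiple fibres, $g_{KE}$ is a smooth Kähler–Einstein metric on $C$. If $\pi$ has multiple fibres, "Kähler–Einstein metric on $C$" is understood in the orbifold sense: a smooth Kähler metric with $\mathrm{Ric}=-g$ off the critical values of $\pi$, whose pull-back by $\pi$ extends to a smooth nowhere vanishing form on $X$ (that is, with cone angle $2\pi/m$ under a fibre of multiplicity $m$). -/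

import Mathlib

open Set Filter Topology Matrix
open scoped Manifold ContDiff ENNReal ComplexConjugate

noncomputable section

/-! ## Hermitian geometry on complex manifolds

A complex manifold of dimension `n` is a `ChartedSpace (Cn n) M` with `IsManifold 𝓘(ℂ, Cn n) ω M`.
Its real tangent spaces are `TangentSpace 𝓘(ℝ, Cn n) x`. -/

/-- The model space `ℂⁿ`. -/
abbrev Cn (n : ℕ) : Type := EuclideanSpace ℂ (Fin n)

section Hermitian

variable {n : ℕ} {M : Type*} [TopologicalSpace M] [ChartedSpace (Cn n) M]

/-- The complex structure `J` of a complex manifold, acting on the real tangent space at `x`: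
multiplication by `i` in the chart at `x` (in every holomorphic chart this is the same map). -/
def cplxJ (x : M) (v : TangentSpace 𝓘(ℝ, Cn n) x) : TangentSpace 𝓘(ℝ, Cn n) x :=
  let w : Cn n := v
  Complex.I • w

variable (n M) in
/-- Fields of real bilinear forms on the tangent spaces (no regularity or symmetry). -/
abbrev BilinField : Type _ :=
  (x : M) → TangentSpace 𝓘(ℝ, Cn n) x →L[ℝ] TangentSpace 𝓘(ℝ, Cn n) x →L[ℝ] ℝ

/-- The vector `v ∈ ℂⁿ` at the point `z` of the chart around `x₀`, as a tangent vector of `M`. -/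
def chartVec (x₀ : M) (z v : Cn n) :
    TangentSpace 𝓘(ℝ, Cn n) ((chartAt (Cn n) x₀).symm z) :=
  mfderiv 𝓘(ℝ, Cn n) 𝓘(ℝ, Cn n) (chartAt (Cn n) x₀).symm z v

/-- The `i`-th standard basis vector of `ℂⁿ`. -/
def stdVec (i : Fin n) : Cn n := EuclideanSpace.single i 1

/-- The components `g_{i j̄} = g(∂_i, ∂_j̄)` in the chart around `x₀`, as a function on (the target
of) the chart. Here `g` is extended complex bilinearly, `∂_i = (e_i - √-1 J e_i) / 2` and
`∂_j̄ = (e_j + √-1 J e_j) / 2`, so that `g_{i j̄} = (g(e_i, e_j) + √-1 g(e_i, J e_j)) / 2` whenever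
`g` is `J`-invariant. -/
def hcoeff (g : BilinField n M) (x₀ : M) (z : Cn n) : Matrix (Fin n) (Fin n) ℂ :=
  Matrix.of fun i j =>
    ((g ((chartAt (Cn n) x₀).symm z) (chartVec x₀ z (stdVec i)) (chartVec x₀ z (stdVec j)) : ℂ)
      + Complex.I *
        (g ((chartAt (Cn n) x₀).symm z) (chartVec x₀ z (stdVec i))
          (cplxJ _ (chartVec x₀ z (stdVec j))) : ℂ)) / 2

/-- `g` is, on the set `U`, a smooth symmetric `J`-invariant form. -/
structure IsHermitianFormOn (g : BilinField n M) (U : Set M) : Prop where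
  symm : ∀ x ∈ U, ∀ v w, g x v w = g x w v
  J_inv : ∀ x ∈ U, ∀ v w, g x (cplxJ x v) (cplxJ x w) = g x v w
  smooth : ∀ x ∈ U, ∀ i j,
    ContDiffAt ℝ ∞ (fun z => hcoeff g x z i j) (chartAt (Cn n) x x)

/-- `g` is, on the set `U`, a smooth Hermitian metric: a `J`-invariant Riemannian metric. -/
structure IsHermitianMetricOn (g : BilinField n M) (U : Set M) : Prop
    extends IsHermitianFormOn g U where
  pos : ∀ x ∈ U, ∀ v, v ≠ 0 → 0 < g x v v

/-- The Wirtinger derivative `∂f/∂z_k`. -/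
def dz (k : Fin n) (f : Cn n → ℂ) (z : Cn n) : ℂ :=
  (fderiv ℝ f z (stdVec k) - Complex.I * fderiv ℝ f z (Complex.I • stdVec k)) / 2

/-- The Wirtinger derivative `∂f/∂z̄_k`. -/
def dzbar (k : Fin n) (f : Cn n → ℂ) (z : Cn n) : ℂ :=
  (fderiv ℝ f z (stdVec k) + Complex.I * fderiv ℝ f z (Complex.I • stdVec k)) / 2

variable (g : BilinField n M) (x₀ : M)

/-- `gInv g x₀ z l k = g^{l̄ k}`, the inverse of the matrix `(g_{k l̄})`. -/
def gInv (z : Cn n) : Matrix (Fin n) (Fin n) ℂ := (hcoeff g x₀ z)⁻¹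

/-- Christoffel symbols `Γ_{k i}^p = g^{q̄ p} ∂_k g_{i q̄}` of the Chern connection,
`∇_{∂_k} ∂_i = Γ_{k i}^p ∂_p` (and `∇_{∂_k̄} ∂_i = 0`). -/
def chernGamma (k i p : Fin n) (z : Cn n) : ℂ :=
  ∑ q, dz k (fun w => hcoeff g x₀ w i q) z * gInv g x₀ z q p

/-- Chern curvature `Ω_{k l̄ i j̄} = g(Ω(∂_k, ∂_l̄) ∂_i, ∂_j̄)` with
`Ω(X, Y) = [∇_X, ∇_Y] - ∇_{[X, Y]}`; thus `Ω(∂_k, ∂_l̄) ∂_i = - (∂_l̄ Γ_{k i}^p) ∂_p`. -/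
def chernCurv (k l i j : Fin n) (z : Cn n) : ℂ :=
  ∑ p, -(dzbar l (chernGamma g x₀ k i p) z) * hcoeff g x₀ z p j

/-- Second Chern-Ricci curvature `S_{i j̄} = g^{l̄ k} Ω_{k l̄ i j̄}`. -/
def chernS (i j : Fin n) (z : Cn n) : ℂ :=
  ∑ k, ∑ l, gInv g x₀ z l k * chernCurv g x₀ k l i j z

/-- Torsion `T_{i j k̄} = g_{p k̄} T_{i j}^p` of the Chern connection, where
`T_{i j}^p = Γ_{i j}^p - Γ_{j i}^p`. The components `T_{ī j̄ k}` are the conjugates. -/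
def chernT (i j k : Fin n) (z : Cn n) : ℂ :=
  ∑ p, (chernGamma g x₀ i j p z - chernGamma g x₀ j i p z) * hcoeff g x₀ z p k

/-- `Q¹_{i j̄} = g^{l̄ k} g^{q̄ m} T_{i k q̄} T_{j̄ l̄ m}`. -/
def hcfQ1 (i j : Fin n) (z : Cn n) : ℂ :=
  ∑ k, ∑ l, ∑ m, ∑ q, gInv g x₀ z l k * gInv g x₀ z q m *
    (chernT g x₀ i k q z * conj (chernT g x₀ j l m z))

/-- `Q²_{i j̄} = g^{l̄ k} g^{q̄ m} T_{k m j̄} T_{l̄ q̄ i}`. -/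
def hcfQ2 (i j : Fin n) (z : Cn n) : ℂ :=
  ∑ k, ∑ l, ∑ m, ∑ q, gInv g x₀ z l k * gInv g x₀ z q m *
    (chernT g x₀ k m j z * conj (chernT g x₀ l q i z))

/-- `Q³_{i j̄} = g^{l̄ k} g^{q̄ m} T_{i k l̄} T_{j̄ q̄ m}`. -/
def hcfQ3 (i j : Fin n) (z : Cn n) : ℂ :=
  ∑ k, ∑ l, ∑ m, ∑ q, gInv g x₀ z l k * gInv g x₀ z q m *
    (chernT g x₀ i k l z * conj (chernT g x₀ j q m z))

/-- `Q⁴_{i j̄} = ½ g^{l̄ k} g^{q̄ m} (T_{m k l̄} T_{q̄ j̄ i} + T_{q̄ l̄ k} T_{m i j̄})`. -/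
def hcfQ4 (i j : Fin n) (z : Cn n) : ℂ :=
  (1 / 2) * ∑ k, ∑ l, ∑ m, ∑ q, gInv g x₀ z l k * gInv g x₀ z q m *
    (chernT g x₀ m k l z * conj (chernT g x₀ q j i z)
      + conj (chernT g x₀ q l k z) * chernT g x₀ m i j z)

/-- The quadratic torsion term `Q = ½ Q¹ - ¼ Q² - ½ Q³ + Q⁴`. -/
def hcfQ (i j : Fin n) (z : Cn n) : ℂ :=
  (1 / 2) * hcfQ1 g x₀ i j z - (1 / 4) * hcfQ2 g x₀ i j z
    - (1 / 2) * hcfQ3 g x₀ i j z + hcfQ4 g x₀ i j z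

/-- The HCF tensor `K = S - Q`. -/
def hcfK (i j : Fin n) (z : Cn n) : ℂ := chernS g x₀ i j z - hcfQ g x₀ i j z

/-- The Ricci tensor `R_{i j̄} = - ∂_i ∂_j̄ log det (g_{k l̄})` of a Kähler metric. -/
def kahlerRic (i j : Fin n) (z : Cn n) : ℂ :=
  -dz i (dzbar j fun w => ((Real.log (hcoeff g x₀ w).det.re : ℝ) : ℂ)) z

/-- A solution `g(t)`, `t ∈ [0, ∞)`, of the Hermitian curvature flow `∂_t g = -K(g)`. At each
point the (tensorial) equation is written in the components of the chart around that point. -/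
structure IsHCFSolution (g : ℝ → BilinField n M) : Prop where
  metric : ∀ t, 0 ≤ t → IsHermitianMetricOn (g t) univ
  flow : ∀ t, 0 ≤ t → ∀ (x : M) (i j : Fin n),
    HasDerivWithinAt (fun s => hcoeff (g s) x (chartAt (Cn n) x x) i j)
      (-hcfK (g t) x i j (chartAt (Cn n) x x)) (Ici 0) t

/-- The Riemannian distance of `g`: the infimum of the lengths `∫ √(g(γ', γ'))` of the `C¹` paths
between two points. -/
def riemDist (g : BilinField n M) (x y : M) : ℝ≥0∞ :=
  letI : ∀ p : M, ENorm (TangentSpace 𝓘(ℝ, Cn n) p) :=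
    fun p => ⟨fun v => ENNReal.ofReal (Real.sqrt (g p v v))⟩
  Manifold.riemannianEDist 𝓘(ℝ, Cn n) x y

end Hermitian

/-! ## Gromov-Hausdorff distance -/

/-- The Gromov-Hausdorff distance of `(X, dX)` and `(Y, dY)`: the infimum of the Hausdorff
distances of their images, over all isometric embeddings into a common metric space. -/
def ghEDist.{u, v} {X : Type u} {Y : Type v} (dX : X → X → ℝ≥0∞) (dY : Y → Y → ℝ≥0∞) : ℝ≥0∞ :=
  sInf {r | ∃ (Z : Type (max u v)) (_ : MetricSpace Z) (φ : X → Z) (ψ : Y → Z),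
    (∀ x x', edist (φ x) (φ x') = dX x x') ∧ (∀ y y', edist (ψ y) (ψ y') = dY y y') ∧
    r = Metric.hausdorffEDist (range φ) (range ψ)}

/-! ## Elliptic fibrations and the Kähler-Einstein metric of the base -/

section Fibration

variable {X : Type*} [TopologicalSpace X] [ChartedSpace (Cn 2) X]
  {C : Type*} [TopologicalSpace C] [ChartedSpace (Cn 1) C]

/-- The critical values of a map from a complex surface to a complex curve. For the fibrations
considered here these are the points under the multiple fibres. -/
def critValues (π : X → C) : Set C :=
  {p | ∃ x, π x = p ∧ mfderiv 𝓘(ℂ, Cn 2) 𝓘(ℂ, Cn 1) π x = 0}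

/-- An elliptic fibration: a surjective holomorphic map with connected fibres, all of whose smooth
fibres are elliptic curves, i.e. images of `ℂ ⧸ Λ` under a holomorphic embedding. -/
structure IsEllipticFibration (π : X → C) : Prop where
  holo : MDifferentiable 𝓘(ℂ, Cn 2) 𝓘(ℂ, Cn 1) π
  surj : Function.Surjective π
  connected : ∀ p, IsConnected (π ⁻¹' {p})
  elliptic : ∀ p ∉ critValues π, ∃ (Λ : Submodule ℤ ℂ) (_ : DiscreteTopology Λ)
    (_ : IsZLattice ℝ Λ) (u : ℂ → X), MDifferentiable 𝓘(ℂ, ℂ) 𝓘(ℂ, Cn 2) u ∧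
      (∀ z, mfderiv 𝓘(ℂ, ℂ) 𝓘(ℂ, Cn 2) u z ≠ 0) ∧ range u = π ⁻¹' {p} ∧
      ∀ z w, u z = u w ↔ z - w ∈ Λ

/-- `h` is a Kähler-Einstein metric with `Ric(h) = -h` on the base curve `C` of `π`: a smooth
Hermitian metric with `Ric(h) = -h` off the critical values of `π`, with the orbifold behaviour at
the critical values, namely `π^* h` extends to a smooth form on `X` without zeros (a cone angle
`2π/m` under a fibre of multiplicity `m`). If `π` is a submersion there are no critical values, so
that `h` is a smooth metric on all of `C`, and the last condition is automatic. The
values of `h` at the critical values are irrelevant. -/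
structure IsBaseKahlerEinstein (π : X → C) (h : BilinField 1 C) : Prop where
  metric : IsHermitianMetricOn h (critValues π)ᶜ
  einstein : ∀ p ∉ critValues π, ∀ i j : Fin 1,
    kahlerRic h p i j (chartAt (Cn 1) p p) = -hcoeff h p (chartAt (Cn 1) p p) i j
  orbifold : ∃ k : BilinField 2 X, IsHermitianFormOn k univ ∧ (∀ x, k x ≠ 0) ∧
    ∀ x, π x ∉ critValues π → ∀ v w, k x v w =
      h (π x) (mfderiv 𝓘(ℝ, Cn 2) 𝓘(ℝ, Cn 1) π x v) (mfderiv 𝓘(ℝ, Cn 2) 𝓘(ℝ, Cn 1) π x w)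

end Fibration

/-! ## The group `SL(2, ℝ)~ × ℝ` with its complex structures `J_λ`, and its compact quotients -/

/-- The underlying space of the Lie algebra `𝔰𝔩(2, ℝ) × ℝ`, in which `[(A, r), (B, s)] = ([A, B], 0)`. -/
abbrev SL2R : Type := LieAlgebra.SpecialLinear.sl (Fin 2) ℝ × ℝ

/-- `H`, as an element of `𝔰𝔩(2, ℝ) × ℝ`. -/
def slH : SL2R := (⟨!![1, 0; 0, -1], by
  simp [LieAlgebra.SpecialLinear.sl, LinearMap.mem_ker, Matrix.trace_fin_two]⟩, 0)

/-- `P = E + F`, as an element of `𝔰𝔩(2, ℝ) × ℝ`. -/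
def slP : SL2R := (⟨!![0, 1; 1, 0], by
  simp [LieAlgebra.SpecialLinear.sl, LinearMap.mem_ker, Matrix.trace_fin_two]⟩, 0)

/-- `R = E - F`, the generator of `𝔰𝔬(2)`, as an element of `𝔰𝔩(2, ℝ) × ℝ`. -/
def slR : SL2R := (⟨!![0, 1; -1, 0], by
  simp [LieAlgebra.SpecialLinear.sl, LinearMap.mem_ker, Matrix.trace_fin_two]⟩, 0)

/-- The generator `T` of the second factor of `𝔰𝔩(2, ℝ) × ℝ`. -/
def slT : SL2R := (0, 1)

/-- The Lie bracket of `𝔰𝔩(2, ℝ) × ℝ`. -/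
def slBracket (v w : SL2R) : SL2R := (⁅v.1, w.1⁆, 0)

section Quotient

variable {G : Type*} [TopologicalSpace G] [Group G] [ChartedSpace (EuclideanSpace ℝ (Fin 4)) G]
  {X : Type*} [TopologicalSpace X] [ChartedSpace (Cn 2) X]

/-- For a map `P` from the Lie group `G` to `X`: the image under `dP` at `a : G` of the
left-invariant vector field of `G` with value `v` at the identity. -/
def pushVec (P : G → X) (v : GroupLieAlgebra (𝓡 4) G) (a : G) :
    TangentSpace 𝓘(ℝ, Cn 2) (P a) :=
  mfderiv (𝓡 4) 𝓘(ℝ, Cn 2) P a (mulInvariantVectorField v a)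

/-- `P : G → X` exhibits the complex surface `X` as the quotient `Γ \ (G, J_λ)`. Here `φ` identifies
the Lie algebra of `G` with `𝔰𝔩(2, ℝ) × ℝ`, and `J_λ` is the left-invariant complex structure with
`J_λ H = P` and `J_λ (R - λ T) = T`. Its left-invariant `(1,0)`-frame `Z₁ = (H - √-1 P)/2`,
`Z₂ = (R - λ T - √-1 T)/2` has the structure constants `[Z₁, Z₂] = √-1 Z₁`, `[Z₁, Z̄₂] = √-1 Z₁`,
`[Z₂, Z̄₂] = 0`, `[Z₁, Z̄₁] = (-λ + √-1) Z₂ + (λ + √-1) Z̄₂`. -/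
structure IsQuotientModel (lam : ℝ) (φ : GroupLieAlgebra (𝓡 4) G ≃ₗ[ℝ] SL2R) (Γ : Subgroup G)
    (P : G → X) : Prop where
  smooth : IsLocalDiffeomorph (𝓡 4) 𝓘(ℝ, Cn 2) ∞ P
  surj : Function.Surjective P
  fibre : ∀ a b, P a = P b ↔ ∃ γ ∈ Γ, b = γ * a
  J_H : ∀ a, cplxJ (P a) (pushVec P (φ.symm slH) a) = pushVec P (φ.symm slP) a
  J_R : ∀ a, cplxJ (P a) (pushVec P (φ.symm (slR - lam • slT)) a) = pushVec P (φ.symm slT) a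

/-- A tensor on `X = Γ \ G` is locally homogeneous: its pull-back to `G` is left-invariant. -/
def IsLocallyHomogeneous (P : G → X) (g : BilinField 2 X) : Prop :=
  ∀ (v w : GroupLieAlgebra (𝓡 4) G) (a b : G),
    g (P a) (pushVec P v a) (pushVec P w a) = g (P b) (pushVec P v b) (pushVec P w b)

/-- A locally homogeneous solution of the HCF on `[0, ∞)` with initial metric `g₀`. -/
def IsLocallyHomogeneousHCF (P : G → X) (g₀ : BilinField 2 X) (g : ℝ → BilinField 2 X) : Prop :=
  IsHCFSolution g ∧ (∀ t, 0 ≤ t → IsLocallyHomogeneous P (g t)) ∧ g 0 = g₀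

end Quotient

end

noncomputable section

set_option linter.unusedSectionVars false

/-! ## Wirtinger calculus -/

lemma two_le_infty : (2 : WithTop ℕ∞) ≤ ((⊤ : ℕ∞) : WithTop ℕ∞) :=
  show ((2 : ℕ∞) : WithTop ℕ∞) ≤ ((⊤ : ℕ∞) : WithTop ℕ∞) from WithTop.coe_le_coe.2 le_top

section Wirtinger

variable {n : ℕ} {f g : Cn n → ℂ} {z : Cn n} {k l : Fin n}

lemma dz_congr (h : f =ᶠ[𝓝 z] g) : dz k f z = dz k g z := by
  simp only [dz, h.fderiv_eq]

lemma dzbar_congr (h : f =ᶠ[𝓝 z] g) : dzbar k f z = dzbar k g z := by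
  simp only [dzbar, h.fderiv_eq]

lemma dz_const (c : ℂ) : dz k (fun _ : Cn n => c) z = 0 := by simp [dz]

lemma dzbar_const (c : ℂ) : dzbar k (fun _ : Cn n => c) z = 0 := by simp [dzbar]

lemma dz_add (hf : DifferentiableAt ℝ f z) (hg : DifferentiableAt ℝ g z) :
    dz k (fun w => f w + g w) z = dz k f z + dz k g z := by
  simp only [dz, fderiv_fun_add hf hg, _root_.add_apply]; ring

lemma dzbar_add (hf : DifferentiableAt ℝ f z) (hg : DifferentiableAt ℝ g z) :
    dzbar k (fun w => f w + g w) z = dzbar k f z + dzbar k g z := by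
  simp only [dzbar, fderiv_fun_add hf hg, _root_.add_apply]; ring

lemma dz_mul (hf : DifferentiableAt ℝ f z) (hg : DifferentiableAt ℝ g z) :
    dz k (fun w => f w * g w) z = dz k f z * g z + f z * dz k g z := by
  simp only [dz, fderiv_fun_mul hf hg, _root_.add_apply,
    _root_.smul_apply, smul_eq_mul]; ring

lemma dzbar_mul (hf : DifferentiableAt ℝ f z) (hg : DifferentiableAt ℝ g z) :
    dzbar k (fun w => f w * g w) z = dzbar k f z * g z + f z * dzbar k g z := by
  simp only [dzbar, fderiv_fun_mul hf hg, _root_.add_apply,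
    _root_.smul_apply, smul_eq_mul]; ring

lemma fderiv_conj_apply (hf : DifferentiableAt ℝ f z) (v : Cn n) :
    fderiv ℝ (fun w => conj (f w)) z v = conj (fderiv ℝ f z v) := by
  have := (Complex.conjCLE.toContinuousLinearMap.hasFDerivAt.comp z hf.hasFDerivAt).fderiv
  change fderiv ℝ (Complex.conjCLE ∘ f) z v = _
  erw [this]; simp

lemma dz_conj (hf : DifferentiableAt ℝ f z) :
    dz k (fun w => conj (f w)) z = conj (dzbar k f z) := by
  simp only [dz, dzbar, fderiv_conj_apply hf]; simp [sub_eq_add_neg, Complex.conj_ofNat]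

lemma dzbar_conj (hf : DifferentiableAt ℝ f z) :
    dzbar k (fun w => conj (f w)) z = conj (dz k f z) := by
  simp only [dz, dzbar, fderiv_conj_apply hf]; simp [sub_eq_add_neg, Complex.conj_ofNat]

lemma fderiv_fderiv_apply (hf : ContDiffAt ℝ 2 f z) (v w : Cn n) :
    fderiv ℝ (fun y => fderiv ℝ f y v) z w = fderiv ℝ (fderiv ℝ f) z w v := by
  have h : DifferentiableAt ℝ (fderiv ℝ f) z :=
    (hf.fderiv_right (m := 1) (by norm_num)).differentiableAt (by norm_num)
  rw [fderiv_clm_apply h (differentiableAt_const v)]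
  simp

lemma differentiableAt_fderiv_apply (hf : ContDiffAt ℝ 2 f z) (v : Cn n) :
    DifferentiableAt ℝ (fun y => fderiv ℝ f y v) z :=
  ((hf.fderiv_right (m := 1) (by norm_num)).differentiableAt (by norm_num)).clm_apply
    (differentiableAt_const v)

lemma differentiableAt_dz (hf : ContDiffAt ℝ 2 f z) : DifferentiableAt ℝ (dz k f) z :=
  ((differentiableAt_fderiv_apply hf _).sub
    ((differentiableAt_fderiv_apply hf _).const_mul _)).mul_const _

lemma differentiableAt_dzbar (hf : ContDiffAt ℝ 2 f z) : DifferentiableAt ℝ (dzbar k f) z :=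
  ((differentiableAt_fderiv_apply hf _).add
    ((differentiableAt_fderiv_apply hf _).const_mul _)).mul_const _

lemma dz_dzbar_comm (hf : ContDiffAt ℝ 2 f z) :
    dz k (dzbar l f) z = dzbar l (dz k f) z := by
  have hs : ∀ v w, fderiv ℝ (fderiv ℝ f) z v w = fderiv ℝ (fderiv ℝ f) z w v := fun v w =>
    hf.isSymmSndFDerivAt (by simp) v w
  have A : ∀ v, DifferentiableAt ℝ (fun y => fderiv ℝ f y v) z := differentiableAt_fderiv_apply hf
  have e1 : ∀ v, fderiv ℝ (dzbar l f) z v = (fderiv ℝ (fderiv ℝ f) z v (stdVec l)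
      + Complex.I * fderiv ℝ (fderiv ℝ f) z v (Complex.I • stdVec l)) * (2 : ℂ)⁻¹ := by
    intro v
    have : dzbar l f = fun y => (fderiv ℝ f y (stdVec l) +
        Complex.I * fderiv ℝ f y (Complex.I • stdVec l)) * (2 : ℂ)⁻¹ := by
      ext y; simp [dzbar, div_eq_mul_inv]
    rw [this, fderiv_mul_const' (DifferentiableAt.fun_add (A _) ((A _).const_mul _)),
      fderiv_fun_add (A _) ((A _).const_mul _), fderiv_const_mul (A _)]
    simp [fderiv_fderiv_apply hf]; ring
  have e2 : ∀ v, fderiv ℝ (dz k f) z v = (fderiv ℝ (fderiv ℝ f) z v (stdVec k)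
      - Complex.I * fderiv ℝ (fderiv ℝ f) z v (Complex.I • stdVec k)) * (2 : ℂ)⁻¹ := by
    intro v
    have : dz k f = fun y => (fderiv ℝ f y (stdVec k) -
        Complex.I * fderiv ℝ f y (Complex.I • stdVec k)) * (2 : ℂ)⁻¹ := by
      ext y; simp [dz, div_eq_mul_inv]
    rw [this, fderiv_mul_const' (DifferentiableAt.fun_sub (A _) ((A _).const_mul _)),
      fderiv_fun_sub (A _) ((A _).const_mul _), fderiv_const_mul (A _)]
    simp [fderiv_fderiv_apply hf]
  have ez : dz k (dzbar l f) z = (fderiv ℝ (dzbar l f) z (stdVec k) -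
    Complex.I * fderiv ℝ (dzbar l f) z (Complex.I • stdVec k)) / 2 := rfl
  have eb : dzbar l (dz k f) z = (fderiv ℝ (dz k f) z (stdVec l) +
    Complex.I * fderiv ℝ (dz k f) z (Complex.I • stdVec l)) / 2 := rfl
  rw [ez, eb, e1, e1, e2, e2, hs (stdVec l), hs (Complex.I • stdVec l), hs (stdVec l),
    hs (Complex.I • stdVec l)]
  ring

end Wirtinger

/-! ## The Hermitian curvature flow tensor of a complex surface -/

section Surface

variable {M : Type*} [TopologicalSpace M] [ChartedSpace (Cn 2) M] (g : BilinField 2 M) (x₀ : M)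

lemma chernT_swap (i j k : Fin 2) (z : Cn 2) : chernT g x₀ i j k z = -chernT g x₀ j i k z := by
  simp only [chernT, ← Finset.sum_neg_distrib]
  exact Finset.sum_congr rfl fun p _ => by ring

/-- On a complex surface the torsion term of the flow is `Q_{i j̄} = T_{12 j̄} T_{1̄2̄ i} / det g`. -/
lemma hcfQ_eq (i j : Fin 2) (z : Cn 2) (hd : (hcoeff g x₀ z).det ≠ 0) :
    hcfQ g x₀ i j z =
      conj (chernT g x₀ 0 1 i z) * chernT g x₀ 0 1 j z / (hcoeff g x₀ z).det := by
  have T00 : ∀ k, chernT g x₀ 0 0 k z = 0 := fun k => by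
    have := chernT_swap g x₀ 0 0 k z; linear_combination this / 2
  have T11 : ∀ k, chernT g x₀ 1 1 k z = 0 := fun k => by
    have := chernT_swap g x₀ 1 1 k z; linear_combination this / 2
  have T10 : ∀ k, chernT g x₀ 1 0 k z = -chernT g x₀ 0 1 k z := fun k => chernT_swap g x₀ 1 0 k z
  have hI : gInv g x₀ z = (hcoeff g x₀ z).det⁻¹ • (hcoeff g x₀ z).adjugate := by
    rw [gInv, Matrix.inv_def, Ring.inverse_eq_inv']
  rw [Matrix.adjugate_fin_two] at hI
  have hdet := Matrix.det_fin_two (hcoeff g x₀ z)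
  simp only [hcfQ, hcfQ1, hcfQ2, hcfQ3, hcfQ4, hI]
  generalize chernT g x₀ = T at *
  generalize (hcoeff g x₀ z) = h at *
  generalize h.det = d at *

  subst hdet
  fin_cases i <;> fin_cases j <;>
  · simp -failIfUnchanged only [Fin.zero_eta, Fin.mk_one]
    simp [Fin.sum_univ_two, T00, T11, T10]
    field_simp
    ring

lemma chernT_eq (k : Fin 2) (z : Cn 2) (hd : (hcoeff g x₀ z).det ≠ 0) :
    chernT g x₀ 0 1 k z = dz 0 (fun w => hcoeff g x₀ w 1 k) z
      - dz 1 (fun w => hcoeff g x₀ w 0 k) z := by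
  have hI : gInv g x₀ z * hcoeff g x₀ z = 1 :=
    Matrix.nonsing_inv_mul _ (isUnit_iff_ne_zero.2 hd)
  have h : ∀ a b, ∑ p, gInv g x₀ z a p * hcoeff g x₀ z p b = if a = b then 1 else 0 := by
    intro a b
    rw [← Matrix.mul_apply, hI, Matrix.one_apply]
  have key : ∀ F : Fin 2 → ℂ,
      ∑ p, (∑ q, F q * gInv g x₀ z q p) * hcoeff g x₀ z p k = F k := by
    intro F
    simp_rw [Finset.sum_mul, mul_assoc]
    rw [Finset.sum_comm]
    simp_rw [← Finset.mul_sum, h]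
    simp
  simp only [chernT, chernGamma, sub_mul, Finset.sum_sub_distrib, key]

end Surface

/-! ## Structure equations of a left-invariant frame -/

section Frame

/-- The matrices `D_b` of the operators `∇_{Z̄_b}` on the frame `Z_1, Z_2`. -/
def frameD (lam : ℝ) : Fin 2 → Matrix (Fin 2) (Fin 2) ℂ :=
  ![!![0, (lam : ℂ) - Complex.I; 0, 0], !![-Complex.I, 0; 0, 0]]

/-- Wirtinger derivatives of matrix valued functions, entry by entry. -/
def dzM (k : Fin 2) (F : Cn 2 → Matrix (Fin 2) (Fin 2) ℂ) (z : Cn 2) : Matrix (Fin 2) (Fin 2) ℂ :=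
  Matrix.of fun i j => dz k (fun w => F w i j) z

def dzbarM (k : Fin 2) (F : Cn 2 → Matrix (Fin 2) (Fin 2) ℂ) (z : Cn 2) :
    Matrix (Fin 2) (Fin 2) ℂ :=
  Matrix.of fun i j => dzbar k (fun w => F w i j) z

/-- Entrywise real differentiability. -/
def MatDiff (F : Cn 2 → Matrix (Fin 2) (Fin 2) ℂ) (z : Cn 2) : Prop :=
  ∀ i j, DifferentiableAt ℝ (fun w => F w i j) z

variable {F F' : Cn 2 → Matrix (Fin 2) (Fin 2) ℂ} {z : Cn 2} {k : Fin 2}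

lemma MatDiff.mul (hF : MatDiff F z) (hF' : MatDiff F' z) : MatDiff (fun w => F w * F' w) z := by
  intro i j
  simp only [Matrix.mul_apply, Fin.sum_univ_two]
  exact ((hF _ _).fun_mul (hF' _ _)).fun_add ((hF _ _).fun_mul (hF' _ _))

lemma MatDiff.const (B : Matrix (Fin 2) (Fin 2) ℂ) : MatDiff (fun _ => B) z :=
  fun _ _ => differentiableAt_const _

lemma MatDiff.star (hF : MatDiff F z) : MatDiff (fun w => (F w)ᴴ) z := fun i j =>
  show DifferentiableAt ℝ (Complex.conjCLE.toContinuousLinearMap ∘ fun w => F w j i) z from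
    Complex.conjCLE.toContinuousLinearMap.differentiableAt.comp z (hF j i)

lemma dzM_mul (hF : MatDiff F z) (hF' : MatDiff F' z) :
    dzM k (fun w => F w * F' w) z = dzM k F z * F' z + F z * dzM k F' z := by
  ext i j
  simp only [dzM, Matrix.mul_apply, Fin.sum_univ_two, Matrix.of_apply, Matrix.add_apply]
  rw [dz_add ((hF _ _).fun_mul (hF' _ _)) ((hF _ _).fun_mul (hF' _ _)), dz_mul (hF _ _) (hF' _ _),
    dz_mul (hF _ _) (hF' _ _)]
  ring

lemma dzbarM_mul (hF : MatDiff F z) (hF' : MatDiff F' z) :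
    dzbarM k (fun w => F w * F' w) z = dzbarM k F z * F' z + F z * dzbarM k F' z := by
  ext i j
  simp only [dzbarM, Matrix.mul_apply, Fin.sum_univ_two, Matrix.of_apply, Matrix.add_apply]
  rw [dzbar_add ((hF _ _).fun_mul (hF' _ _)) ((hF _ _).fun_mul (hF' _ _)),
    dzbar_mul (hF _ _) (hF' _ _), dzbar_mul (hF _ _) (hF' _ _)]
  ring

lemma dzM_const (B : Matrix (Fin 2) (Fin 2) ℂ) : dzM k (fun _ => B) z = 0 := by
  ext; simp [dzM, dz_const]

lemma dzbarM_const (B : Matrix (Fin 2) (Fin 2) ℂ) : dzbarM k (fun _ => B) z = 0 := by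
  ext; simp [dzbarM, dzbar_const]

lemma dzM_star (hF : MatDiff F z) : dzM k (fun w => (F w)ᴴ) z = (dzbarM k F z)ᴴ := by
  ext i j
  exact dz_conj (hF j i)

lemma dzM_congr (h : F =ᶠ[𝓝 z] F') : dzM k F z = dzM k F' z := by
  ext i j
  exact dz_congr (h.mono fun w hw => by simp [hw])

lemma dzbarM_congr (h : F =ᶠ[𝓝 z] F') : dzbarM k F z = dzbarM k F' z := by
  ext i j
  exact dzbar_congr (h.mono fun w hw => by simp [hw])

/-- The structure equations of the coframe `A` (the rows of `A` are the components of the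
coordinate fields in the frame). -/
structure IsInvariantCoframe (lam : ℝ) (A Ξ : Cn 2 → Matrix (Fin 2) (Fin 2) ℂ) (z₀ : Cn 2) :
    Prop where
  smooth : ∀ i j, ContDiffAt ℝ ∞ (fun w => A w i j) z₀
  smoothInv : ∀ i j, ContDiffAt ℝ ∞ (fun w => Ξ w i j) z₀
  inv : ∀ᶠ z in 𝓝 z₀, A z * Ξ z = 1
  dbar : ∀ᶠ z in 𝓝 z₀, ∀ k, dzbarM k A z =
    -(∑ b, conj (A z k b) • (A z * frameD lam b))
  torsion : ∀ᶠ z in 𝓝 z₀, ∀ a, dz 0 (fun w => A w 1 a) z - dz 1 (fun w => A w 0 a) z =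
    -(A z).det * (if a = 0 then Complex.I else 0)

/-- The matrices `N_b` of the operators `∇_{Z_b}` for the metric with matrix `B`. -/
def frameN (lam : ℝ) (B : Matrix (Fin 2) (Fin 2) ℂ) (b : Fin 2) : Matrix (Fin 2) (Fin 2) ℂ :=
  -(B * (frameD lam b)ᴴ * B⁻¹)

/-- The Chern curvature of the metric with matrix `B` in the frame. -/
def frameOmega (lam : ℝ) (B : Matrix (Fin 2) (Fin 2) ℂ) (b c : Fin 2) :
    Matrix (Fin 2) (Fin 2) ℂ :=
  frameD lam c * frameN lam B b - frameN lam B b * frameD lam c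
    + ∑ e, (frameD lam c b e) • frameN lam B e
    - ∑ e, conj (frameD lam b c e) • frameD lam e

/-- The second Chern-Ricci curvature of the metric with matrix `B` in the frame. -/
def frameS (lam : ℝ) (B : Matrix (Fin 2) (Fin 2) ℂ) : Matrix (Fin 2) (Fin 2) ℂ :=
  (∑ b, ∑ c, B⁻¹ c b • frameOmega lam B b c) * B

variable {M : Type*} [TopologicalSpace M] [ChartedSpace (Cn 2) M] {g : BilinField 2 M} {x₀ : M}
  {lam : ℝ} {A Ξ : Cn 2 → Matrix (Fin 2) (Fin 2) ℂ} {z₀ : Cn 2} {B : Matrix (Fin 2) (Fin 2) ℂ}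

lemma IsInvariantCoframe.matDiff (hA : IsInvariantCoframe lam A Ξ z₀) :
    ∀ᶠ z in 𝓝 z₀, (∀ i j, ContDiffAt ℝ 2 (fun w => A w i j) z) ∧ MatDiff A z ∧ MatDiff Ξ z := by
  have h1 : ∀ᶠ z in 𝓝 z₀, ∀ i j, ContDiffAt ℝ 2 (fun w => A w i j) z := by
    simp only [eventually_all]
    exact fun i j => ((hA.smooth i j).of_le two_le_infty).eventually (by simp)
  have h2 : ∀ᶠ z in 𝓝 z₀, ∀ i j, ContDiffAt ℝ 2 (fun w => Ξ w i j) z := by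
    simp only [eventually_all]
    exact fun i j => ((hA.smoothInv i j).of_le two_le_infty).eventually (by simp)
  filter_upwards [h1, h2] with z h1 h2
  exact ⟨h1, fun i j => (h1 i j).differentiableAt (by norm_num),
    fun i j => (h2 i j).differentiableAt (by norm_num)⟩

/-- The matrix `Γ_k` of Christoffel symbols. -/
lemma chernGamma_frame (hA : IsInvariantCoframe lam A Ξ z₀) (hB : B.det ≠ 0)
    (hg : ∀ᶠ z in 𝓝 z₀, hcoeff g x₀ z = A z * B * (A z)ᴴ) :
    ∀ᶠ z in 𝓝 z₀, ∀ k, (Matrix.of fun i p => chernGamma g x₀ k i p z) =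
      dzM k A z * Ξ z + ∑ b, A z k b • (A z * frameN lam B b * Ξ z) := by
  filter_upwards [hA.matDiff, hA.inv, hA.dbar, hg.eventually_nhds] with z hd hinv hbar hg k
  have hB' : IsUnit B.det := isUnit_iff_ne_zero.2 hB
  have hinv' : Ξ z * A z = 1 := mul_eq_one_comm.1 hinv
  have hI : gInv g x₀ z = (Ξ z)ᴴ * B⁻¹ * Ξ z := by
    rw [gInv, hg.self_of_nhds]
    refine Matrix.inv_eq_right_inv ?_
    have : (A z)ᴴ * (Ξ z)ᴴ = 1 := by rw [← Matrix.conjTranspose_mul, hinv']; simp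
    calc A z * B * (A z)ᴴ * ((Ξ z)ᴴ * B⁻¹ * Ξ z)
        = A z * B * ((A z)ᴴ * (Ξ z)ᴴ) * B⁻¹ * Ξ z := by simp only [Matrix.mul_assoc]
      _ = A z * (B * B⁻¹) * Ξ z := by rw [this]; simp only [Matrix.mul_assoc, Matrix.one_mul]
      _ = 1 := by rw [Matrix.mul_nonsing_inv _ hB', Matrix.mul_one, hinv]
  have hG : (Matrix.of fun i p => chernGamma g x₀ k i p z) =
      dzM k (fun w => hcoeff g x₀ w) z * gInv g x₀ z := by
    ext i p
    simp [chernGamma, dzM, Matrix.mul_apply]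
  have hs : (A z)ᴴ * (Ξ z)ᴴ = 1 := by rw [← Matrix.conjTranspose_mul, hinv']; simp
  rw [hG, hI, dzM_congr hg, dzM_mul (hd.2.1.mul (MatDiff.const B)) hd.2.1.star,
    dzM_mul hd.2.1 (MatDiff.const B), dzM_const, dzM_star hd.2.1, hbar k]
  have e1 : dzM k A z * B * (A z)ᴴ * ((Ξ z)ᴴ * B⁻¹ * Ξ z) = dzM k A z * Ξ z := by
    calc _ = dzM k A z * B * ((A z)ᴴ * (Ξ z)ᴴ) * B⁻¹ * Ξ z := by simp only [Matrix.mul_assoc]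
      _ = dzM k A z * (B * B⁻¹) * Ξ z := by rw [hs]; simp only [Matrix.mul_assoc, Matrix.one_mul]
      _ = _ := by rw [Matrix.mul_nonsing_inv _ hB', Matrix.mul_one]
  have e2 : ∀ b, A z * B * (conj (A z k b) • (A z * frameD lam b))ᴴ * ((Ξ z)ᴴ * B⁻¹ * Ξ z)
      = -(A z k b • (A z * frameN lam B b * Ξ z)) := by
    intro b
    rw [Matrix.conjTranspose_smul, Matrix.conjTranspose_mul, frameN]
    simp only [Matrix.mul_smul, Matrix.smul_mul, Matrix.mul_neg, Matrix.neg_mul, smul_neg, neg_neg,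
      RCLike.star_def, Complex.conj_conj]
    congr 1
    calc _ = A z * B * (frameD lam b)ᴴ * ((A z)ᴴ * (Ξ z)ᴴ) * B⁻¹ * Ξ z := by
            simp only [Matrix.mul_assoc]
      _ = _ := by rw [hs]; simp only [Matrix.mul_assoc, Matrix.one_mul]
  simp only [Fin.sum_univ_two, Matrix.mul_zero, add_zero, Matrix.conjTranspose_neg,
    Matrix.conjTranspose_add, Matrix.add_mul, Matrix.mul_add, Matrix.mul_neg, Matrix.neg_mul, e1,
    e2, neg_add, neg_neg]

end Frame

section FrameCurvature

variable {F : Cn 2 → Matrix (Fin 2) (Fin 2) ℂ} {c : Cn 2 → ℂ} {z : Cn 2} {k l : Fin 2}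

lemma MatDiff.smul (hc : DifferentiableAt ℝ c z) (hF : MatDiff F z) :
    MatDiff (fun w => c w • F w) z := fun i j => hc.fun_mul (hF i j)

lemma MatDiff.add {F' : Cn 2 → Matrix (Fin 2) (Fin 2) ℂ} (hF : MatDiff F z) (hF' : MatDiff F' z) :
    MatDiff (fun w => F w + F' w) z := fun i j => (hF i j).fun_add (hF' i j)

lemma dzM_smul (hc : DifferentiableAt ℝ c z) (hF : MatDiff F z) :
    dzM k (fun w => c w • F w) z = dz k c z • F z + c z • dzM k F z := by
  ext i j
  exact dz_mul hc (hF i j)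

lemma dzbarM_smul (hc : DifferentiableAt ℝ c z) (hF : MatDiff F z) :
    dzbarM k (fun w => c w • F w) z = dzbar k c z • F z + c z • dzbarM k F z := by
  ext i j
  exact dzbar_mul hc (hF i j)

lemma dzM_add {F' : Cn 2 → Matrix (Fin 2) (Fin 2) ℂ} (hF : MatDiff F z) (hF' : MatDiff F' z) :
    dzM k (fun w => F w + F' w) z = dzM k F z + dzM k F' z := by
  ext i j
  exact dz_add (hF i j) (hF' i j)

lemma dzbarM_add {F' : Cn 2 → Matrix (Fin 2) (Fin 2) ℂ} (hF : MatDiff F z) (hF' : MatDiff F' z) :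
    dzbarM k (fun w => F w + F' w) z = dzbarM k F z + dzbarM k F' z := by
  ext i j
  exact dzbar_add (hF i j) (hF' i j)

variable {M : Type*} [TopologicalSpace M] [ChartedSpace (Cn 2) M] {g : BilinField 2 M} {x₀ : M}
  {lam : ℝ} {A Ξ : Cn 2 → Matrix (Fin 2) (Fin 2) ℂ} {z₀ : Cn 2} {B : Matrix (Fin 2) (Fin 2) ℂ}

lemma dzM_neg : dzM k (fun w => -F w) z = -dzM k F z := by
  ext i j
  simp only [dzM, dz, Matrix.neg_apply, Matrix.of_apply, fderiv_fun_neg, _root_.neg_apply]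
  ring

lemma dzM_dzbarM_frame (hA : IsInvariantCoframe lam A Ξ z₀) :
    dzM k (fun w => dzbarM l A w) z₀ =
      -∑ b, (conj (dzbarM k A z₀ l b) • (A z₀ * frameD lam b)
        + conj (A z₀ l b) • (dzM k A z₀ * frameD lam b)) := by
  have hd := hA.matDiff.self_of_nhds.2.1
  have hE : (fun w => dzbarM l A w) =ᶠ[𝓝 z₀]
      fun w => -(conj (A w l 0) • (A w * frameD lam 0) + conj (A w l 1) • (A w * frameD lam 1)) := by
    filter_upwards [hA.dbar] with w hw
    rw [hw l, Fin.sum_univ_two]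
  have hD : ∀ b, MatDiff (fun w => A w * frameD lam b) z₀ := fun b => hd.mul (MatDiff.const _)
  have hc : ∀ b, DifferentiableAt ℝ (fun w => conj (A w l b)) z₀ := fun b => hd.star b l
  rw [dzM_congr hE, dzM_neg, dzM_add ((hD 0).smul (hc 0)) ((hD 1).smul (hc 1)),
    dzM_smul (hc 0) (hD 0), dzM_smul (hc 1) (hD 1), dzM_mul hd (MatDiff.const _),
    dzM_mul hd (MatDiff.const _), dz_conj (hd l 0), dz_conj (hd l 1), Fin.sum_univ_two]
  simp only [dzM_const, Matrix.mul_zero, add_zero, dzbarM, Matrix.of_apply]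

lemma dzbarM_chernGamma (hA : IsInvariantCoframe lam A Ξ z₀) (hB : B.det ≠ 0)
    (hg : ∀ᶠ z in 𝓝 z₀, hcoeff g x₀ z = A z * B * (A z)ᴴ) :
    dzbarM l (fun z => Matrix.of fun i p => chernGamma g x₀ k i p z) z₀ =
      -∑ b, ∑ c, (A z₀ k b * conj (A z₀ l c)) • (A z₀ * frameOmega lam B b c * Ξ z₀) := by
  obtain ⟨hC, hd, hdΞ⟩ := hA.matDiff.self_of_nhds
  have hinv := hA.inv.self_of_nhds
  have hinv' : Ξ z₀ * A z₀ = 1 := mul_eq_one_comm.1 hinv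
  have hbar := hA.dbar.self_of_nhds
  have hE : (fun z => Matrix.of fun i p => chernGamma g x₀ k i p z) =ᶠ[𝓝 z₀] fun z =>
      dzM k A z * Ξ z + (A z k 0 • (A z * frameN lam B 0 * Ξ z) +
        A z k 1 • (A z * frameN lam B 1 * Ξ z)) := by
    filter_upwards [chernGamma_frame hA hB hg] with z hz
    rw [hz k, Fin.sum_univ_two]
  have hU : MatDiff (dzM k A) z₀ := fun i j => differentiableAt_dz (hC i j)
  have hN : ∀ b, MatDiff (fun z => A z * frameN lam B b * Ξ z) z₀ := fun b =>
    (hd.mul (MatDiff.const _)).mul hdΞ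
  have hcomm : dzbarM l (dzM k A) z₀ = dzM k (fun w => dzbarM l A w) z₀ := by
    ext i j
    exact (dz_dzbar_comm (hC i j)).symm
  have hΞ : dzbarM l Ξ z₀ = -(Ξ z₀ * dzbarM l A z₀ * Ξ z₀) := by
    have h0 : dzbarM l (fun z => A z * Ξ z) z₀ = 0 := by
      rw [dzbarM_congr (F' := fun _ => 1) hA.inv, dzbarM_const]
    rw [dzbarM_mul hd hdΞ] at h0
    calc dzbarM l Ξ z₀ = Ξ z₀ * (A z₀ * dzbarM l Ξ z₀) := by rw [← Matrix.mul_assoc, hinv',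
          Matrix.one_mul]
      _ = _ := by rw [eq_neg_of_add_eq_zero_right h0]; simp only [Matrix.mul_neg, Matrix.mul_assoc]
  rw [dzbarM_congr hE, dzbarM_add (hU.mul hdΞ) (((hN 0).smul (hd k 0)).add ((hN 1).smul (hd k 1))),
    dzbarM_add ((hN 0).smul (hd k 0)) ((hN 1).smul (hd k 1)), dzbarM_mul hU hdΞ,
    dzbarM_smul (hd k 0) (hN 0), dzbarM_smul (hd k 1) (hN 1),
    dzbarM_mul (hd.mul (MatDiff.const _)) hdΞ, dzbarM_mul (hd.mul (MatDiff.const _)) hdΞ,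
    dzbarM_mul hd (MatDiff.const _), dzbarM_mul hd (MatDiff.const _), hcomm, dzM_dzbarM_frame hA, hΞ]
  have e : ∀ b, dzbar l (fun w => A w k b) z₀ = dzbarM l A z₀ k b := fun b => rfl
  rw [e 0, e 1, hbar l, hbar k]
  have r1 : ∀ X : Matrix (Fin 2) (Fin 2) ℂ, Ξ z₀ * (A z₀ * X) = X := fun X => by
    rw [← Matrix.mul_assoc, hinv', Matrix.one_mul]
  generalize A z₀ = a at *
  generalize Ξ z₀ = ξ at *
  generalize dzM k A z₀ = u at *
  simp only [dzbarM_const, frameOmega, Fin.sum_univ_two, Matrix.add_mul, Matrix.mul_add,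
    Matrix.smul_mul, Matrix.mul_smul, Matrix.mul_neg, Matrix.neg_mul, Matrix.mul_sub,
    Matrix.sub_mul, Matrix.mul_assoc, r1, neg_neg, Matrix.mul_zero,
    add_zero, Matrix.neg_apply, Matrix.add_apply, Matrix.smul_apply, map_neg, map_add, map_mul,
    smul_eq_mul, Complex.conj_conj, Matrix.mul_apply]
  module

end FrameCurvature

section FrameFlow

variable {M : Type*} [TopologicalSpace M] [ChartedSpace (Cn 2) M] {g : BilinField 2 M} {x₀ : M}
  {lam : ℝ} {A Ξ : Cn 2 → Matrix (Fin 2) (Fin 2) ℂ} {z₀ : Cn 2} {B : Matrix (Fin 2) (Fin 2) ℂ}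

lemma chernS_frame (hA : IsInvariantCoframe lam A Ξ z₀) (hB : B.det ≠ 0)
    (hg : ∀ᶠ z in 𝓝 z₀, hcoeff g x₀ z = A z * B * (A z)ᴴ) (i j : Fin 2) :
    chernS g x₀ i j z₀ = (A z₀ * frameS lam B * (A z₀)ᴴ) i j := by
  have hinv := hA.inv.self_of_nhds
  have hinv' : Ξ z₀ * A z₀ = 1 := mul_eq_one_comm.1 hinv
  have hB' : IsUnit B.det := isUnit_iff_ne_zero.2 hB
  have hs : (A z₀)ᴴ * (Ξ z₀)ᴴ = 1 := by rw [← Matrix.conjTranspose_mul, hinv']; simp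
  have hI : gInv g x₀ z₀ = (Ξ z₀)ᴴ * B⁻¹ * Ξ z₀ := by
    rw [gInv, hg.self_of_nhds]
    refine Matrix.inv_eq_right_inv ?_
    calc A z₀ * B * (A z₀)ᴴ * ((Ξ z₀)ᴴ * B⁻¹ * Ξ z₀)
        = A z₀ * B * ((A z₀)ᴴ * (Ξ z₀)ᴴ) * B⁻¹ * Ξ z₀ := by simp only [Matrix.mul_assoc]
      _ = A z₀ * (B * B⁻¹) * Ξ z₀ := by rw [hs]; simp only [Matrix.mul_assoc, Matrix.one_mul]
      _ = 1 := by rw [Matrix.mul_nonsing_inv _ hB', Matrix.mul_one, hinv]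
  have hcurv : ∀ k l, chernCurv g x₀ k l i j z₀ = ∑ b, ∑ c, (A z₀ k b * conj (A z₀ l c)) *
      (A z₀ * frameOmega lam B b c * B * (A z₀)ᴴ) i j := by
    intro k l
    have h1 : chernCurv g x₀ k l i j z₀ =
        -(dzbarM l (fun z => Matrix.of fun i p => chernGamma g x₀ k i p z) z₀
          * hcoeff g x₀ z₀) i j := by
      simp only [chernCurv, Matrix.mul_apply, ← Finset.sum_neg_distrib, neg_mul]; rfl
    rw [h1, dzbarM_chernGamma hA hB hg, hg.self_of_nhds, Matrix.neg_mul, Matrix.neg_apply, neg_neg,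
      Finset.sum_mul, Matrix.sum_apply]
    refine Finset.sum_congr rfl fun b _ => ?_
    rw [Finset.sum_mul, Matrix.sum_apply]
    refine Finset.sum_congr rfl fun c _ => ?_
    rw [Matrix.smul_mul, Matrix.smul_apply, smul_eq_mul]
    have : A z₀ * frameOmega lam B b c * Ξ z₀ * (A z₀ * B * (A z₀)ᴴ) =
        A z₀ * frameOmega lam B b c * (Ξ z₀ * A z₀) * B * (A z₀)ᴴ := by
      simp only [Matrix.mul_assoc]
    rw [this, hinv', Matrix.mul_one]
  have hcon : ∀ b c, ∑ k, ∑ l, gInv g x₀ z₀ l k * (A z₀ k b * conj (A z₀ l c)) = B⁻¹ c b := by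
    intro b c
    have : (A z₀)ᴴ * gInv g x₀ z₀ * A z₀ = B⁻¹ := by
      rw [hI]
      calc _ = ((A z₀)ᴴ * (Ξ z₀)ᴴ) * B⁻¹ * (Ξ z₀ * A z₀) := by simp only [Matrix.mul_assoc]
        _ = _ := by rw [hs, hinv', Matrix.one_mul, Matrix.mul_one]
    rw [← this]
    simp only [Matrix.mul_apply, Matrix.conjTranspose_apply, RCLike.star_def, Fin.sum_univ_two]
    ring
  calc chernS g x₀ i j z₀ = ∑ b, ∑ c, (∑ k, ∑ l, gInv g x₀ z₀ l k *
        (A z₀ k b * conj (A z₀ l c))) * (A z₀ * frameOmega lam B b c * B * (A z₀)ᴴ) i j := by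
        simp only [chernS, hcurv, Fin.sum_univ_two]
        ring
    _ = _ := by
        simp only [hcon]
        simp only [frameS, Fin.sum_univ_two, Matrix.add_mul, Matrix.mul_add,
          Matrix.smul_mul, Matrix.mul_smul, Matrix.add_apply, Matrix.smul_apply, smul_eq_mul,
          Matrix.mul_assoc]

/-- The torsion components `T_{12 d̄}` of the metric with matrix `B` in the frame. -/
def frameT (lam : ℝ) (B : Matrix (Fin 2) (Fin 2) ℂ) : Fin 2 → ℂ :=
  ![-((lam : ℂ) + Complex.I) * B 1 1, -Complex.I * B 0 1]

lemma chernT_frame (hA : IsInvariantCoframe lam A Ξ z₀) (hB : B.det ≠ 0)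
    (hg : ∀ᶠ z in 𝓝 z₀, hcoeff g x₀ z = A z * B * (A z)ᴴ) (j : Fin 2) :
    chernT g x₀ 0 1 j z₀ = (A z₀).det * ∑ d, frameT lam B d * conj (A z₀ j d) := by
  obtain ⟨hC, hd, hdΞ⟩ := hA.matDiff.self_of_nhds
  have hinv := hA.inv.self_of_nhds
  have hdA : (A z₀).det ≠ 0 := by
    intro h; have := congrArg Matrix.det hinv; simp [h] at this
  have hdet : (hcoeff g x₀ z₀).det ≠ 0 := by
    rw [hg.self_of_nhds]; simp [hdA, hB]
  have hM : ∀ k, dzM k (fun w => hcoeff g x₀ w) z₀ =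
      dzM k A z₀ * B * (A z₀)ᴴ + A z₀ * B * (dzbarM k A z₀)ᴴ := by
    intro k
    rw [dzM_congr hg, dzM_mul (hd.mul (MatDiff.const B)) hd.star,
      dzM_mul hd (MatDiff.const B), dzM_const, dzM_star hd, Matrix.mul_zero, add_zero]
  have e : ∀ k i, dz k (fun w => hcoeff g x₀ w i j) z₀ = dzM k (fun w => hcoeff g x₀ w) z₀ i j :=
    fun _ _ => rfl
  have ht : ∀ a, dzM 0 A z₀ 1 a - dzM 1 A z₀ 0 a =
      -(A z₀).det * (if a = 0 then Complex.I else 0) := hA.torsion.self_of_nhds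
  have t0 := ht 0
  have t1 := ht 1
  rw [chernT_eq g x₀ j z₀ hdet, e, e, hM, hM, hA.dbar.self_of_nhds, hA.dbar.self_of_nhds]
  generalize dzM 0 A z₀ = u0 at *
  generalize dzM 1 A z₀ = u1 at *
  simp only [Matrix.det_fin_two] at *
  generalize A z₀ = a at *
  simp only [if_true, one_ne_zero, if_false, mul_zero] at t0 t1
  have t0' := eq_add_of_sub_eq t0
  have t1' := eq_add_of_sub_eq t1
  simp only [Matrix.add_apply, Matrix.mul_apply, Fin.sum_univ_two, Matrix.conjTranspose_apply,
    Matrix.neg_apply, Matrix.smul_apply, smul_eq_mul, frameD, frameT, t0', t1', RCLike.star_def,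
    map_neg, map_add, map_mul, Complex.conj_conj]
  simp
  ring

/-- The flow tensor `K = S - Q` of the metric with matrix `B` in the frame. -/
def frameK (lam : ℝ) (B : Matrix (Fin 2) (Fin 2) ℂ) : Matrix (Fin 2) (Fin 2) ℂ :=
  frameS lam B - B.det⁻¹ • Matrix.vecMulVec (fun i => conj (frameT lam B i)) (frameT lam B)

lemma hcfK_frame (hA : IsInvariantCoframe lam A Ξ z₀) (hB : B.det ≠ 0)
    (hg : ∀ᶠ z in 𝓝 z₀, hcoeff g x₀ z = A z * B * (A z)ᴴ) (i j : Fin 2) :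
    hcfK g x₀ i j z₀ = (A z₀ * frameK lam B * (A z₀)ᴴ) i j := by
  have hinv := hA.inv.self_of_nhds
  have hdA : (A z₀).det ≠ 0 := by
    intro h; have := congrArg Matrix.det hinv; simp [h] at this
  have hdA' : conj (A z₀).det ≠ 0 := by simpa using hdA
  have hdet : (hcoeff g x₀ z₀).det = (A z₀).det * B.det * conj (A z₀).det := by
    rw [hg.self_of_nhds]; simp [Matrix.det_conjTranspose]
  have hdet' : (hcoeff g x₀ z₀).det ≠ 0 := by rw [hdet]; simp [hdA, hB]
  rw [hcfK, hcfQ_eq g x₀ i j z₀ hdet', chernS_frame hA hB hg, chernT_frame hA hB hg,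
    chernT_frame hA hB hg, hdet, frameK, Matrix.mul_sub, Matrix.sub_mul, Matrix.sub_apply]
  congr 1
  rw [map_mul, map_sum]
  field_simp
  simp only [Matrix.mul_apply, Matrix.smul_apply, Matrix.vecMulVec_apply, Fin.sum_univ_two,
    Matrix.conjTranspose_apply, RCLike.star_def, smul_eq_mul, map_mul, Complex.conj_conj]
  field_simp

/-- The matrix of a Hermitian metric in the frame. -/
def hermMat (x y : ℝ) (z : ℂ) : Matrix (Fin 2) (Fin 2) ℂ := !![(x : ℂ), z; conj z, (y : ℂ)]

lemma frameK_hermMat (lam x y : ℝ) (z : ℂ) (hd : x * y - Complex.normSq z ≠ 0) :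
    frameK lam (hermMat x y z) = hermMat
      (-2 - 2 * (1 + lam ^ 2) * y ^ 2 / (x * y - Complex.normSq z)
        + Complex.normSq z * ((1 + lam ^ 2) * y ^ 2 + x ^ 2 - 2 * Complex.normSq z)
          / (x * y - Complex.normSq z) ^ 2)
      (((1 + lam ^ 2) * y ^ 4 - 2 * y ^ 2 * Complex.normSq z + Complex.normSq z ^ 2)
          / (x * y - Complex.normSq z) ^ 2)
      (((y * ((1 + lam ^ 2) * y ^ 2 + x ^ 2 - 2 * x * y)
          / (x * y - Complex.normSq z) ^ 2 : ℝ) : ℂ) * z) := by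
  have hn : (Complex.normSq z : ℂ) = z * conj z := (Complex.mul_conj z).symm
  have hdet : (hermMat x y z).det = (x : ℂ) * y - z * conj z := by
    simp [hermMat, Matrix.det_fin_two]
  have hd' : (x : ℂ) * y - z * conj z ≠ 0 := by
    rw [← hn]; exact_mod_cast hd
  have hI : (hermMat x y z)⁻¹ = ((x : ℂ) * y - z * conj z)⁻¹ • !![(y : ℂ), -z; -conj z, (x : ℂ)] := by
    rw [Matrix.inv_def, Ring.inverse_eq_inv', hdet, Matrix.adjugate_fin_two]
    simp [hermMat]
  have hi : Complex.I ^ 2 = -1 := Complex.I_sq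
  have s0 : (frameD lam 0)ᴴ = !![0, 0; (lam : ℂ) + Complex.I, 0] := by
    ext i j; fin_cases i <;> fin_cases j <;> simp [frameD]
  have s1 : (frameD lam 1)ᴴ = !![Complex.I, 0; 0, 0] := by
    ext i j; fin_cases i <;> fin_cases j <;> simp [frameD]
  have n0 : frameN lam (hermMat x y z) 0 = (((lam : ℂ) + Complex.I) *
      ((x : ℂ) * y - z * conj z)⁻¹) • !![-(z * y), z ^ 2; -(y ^ 2 : ℂ), y * z] := by
    rw [frameN, s0, hI]
    ext i j; fin_cases i <;> fin_cases j <;> simp [hermMat] <;> ring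
  have n1 : frameN lam (hermMat x y z) 1 = (Complex.I *
      ((x : ℂ) * y - z * conj z)⁻¹) • !![-(x * y : ℂ), x * z; -(conj z * y), z * conj z] := by
    rw [frameN, s1, hI]
    ext i j; fin_cases i <;> fin_cases j <;> simp [hermMat] <;> ring
  ext i j
  rw [frameK, frameS, hdet]
  simp only [frameOmega, Fin.sum_univ_two, n0, n1, hI]
  simp only [frameD, frameT]
  fin_cases i <;> fin_cases j <;>
  · simp [hermMat, hn, Complex.conj_ofNat]
    field_simp
    ring_nf
    try simp only [hi]
    ring_nf

end FrameFlow

/-! ## Global solutions of the flow equations -/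

section ODE

open scoped NNReal

/-- The nearest point projection onto the box `Icc a b` of `ℝ³`. -/
def boxClamp (a b v : ℝ × ℝ × ℝ) : ℝ × ℝ × ℝ :=
  (max a.1 (min v.1 b.1), max a.2.1 (min v.2.1 b.2.1), max a.2.2 (min v.2.2 b.2.2))

lemma lipschitzWith_boxClamp (a b : ℝ × ℝ × ℝ) : LipschitzWith 1 (boxClamp a b) := by
  have h : ∀ (f : ℝ × ℝ × ℝ → ℝ) (p q : ℝ), LipschitzWith 1 f →
      LipschitzWith 1 (fun v => max p (min (f v) q)) := fun f p q hf =>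
    (hf.min_const q).const_max p
  have h1 : LipschitzWith 1 (fun v : ℝ × ℝ × ℝ => v.1) := LipschitzWith.prod_fst
  have h2 : LipschitzWith 1 (fun v : ℝ × ℝ × ℝ => v.2.1) := by
    have := LipschitzWith.prod_fst.comp (LipschitzWith.prod_snd (α := ℝ) (β := ℝ × ℝ))
    rwa [one_mul] at this
  have h3 : LipschitzWith 1 (fun v : ℝ × ℝ × ℝ => v.2.2) := by
    have := LipschitzWith.prod_snd.comp (LipschitzWith.prod_snd (α := ℝ) (β := ℝ × ℝ))
    rwa [one_mul] at this
  have := (h _ a.1 b.1 h1).prodMk ((h _ a.2.1 b.2.1 h2).prodMk (h _ a.2.2 b.2.2 h3))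
  rwa [max_self, max_self] at this

lemma boxClamp_mem {a b : ℝ × ℝ × ℝ} (hab : a ≤ b) (v : ℝ × ℝ × ℝ) :
    boxClamp a b v ∈ Icc a b := by
  obtain ⟨h1, h2, h3⟩ := hab
  exact ⟨⟨le_max_left _ _, le_max_left _ _, le_max_left _ _⟩,
    ⟨max_le h1 (min_le_right _ _), max_le h2 (min_le_right _ _), max_le h3 (min_le_right _ _)⟩⟩

lemma boxClamp_eq {a b v : ℝ × ℝ × ℝ} (hv : v ∈ Icc a b) : boxClamp a b v = v := by
  obtain ⟨⟨h1, h2, h3⟩, ⟨h4, h5, h6⟩⟩ := hv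
  simp only [boxClamp]
  rw [min_eq_left h4, min_eq_left h5, min_eq_left h6, max_eq_right h1, max_eq_right h2,
    max_eq_right h3]

/-- A `C¹` differential equation has a global solution if a priori every solution on `[0, n]` of the
equation extended constantly from a box `n` stays in this box. -/
lemma exists_global_solution {F : ℝ × ℝ × ℝ → ℝ × ℝ × ℝ} {v₀ : ℝ × ℝ × ℝ} {a b : ℕ → ℝ × ℝ × ℝ}
    (hab : ∀ n, a n ≤ b n) (hmono : ∀ n m, n ≤ m → Icc (a n) (b n) ⊆ Icc (a m) (b m))
    (hF : ∀ n, ContDiffOn ℝ 1 F (Icc (a n) (b n)))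
    (hstay : ∀ (n : ℕ) (f : ℝ → ℝ × ℝ × ℝ), f 0 = v₀ →
      (∀ t ∈ Icc (0 : ℝ) n, HasDerivWithinAt f (F (boxClamp (a n) (b n) (f t))) (Icc 0 n) t) →
      ∀ t ∈ Icc (0 : ℝ) n, f t ∈ Icc (a n) (b n)) :
    ∃ f : ℝ → ℝ × ℝ × ℝ, f 0 = v₀ ∧ ∀ t, 0 ≤ t →
      HasDerivWithinAt f (F (f t)) (Ici 0) t ∧ ∃ n, f t ∈ Icc (a n) (b n) := by
  have hlip : ∀ n, ∃ K, LipschitzWith K (fun v => F (boxClamp (a n) (b n) v)) := by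
    intro n
    obtain ⟨K, hK⟩ := (hF n).exists_lipschitzOnWith one_ne_zero (convex_Icc _ _) isCompact_Icc
    refine ⟨K, fun v w => ?_⟩
    refine (hK (boxClamp_mem (hab n) v) (boxClamp_mem (hab n) w)).trans ?_
    gcongr
    simpa using lipschitzWith_boxClamp (a n) (b n) v w
  have hbd : ∀ n, ∃ L : ℝ≥0, ∀ v, ‖F (boxClamp (a n) (b n) v)‖ ≤ L := by
    intro n
    obtain ⟨L, hL⟩ := isCompact_Icc.exists_bound_of_continuousOn (hF n).continuousOn
    exact ⟨⟨max L 0, le_max_right _ _⟩, fun v =>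
      (hL _ (boxClamp_mem (hab n) v)).trans (le_max_left _ _)⟩
  have hsol : ∀ n : ℕ, ∃ f : ℝ → ℝ × ℝ × ℝ, f 0 = v₀ ∧
      ∀ t ∈ Icc (0 : ℝ) n, HasDerivWithinAt f (F (boxClamp (a n) (b n) (f t))) (Icc 0 n) t := by
    intro n
    obtain ⟨K, hK⟩ := hlip n
    obtain ⟨L, hL⟩ := hbd n
    have hp : IsPicardLindelof (fun _ v => F (boxClamp (a n) (b n) v))
        (⟨0, left_mem_Icc.2 n.cast_nonneg⟩ : Icc (0 : ℝ) n) v₀ (L * n) 0 L K :=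
      { lipschitzOnWith := fun t _ => hK.lipschitzOnWith
        continuousOn := fun _ _ => continuousOn_const
        norm_le := fun t _ v _ => hL v
        mul_max_le := by simp }
    exact hp.exists_eq_forall_mem_Icc_hasDerivWithinAt₀
  choose f hf0 hf using hsol
  have hbox : ∀ n : ℕ, ∀ t ∈ Icc (0 : ℝ) n, f n t ∈ Icc (a n) (b n) := fun n =>
    hstay n (f n) (hf0 n) (hf n)
  have hf' : ∀ n : ℕ, ∀ t ∈ Icc (0 : ℝ) n, HasDerivWithinAt (f n) (F (f n t)) (Icc 0 n) t := by
    intro n t ht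
    have := hf n t ht
    rwa [boxClamp_eq (hbox n t ht)] at this
  have huniq : ∀ n m : ℕ, n ≤ m → EqOn (f n) (f m) (Icc 0 n) := by
    intro n m hnm
    obtain ⟨K, hK⟩ := hlip m
    have hnm' : (n : ℝ) ≤ m := by exact_mod_cast hnm
    have hd : ∀ k : ℕ, n ≤ k → k ≤ m → ∀ t ∈ Ico (0 : ℝ) n,
        HasDerivWithinAt (f k) (F (boxClamp (a m) (b m) (f k t))) (Ici t) t := by
      intro k hk hkm t ht
      have hk' : (n : ℝ) ≤ k := by exact_mod_cast hk
      have htk : t ∈ Icc (0 : ℝ) k := ⟨ht.1, ht.2.le.trans hk'⟩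
      rw [boxClamp_eq (hmono k m hkm (hbox k t htk))]
      refine (hf' k t htk).mono_of_mem_nhdsWithin ?_
      exact mem_of_superset (Icc_mem_nhdsGE (ht.2.trans_le hk')) (Icc_subset_Icc_left ht.1)
    have hc : ∀ k : ℕ, n ≤ k → ContinuousOn (f k) (Icc 0 n) := by
      intro k hk t ht
      have hk' : (n : ℝ) ≤ k := by exact_mod_cast hk
      exact ((hf' k t ⟨ht.1, ht.2.trans hk'⟩).continuousWithinAt).mono (Icc_subset_Icc_right hk')
    exact ODE_solution_unique (v := fun _ v => F (boxClamp (a m) (b m) v)) (fun _ => hK)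
      (hc n le_rfl) (hd n le_rfl hnm) (hc m hnm) (hd m hnm le_rfl) (by rw [hf0, hf0])
  refine ⟨fun t => f (⌈t⌉₊ + 1) t, by simp [hf0], fun t ht => ?_⟩
  have hlt : t < (⌈t⌉₊ + 1 : ℕ) := by
    push_cast; exact (Nat.le_ceil t).trans_lt (lt_add_one _)
  refine ⟨?_, ⌈t⌉₊ + 1, hbox _ t ⟨ht, hlt.le⟩⟩
  have h1 : HasDerivWithinAt (f (⌈t⌉₊ + 1)) (F (f (⌈t⌉₊ + 1) t)) (Ici 0) t := by
    refine (hf' _ t ⟨ht, hlt.le⟩).mono_of_mem_nhdsWithin ?_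
    rw [← Ici_inter_Iic]
    exact inter_mem self_mem_nhdsWithin (mem_nhdsWithin_of_mem_nhds (Iic_mem_nhds hlt))
  refine h1.congr_of_eventuallyEq ?_ rfl
  filter_upwards [self_mem_nhdsWithin, mem_nhdsWithin_of_mem_nhds (Iio_mem_nhds hlt)] with s hs hs'
  have hs1 : s ≤ (⌈s⌉₊ + 1 : ℕ) := by
    push_cast; exact (Nat.le_ceil s).trans (le_add_of_nonneg_right zero_le_one)
  rcases le_total (⌈s⌉₊ + 1) (⌈t⌉₊ + 1) with h | h
  · exact huniq _ _ h ⟨hs, hs1⟩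
  · exact (huniq _ _ h ⟨hs, le_of_lt hs'⟩).symm

/-- The flow equations for a metric with matrix `hermMat x y z` in the frame, `c = 1 + λ²`. -/
structure IsFlowSolution (c : ℝ) (x y : ℝ → ℝ) (z : ℝ → ℂ) : Prop where
  pos_y : ∀ t, 0 ≤ t → 0 < y t
  pos_det : ∀ t, 0 ≤ t → 0 < x t * y t - Complex.normSq (z t)
  hx : ∀ t, 0 ≤ t → HasDerivWithinAt x
    (2 + 2 * c * y t ^ 2 / (x t * y t - Complex.normSq (z t))
      - Complex.normSq (z t) * (c * y t ^ 2 + x t ^ 2 - 2 * Complex.normSq (z t))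
        / (x t * y t - Complex.normSq (z t)) ^ 2) (Ici 0) t
  hy : ∀ t, 0 ≤ t → HasDerivWithinAt y
    (-((c * y t ^ 4 - 2 * y t ^ 2 * Complex.normSq (z t) + Complex.normSq (z t) ^ 2)
        / (x t * y t - Complex.normSq (z t)) ^ 2)) (Ici 0) t
  hz : ∀ t, 0 ≤ t → HasDerivWithinAt z
    (-(((y t * (c * y t ^ 2 + x t ^ 2 - 2 * x t * y t)
        / (x t * y t - Complex.normSq (z t)) ^ 2 : ℝ) : ℂ) * z t)) (Ici 0) t

/-- The flow equations in the variables `d = det`, `y` and `r`, where `z = r z₀` and `u₀ = |z₀|²`. -/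
def flowField (c u₀ : ℝ) (v : ℝ × ℝ × ℝ) : ℝ × ℝ × ℝ :=
  ((2 * v.2.1 * v.1 + c * v.2.1 ^ 3 + u₀ * v.2.2 ^ 2 * ((v.1 + u₀ * v.2.2 ^ 2) / v.2.1)
      - 2 * (u₀ * v.2.2 ^ 2) * v.2.1) / v.1,
    -((c * v.2.1 ^ 4 - 2 * v.2.1 ^ 2 * (u₀ * v.2.2 ^ 2) + (u₀ * v.2.2 ^ 2) ^ 2) / v.1 ^ 2),
    -(v.2.2 * (v.2.1 * (c * v.2.1 ^ 2 + ((v.1 + u₀ * v.2.2 ^ 2) / v.2.1) ^ 2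
      - 2 * ((v.1 + u₀ * v.2.2 ^ 2) / v.2.1) * v.2.1) / v.1 ^ 2)))

lemma contDiffOn_flowField (c u₀ : ℝ) :
    ContDiffOn ℝ 1 (flowField c u₀) {v | 0 < v.1 ∧ 0 < v.2.1} := by
  intro v hv
  have h1 : v.1 ≠ 0 := hv.1.ne'
  have h2 : v.2.1 ≠ 0 := hv.2.ne'
  have h3 : v.1 ^ 2 ≠ 0 := pow_ne_zero 2 h1
  refine ContDiffAt.contDiffWithinAt ?_
  unfold flowField
  fun_prop (disch := assumption)

lemma flow_num_nonneg {c u d y : ℝ} (hc : 1 ≤ c) (hu : 0 ≤ u) (hd : 0 < d) (hy : 0 < y) :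
    0 ≤ c * y ^ 3 + u * ((d + u) / y) - 2 * u * y := by
  have h : c * y ^ 3 + u * ((d + u) / y) - 2 * u * y
      = ((c - 1) * y ^ 4 + (y ^ 2 - u) ^ 2 + u * d) / y := by field_simp; ring
  rw [h]
  have : 0 ≤ c - 1 := by linarith
  positivity

lemma flow_y_nonneg {c u d y : ℝ} (hc : 1 ≤ c) :
    0 ≤ (c * y ^ 4 - 2 * y ^ 2 * u + u ^ 2) / d ^ 2 := by
  have h : c * y ^ 4 - 2 * y ^ 2 * u + u ^ 2 = (c - 1) * y ^ 4 + (y ^ 2 - u) ^ 2 := by ring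
  have : 0 ≤ c - 1 := by linarith
  rw [h]; positivity

lemma flow_r_ge {c x y d : ℝ} (hc : 1 ≤ c) (hy : 0 < y) :
    y * (x - y) ^ 2 / d ^ 2 ≤ y * (c * y ^ 2 + x ^ 2 - 2 * x * y) / d ^ 2 := by
  have h : c * y ^ 2 + x ^ 2 - 2 * x * y = (c - 1) * y ^ 2 + (x - y) ^ 2 := by ring
  have : 0 ≤ c - 1 := by linarith
  rw [h]
  gcongr
  nlinarith [mul_nonneg this (sq_nonneg y)]

lemma flow_x_le {c u u₀ x y y₀ d d₀ : ℝ} (hc : 1 ≤ c) (hu : 0 ≤ u) (hu' : u ≤ u₀) (hd₀ : 0 < d₀)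
    (hd : d₀ ≤ d) (hy : 0 < y) (hy' : y ≤ y₀) :
    2 + 2 * c * y ^ 2 / d - u * (c * y ^ 2 + x ^ 2 - 2 * u) / d ^ 2 ≤
      2 + 2 * c * y₀ ^ 2 / d₀ + 2 * u₀ ^ 2 / d₀ ^ 2 := by
  have hd' : 0 < d := hd₀.trans_le hd
  have h1 : 2 * c * y ^ 2 / d ≤ 2 * c * y₀ ^ 2 / d₀ := by gcongr
  have h2 : -(u * (c * y ^ 2 + x ^ 2 - 2 * u) / d ^ 2) ≤ 2 * u₀ ^ 2 / d₀ ^ 2 := by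
    have : -(u * (c * y ^ 2 + x ^ 2 - 2 * u) / d ^ 2) ≤ 2 * u ^ 2 / d ^ 2 := by
      rw [← neg_div]
      gcongr
      have : 0 ≤ u * (c * y ^ 2 + x ^ 2) := by positivity
      nlinarith
    exact this.trans (by gcongr)
  linarith

lemma flow_x_identity {c u d y : ℝ} (hd : d ≠ 0) (hy : y ≠ 0) :
    (((2 * y * d + c * y ^ 3 + u * ((d + u) / y) - 2 * u * y) / d
        - 2 * u * (y * (c * y ^ 2 + ((d + u) / y) ^ 2 - 2 * ((d + u) / y) * y) / d ^ 2)) * y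
      - (d + u) * -((c * y ^ 4 - 2 * y ^ 2 * u + u ^ 2) / d ^ 2)) / y ^ 2
      = 2 + 2 * c * y ^ 2 / d - u * (c * y ^ 2 + ((d + u) / y) ^ 2 - 2 * u) / d ^ 2 := by
  field_simp
  ring

theorem exists_isFlowSolution {c x₀ y₀ : ℝ} {z₀ : ℂ} (hc : 1 ≤ c) (hy₀ : 0 < y₀)
    (hd₀ : 0 < x₀ * y₀ - Complex.normSq z₀) :
    ∃ x y z, IsFlowSolution c x y z ∧ x 0 = x₀ ∧ y 0 = y₀ ∧ z 0 = z₀ := by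
  set u₀ := Complex.normSq z₀ with hu₀
  set d₀ := x₀ * y₀ - u₀ with hd₀'
  have hu₀p : 0 ≤ u₀ := Complex.normSq_nonneg _
  have hx₀ : 0 < x₀ := by
    by_contra h
    nlinarith [mul_nonneg (neg_nonneg.2 (not_lt.1 h)) hy₀.le]
  set C₀ := 2 + 2 * c * y₀ ^ 2 / d₀ + 2 * u₀ ^ 2 / d₀ ^ 2 with hC₀
  have hC₀p : 0 < C₀ := by positivity
  let X : ℕ → ℝ := fun n => x₀ + C₀ * n
  have hX : ∀ n, x₀ ≤ X n := fun n => le_add_of_nonneg_right (by positivity)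
  have hXp : ∀ n, 0 < X n := fun n => hx₀.trans_le (hX n)
  let w : ℕ → ℝ := fun n => d₀ / X n / 2
  have hw : ∀ n, 0 < w n := fun n => by have := hXp n; positivity
  have hwy : ∀ n, w n ≤ y₀ := by
    intro n
    have h1 : d₀ / X n ≤ y₀ := by
      rw [div_le_iff₀ (hXp n)]
      nlinarith [hX n]
    have h2 : 0 < d₀ / X n := by have := hXp n; positivity
    change d₀ / X n / 2 ≤ y₀
    linarith
  have hXm : ∀ n m, n ≤ m → X n ≤ X m := fun n m h => by
    change x₀ + C₀ * n ≤ x₀ + C₀ * m; gcongr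
  have hwm : ∀ n m, n ≤ m → w m ≤ w n := fun n m h => by
    have := hXp n
    have := hXm n m h
    change d₀ / X m / 2 ≤ d₀ / X n / 2; gcongr
  let L : ℕ → ℝ := fun n => 2 * y₀ + c * y₀ ^ 3 / d₀ + u₀ * (1 + u₀ / d₀) / w n
  have hL : ∀ n, 0 ≤ L n := fun n => by have := hw n; positivity
  have hLm : ∀ n m, n ≤ m → L n ≤ L m := fun n m h => by
    have := hwm n m h
    have := hw m
    change 2 * y₀ + c * y₀ ^ 3 / d₀ + u₀ * (1 + u₀ / d₀) / w n ≤
      2 * y₀ + c * y₀ ^ 3 / d₀ + u₀ * (1 + u₀ / d₀) / w m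
    gcongr
  let a : ℕ → ℝ × ℝ × ℝ := fun n => (d₀, w n, -1)
  let b : ℕ → ℝ × ℝ × ℝ := fun n => (d₀ + L n * n, y₀, 1)
  have hmem : ∀ n (v : ℝ × ℝ × ℝ), v ∈ Icc (a n) (b n) ↔
      (d₀ ≤ v.1 ∧ v.1 ≤ d₀ + L n * n) ∧ (w n ≤ v.2.1 ∧ v.2.1 ≤ y₀) ∧ (-1 ≤ v.2.2 ∧ v.2.2 ≤ 1) := by
    intro n v
    simp only [mem_Icc, Prod.le_def, a, b]
    tauto
  have hpos : ∀ n (v : ℝ × ℝ × ℝ), v ∈ Icc (a n) (b n) → 0 < v.1 ∧ 0 < v.2.1 := fun n v hv => by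
    rw [hmem] at hv
    exact ⟨hd₀.trans_le hv.1.1, (hw n).trans_le hv.2.1.1⟩
  have hur : ∀ r : ℝ, -1 ≤ r → r ≤ 1 → u₀ * r ^ 2 ≤ u₀ := fun r h1 h2 => by
    have : r ^ 2 ≤ 1 := by nlinarith
    nlinarith
  have hab : ∀ n, a n ≤ b n := fun n =>
    ⟨le_add_of_nonneg_right (mul_nonneg (hL n) n.cast_nonneg), hwy n, by norm_num [a, b]⟩
  obtain ⟨f, hf0, hf⟩ : ∃ f : ℝ → ℝ × ℝ × ℝ, f 0 = (d₀, y₀, 1) ∧ ∀ t, 0 ≤ t →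
      HasDerivWithinAt f (flowField c u₀ (f t)) (Ici 0) t ∧ ∃ n, f t ∈ Icc (a n) (b n) := by
    refine exists_global_solution (a := a) (b := b) hab ?_ ?_ ?_
    · intro n m hnm v hv
      rw [hmem] at hv ⊢
      have h1 : L n * n ≤ L m * m := by
        have := hLm n m hnm
        have := hL n
        have := hL m
        gcongr
      exact ⟨⟨hv.1.1, hv.1.2.trans (by linarith)⟩, ⟨(hwm n m hnm).trans hv.2.1.1, hv.2.1.2⟩, hv.2.2⟩
    · exact fun n => (contDiffOn_flowField c u₀).mono fun v hv => hpos n v hv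
    · intro n f hf0 hf
      set k : ℝ → ℝ × ℝ × ℝ := fun t => boxClamp (a n) (b n) (f t) with hk
      have hkm : ∀ t, k t ∈ Icc (a n) (b n) := fun t => boxClamp_mem (hab n) _
      have hkm' := fun t => (hmem n (k t)).1 (hkm t)
      have hkp : ∀ t, 0 < (k t).1 ∧ 0 < (k t).2.1 := fun t => hpos n _ (hkm t)
      have hku : ∀ t, u₀ * (k t).2.2 ^ 2 ≤ u₀ := fun t => hur _ (hkm' t).2.2.1 (hkm' t).2.2.2
      have hku0 : ∀ t, 0 ≤ u₀ * (k t).2.2 ^ 2 := fun t => by positivity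
      have hd1 : ∀ t ∈ Icc (0 : ℝ) n, HasDerivWithinAt (fun s => (f s).1) (flowField c u₀ (k t)).1
          (Icc 0 n) t := fun t ht => (hf t ht).fst
      have hd2 : ∀ t ∈ Icc (0 : ℝ) n, HasDerivWithinAt (fun s => (f s).2.1)
          (flowField c u₀ (k t)).2.1 (Icc 0 n) t := fun t ht => (hf t ht).snd.fst
      have hd3 : ∀ t ∈ Icc (0 : ℝ) n, HasDerivWithinAt (fun s => (f s).2.2)
          (flowField c u₀ (k t)).2.2 (Icc 0 n) t := fun t ht => (hf t ht).snd.snd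
      have mono : ∀ (T : ℝ) (p p' : ℝ → ℝ), T ≤ n →
          (∀ t ∈ Icc (0 : ℝ) T, HasDerivWithinAt p (p' t) (Icc 0 n) t) →
          (∀ t ∈ Icc (0 : ℝ) T, 0 ≤ p' t) → MonotoneOn p (Icc 0 T) := by
        intro T p p' hT hp hp'
        refine monotoneOn_of_hasDerivWithinAt_nonneg (convex_Icc _ _)
          (fun t ht => (hp t ht).continuousWithinAt.mono (Icc_subset_Icc_right hT))
          (fun t ht => (hp t (interior_subset ht)).mono
            (interior_subset.trans (Icc_subset_Icc_right hT)))
          (fun t ht => hp' t (interior_subset ht))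
      have z0 : (0 : ℝ) ∈ Icc (0 : ℝ) n := left_mem_Icc.2 n.cast_nonneg
      have F1 : ∀ t, 0 ≤ (flowField c u₀ (k t)).1 ∧ (flowField c u₀ (k t)).1 ≤ L n := by
        intro t
        obtain ⟨p1, p2⟩ := hkp t
        have e : (flowField c u₀ (k t)).1 = 2 * (k t).2.1 + (c * (k t).2.1 ^ 3 + u₀ * (k t).2.2 ^ 2 *
            (((k t).1 + u₀ * (k t).2.2 ^ 2) / (k t).2.1) - 2 * (u₀ * (k t).2.2 ^ 2) * (k t).2.1)
            / (k t).1 := by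
          simp only [flowField]; field_simp; ring
        have := flow_num_nonneg hc (hku0 t) p1 p2
        refine ⟨by rw [e]; positivity, ?_⟩
        have hY := (hkm' t).2.1.2
        have hW := (hkm' t).2.1.1
        have hwn := hw n
        have hD := (hkm' t).1.1
        have g1 : c * (k t).2.1 ^ 3 / (k t).1 ≤ c * y₀ ^ 3 / d₀ := by gcongr
        have g2 : u₀ * (k t).2.2 ^ 2 * (((k t).1 + u₀ * (k t).2.2 ^ 2) / (k t).2.1) / (k t).1 ≤
            u₀ * (1 + u₀ / d₀) / w n := by
          have : u₀ * (k t).2.2 ^ 2 * (((k t).1 + u₀ * (k t).2.2 ^ 2) / (k t).2.1) / (k t).1 =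
            u₀ * (k t).2.2 ^ 2 * (1 + u₀ * (k t).2.2 ^ 2 / (k t).1) / (k t).2.1 := by
              field_simp
          rw [this]
          have := hku t
          have := hku0 t
          gcongr
        have g3 : 0 ≤ 2 * (u₀ * (k t).2.2 ^ 2) * (k t).2.1 / (k t).1 := by
          have := hku0 t
          positivity
        rw [e, sub_div, add_div]
        change _ ≤ 2 * y₀ + c * y₀ ^ 3 / d₀ + u₀ * (1 + u₀ / d₀) / w n
        linarith
      have F2 : ∀ t, (flowField c u₀ (k t)).2.1 ≤ 0 := fun t => by
        simpa [flowField] using flow_y_nonneg (u := u₀ * (k t).2.2 ^ 2) (d := (k t).1) hc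
      have D1 : MonotoneOn (fun s => (f s).1) (Icc 0 (n : ℝ)) :=
        mono n _ _ le_rfl hd1 fun t _ => (F1 t).1
      have D1' : MonotoneOn (fun s => L n * s - (f s).1) (Icc 0 (n : ℝ)) := by
        refine mono n _ (fun t => L n * 1 - (flowField c u₀ (k t)).1) le_rfl (fun t ht => ?_)
          (fun t _ => ?_)
        · exact ((hasDerivAt_id t).hasDerivWithinAt.const_mul (L n)).sub (hd1 t ht)
        · have := (F1 t).2; linarith
      have D2 : MonotoneOn (fun s => -(f s).2.1) (Icc 0 (n : ℝ)) :=
        mono n _ (fun t => -(flowField c u₀ (k t)).2.1) le_rfl (fun t ht => (hd2 t ht).neg)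
          fun t _ => by have := F2 t; linarith
      have D3 : MonotoneOn (fun s => -(f s).2.2 ^ 2) (Icc 0 (n : ℝ)) := by
        refine mono n _ (fun t => -(2 * (f t).2.2 * (flowField c u₀ (k t)).2.2)) le_rfl
          (fun t ht => ?_) (fun t _ => ?_)
        · exact (((hd3 t ht).pow 2).neg).congr_deriv (by push_cast; ring)
        · have h1 : 0 ≤ (f t).2.2 * (k t).2.2 := by
            have : (k t).2.2 = max (-1) (min (f t).2.2 1) := rfl
            rw [this]
            rcases le_total 0 (f t).2.2 with h | h
            · exact mul_nonneg h (le_max_of_le_right (le_min h zero_le_one))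
            · exact mul_nonneg_of_nonpos_of_nonpos h
                (max_le (by norm_num) ((min_le_left _ _).trans h))
          have h2 := (flow_r_ge (x := ((k t).1 + u₀ * (k t).2.2 ^ 2) / (k t).2.1) (d := (k t).1)
            hc (hkp t).2)
          have h3 : 0 ≤ (k t).2.1 * (((k t).1 + u₀ * (k t).2.2 ^ 2) / (k t).2.1 - (k t).2.1) ^ 2
            / (k t).1 ^ 2 := by have := (hkp t).2; positivity
          have := mul_nonneg h1 (h3.trans h2)
          simp only [flowField]
          linarith
      have E1 : ∀ t ∈ Icc (0 : ℝ) n, d₀ ≤ (f t).1 ∧ (f t).1 ≤ d₀ + L n * n := fun t ht => by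
        have h1 := D1 z0 ht ht.1
        have h2 := D1' z0 ht ht.1
        simp only [hf0] at h1 h2
        have h3 : L n * t ≤ L n * n := mul_le_mul_of_nonneg_left ht.2 (hL n)
        constructor <;> linarith
      have E2 : ∀ t ∈ Icc (0 : ℝ) n, (f t).2.1 ≤ y₀ := fun t ht => by
        have h1 := D2 z0 ht ht.1
        simp only [hf0] at h1
        linarith
      have E3 : ∀ t ∈ Icc (0 : ℝ) n, -1 ≤ (f t).2.2 ∧ (f t).2.2 ≤ 1 := fun t ht => by
        have h1 := D3 z0 ht ht.1
        simp only [hf0] at h1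
        have : (f t).2.2 ^ 2 ≤ 1 := by linarith
        exact abs_le.1 ((sq_le_one_iff_abs_le_one _).1 this)
      suffices hlow : ∀ t ∈ Icc (0 : ℝ) n, w n ≤ (f t).2.1 from fun t ht =>
        (hmem n _).2 ⟨E1 t ht, ⟨hlow t ht, E2 t ht⟩, E3 t ht⟩
      intro t ht
      by_contra hlt
      push Not at hlt
      have hcont : ContinuousOn (fun s => (f s).2.1) (Icc 0 t) := fun s hs =>
        ((hd2 s ⟨hs.1, hs.2.trans ht.2⟩).continuousWithinAt).mono (Icc_subset_Icc_right ht.2)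
      obtain ⟨τ, hτ, hτw⟩ := intermediate_value_Icc' ht.1 hcont
        ⟨hlt.le, by simpa [hf0] using hwy n⟩
      simp only at hτw
      have hτn : τ ≤ n := hτ.2.trans ht.2
      have hin : ∀ s ∈ Icc 0 τ, f s ∈ Icc (a n) (b n) := fun s hs => by
        have hs' : s ∈ Icc (0 : ℝ) n := ⟨hs.1, hs.2.trans hτn⟩
        have h1 := D2 hs' ⟨hτ.1, hτn⟩ hs.2
        simp only at h1
        exact (hmem n _).2 ⟨E1 s hs', ⟨by linarith, E2 s hs'⟩, E3 s hs'⟩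
      have hkf : ∀ s ∈ Icc 0 τ, k s = f s := fun s hs => boxClamp_eq (hin s hs)
      have hx : MonotoneOn (fun s => C₀ * s - ((f s).1 + u₀ * (f s).2.2 ^ 2) / (f s).2.1)
          (Icc 0 τ) := by
        refine mono τ _ (fun s => C₀ * 1 - (2 + 2 * c * (f s).2.1 ^ 2 / (f s).1
          - u₀ * (f s).2.2 ^ 2 * (c * (f s).2.1 ^ 2 + (((f s).1 + u₀ * (f s).2.2 ^ 2) / (f s).2.1) ^ 2
            - 2 * (u₀ * (f s).2.2 ^ 2)) / (f s).1 ^ 2)) hτn (fun s hs => ?_) (fun s hs => ?_)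
        · have hs' : s ∈ Icc (0 : ℝ) n := ⟨hs.1, hs.2.trans hτn⟩
          have hp := hpos n _ (hin s hs)
          refine ((hasDerivAt_id s).hasDerivWithinAt.const_mul C₀).sub ?_
          have h := ((hd1 s hs').add (((hd3 s hs').pow 2).const_mul u₀)).div (hd2 s hs') hp.2.ne'
          refine h.congr_deriv ?_
          rw [← flow_x_identity hp.1.ne' hp.2.ne', hkf s hs]
          simp only [flowField, Pi.add_apply, Pi.pow_apply]
          congr 1
          push_cast
          ring
        · have hp := (hmem n _).1 (hin s hs)
          have := flow_x_le (x := ((f s).1 + u₀ * (f s).2.2 ^ 2) / (f s).2.1) hc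
            (by positivity : 0 ≤ u₀ * (f s).2.2 ^ 2) (hur _ hp.2.2.1 hp.2.2.2) hd₀ hp.1.1
            (hpos n _ (hin s hs)).2 hp.2.1.2
          rw [mul_one, sub_nonneg]
          exact this
      have h1 := hx (left_mem_Icc.2 hτ.1) (right_mem_Icc.2 hτ.1) hτ.1
      simp only [hf0, hτw] at h1
      have h2 : (d₀ + u₀ * 1 ^ 2) / y₀ = x₀ := by rw [hd₀']; field_simp; ring
      rw [h2] at h1
      have h3 : ((f τ).1 + u₀ * (f τ).2.2 ^ 2) / w n ≤ X n := by
        have : C₀ * τ ≤ C₀ * n := mul_le_mul_of_nonneg_left hτn hC₀p.le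
        change _ ≤ x₀ + C₀ * n
        linarith
      rw [div_le_iff₀ (hw n)] at h3
      have h4 : X n * w n = d₀ / 2 := by
        have := (hXp n).ne'
        change X n * (d₀ / X n / 2) = d₀ / 2
        field_simp
      have h5 := (E1 τ ⟨hτ.1, hτn⟩).1
      have h6 : 0 ≤ u₀ * (f τ).2.2 ^ 2 := by positivity
      linarith
  have hp : ∀ t, 0 ≤ t → 0 < (f t).1 ∧ 0 < (f t).2.1 := fun t ht => by
    obtain ⟨n, hn⟩ := (hf t ht).2
    exact hpos n _ hn
  have hns : ∀ t, Complex.normSq ((((f t).2.2 : ℝ) : ℂ) * z₀) = u₀ * (f t).2.2 ^ 2 := fun t => by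
    rw [map_mul, Complex.normSq_ofReal, ← hu₀]; ring
  have hdet : ∀ t, 0 ≤ t → ((f t).1 + u₀ * (f t).2.2 ^ 2) / (f t).2.1 * (f t).2.1
      - Complex.normSq ((((f t).2.2 : ℝ) : ℂ) * z₀) = (f t).1 := fun t ht => by
    rw [hns, div_mul_cancel₀ _ (hp t ht).2.ne']; ring
  have hd1 : ∀ t, 0 ≤ t → HasDerivWithinAt (fun s => (f s).1) (flowField c u₀ (f t)).1 (Ici 0) t :=
    fun t ht => (hf t ht).1.fst
  have hd2 : ∀ t, 0 ≤ t → HasDerivWithinAt (fun s => (f s).2.1) (flowField c u₀ (f t)).2.1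
      (Ici 0) t := fun t ht => (hf t ht).1.snd.fst
  have hd3 : ∀ t, 0 ≤ t → HasDerivWithinAt (fun s => (f s).2.2) (flowField c u₀ (f t)).2.2
      (Ici 0) t := fun t ht => (hf t ht).1.snd.snd
  refine ⟨fun t => ((f t).1 + u₀ * (f t).2.2 ^ 2) / (f t).2.1, fun t => (f t).2.1,
    fun t => (((f t).2.2 : ℝ) : ℂ) * z₀, ⟨fun t ht => (hp t ht).2, fun t ht => ?_, fun t ht => ?_,
    fun t ht => ?_, fun t ht => ?_⟩, ?_, by simp [hf0], by simp [hf0]⟩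
  · rw [hdet t ht]; exact (hp t ht).1
  · rw [hdet t ht, hns]
    have h := ((hd1 t ht).add (((hd3 t ht).pow 2).const_mul u₀)).div (hd2 t ht) (hp t ht).2.ne'
    refine h.congr_deriv ?_
    rw [← flow_x_identity (hp t ht).1.ne' (hp t ht).2.ne']
    simp only [flowField, Pi.add_apply, Pi.pow_apply]
    congr 1
    push_cast
    ring
  · rw [hdet t ht, hns]
    exact hd2 t ht
  · rw [hdet t ht]
    refine ((hd3 t ht).ofReal_comp.mul_const z₀).congr_deriv ?_
    simp only [flowField]
    push_cast
    ring
  · simp [hf0, hd₀', hy₀.ne']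

end ODE

/-! ## Asymptotics of the flow equations -/

section Asymptotics

lemma monotoneOn_Ici_of_hasDerivWithinAt {f f' : ℝ → ℝ} {a : ℝ} (ha : 0 ≤ a)
    (hf : ∀ t, a ≤ t → HasDerivWithinAt f (f' t) (Ici 0) t) (hf' : ∀ t, a ≤ t → 0 ≤ f' t) :
    MonotoneOn f (Ici a) :=
  monotoneOn_of_hasDerivWithinAt_nonneg (convex_Ici _)
    (fun t ht => (hf t ht).continuousWithinAt.mono (Ici_subset_Ici.2 ha))
    (fun t ht => (hf t (interior_subset ht)).mono (interior_subset.trans (Ici_subset_Ici.2 ha)))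
    (fun t ht => hf' t (interior_subset ht))

/-- A function whose derivative tends to `m` grows like `m t`. -/
lemma tendsto_div_one_add_of_hasDerivWithinAt {f f' : ℝ → ℝ} {m : ℝ}
    (hf : ∀ t, 0 ≤ t → HasDerivWithinAt f (f' t) (Ici 0) t) (hf' : Tendsto f' atTop (𝓝 m)) :
    Tendsto (fun t => f t / (1 + t)) atTop (𝓝 m) := by
  rw [Metric.tendsto_atTop]
  intro ε hε
  obtain ⟨a, ha⟩ := (Metric.tendsto_atTop.1 hf') (ε / 2) (by positivity)
  set b := max a 0 with hb
  have hb0 : 0 ≤ b := le_max_right _ _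
  have hd : ∀ t, b ≤ t → |f' t - m| < ε / 2 := fun t ht => by
    simpa [Real.dist_eq] using ha t ((le_max_left _ _).trans ht)
  have h1 : MonotoneOn (fun s => (m + ε / 2) * s - f s) (Ici b) :=
    monotoneOn_Ici_of_hasDerivWithinAt hb0 (f' := fun t => (m + ε / 2) * 1 - f' t)
      (fun t ht => ((hasDerivAt_id t).hasDerivWithinAt.const_mul _).sub (hf t (hb0.trans ht)))
      (fun t ht => by have := (abs_lt.1 (hd t ht)).2; linarith)
  have h2 : MonotoneOn (fun s => f s - (m - ε / 2) * s) (Ici b) :=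
    monotoneOn_Ici_of_hasDerivWithinAt hb0 (f' := fun t => f' t - (m - ε / 2) * 1)
      (fun t ht => (hf t (hb0.trans ht)).sub ((hasDerivAt_id t).hasDerivWithinAt.const_mul _))
      (fun t ht => by have := (abs_lt.1 (hd t ht)).1; linarith)
  set K := |f b| + |m| + (|m| + ε) * b + ε with hK
  refine ⟨max b (2 * K / ε), fun t ht => ?_⟩
  have hbt : b ≤ t := (le_max_left _ _).trans ht
  have htK : 2 * K / ε ≤ t := (le_max_right _ _).trans ht
  have ht0 : 0 < 1 + t := by linarith
  have e1 := h1 (mem_Ici.2 le_rfl) hbt hbt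
  have e2 := h2 (mem_Ici.2 le_rfl) hbt hbt
  simp only at e1 e2
  rw [div_le_iff₀ hε] at htK
  have a1 := abs_le.1 (le_refl |f b|)
  have a2 := abs_le.1 (le_refl |m|)
  have a3 : |m * b| = |m| * b := by rw [abs_mul, abs_of_nonneg hb0]
  have a4 := abs_le.1 (le_refl |m * b|)
  have a5 : 0 ≤ ε * b := by positivity
  rw [Real.dist_eq, abs_lt]
  have : f t / (1 + t) - m = (f t - m * (1 + t)) / (1 + t) := by field_simp
  rw [this, lt_div_iff₀ ht0, div_lt_iff₀ ht0]
  constructor <;> nlinarith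

variable {c : ℝ} {x y : ℝ → ℝ} {z : ℝ → ℂ}

lemma IsFlowSolution.pos_x (h : IsFlowSolution c x y z) {t : ℝ} (ht : 0 ≤ t) : 0 < x t := by
  by_contra hx
  nlinarith [mul_nonneg (neg_nonneg.2 (not_lt.1 hx)) (h.pos_y t ht).le, h.pos_det t ht,
    Complex.normSq_nonneg (z t)]

lemma hasDerivWithinAt_normSq {z : ℝ → ℂ} {z' : ℂ} {s : Set ℝ} {t : ℝ}
    (h : HasDerivWithinAt z z' s t) :
    HasDerivWithinAt (fun s => Complex.normSq (z s)) (2 * (z t * conj z').re) s t := by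
  have h1 : HasDerivWithinAt (fun s => (z s).re) z'.re s t :=
    Complex.reCLM.hasFDerivAt.comp_hasDerivWithinAt t h
  have h2 : HasDerivWithinAt (fun s => (z s).im) z'.im s t :=
    Complex.imCLM.hasFDerivAt.comp_hasDerivWithinAt t h
  have h3 := (h1.fun_mul h1).fun_add (h2.fun_mul h2)
  refine (h3.congr_deriv ?_)
  simp; ring

lemma IsFlowSolution.hasDerivWithinAt_normSq (h : IsFlowSolution c x y z) {t : ℝ} (ht : 0 ≤ t) :
    HasDerivWithinAt (fun s => Complex.normSq (z s))
      (-(2 * (y t * (c * y t ^ 2 + x t ^ 2 - 2 * x t * y t)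
        / (x t * y t - Complex.normSq (z t)) ^ 2) * Complex.normSq (z t))) (Ici 0) t := by
  refine (_root_.hasDerivWithinAt_normSq (h.hz t ht)).congr_deriv ?_
  rw [map_neg, map_mul, Complex.conj_ofReal, mul_neg, Complex.neg_re, mul_left_comm,
    Complex.mul_conj, ← Complex.ofReal_mul, Complex.ofReal_re]
  ring

lemma IsFlowSolution.hasDerivWithinAt_det (h : IsFlowSolution c x y z) {t : ℝ} (ht : 0 ≤ t) :
    HasDerivWithinAt (fun s => x s * y s - Complex.normSq (z s))
      (2 * y t + (c * y t ^ 3 + Complex.normSq (z t) * x t - 2 * Complex.normSq (z t) * y t)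
        / (x t * y t - Complex.normSq (z t))) (Ici 0) t := by
  refine (((h.hx t ht).fun_mul (h.hy t ht)).fun_sub (h.hasDerivWithinAt_normSq ht)).congr_deriv ?_
  have hd := (h.pos_det t ht).ne'
  generalize Complex.normSq (z t) = u at *
  obtain ⟨D, hD⟩ : ∃ D, D = x t * y t - u := ⟨_, rfl⟩
  rw [← hD] at hd ⊢
  obtain rfl : u = x t * y t - D := by linarith
  field_simp
  ring

theorem IsFlowSolution.tendsto (hc : 1 ≤ c) (h : IsFlowSolution c x y z) :
    Tendsto (fun t => x t / (1 + t)) atTop (𝓝 2) ∧ Tendsto (fun t => y t / (1 + t)) atTop (𝓝 0) ∧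
    Tendsto (fun t => z t / (1 + t)) atTop (𝓝 0) ∧
    Tendsto (fun t => (x t - Complex.normSq (z t) / y t) / (1 + t)) atTop (𝓝 2) := by
  set u : ℝ → ℝ := fun t => Complex.normSq (z t) with hu
  set d : ℝ → ℝ := fun t => x t * y t - u t with hd
  have hu0 : ∀ t, 0 ≤ u t := fun t => Complex.normSq_nonneg _
  have hyp := h.pos_y
  have hdp : ∀ t, 0 ≤ t → 0 < d t := h.pos_det
  have hxp : ∀ t, 0 ≤ t → 0 < x t := fun t ht => h.pos_x ht
  have hxy : ∀ t, 0 ≤ t → x t = (d t + u t) / y t := fun t ht => by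
    have := (hyp t ht).ne'
    simp only [hd]; field_simp; ring
  have hphi : ∀ t, 0 ≤ t → y t * (x t - y t) ^ 2 / d t ^ 2 ≤
      y t * (c * y t ^ 2 + x t ^ 2 - 2 * x t * y t) / d t ^ 2 := fun t ht =>
    flow_r_ge hc (hyp t ht)
  have hphi0 : ∀ t, 0 ≤ t → 0 ≤ y t * (x t - y t) ^ 2 / d t ^ 2 := fun t ht => by
    have := hyp t ht; positivity
  have ud : ∀ t, 0 ≤ t → HasDerivWithinAt u
      (-(2 * (y t * (c * y t ^ 2 + x t ^ 2 - 2 * x t * y t) / d t ^ 2) * u t)) (Ici 0) t :=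
    fun t ht => h.hasDerivWithinAt_normSq ht
  have my : MonotoneOn (fun t => -y t) (Ici 0) :=
    monotoneOn_Ici_of_hasDerivWithinAt le_rfl (fun t ht => (h.hy t ht).neg) fun t _ => by
      rw [neg_neg]; exact flow_y_nonneg hc
  have mu : MonotoneOn (fun t => -u t) (Ici 0) :=
    monotoneOn_Ici_of_hasDerivWithinAt le_rfl (fun t ht => (ud t ht).neg) fun t ht => by
      have := mul_nonneg ((hphi0 t ht).trans (hphi t ht)) (hu0 t)
      linarith
  have hdd : ∀ t, 0 ≤ t → 0 ≤ (c * y t ^ 3 + u t * x t - 2 * u t * y t) / d t := fun t ht => by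
    have h1 := flow_num_nonneg hc (hu0 t) (hdp t ht) (hyp t ht)
    rw [← hxy t ht] at h1
    exact div_nonneg h1 (hdp t ht).le
  have md : MonotoneOn d (Ici 0) :=
    monotoneOn_Ici_of_hasDerivWithinAt le_rfl (fun t ht => h.hasDerivWithinAt_det ht)
      fun t ht => by have := hyp t ht; have := hdd t ht; simp only [hd, hu] at this; linarith
  have m0 : (0 : ℝ) ∈ Ici (0 : ℝ) := mem_Ici.2 le_rfl
  have by0 : ∀ t, 0 ≤ t → y t ≤ y 0 := fun t ht => by have := my m0 ht ht; simp only at this; linarith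
  have bu0 : ∀ t, 0 ≤ t → u t ≤ u 0 := fun t ht => by have := mu m0 ht ht; simp only at this; linarith
  have bd0 : ∀ t, 0 ≤ t → d 0 ≤ d t := fun t ht => md m0 ht ht
  have d0p := hdp 0 le_rfl
  have y0p := hyp 0 le_rfl
  have x0p := hxp 0 le_rfl
  set C₀ := 2 + 2 * c * y 0 ^ 2 / d 0 + 2 * u 0 ^ 2 / d 0 ^ 2 with hC₀
  have hC₀p : 0 < C₀ := by have := hu0 0; positivity
  have mx : MonotoneOn (fun t => C₀ * t - x t) (Ici 0) :=
    monotoneOn_Ici_of_hasDerivWithinAt le_rfl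
      (fun t ht => ((hasDerivAt_id t).hasDerivWithinAt.const_mul C₀).sub (h.hx t ht)) fun t ht => by
        have := flow_x_le (x := x t) hc (hu0 t) (bu0 t ht) d0p (bd0 t ht) (hyp t ht) (by0 t ht)
        rw [mul_one, sub_nonneg]
        exact this
  have bx : ∀ t, 0 ≤ t → x t ≤ x 0 + C₀ * t := fun t ht => by
    have := mx m0 ht ht
    simp only [mul_zero] at this
    linarith
  have lind : ∀ t, 0 ≤ t → 0 < x 0 + C₀ * t := fun t ht => by positivity
  have by1 : ∀ t, 0 ≤ t → d 0 / (x 0 + C₀ * t) ≤ y t := fun t ht => by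
    rw [div_le_iff₀ (lind t ht)]
    have h1 : d 0 ≤ x t * y t := (bd0 t ht).trans (by simp only [hd]; linarith [hu0 t])
    nlinarith [bx t ht, hyp t ht]
  -- the determinant tends to infinity
  have mlog : MonotoneOn (fun t => d t - 2 * d 0 / C₀ * Real.log (x 0 + C₀ * t)) (Ici 0) := by
    refine monotoneOn_Ici_of_hasDerivWithinAt le_rfl (fun t ht => ?_)
      (f' := fun t => (2 * y t + (c * y t ^ 3 + u t * x t - 2 * u t * y t) / d t)
        - 2 * d 0 / C₀ * (C₀ * 1 / (x 0 + C₀ * t))) (fun t ht => ?_)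
    · have hl : HasDerivAt (fun t => Real.log (x 0 + C₀ * t)) (C₀ * 1 / (x 0 + C₀ * t)) t :=
        (((hasDerivAt_id t).const_mul C₀).const_add (x 0)).log (lind t ht).ne'
      exact (h.hasDerivWithinAt_det ht).sub (hl.hasDerivWithinAt.const_mul _)
    · have h1 := by1 t ht
      have h2 := hdd t ht
      have h3 : 2 * d 0 / C₀ * (C₀ * 1 / (x 0 + C₀ * t)) = 2 * (d 0 / (x 0 + C₀ * t)) := by
        field_simp
      rw [h3]; linarith
  have tl : Tendsto (fun t => x 0 + C₀ * t) atTop atTop :=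
    tendsto_atTop_add_const_left _ _ (tendsto_id.const_mul_atTop hC₀p)
  have td : Tendsto d atTop atTop := by
    have h1 : Tendsto (fun t => (d 0 - 2 * d 0 / C₀ * Real.log (x 0 + C₀ * 0))
        + 2 * d 0 / C₀ * Real.log (x 0 + C₀ * t)) atTop atTop :=
      tendsto_atTop_add_const_left _ _
        ((Real.tendsto_log_atTop.comp tl).const_mul_atTop (by positivity))
    refine tendsto_atTop_mono' _ ?_ h1
    filter_upwards [eventually_ge_atTop (0 : ℝ)] with t ht
    have := mlog m0 ht ht
    simp only at this
    linarith
  have tx : Tendsto x atTop atTop := by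
    refine tendsto_atTop_mono' _ ?_ (td.atTop_div_const y0p)
    filter_upwards [eventually_ge_atTop (0 : ℝ)] with t ht
    rw [div_le_iff₀ y0p]
    have h1 : d t ≤ x t * y t := by simp only [hd]; linarith [hu0 t]
    nlinarith [by0 t ht, hxp t ht]
  -- exponential decay of the off-diagonal term
  set k := 1 / (2 * y 0) with hk
  have hkp : 0 < k := by positivity
  obtain ⟨a, ha0, ha⟩ : ∃ a, 0 ≤ a ∧ ∀ t, a ≤ t → 2 * y 0 ≤ x t := by
    obtain ⟨a, ha⟩ := (eventually_atTop.1 (tx.eventually_ge_atTop (2 * y 0)))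
    exact ⟨max a 0, le_max_right _ _, fun t ht => ha t ((le_max_left _ _).trans ht)⟩
  have hphik : ∀ t, a ≤ t → k ≤ 2 * (y t * (c * y t ^ 2 + x t ^ 2 - 2 * x t * y t) / d t ^ 2) := by
    intro t ht
    have ht0 := ha0.trans ht
    have h1 : k / 2 ≤ y t * (x t - y t) ^ 2 / d t ^ 2 := by
      have hy := hyp t ht0
      have hx := hxp t ht0
      have hdt := hdp t ht0
      have g1 : d t ≤ x t * y t := by simp only [hd]; linarith [hu0 t]
      have g2 : x t / 2 ≤ x t - y t := by linarith [ha t ht, by0 t ht0]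
      have g3 : y t * (x t / 2) ^ 2 / (x t * y t) ^ 2 ≤ y t * (x t - y t) ^ 2 / d t ^ 2 := by
        gcongr
      have g4 : y t * (x t / 2) ^ 2 / (x t * y t) ^ 2 = 1 / (4 * y t) := by
        field_simp; norm_num
      have g5 : k / 2 ≤ 1 / (4 * y t) := by
        have : k / 2 = 1 / (4 * y 0) := by rw [hk]; field_simp; norm_num
        rw [this]
        have := by0 t ht0
        gcongr
      linarith
    linarith [hphi t ht0]
  have me : MonotoneOn (fun t => -(u t * Real.exp (k * t))) (Ici a) := by
    refine monotoneOn_Ici_of_hasDerivWithinAt ha0 (fun t ht => ?_)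
      (f' := fun t => -(-(2 * (y t * (c * y t ^ 2 + x t ^ 2 - 2 * x t * y t) / d t ^ 2) * u t)
        * Real.exp (k * t) + u t * (Real.exp (k * t) * (k * 1)))) (fun t ht => ?_)
    · exact ((ud t (ha0.trans ht)).fun_mul
        ((hasDerivAt_id t).const_mul k).exp.hasDerivWithinAt).fun_neg
    · have := mul_nonneg (mul_nonneg (hu0 t) (Real.exp_pos (k * t)).le)
        (sub_nonneg.2 (hphik t ht))
      nlinarith
  set E := u a * Real.exp (k * a) with hE
  have hE0 : 0 ≤ E := mul_nonneg (hu0 a) (Real.exp_pos _).le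
  have bue : ∀ t, a ≤ t → u t ≤ E * Real.exp (-(k * t)) := fun t ht => by
    have := me (mem_Ici.2 le_rfl) ht ht
    simp only at this
    rw [Real.exp_neg, ← div_eq_mul_inv, le_div_iff₀ (Real.exp_pos _)]
    linarith
  have texp : ∀ n : ℕ, Tendsto (fun t => t ^ n * Real.exp (-(k * t))) atTop (𝓝 0) := fun n => by
    have := Real.tendsto_pow_mul_exp_neg_atTop_nhds_zero n
    have h2 := (this.comp (tendsto_id.const_mul_atTop hkp)).const_mul ((1 / k) ^ n)
    rw [mul_zero] at h2
    refine h2.congr fun t => ?_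
    simp only [Function.comp, id, mul_pow, ← mul_assoc]
    rw [← mul_pow, one_div, inv_mul_cancel₀ hkp.ne', one_pow, one_mul]
  have tu : Tendsto u atTop (𝓝 0) := by
    have h1 : Tendsto (fun t => E * (t ^ 0 * Real.exp (-(k * t)))) atTop (𝓝 0) := by
      simpa using (texp 0).const_mul E
    refine squeeze_zero' (Eventually.of_forall hu0) ?_ h1
    filter_upwards [eventually_ge_atTop a] with t ht
    simpa using bue t ht
  have tux : Tendsto (fun t => u t * x t ^ 2) atTop (𝓝 0) := by
    have h1 : Tendsto (fun t => E * (x 0 ^ 2 * (t ^ 0 * Real.exp (-(k * t)))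
        + 2 * x 0 * C₀ * (t ^ 1 * Real.exp (-(k * t)))
        + C₀ ^ 2 * (t ^ 2 * Real.exp (-(k * t))))) atTop (𝓝 0) := by
      simpa using ((((texp 0).const_mul (x 0 ^ 2)).add ((texp 1).const_mul (2 * x 0 * C₀))).add
        ((texp 2).const_mul (C₀ ^ 2))).const_mul E
    refine squeeze_zero' (Eventually.of_forall fun t => mul_nonneg (hu0 t) (sq_nonneg _)) ?_ h1
    filter_upwards [eventually_ge_atTop a] with t ht
    have ht0 := ha0.trans ht
    have h2 : x t ^ 2 ≤ (x 0 + C₀ * t) ^ 2 := by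
      have := hxp t ht0; have := bx t ht0; gcongr
    calc u t * x t ^ 2 ≤ E * Real.exp (-(k * t)) * (x 0 + C₀ * t) ^ 2 :=
          mul_le_mul (bue t ht) h2 (sq_nonneg _) ((hu0 t).trans (bue t ht))
      _ = _ := by ring
  -- the derivative of `x` tends to two
  have tx' : Tendsto (fun t => 2 + 2 * c * y t ^ 2 / d t
      - u t * (c * y t ^ 2 + x t ^ 2 - 2 * u t) / d t ^ 2) atTop (𝓝 2) := by
    have tdi : Tendsto (fun t => (d t)⁻¹) atTop (𝓝 0) := tendsto_inv_atTop_zero.comp td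
    have h1 : Tendsto (fun t => 2 * c * y t ^ 2 / d t) atTop (𝓝 0) := by
      refine squeeze_zero' (g := fun t => 2 * c * y 0 ^ 2 * (d t)⁻¹) ?_ ?_ ?_
      · filter_upwards [eventually_ge_atTop (0 : ℝ)] with t ht
        have := hdp t ht; positivity
      · filter_upwards [eventually_ge_atTop (0 : ℝ)] with t ht
        have := hdp t ht; have := hyp t ht; have := by0 t ht
        rw [div_eq_mul_inv]; gcongr
      · simpa using tdi.const_mul (2 * c * y 0 ^ 2)
    have h2 : Tendsto (fun t => u t * (c * y t ^ 2 + x t ^ 2 - 2 * u t) / d t ^ 2)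
        atTop (𝓝 0) := by
      have h3 : Tendsto (fun t => (u t * (c * y 0 ^ 2) + u t * x t ^ 2 + 2 * (u t * u t))
          * ((d t)⁻¹ * (d t)⁻¹)) atTop (𝓝 0) := by
        simpa using (((tu.mul_const (c * y 0 ^ 2)).add tux).add
          ((tu.mul tu).const_mul 2)).mul (tdi.mul tdi)
      refine squeeze_zero_norm' ?_ h3
      filter_upwards [eventually_ge_atTop (0 : ℝ)] with t ht
      have hdt := hdp t ht; have hy := hyp t ht; have hy0 := by0 t ht; have hut := hu0 t
      rw [Real.norm_eq_abs, abs_div, abs_of_nonneg (sq_nonneg (d t)), div_eq_mul_inv, ← mul_inv,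
        sq (d t)]
      refine mul_le_mul_of_nonneg_right ?_ (inv_nonneg.2 (mul_self_nonneg (d t)))
      have e1 : c * y t ^ 2 ≤ c * y 0 ^ 2 := by gcongr
      have e2 := mul_le_mul_of_nonneg_left e1 hut
      have e3 : 0 ≤ u t * (c * y t ^ 2) := by positivity
      have e4 : 0 ≤ u t * x t ^ 2 := by positivity
      have e5 : 0 ≤ u t * u t := by positivity
      rw [abs_le]
      constructor <;> nlinarith
    simpa using (h1.const_add 2).sub h2
  have tx2 : Tendsto (fun t => x t / (1 + t)) atTop (𝓝 2) :=
    tendsto_div_one_add_of_hasDerivWithinAt h.hx tx'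
  have t1 : Tendsto (fun t : ℝ => (1 + t)⁻¹) atTop (𝓝 0) :=
    tendsto_inv_atTop_zero.comp (tendsto_atTop_add_const_left _ _ tendsto_id)
  refine ⟨tx2, ?_, ?_, ?_⟩
  · refine squeeze_zero' (g := fun t => y 0 * (1 + t)⁻¹) ?_ ?_ (by simpa using t1.const_mul (y 0))
    · filter_upwards [eventually_ge_atTop (0 : ℝ)] with t ht
      have := hyp t ht; positivity
    · filter_upwards [eventually_ge_atTop (0 : ℝ)] with t ht
      rw [div_eq_mul_inv]
      have := by0 t ht; gcongr
  · refine squeeze_zero_norm' (a := fun t => Real.sqrt (u 0) * (1 + t)⁻¹) ?_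
      (by simpa using t1.const_mul (Real.sqrt (u 0)))
    filter_upwards [eventually_ge_atTop (0 : ℝ)] with t ht
    have e : ‖z t‖ ≤ Real.sqrt (u 0) := by
      rw [show ‖z t‖ = Real.sqrt (u t) from Complex.norm_def (z t)]
      exact Real.sqrt_le_sqrt (bu0 t ht)
    have e2 : ‖(1 + (t : ℂ))‖ = 1 + t := by
      rw [show (1 + (t : ℂ)) = ((1 + t : ℝ) : ℂ) by push_cast; rfl, Complex.norm_real,
        Real.norm_of_nonneg (by positivity)]
    rw [norm_div, e2, div_eq_mul_inv]
    gcongr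
  · have h1 : Tendsto (fun t => u t * (x t / (1 + t)) * (d 0)⁻¹) atTop (𝓝 0) := by
      simpa using (tu.mul tx2).mul_const (d 0)⁻¹
    have h2 : Tendsto (fun t => u t / y t / (1 + t)) atTop (𝓝 0) := by
      refine squeeze_zero' ?_ ?_ h1
      · filter_upwards [eventually_ge_atTop (0 : ℝ)] with t ht
        have := hyp t ht; have := hu0 t; positivity
      · filter_upwards [eventually_ge_atTop (0 : ℝ)] with t ht
        have hy := hyp t ht; have hx := hxp t ht; have hut := hu0 t
        have g1 : d 0 ≤ x t * y t := (bd0 t ht).trans (by simp only [hd]; linarith)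
        have : u t / y t / (1 + t) = u t / (1 + t) * (1 / y t) := by field_simp
        rw [this]
        have : u t * (x t / (1 + t)) * (d 0)⁻¹ = u t / (1 + t) * (x t / d 0) := by field_simp
        rw [this]
        refine mul_le_mul_of_nonneg_left ?_ (by positivity)
        rw [div_le_div_iff₀ hy d0p]
        linarith
    simpa [sub_div] using tx2.sub h2

end Asymptotics

section DirectionalWirtinger

variable {n : ℕ} {F : Cn n → ℂ} {z : Cn n}

lemma sum_smul_stdVec (w : Cn n) : ∑ k, w k • (stdVec k : Cn n) = w := by
  ext j
  simp [stdVec, Finset.sum_apply, Pi.single_apply]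

lemma fderiv_eq_sum (F : Cn n → ℂ) (z w : Cn n) : fderiv ℝ F z w =
    ∑ k, ((w k).re * fderiv ℝ F z (stdVec k) + (w k).im * fderiv ℝ F z (Complex.I • stdVec k)) := by
  conv_lhs => rw [← sum_smul_stdVec w, map_sum]
  refine Finset.sum_congr rfl fun k _ => ?_
  have : w k • (stdVec k : Cn n) = (w k).re • stdVec k + (w k).im • (Complex.I • stdVec k) := by
    conv_lhs => rw [← Complex.re_add_im (w k), add_smul, mul_smul]
    rw [Complex.coe_smul, Complex.coe_smul]
  rw [this, map_add, map_smul, map_smul, Complex.real_smul, Complex.real_smul]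

lemma sum_mul_dz (F : Cn n → ℂ) (z w : Cn n) : ∑ k, w k * dz k F z =
    (fderiv ℝ F z w - Complex.I * fderiv ℝ F z (Complex.I • w)) / 2 := by
  rw [fderiv_eq_sum F z w, fderiv_eq_sum F z (Complex.I • w), Finset.mul_sum,
    ← Finset.sum_sub_distrib, Finset.sum_div]
  refine Finset.sum_congr rfl fun k _ => ?_
  simp only [dz, PiLp.smul_apply, smul_eq_mul, Complex.I_mul_re, Complex.I_mul_im]
  conv_lhs => rw [← Complex.re_add_im (w k)]
  push_cast
  ring_nf
  rw [Complex.I_sq]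
  ring

lemma sum_conj_mul_dzbar (F : Cn n → ℂ) (z w : Cn n) : ∑ k, conj (w k) * dzbar k F z =
    (fderiv ℝ F z w + Complex.I * fderiv ℝ F z (Complex.I • w)) / 2 := by
  rw [fderiv_eq_sum F z w, fderiv_eq_sum F z (Complex.I • w), Finset.mul_sum,
    ← Finset.sum_add_distrib, Finset.sum_div]
  refine Finset.sum_congr rfl fun k _ => ?_
  simp only [dzbar, PiLp.smul_apply, smul_eq_mul, Complex.I_mul_re, Complex.I_mul_im]
  conv_lhs => rw [← Complex.re_add_im (w k)]
  simp only [map_add, map_mul, Complex.conj_ofReal, Complex.conj_I]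
  push_cast
  ring_nf
  rw [Complex.I_sq]
  ring

lemma fderiv_coord_apply {ξ : Cn n → Cn n} {z : Cn n} (h : DifferentiableAt ℝ ξ z) (j : Fin n)
    (v : Cn n) : fderiv ℝ (fun w => ξ w j) z v = fderiv ℝ ξ z v j := by
  have := ((EuclideanSpace.proj j : Cn n →L[ℂ] ℂ).restrictScalars ℝ).hasFDerivAt.comp z
    h.hasFDerivAt
  rw [show (fun w => ξ w j) = ((EuclideanSpace.proj j : Cn n →L[ℂ] ℂ).restrictScalars ℝ) ∘ ξ
    from rfl, this.fderiv]
  rfl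

end DirectionalWirtinger

section CoframeOfBrackets

open VectorField

/-- The matrix whose rows are the values of two vector fields. -/
def rowMat (ξ₁ ξ₂ : Cn 2 → Cn 2) (z : Cn 2) : Matrix (Fin 2) (Fin 2) ℂ :=
  Matrix.of fun a k => if a = 0 then ξ₁ z k else ξ₂ z k

/-- The brackets of the frame `ξ₁, ξ₂, Jξ₁, Jξ₂`. -/
structure HasFrameBrackets (lam : ℝ) (ξ₁ ξ₂ : Cn 2 → Cn 2) (z : Cn 2) : Prop where
  hp : lieBracket ℝ ξ₁ (fun w => Complex.I • ξ₁ w) z =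
    (2 : ℂ) • (ξ₂ z + ((lam : ℂ) * Complex.I) • ξ₂ z)
  rh : lieBracket ℝ ξ₂ ξ₁ z = (-2 * Complex.I) • ξ₁ z
  rp : lieBracket ℝ ξ₂ (fun w => Complex.I • ξ₁ w) z = (2 : ℂ) • ξ₁ z
  th : lieBracket ℝ (fun w => Complex.I • ξ₂ w) ξ₁ z = 0
  tp : lieBracket ℝ (fun w => Complex.I • ξ₂ w) (fun w => Complex.I • ξ₁ w) z = 0
  rt : lieBracket ℝ ξ₂ (fun w => Complex.I • ξ₂ w) z = 0

variable {lam : ℝ} {ξ₁ ξ₂ : Cn 2 → Cn 2} {z z₀ : Cn 2}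

lemma fderiv_I_smul {ξ : Cn 2 → Cn 2} (v : Cn 2) (h : DifferentiableAt ℝ ξ z) :
    fderiv ℝ (fun w => Complex.I • ξ w) z v = Complex.I • fderiv ℝ ξ z v := by
  rw [fderiv_fun_const_smul h]; rfl

lemma HasFrameBrackets.eqs (h : HasFrameBrackets lam ξ₁ ξ₂ z) (h₁ : DifferentiableAt ℝ ξ₁ z)
    (h₂ : DifferentiableAt ℝ ξ₂ z) (j : Fin 2) :
    (∑ k, conj (ξ₁ z k) * dzbar k (fun w => ξ₁ w j) z = (lam - Complex.I) * ξ₂ z j) ∧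
    (∑ k, conj (ξ₂ z k) * dzbar k (fun w => ξ₁ w j) z = -Complex.I * ξ₁ z j) ∧
    (∑ k, conj (ξ₁ z k) * dzbar k (fun w => ξ₂ w j) z = 0) ∧
    (∑ k, conj (ξ₂ z k) * dzbar k (fun w => ξ₂ w j) z = 0) ∧
    (∑ k, ξ₁ z k * dz k (fun w => ξ₂ w j) z - ∑ k, ξ₂ z k * dz k (fun w => ξ₁ w j) z =
      Complex.I * ξ₁ z j) := by
  simp only [sum_mul_dz, sum_conj_mul_dzbar, fderiv_coord_apply h₁, fderiv_coord_apply h₂]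
  have e1 := congrArg (fun v : Cn 2 => v j) h.hp
  have e2 := congrArg (fun v : Cn 2 => v j) h.rh
  have e3 := congrArg (fun v : Cn 2 => v j) h.rp
  have e4 := congrArg (fun v : Cn 2 => v j) h.th
  have e5 := congrArg (fun v : Cn 2 => v j) h.tp
  have e6 := congrArg (fun v : Cn 2 => v j) h.rt
  simp only [lieBracket, fderiv_I_smul _ h₁, fderiv_I_smul _ h₂, PiLp.sub_apply, PiLp.smul_apply,
    PiLp.add_apply, smul_eq_mul, PiLp.zero_apply] at e1 e2 e3 e4 e5 e6
  have hI := Complex.I_mul_I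
  refine ⟨?_, ?_, ?_, ?_, ?_⟩
  · linear_combination (-Complex.I / 2) * e1 + (fderiv ℝ ξ₁ z (ξ₁ z) j / 2 - lam * ξ₂ z j) * hI
  · linear_combination (1 / 2) * e2 + (Complex.I / 2) * e4
      + (fderiv ℝ ξ₂ z (ξ₁ z) j / 2) * hI
  · linear_combination (-1 / 2) * e5 + (Complex.I / 2) * e4 + (fderiv ℝ ξ₂ z (ξ₁ z) j / 2) * hI
  · linear_combination (-Complex.I / 2) * e6 + (fderiv ℝ ξ₂ z (ξ₂ z) j / 2) * hI
  · linear_combination (-1 / 2) * e2 + (1 / 2) * e5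

lemma dbarM_rowMat (h : HasFrameBrackets lam ξ₁ ξ₂ z) (h₁ : DifferentiableAt ℝ ξ₁ z)
    (h₂ : DifferentiableAt ℝ ξ₂ z) (b : Fin 2) :
    ∑ k, conj (rowMat ξ₁ ξ₂ z b k) • dzbarM k (rowMat ξ₁ ξ₂) z =
      frameD lam b * rowMat ξ₁ ξ₂ z := by
  ext a j
  obtain ⟨e1, e2, e3, e4, -⟩ := h.eqs h₁ h₂ j
  rw [Matrix.sum_apply]
  fin_cases b <;> fin_cases a <;>
    simp [dzbarM, rowMat, frameD, Matrix.mul_apply, -Fin.sum_univ_two] at e1 e2 e3 e4 ⊢ <;>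
    simp [Fin.sum_univ_two] at e1 e2 e3 e4 ⊢ <;> assumption

lemma dzM_rowMat (h : HasFrameBrackets lam ξ₁ ξ₂ z) (h₁ : DifferentiableAt ℝ ξ₁ z)
    (h₂ : DifferentiableAt ℝ ξ₂ z) (j : Fin 2) :
    ∑ k, rowMat ξ₁ ξ₂ z 0 k * dzM k (rowMat ξ₁ ξ₂) z 1 j
      - ∑ k, rowMat ξ₁ ξ₂ z 1 k * dzM k (rowMat ξ₁ ξ₂) z 0 j =
      Complex.I * rowMat ξ₁ ξ₂ z 0 j := by
  obtain ⟨-, -, -, -, e5⟩ := h.eqs h₁ h₂ j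
  simpa [dzM, rowMat] using e5

lemma contDiffAt_rowMat (h₁ : ContDiffAt ℝ ∞ ξ₁ z) (h₂ : ContDiffAt ℝ ∞ ξ₂ z) (i j : Fin 2) :
    ContDiffAt ℝ ∞ (fun w => rowMat ξ₁ ξ₂ w i j) z := by
  have key : ∀ ξ : Cn 2 → Cn 2, ContDiffAt ℝ ∞ ξ z → ContDiffAt ℝ ∞ (fun w => ξ w j) z :=
    fun ξ h => ((EuclideanSpace.proj j : Cn 2 →L[ℂ] ℂ).restrictScalars ℝ).contDiff.contDiffAt.comp z h
  fin_cases i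
  · exact key _ h₁
  · exact key _ h₂

theorem isInvariantCoframe_of_brackets (h₁ : ContDiffAt ℝ ∞ ξ₁ z₀) (h₂ : ContDiffAt ℝ ∞ ξ₂ z₀)
    (hdet : (rowMat ξ₁ ξ₂ z₀).det ≠ 0) (hbr : ∀ᶠ z in 𝓝 z₀, HasFrameBrackets lam ξ₁ ξ₂ z) :
    IsInvariantCoframe lam (fun z => (rowMat ξ₁ ξ₂ z)⁻¹) (rowMat ξ₁ ξ₂) z₀ := by
  have hs := contDiffAt_rowMat h₁ h₂
  have hsd : ContDiffAt ℝ ∞ (fun w => (rowMat ξ₁ ξ₂ w).det) z₀ := by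
    simp only [Matrix.det_fin_two]
    exact ((hs 0 0).mul (hs 1 1)).sub ((hs 0 1).mul (hs 1 0))
  have hsA : ∀ i j, ContDiffAt ℝ ∞ (fun w => (rowMat ξ₁ ξ₂ w)⁻¹ i j) z₀ := by
    intro i j
    simp only [Matrix.inv_def, Ring.inverse_eq_inv', Matrix.adjugate_fin_two, Matrix.smul_apply,
      smul_eq_mul]
    refine (hsd.inv hdet).mul ?_
    fin_cases i <;> fin_cases j <;> simp <;> first | exact hs _ _ | exact (hs _ _).neg
  have hinv : ∀ᶠ z in 𝓝 z₀, (rowMat ξ₁ ξ₂ z)⁻¹ * rowMat ξ₁ ξ₂ z = 1 := by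
    filter_upwards [hsd.continuousAt.eventually_ne hdet] with z hz
    exact Matrix.nonsing_inv_mul _ (isUnit_iff_ne_zero.2 hz)
  have hdiff : ∀ {F : Cn 2 → ℂ}, ContDiffAt ℝ ∞ F z₀ → ∀ᶠ z in 𝓝 z₀, DifferentiableAt ℝ F z :=
    fun hF => ((hF.of_le two_le_infty).eventually (by simp)).mono
      fun z hz => hz.differentiableAt two_ne_zero
  have hd1 : ∀ᶠ z in 𝓝 z₀, DifferentiableAt ℝ ξ₁ z :=
    ((h₁.of_le two_le_infty).eventually (by simp)).mono fun z hz => hz.differentiableAt two_ne_zero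
  have hd2 : ∀ᶠ z in 𝓝 z₀, DifferentiableAt ℝ ξ₂ z :=
    ((h₂.of_le two_le_infty).eventually (by simp)).mono fun z hz => hz.differentiableAt two_ne_zero
  have hdA : ∀ᶠ z in 𝓝 z₀, MatDiff (fun z => (rowMat ξ₁ ξ₂ z)⁻¹) z := by
    simp only [MatDiff, eventually_all]; exact fun i j => hdiff (hsA i j)
  have hdX : ∀ᶠ z in 𝓝 z₀, MatDiff (rowMat ξ₁ ξ₂) z := by
    simp only [MatDiff, eventually_all]; exact fun i j => hdiff (hs i j)
  have hbarA : ∀ᶠ z in 𝓝 z₀, ∀ k, dzbarM k (fun z => (rowMat ξ₁ ξ₂ z)⁻¹) z =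
      -((rowMat ξ₁ ξ₂ z)⁻¹ * dzbarM k (rowMat ξ₁ ξ₂) z * (rowMat ξ₁ ξ₂ z)⁻¹) := by
    filter_upwards [hdA, hdX, hinv, hinv.eventually_nhds] with z hA hX hi hi' k
    have e := dzbarM_mul (k := k) hA hX
    rw [dzbarM_congr (F' := fun _ => 1) hi', dzbarM_const] at e
    have hi2 := mul_eq_one_comm.1 hi
    calc _ = dzbarM k (fun z => (rowMat ξ₁ ξ₂ z)⁻¹) z * rowMat ξ₁ ξ₂ z * (rowMat ξ₁ ξ₂ z)⁻¹ := by
          rw [Matrix.mul_assoc, hi2, Matrix.mul_one]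
      _ = _ := by rw [eq_neg_of_add_eq_zero_left e.symm, Matrix.neg_mul]
  have hzA : ∀ᶠ z in 𝓝 z₀, ∀ k, dzM k (fun z => (rowMat ξ₁ ξ₂ z)⁻¹) z =
      -((rowMat ξ₁ ξ₂ z)⁻¹ * dzM k (rowMat ξ₁ ξ₂) z * (rowMat ξ₁ ξ₂ z)⁻¹) := by
    filter_upwards [hdA, hdX, hinv, hinv.eventually_nhds] with z hA hX hi hi' k
    have e := dzM_mul (k := k) hA hX
    rw [dzM_congr (F' := fun _ => 1) hi', dzM_const] at e
    have hi2 := mul_eq_one_comm.1 hi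
    calc _ = dzM k (fun z => (rowMat ξ₁ ξ₂ z)⁻¹) z * rowMat ξ₁ ξ₂ z * (rowMat ξ₁ ξ₂ z)⁻¹ := by
          rw [Matrix.mul_assoc, hi2, Matrix.mul_one]
      _ = _ := by rw [eq_neg_of_add_eq_zero_left e.symm, Matrix.neg_mul]
  refine ⟨hsA, hs, hinv, ?_, ?_⟩
  · filter_upwards [hbarA, hinv, hd1, hd2, hbr] with z hA hi hz1 hz2 hb k
    rw [hA]
    generalize hAz : (rowMat ξ₁ ξ₂ z)⁻¹ = A at *
    congr 1
    have key : dzbarM k (rowMat ξ₁ ξ₂) z = ∑ b, conj (A k b) • (frameD lam b * rowMat ξ₁ ξ₂ z) := by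
      simp only [← dbarM_rowMat hb hz1 hz2, Finset.smul_sum, smul_smul, ← map_mul]
      rw [Finset.sum_comm]
      simp only [← Finset.sum_smul, ← map_sum, ← Matrix.mul_apply, hi]
      simp [Matrix.one_apply, Finset.sum_ite_eq]
    rw [key, Matrix.mul_sum, Matrix.sum_mul]
    refine Finset.sum_congr rfl fun b _ => ?_
    rw [Matrix.mul_smul, Matrix.smul_mul, Matrix.mul_assoc, Matrix.mul_assoc,
      mul_eq_one_comm.1 hi, Matrix.mul_one]
  · filter_upwards [hzA, hinv, hd1, hd2, hbr] with z hA hi hz1 hz2 hb a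
    have hA' : ∀ k i, dz k (fun w => (rowMat ξ₁ ξ₂ w)⁻¹ i a) z =
      (-((rowMat ξ₁ ξ₂ z)⁻¹ * dzM k (rowMat ξ₁ ξ₂) z * (rowMat ξ₁ ξ₂ z)⁻¹)) i a :=
        fun k i => by rw [← hA k]; rfl
    rw [hA', hA']
    have key := dzM_rowMat hb hz1 hz2
    generalize (rowMat ξ₁ ξ₂ z)⁻¹ = A at *
    generalize rowMat ξ₁ ξ₂ z = Ξ at *
    have a00 := congrFun (congrFun hi 0) 0
    have a01 := congrFun (congrFun hi 0) 1
    have a10 := congrFun (congrFun hi 1) 0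
    have a11 := congrFun (congrFun hi 1) 1
    have b0 := congrFun (congrFun (mul_eq_one_comm.1 hi : Ξ * A = 1) 0) a
    simp only [Matrix.mul_apply, Fin.sum_univ_two, Matrix.neg_apply, Matrix.det_fin_two,
      Matrix.one_apply_eq, Matrix.one_apply_ne zero_ne_one, Matrix.one_apply_ne one_ne_zero]
      at key a00 a01 a10 a11 b0 ⊢
    have h00 : A 0 0 = (A 0 0 * A 1 1 - A 0 1 * A 1 0) * Ξ 1 1 := by
      linear_combination -A 0 0 * a11 + A 1 0 * a01
    have h01 : A 0 1 = -(A 0 0 * A 1 1 - A 0 1 * A 1 0) * Ξ 0 1 := by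
      linear_combination A 1 1 * a01 - A 0 1 * a11
    have h10 : A 1 0 = -(A 0 0 * A 1 1 - A 0 1 * A 1 0) * Ξ 1 0 := by
      linear_combination A 0 0 * a10 - A 1 0 * a00
    have h11 : A 1 1 = (A 0 0 * A 1 1 - A 0 1 * A 1 0) * Ξ 0 0 := by
      linear_combination -A 1 1 * a00 + A 0 1 * a10
    have b0' : Ξ 0 0 * A 0 a + Ξ 0 1 * A 1 a = if a = 0 then 1 else 0 := by
      rw [b0, Matrix.one_apply]; simp only [eq_comm]
    have hite : (if a = 0 then Complex.I else 0) = Complex.I * (if a = 0 then 1 else 0) := by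
      split_ifs <;> simp
    rw [hite, ← b0']
    set U := dzM 0 (rowMat ξ₁ ξ₂) z
    set V := dzM 1 (rowMat ξ₁ ξ₂) z
    have key0 := key 0
    have key1 := key 1
    linear_combination -(U 0 0 * A 0 a + U 0 1 * A 1 a) * h10 - (U 1 0 * A 0 a + U 1 1 * A 1 a) * h11
      + (V 0 0 * A 0 a + V 0 1 * A 1 a) * h00 + (V 1 0 * A 0 a + V 1 1 * A 1 a) * h01
      - (A 0 0 * A 1 1 - A 0 1 * A 1 0) * (A 0 a * key0 + A 1 a * key1)

end CoframeOfBrackets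

section ComplexManifold

variable {n : ℕ} {M : Type*} [TopologicalSpace M] [ChartedSpace (Cn n) M]

lemma contDiffOn_chart_transition [IsManifold 𝓘(ℂ, Cn n) ω M] (x y : M) :
    ContDiffOn ℂ ω (chartAt (Cn n) y ∘ (chartAt (Cn n) x).symm)
      ((chartAt (Cn n) x).symm.trans (chartAt (Cn n) y)).source := by
  have h := StructureGroupoid.compatible (contDiffGroupoid ω 𝓘(ℂ, Cn n))
    (chart_mem_atlas (Cn n) x) (chart_mem_atlas (Cn n) y)
  rw [contDiffGroupoid, mem_groupoid_of_pregroupoid] at h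
  simpa [contDiffPregroupoid] using h.1

variable (n M) in
lemma isManifold_real [IsManifold 𝓘(ℂ, Cn n) ω M] : IsManifold 𝓘(ℝ, Cn n) ∞ M := by
  refine isManifold_of_contDiffOn _ _ _ fun e e' he he' => ?_
  have h := StructureGroupoid.compatible (contDiffGroupoid ω 𝓘(ℂ, Cn n)) he he'
  rw [contDiffGroupoid, mem_groupoid_of_pregroupoid] at h
  have h1 : ContDiffOn ℂ ω (e.symm.trans e') (e.symm.trans e').source := by
    simpa [contDiffPregroupoid] using h.1
  simpa using (h1.restrict_scalars ℝ).of_le le_top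

lemma mdifferentiableAt_chart_symm [IsManifold 𝓘(ℂ, Cn n) ω M] {x₀ : M} {z : Cn n}
    (hz : z ∈ (chartAt (Cn n) x₀).target) :
    MDifferentiableAt 𝓘(ℝ, Cn n) 𝓘(ℝ, Cn n) (chartAt (Cn n) x₀).symm z := by
  have := isManifold_real n M
  exact ((contMDiffOn_chart_symm (I := 𝓘(ℝ, Cn n)) (n := ∞) (x := x₀)).contMDiffAt
    ((chartAt (Cn n) x₀).open_target.mem_nhds hz)).mdifferentiableAt (by simp)

lemma chartVec_eq [IsManifold 𝓘(ℂ, Cn n) ω M] {x₀ : M} {z : Cn n}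
    (hz : z ∈ (chartAt (Cn n) x₀).target) (v : Cn n) :
    chartVec x₀ z v = fderiv ℂ (chartAt (Cn n) ((chartAt (Cn n) x₀).symm z) ∘
      (chartAt (Cn n) x₀).symm) z v := by
  have h1 : DifferentiableAt ℂ (chartAt (Cn n) ((chartAt (Cn n) x₀).symm z) ∘
      (chartAt (Cn n) x₀).symm) z := by
    refine ((contDiffOn_chart_transition x₀ ((chartAt (Cn n) x₀).symm z)).contDiffAt
      ?_).differentiableAt (by simp)
    refine (OpenPartialHomeomorph.open_source _).mem_nhds ?_
    simp [hz]
  have h2 : fderivWithin ℝ (writtenInExtChartAt 𝓘(ℝ, Cn n) 𝓘(ℝ, Cn n) z (chartAt (Cn n) x₀).symm)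
      (range 𝓘(ℝ, Cn n)) (extChartAt 𝓘(ℝ, Cn n) z z) =
      (fderiv ℂ (chartAt (Cn n) ((chartAt (Cn n) x₀).symm z) ∘
      (chartAt (Cn n) x₀).symm) z).restrictScalars ℝ := by
    rw [← h1.fderiv_restrictScalars ℝ]
    simp only [mfld_simps, fderivWithin_univ, writtenInExtChartAt]
    rfl
  exact congrFun (congrArg DFunLike.coe ((mdifferentiableAt_chart_symm hz).mfderiv.trans h2)) v

end ComplexManifold

section InvariantFields

variable {G : Type*} [TopologicalSpace G] [Group G] [ChartedSpace (EuclideanSpace ℝ (Fin 4)) G]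
  [LieGroup (𝓡 4) ∞ G]

open VectorField

variable (G) in
lemma lieGroup_minSmoothness : LieGroup (𝓡 4) (minSmoothness ℝ 3) G := by
  rw [minSmoothness_of_isRCLikeNormedField]
  exact LieGroup.of_le (n := ∞) (show ((3 : ℕ∞) : WithTop ℕ∞) ≤ ((⊤ : ℕ∞) : WithTop ℕ∞) from WithTop.coe_le_coe.2 le_top)

lemma mfderiv_mul_pair (g : G) (v : GroupLieAlgebra (𝓡 4) G) :
    mfderiv ((𝓡 4).prod (𝓡 4)) (𝓡 4) (fun p : G × G => p.1 * p.2) (g, 1)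
      ((0 : TangentSpace (𝓡 4) g), v) = (mulInvariantVectorField v g : EuclideanSpace ℝ (Fin 4)) := by
  have h := mfderiv_prod_eq_add_apply (I := 𝓡 4) (I' := 𝓡 4) (I'' := 𝓡 4) (p := ((g, 1) : G × G))
    (v := ((0 : TangentSpace (𝓡 4) g), v))
    (((contMDiff_mul (𝓡 4) ∞ (G := G))).mdifferentiableAt (by simp))
  refine h.trans ?_
  exact (congrArg₂ (· + ·) (map_zero (mfderiv (𝓡 4) (𝓡 4) (fun z : G => z * 1) g)) rfl).trans
    (zero_add _)

theorem contMDiff_infty_mulInvariantVectorField (v : GroupLieAlgebra (𝓡 4) G) :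
    ContMDiff (𝓡 4) (𝓡 4).tangent ∞
      (fun g : G => (⟨g, mulInvariantVectorField v g⟩ : TangentBundle (𝓡 4) G)) := by
  let fg : G → TangentBundle (𝓡 4) G := fun g => ⟨g, 0⟩
  have : IsManifold (𝓡 4) ((∞ : WithTop ℕ∞) + 1) G := by
    show IsManifold (𝓡 4) ∞ G
    infer_instance
  have sfg : ContMDiff (𝓡 4) (𝓡 4).tangent ∞ fg := Bundle.contMDiff_zeroSection _ _
  let fv : G → TangentBundle (𝓡 4) G := fun _ => ⟨1, v⟩
  have sfv : ContMDiff (𝓡 4) (𝓡 4).tangent ∞ fv := contMDiff_const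
  let F₂ : (TangentBundle (𝓡 4) G × TangentBundle (𝓡 4) G) →
      TangentBundle ((𝓡 4).prod (𝓡 4)) (G × G) := (equivTangentBundleProd (𝓡 4) G (𝓡 4) G).symm
  have S₂ : ContMDiff ((𝓡 4).tangent.prod (𝓡 4).tangent) ((𝓡 4).prod (𝓡 4)).tangent ∞ F₂ :=
    contMDiff_equivTangentBundleProd_symm
  let F₃ : TangentBundle ((𝓡 4).prod (𝓡 4)) (G × G) → TangentBundle (𝓡 4) G :=
    tangentMap ((𝓡 4).prod (𝓡 4)) (𝓡 4) (fun (p : G × G) ↦ p.1 * p.2)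
  have S₃ : ContMDiff ((𝓡 4).prod (𝓡 4)).tangent (𝓡 4).tangent ∞ F₃ :=
    ContMDiff.contMDiff_tangentMap (n := ∞) (contMDiff_mul (𝓡 4) ∞) le_rfl
  have S := (S₃.comp S₂).comp (sfg.prodMk sfv)
  refine S.congr fun g => ?_
  have key := mfderiv_mul_pair g v
  refine Bundle.TotalSpace.ext (mul_one g).symm ?_
  exact heq_of_eq key.symm

end InvariantFields

section LocalFrame

variable {G : Type*} [TopologicalSpace G] [Group G] [ChartedSpace (EuclideanSpace ℝ (Fin 4)) G]
  {X : Type*} [TopologicalSpace X] [ChartedSpace (Cn 2) X] {P : G → X}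

open VectorField

lemma mlieBracket_eq_lieBracket {E : Type*} [NormedAddCommGroup E] [NormedSpace ℝ E]
    (V W : E → E) (z : E) : mlieBracket 𝓘(ℝ, E) V W z = lieBracket ℝ V W z := by
  have h := congrFun (mlieBracketWithin_eq_lieBracketWithin (𝕜 := ℝ) (V := V) (W := W)
    (s := univ)) z
  rw [lieBracketWithin_univ] at h
  exact h

lemma pushVec_add (v w : GroupLieAlgebra (𝓡 4) G) (a : G) :
    pushVec P (v + w) a = pushVec P v a + pushVec P w a :=
  (congrArg (mfderiv (𝓡 4) 𝓘(ℝ, Cn 2) P a)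
    (map_add (mfderiv (𝓡 4) (𝓡 4) (a * ·) (1 : G)) v w)).trans
    (map_add (mfderiv (𝓡 4) 𝓘(ℝ, Cn 2) P a) _ _)

lemma pushVec_smul (c : ℝ) (v : GroupLieAlgebra (𝓡 4) G) (a : G) :
    pushVec P (c • v) a = c • pushVec P v a :=
  (congrArg (mfderiv (𝓡 4) 𝓘(ℝ, Cn 2) P a)
    (map_smul (mfderiv (𝓡 4) (𝓡 4) (a * ·) (1 : G)) c v)).trans
    (map_smul (mfderiv (𝓡 4) 𝓘(ℝ, Cn 2) P a) _ _)

variable [LieGroup (𝓡 4) ∞ G]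

lemma mfderiv_mul_left_mulInvariantVectorField (g a : G) (v : GroupLieAlgebra (𝓡 4) G) :
    (mfderiv (𝓡 4) (𝓡 4) (g * ·) a (mulInvariantVectorField v a) : EuclideanSpace ℝ (Fin 4)) =
      mulInvariantVectorField v (g * a) := by
  have hd : ∀ (g b : G), MDifferentiableAt (𝓡 4) (𝓡 4) (g * ·) b := fun g b =>
    (contMDiff_mul_left (I := 𝓡 4) (n := ∞) (a := g)).mdifferentiableAt (by simp)
  have h1 : mfderiv (𝓡 4) (𝓡 4) ((g * ·) ∘ (a * ·)) (1 : G) =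
      (mfderiv (𝓡 4) (𝓡 4) (g * ·) (a * 1)).comp (mfderiv (𝓡 4) (𝓡 4) (a * ·) (1 : G)) :=
    mfderiv_comp (1 : G) (hd g _) (hd a _)
  have h2 : ((g * ·) ∘ (a * ·) : G → G) = (g * a * ·) := by
    ext b; simp [mul_assoc]
  rw [h2] at h1
  have h3 := congrFun (congrArg DFunLike.coe h1) v
  refine Eq.trans ?_ h3.symm
  rw [mul_one]
  rfl

/-- The field pushed forward from `G` is well defined on `X`. -/
lemma pushVec_mul_left {g : G} (hg : ∀ a, P (g * a) = P a)
    (hP : MDifferentiable (𝓡 4) 𝓘(ℝ, Cn 2) P) (v : GroupLieAlgebra (𝓡 4) G) (a : G) :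
    (pushVec P v (g * a) : Cn 2) = pushVec P v a := by
  have hd : MDifferentiableAt (𝓡 4) (𝓡 4) (g * ·) a :=
    (contMDiff_mul_left (I := 𝓡 4) (n := ∞) (a := g)).mdifferentiableAt (by simp)
  have h1 : mfderiv (𝓡 4) 𝓘(ℝ, Cn 2) (P ∘ (g * ·)) a =
      (mfderiv (𝓡 4) 𝓘(ℝ, Cn 2) P (g * a)).comp (mfderiv (𝓡 4) (𝓡 4) (g * ·) a) :=
    mfderiv_comp a (hP _) hd
  have h2 : P ∘ (g * ·) = P := funext hg
  have h3 := congrFun (congrArg DFunLike.coe h1) (mulInvariantVectorField v a)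
  have h4 : (mfderiv (𝓡 4) 𝓘(ℝ, Cn 2) (P ∘ (g * ·)) a (mulInvariantVectorField v a) : Cn 2) =
      mfderiv (𝓡 4) 𝓘(ℝ, Cn 2) P a (mulInvariantVectorField v a) := by rw [h2]
  refine Eq.trans ?_ (h3.symm.trans h4)
  exact congrArg (mfderiv (𝓡 4) 𝓘(ℝ, Cn 2) P (g * a))
    (mfderiv_mul_left_mulInvariantVectorField g a v).symm

theorem exists_local_frame [IsManifold 𝓘(ℂ, Cn 2) ω X] (hP : IsLocalDiffeomorph (𝓡 4) 𝓘(ℝ, Cn 2) ∞ P)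
    (hsurj : Function.Surjective P) {x₀ : X} {z₀ : Cn 2} (hz : z₀ ∈ (chartAt (Cn 2) x₀).target) :
    ∃ (τ : Cn 2 → G) (V : GroupLieAlgebra (𝓡 4) G → Cn 2 → Cn 2),
      (∀ᶠ z in 𝓝 z₀, P (τ z) = (chartAt (Cn 2) x₀).symm z) ∧
      (∀ v, ContDiffAt ℝ ∞ (V v) z₀) ∧
      (∀ᶠ z in 𝓝 z₀, ∀ v w, lieBracket ℝ (V v) (V w) z = V ⁅v, w⁆ z) ∧
      ∀ᶠ z in 𝓝 z₀, ∀ v, (chartVec x₀ z (V v z) : Cn 2) = pushVec P v (τ z) := by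
  have := isManifold_real 2 X
  have := lieGroup_minSmoothness G
  have m1 : IsManifold (𝓡 4) (minSmoothness ℝ 2) G := by
    rw [minSmoothness_of_isRCLikeNormedField]; exact IsManifold.of_le two_le_infty
  have m2 : IsManifold (𝓡 4) 1 G :=
    IsManifold.of_le (n := ∞) (le_trans (by norm_num) two_le_infty)
  obtain ⟨a₀, ha₀⟩ := hsurj ((chartAt (Cn 2) x₀).symm z₀)
  obtain ⟨Φ, hΦ, hΦe⟩ := hP a₀
  let e := chartAt (Cn 2) x₀
  let Ψ : PartialDiffeomorph 𝓘(ℝ, Cn 2) 𝓘(ℝ, Cn 2) (Cn 2) X ∞ :=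
    { e.symm.toPartialEquiv with
      open_source := e.open_target
      open_target := e.open_source
      contMDiffOn_toFun := contMDiffOn_chart_symm (I := 𝓘(ℝ, Cn 2)) (n := ∞) (x := x₀)
      contMDiffOn_invFun := contMDiffOn_chart (I := 𝓘(ℝ, Cn 2)) (n := ∞) (x := x₀) }
  let τ := Ψ.trans Φ.symm
  have hτz : z₀ ∈ τ.source := by
    refine ⟨hz, ?_⟩
    show e.symm z₀ ∈ Φ.target
    rw [show e.symm z₀ = P a₀ from ha₀.symm, hΦe hΦ]
    exact Φ.map_source hΦ
  have hτs : ∀ᶠ z in 𝓝 z₀, z ∈ τ.source := τ.open_source.mem_nhds hτz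
  have hPτ : ∀ z ∈ τ.source, P (τ z) = e.symm z := by
    intro z hz
    have h2 : e.symm z ∈ Φ.target := hz.2
    show P (Φ.toPartialEquiv.symm (e.symm z)) = e.symm z
    rw [hΦe (Φ.map_target h2)]
    exact Φ.right_inv h2
  have hinv : ∀ z ∈ τ.source, (mfderiv 𝓘(ℝ, Cn 2) (𝓡 4) τ z).IsInvertible := fun z hz =>
    ⟨(show IsLocalDiffeomorphAt 𝓘(ℝ, Cn 2) (𝓡 4) ∞ τ z from
      ⟨τ, hz, fun _ _ => rfl⟩).mfderivToContinuousLinearEquiv (by simp), rfl⟩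
  have hsm : ∀ z ∈ τ.source, ContMDiffAt 𝓘(ℝ, Cn 2) (𝓡 4) ∞ τ z := fun z hz =>
    τ.contMDiffOn.contMDiffAt (τ.open_source.mem_nhds hz)
  refine ⟨τ, fun v => mpullback 𝓘(ℝ, Cn 2) (𝓡 4) τ (mulInvariantVectorField v), ?_, ?_, ?_, ?_⟩
  · filter_upwards [hτs] with z hz using hPτ z hz
  · intro v
    have h := ContMDiffAt.mpullback_vectorField_preimage (m := ∞) (n := ∞)
      (contMDiff_infty_mulInvariantVectorField v (τ z₀)) (hsm z₀ hτz) (hinv z₀ hτz) le_rfl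
    rw [contMDiffAt_vectorSpace_iff_contDiffAt] at h
    exact h
  · filter_upwards [hτs] with z hz v w
    have h := mpullback_mlieBracket (I := 𝓘(ℝ, Cn 2)) (I' := 𝓡 4) (n := ∞)
      (mdifferentiableAt_mulInvariantVectorField v (g := τ z))
      (mdifferentiableAt_mulInvariantVectorField w (g := τ z)) (hsm z hz)
      (by rw [minSmoothness_of_isRCLikeNormedField]; exact two_le_infty)
    rw [← mulInvariantVector_mlieBracket] at h
    exact (mlieBracket_eq_lieBracket _ _ z).symm.trans h.symm
  · filter_upwards [hτs] with z hz v
    have hd1 : MDifferentiableAt (𝓡 4) 𝓘(ℝ, Cn 2) P (τ z) := (hP (τ z)).mdifferentiableAt (by simp)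
    have hd2 : MDifferentiableAt 𝓘(ℝ, Cn 2) (𝓡 4) τ z := (hsm z hz).mdifferentiableAt (by simp)
    have h1 := mfderiv_comp z hd1 hd2
    have h2 : P ∘ τ =ᶠ[𝓝 z] e.symm := by
      filter_upwards [τ.open_source.mem_nhds hz] with w hw using hPτ w hw
    rw [h2.mfderiv_eq] at h1
    set w : Cn 2 := mpullback 𝓘(ℝ, Cn 2) (𝓡 4) τ (mulInvariantVectorField v) z
    have h3 := congrFun (congrArg DFunLike.coe h1) w
    refine Eq.trans h3 ?_
    have h4 : mfderiv 𝓘(ℝ, Cn 2) (𝓡 4) τ z w = mulInvariantVectorField v (τ z) :=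
      (hinv z hz).self_apply_inverse _
    exact congrArg (mfderiv (𝓡 4) 𝓘(ℝ, Cn 2) P (τ z)) h4

end LocalFrame

section Coframe

variable {X : Type*} [TopologicalSpace X] [ChartedSpace (Cn 2) X]

/-- The components of a tangent vector in the frame dual to the coframe with matrices `A`. -/
def coframe (A : X → Matrix (Fin 2) (Fin 2) ℂ) (x : X) (w : Cn 2) : Fin 2 → ℂ :=
  w.ofLp ᵥ* A x

/-- The matrix of a coframe in the chart around `x₀`. -/
def coMat (A : X → Matrix (Fin 2) (Fin 2) ℂ) (x₀ : X) (z : Cn 2) : Matrix (Fin 2) (Fin 2) ℂ :=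
  Matrix.of fun k => coframe A ((chartAt (Cn 2) x₀).symm z) (chartVec x₀ z (stdVec k))

/-- The coframe `A` is dual to a frame of type `(1,0)` with the structure constants of `J_λ`. -/
def IsInvariantCoframeOn (lam : ℝ) (A : X → Matrix (Fin 2) (Fin 2) ℂ) : Prop :=
  ∀ x₀ : X, ∀ z ∈ (chartAt (Cn 2) x₀).target, ∃ Ξ, IsInvariantCoframe lam (coMat A x₀) Ξ z

variable {A : X → Matrix (Fin 2) (Fin 2) ℂ} {x₀ : X} {z : Cn 2}

lemma coframe_add (x : X) (v w : Cn 2) : coframe A x (v + w) = coframe A x v + coframe A x w :=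
  Matrix.add_vecMul _ _ _

lemma coframe_smul (x : X) (c : ℂ) (w : Cn 2) : coframe A x (c • w) = c • coframe A x w :=
  Matrix.smul_vecMul _ _ _

lemma coframe_real_smul (x : X) (c : ℝ) (w : Cn 2) : coframe A x (c • w) = c • coframe A x w := by
  rw [← Complex.coe_smul, coframe_smul]; ext; simp

lemma coframe_chartVec [IsManifold 𝓘(ℂ, Cn 2) ω X] (hz : z ∈ (chartAt (Cn 2) x₀).target)
    (v : Cn 2) :
    coframe A ((chartAt (Cn 2) x₀).symm z) (chartVec x₀ z v) = v.ofLp ᵥ* coMat A x₀ z := by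
  have h : ∀ v : Cn 2, coframe A ((chartAt (Cn 2) x₀).symm z) (chartVec x₀ z v) =
      coframe A ((chartAt (Cn 2) x₀).symm z) (fderiv ℂ (chartAt (Cn 2)
        ((chartAt (Cn 2) x₀).symm z) ∘ (chartAt (Cn 2) x₀).symm) z v) := fun v =>
    congrArg (coframe A _) (chartVec_eq hz v)
  ext a
  simp only [Matrix.vecMul, dotProduct, coMat, Matrix.of_apply, h]
  conv_lhs => rw [← sum_smul_stdVec v, Fin.sum_univ_two, map_add, map_smul, map_smul, coframe_add,
    coframe_smul, coframe_smul]
  simp [Fin.sum_univ_two]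

lemma IsInvariantCoframe.congr {lam : ℝ} {A A' Ξ : Cn 2 → Matrix (Fin 2) (Fin 2) ℂ} {z₀ : Cn 2}
    (h : IsInvariantCoframe lam A Ξ z₀) (hA : A' =ᶠ[𝓝 z₀] A) : IsInvariantCoframe lam A' Ξ z₀ := by
  have hij : ∀ z, A' =ᶠ[𝓝 z] A → ∀ i j, (fun w => A' w i j) =ᶠ[𝓝 z] fun w => A w i j :=
    fun z hz i j => hz.mono fun w hw => congrFun (congrFun hw i) j
  refine ⟨fun i j => (h.smooth i j).congr_of_eventuallyEq (hij z₀ hA i j), h.smoothInv, ?_, ?_, ?_⟩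
  · filter_upwards [h.inv, hA] with z h1 h2
    rw [h2, h1]
  · filter_upwards [h.dbar, hA, hA.eventuallyEq_nhds] with z h1 h2 h3 k
    rw [dzbarM_congr h3, h1, h2]
  · filter_upwards [h.torsion, hA, hA.eventuallyEq_nhds] with z h1 h2 h3 a
    rw [dz_congr (hij z h3 1 a), dz_congr (hij z h3 0 a), h1, h2]

end Coframe

section FrameOfModel

open VectorField

lemma slBracket_H_P : slBracket slH slP = (2 : ℝ) • slR := by
  refine Prod.ext (Subtype.ext ?_) (by simp [slBracket, slR])
  ext i j
  fin_cases i <;> fin_cases j <;>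
    simp [slBracket, slH, slP, slR, Ring.lie_def] <;> norm_num

lemma slBracket_R_H : slBracket slR slH = (-2 : ℝ) • slP := by
  refine Prod.ext (Subtype.ext ?_) (by simp [slBracket, slP])
  ext i j
  fin_cases i <;> fin_cases j <;>
    simp [slBracket, slH, slP, slR, Ring.lie_def] <;> norm_num

lemma slBracket_R_P : slBracket slR slP = (2 : ℝ) • slH := by
  refine Prod.ext (Subtype.ext ?_) (by simp [slBracket, slH])
  ext i j
  fin_cases i <;> fin_cases j <;>
    simp [slBracket, slH, slP, slR, Ring.lie_def] <;> norm_num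

lemma slBracket_T_left (v : SL2R) : slBracket slT v = 0 := by
  simp [slBracket, slT]

lemma slBracket_T_right (v : SL2R) : slBracket v slT = 0 := by
  simp [slBracket, slT]

lemma slBracket_sub_smul_left (c : ℝ) (v w u : SL2R) :
    slBracket (v - c • w) u = slBracket v u - c • slBracket w u := by
  refine Prod.ext ?_ (by simp [slBracket])
  simp [slBracket]

lemma exists_sl_coords (s : SL2R) : ∃ h p r t : ℝ, s = h • slH + p • slP + r • slR + t • slT := by
  obtain ⟨⟨M, hM⟩, u⟩ := s
  have htr : M 1 1 = -M 0 0 := by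
    have : M.trace = 0 := by
      simpa [LieAlgebra.SpecialLinear.sl, LinearMap.mem_ker] using hM
    rw [Matrix.trace_fin_two] at this; linarith
  refine ⟨M 0 0, (M 0 1 + M 1 0) / 2, (M 0 1 - M 1 0) / 2, u, ?_⟩
  refine Prod.ext (Subtype.ext ?_) (by simp [slH, slP, slR, slT])
  ext i j
  fin_cases i <;> fin_cases j <;> simp [slH, slP, slR, slT, htr] <;> ring

variable {G : Type*} [TopologicalSpace G] [Group G] [ChartedSpace (EuclideanSpace ℝ (Fin 4)) G]
  [LieGroup (𝓡 4) ∞ G] {φ : GroupLieAlgebra (𝓡 4) G ≃ₗ[ℝ] SL2R}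
  {X : Type*} [TopologicalSpace X] [ChartedSpace (Cn 2) X]
  {lam : ℝ} {Γ : Subgroup G} {P : G → X}

/-- `pushVec` with values in the model space. -/
def pushC (P : G → X) (v : GroupLieAlgebra (𝓡 4) G) (a : G) : Cn 2 := pushVec P v a

lemma pushC_add (v w : GroupLieAlgebra (𝓡 4) G) (a : G) :
    pushC P (v + w) a = pushC P v a + pushC P w a := pushVec_add v w a

lemma pushC_smul (c : ℝ) (v : GroupLieAlgebra (𝓡 4) G) (a : G) :
    pushC P (c • v) a = c • pushC P v a := pushVec_smul c v a

lemma IsQuotientModel.pushVec_congr (hP : IsQuotientModel lam φ Γ P) {a b : G} (h : P a = P b)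
    (v : GroupLieAlgebra (𝓡 4) G) : pushC P v a = pushC P v b := by
  obtain ⟨γ, hγ, rfl⟩ := (hP.fibre a b).1 h
  exact (pushVec_mul_left (fun a => ((hP.fibre a (γ * a)).2 ⟨γ, hγ, rfl⟩).symm)
    (fun a => (hP.smooth a).mdifferentiableAt (by simp)) v a).symm

lemma IsQuotientModel.pushVec_eq_zero (hP : IsQuotientModel lam φ Γ P) {a : G}
    {v : GroupLieAlgebra (𝓡 4) G} (h : pushC P v a = 0) : v = 0 := by
  have h1 : mulInvariantVectorField v a = 0 :=
    ((hP.smooth a).mfderivToContinuousLinearEquiv (by simp)).injective (h.trans (map_zero _).symm)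
  have h2 := mfderiv_mul_left_mulInvariantVectorField a⁻¹ a v
  rw [h1] at h2
  have h3 : (mulInvariantVectorField v (a⁻¹ * a) : EuclideanSpace ℝ (Fin 4)) = 0 :=
    h2.symm.trans (map_zero (mfderiv (𝓡 4) (𝓡 4) (a⁻¹ * ·) a))
  rw [inv_mul_cancel] at h3
  have h4 : (mulInvariantVectorField v (1 : G) : EuclideanSpace ℝ (Fin 4)) = v := by
    have : ((1 : G) * ·) = (id : G → G) := by ext; simp
    unfold mulInvariantVectorField
    rw [this, mfderiv_id]
    rfl
  exact h4.symm.trans h3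

/-- The coordinates of an element of the Lie algebra in the complex frame `H, R - λ T`. -/
def slCoord (lam : ℝ) (s : SL2R) : Fin 2 → ℂ :=
  ![s.1.1 0 0 + ((s.1.1 0 1 + s.1.1 1 0) / 2 : ℝ) * Complex.I,
    ((s.1.1 0 1 - s.1.1 1 0) / 2 : ℝ) + (s.2 + lam * ((s.1.1 0 1 - s.1.1 1 0) / 2) : ℝ) * Complex.I]

lemma slCoord_surjective (lam : ℝ) : Function.Surjective (slCoord lam) := fun c =>
  ⟨(c 0).re • slH + (c 0).im • slP + (c 1).re • slR + ((c 1).im - lam * (c 1).re) • slT, by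
    ext a
    fin_cases a
    · apply Complex.ext <;> simp [slCoord, slH, slP, slR, slT] <;> ring
    · apply Complex.ext <;> simp [slCoord, slH, slP, slR, slT]⟩

lemma IsQuotientModel.pushVec_eq (hP : IsQuotientModel lam φ Γ P) (a : G)
    (v : GroupLieAlgebra (𝓡 4) G) : pushC P v a =
      slCoord lam (φ v) 0 • pushC P (φ.symm slH) a +
      slCoord lam (φ v) 1 • pushC P (φ.symm (slR - lam • slT)) a := by
  obtain ⟨h, p, r, t, e⟩ := exists_sl_coords (φ v)
  have hv : v = h • φ.symm slH + p • φ.symm slP + r • φ.symm (slR - lam • slT)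
      + (t + lam * r) • φ.symm slT := by
    apply φ.injective
    simp only [map_add, map_smul, LinearEquiv.apply_symm_apply, e]
    module
  have c0 : slCoord lam (φ v) 0 = h + p * Complex.I := by
    rw [e]; apply Complex.ext <;> simp [slCoord, slH, slP, slR, slT]
    ring
  have c1 : slCoord lam (φ v) 1 = r + (t + lam * r : ℝ) * Complex.I := by
    rw [e]; apply Complex.ext <;> simp [slCoord, slH, slP, slR, slT]
  have hJ : pushC P (φ.symm slP) a = Complex.I • pushC P (φ.symm slH) a :=
    (hP.J_H a).symm
  have hJ' : pushC P (φ.symm slT) a =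
    Complex.I • pushC P (φ.symm (slR - lam • slT)) a := (hP.J_R a).symm
  rw [c0, c1]
  conv_lhs => rw [hv]
  simp only [pushC_add, pushC_smul]
  rw [hJ, hJ']
  ext k
  simp only [PiLp.add_apply, PiLp.smul_apply, smul_eq_mul, Complex.real_smul]
  push_cast
  ring

/-- The frame `H, R - λ T` at a point of the quotient. -/
def IsQuotientModel.frame (hP : IsQuotientModel lam φ Γ P) (x : X) : Matrix (Fin 2) (Fin 2) ℂ :=
  rowMat (fun _ => pushC P (φ.symm slH) (Function.surjInv hP.surj x))
    (fun _ => pushC P (φ.symm (slR - lam • slT)) (Function.surjInv hP.surj x)) 0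

lemma IsQuotientModel.frame_apply (hP : IsQuotientModel lam φ Γ P) (a : G) :
    hP.frame (P a) = rowMat (fun _ => pushC P (φ.symm slH) a)
      (fun _ => pushC P (φ.symm (slR - lam • slT)) a) 0 := by
  have h := Function.surjInv_eq hP.surj (P a)
  ext i k
  unfold IsQuotientModel.frame rowMat
  simp only [Matrix.of_apply]
  have h1 := congrArg (fun v : Cn 2 => v k) (hP.pushVec_congr h (φ.symm slH))
  have h2 := congrArg (fun v : Cn 2 => v k) (hP.pushVec_congr h (φ.symm (slR - lam • slT)))
  split_ifs
  · exact h1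
  · exact h2

lemma IsQuotientModel.vecMul_frame (hP : IsQuotientModel lam φ Γ P) (a : G)
    (v : GroupLieAlgebra (𝓡 4) G) :
    slCoord lam (φ v) ᵥ* hP.frame (P a) = (pushC P v a).ofLp := by
  ext k
  rw [hP.frame_apply, hP.pushVec_eq a v]
  simp [Matrix.vecMul, dotProduct, Fin.sum_univ_two, rowMat]

lemma IsQuotientModel.det_frame_ne_zero (hP : IsQuotientModel lam φ Γ P) (x : X) :
    (hP.frame x).det ≠ 0 := by
  obtain ⟨a, rfl⟩ := hP.surj x
  intro h
  obtain ⟨c, hc, hc'⟩ := Matrix.exists_vecMul_eq_zero_iff.2 h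
  obtain ⟨s, rfl⟩ := slCoord_surjective lam c
  have h1 := hP.vecMul_frame a (φ.symm s)
  rw [LinearEquiv.apply_symm_apply, hc'] at h1
  have h2 : pushC P (φ.symm s) a = 0 := by
    ext k; exact (congrFun h1 k).symm
  have h3 := hP.pushVec_eq_zero h2
  rw [LinearEquiv.map_eq_zero_iff] at h3
  subst h3
  apply hc
  ext k; fin_cases k <;> simp [slCoord]

/-- The coframe dual to `H, R - λ T`. -/
def IsQuotientModel.coframeMat (hP : IsQuotientModel lam φ Γ P) (x : X) :
    Matrix (Fin 2) (Fin 2) ℂ := (hP.frame x)⁻¹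

lemma IsQuotientModel.det_coframeMat_ne_zero (hP : IsQuotientModel lam φ Γ P) (x : X) :
    (hP.coframeMat x).det ≠ 0 := by
  rw [IsQuotientModel.coframeMat, Matrix.det_nonsing_inv, Ring.inverse_eq_inv']
  exact inv_ne_zero (hP.det_frame_ne_zero x)

lemma IsQuotientModel.coframe_pushVec (hP : IsQuotientModel lam φ Γ P) (a : G)
    (v : GroupLieAlgebra (𝓡 4) G) :
    coframe hP.coframeMat (P a) (pushVec P v a) = slCoord lam (φ v) := by
  show (pushC P v a).ofLp ᵥ* (hP.frame (P a))⁻¹ = _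
  rw [← hP.vecMul_frame a v, Matrix.vecMul_vecMul,
    Matrix.mul_nonsing_inv _ (isUnit_iff_ne_zero.2 (hP.det_frame_ne_zero _)), Matrix.vecMul_one]

theorem IsQuotientModel.isInvariantCoframeOn [IsManifold 𝓘(ℂ, Cn 2) ω X]
    (hφ : ∀ v w, φ ⁅v, w⁆ = slBracket (φ v) (φ w)) (hP : IsQuotientModel lam φ Γ P) :
    IsInvariantCoframeOn lam hP.coframeMat := by
  intro x₀ z₀ hz₀
  obtain ⟨τ, V, h1, h2, h3, h4⟩ := exists_local_frame hP.smooth hP.surj hz₀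
  have htgt : ∀ᶠ z in 𝓝 z₀, z ∈ (chartAt (Cn 2) x₀).target :=
    (chartAt (Cn 2) x₀).open_target.mem_nhds hz₀
  have hco : ∀ᶠ z in 𝓝 z₀, ∀ v, (V v z).ofLp ᵥ* coMat hP.coframeMat x₀ z =
      slCoord lam (φ v) := by
    filter_upwards [htgt, h1, h4] with z hz e1 e4 v
    rw [← coframe_chartVec hz, ← hP.coframe_pushVec (τ z) v, e1]
    exact congrArg (coframe hP.coframeMat _) (e4 v)
  set ξ₁ := V (φ.symm slH) with hξ₁
  set ξ₂ := V (φ.symm (slR - lam • slT)) with hξ₂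
  have cH : slCoord lam slH = ![1, 0] := by
    ext k; fin_cases k <;> simp [slCoord, slH]
  have cP : slCoord lam slP = Complex.I • ![1, 0] := by
    ext k; fin_cases k <;> simp [slCoord, slP]
  have cR : slCoord lam (slR - lam • slT) = ![0, 1] := by
    ext k; fin_cases k <;> apply Complex.ext <;> simp [slCoord, slR, slT]
  have cT : slCoord lam slT = Complex.I • ![0, 1] := by
    ext k; fin_cases k <;> simp [slCoord, slT]
  have hprod : ∀ᶠ z in 𝓝 z₀, rowMat ξ₁ ξ₂ z * coMat hP.coframeMat x₀ z = 1 := by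
    filter_upwards [hco] with z hz
    have e1 := hz (φ.symm slH)
    have e2 := hz (φ.symm (slR - lam • slT))
    rw [LinearEquiv.apply_symm_apply] at e1 e2
    ext a b
    fin_cases a
    · exact (congrFun (e1.trans cH) b).trans (by fin_cases b <;> rfl)
    · exact (congrFun (e2.trans cR) b).trans (by fin_cases b <;> rfl)
  have hinj : ∀ᶠ z in 𝓝 z₀, ∀ v (w : Cn 2), w.ofLp ᵥ* coMat hP.coframeMat x₀ z =
      slCoord lam (φ v) → w = V v z := by
    filter_upwards [hco, hprod] with z hz hp v w hw
    rw [← hz v] at hw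
    have := congrArg (· ᵥ* rowMat ξ₁ ξ₂ z) hw
    simp only [Matrix.vecMul_vecMul, mul_eq_one_comm.1 hp, Matrix.vecMul_one] at this
    exact WithLp.ofLp_injective 2 this
  have hw1 : ∀ᶠ z in 𝓝 z₀, (ξ₁ z).ofLp ᵥ* coMat hP.coframeMat x₀ z = ![1, 0] := by
    filter_upwards [hco] with z hz
    rw [hξ₁, hz, LinearEquiv.apply_symm_apply, cH]
  have hw2 : ∀ᶠ z in 𝓝 z₀, (ξ₂ z).ofLp ᵥ* coMat hP.coframeMat x₀ z = ![0, 1] := by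
    filter_upwards [hco] with z hz
    rw [hξ₂, hz, LinearEquiv.apply_symm_apply, cR]
  have hP1 : ∀ᶠ z in 𝓝 z₀, Complex.I • ξ₁ z = V (φ.symm slP) z := by
    filter_upwards [hw1, hinj] with z h1 hi
    refine hi _ _ ?_
    rw [WithLp.ofLp_smul, Matrix.smul_vecMul, h1, LinearEquiv.apply_symm_apply, cP]
  have hT2 : ∀ᶠ z in 𝓝 z₀, Complex.I • ξ₂ z = V (φ.symm slT) z := by
    filter_upwards [hw2, hinj] with z h1 hi
    refine hi _ _ ?_
    rw [WithLp.ofLp_smul, Matrix.smul_vecMul, h1, LinearEquiv.apply_symm_apply, cT]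
  have hbr : ∀ᶠ z in 𝓝 z₀, HasFrameBrackets lam ξ₁ ξ₂ z := by
    filter_upwards [h3, hinj, hw1, hw2, hP1.eventually_nhds, hT2.eventually_nhds]
      with z hb hi e1 e2 hP1 hT2
    have hP1 : (fun w => Complex.I • ξ₁ w) =ᶠ[𝓝 z] V (φ.symm slP) := hP1
    have hT2 : (fun w => Complex.I • ξ₂ w) =ᶠ[𝓝 z] V (φ.symm slT) := hT2
    have key : ∀ v w (u : Cn 2), u.ofLp ᵥ* coMat hP.coframeMat x₀ z =
        slCoord lam (slBracket v w) → lieBracket ℝ (V (φ.symm v)) (V (φ.symm w)) z = u := by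
      intro v w u hu
      rw [hb]
      refine (hi _ _ ?_).symm
      rw [hφ, LinearEquiv.apply_symm_apply, LinearEquiv.apply_symm_apply, hu]
    refine ⟨?_, ?_, ?_, ?_, ?_, ?_⟩
    · rw [(EventuallyEq.refl _ ξ₁).lieBracket_vectorField_eq hP1]
      refine key _ _ _ ?_
      rw [slBracket_H_P]
      simp only [WithLp.ofLp_smul, WithLp.ofLp_add, Matrix.smul_vecMul, Matrix.add_vecMul, e2]
      ext k; fin_cases k <;> apply Complex.ext <;> simp [slCoord, slR] <;> ring
    · refine key _ _ _ ?_
      rw [slBracket_sub_smul_left, slBracket_R_H, slBracket_T_left]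
      simp only [WithLp.ofLp_smul, Matrix.smul_vecMul, e1]
      ext k; fin_cases k <;> apply Complex.ext <;> simp [slCoord, slP]
    · rw [(EventuallyEq.refl _ ξ₂).lieBracket_vectorField_eq hP1]
      refine key _ _ _ ?_
      rw [slBracket_sub_smul_left, slBracket_R_P, slBracket_T_left]
      simp only [WithLp.ofLp_smul, Matrix.smul_vecMul, e1]
      ext k; fin_cases k <;> apply Complex.ext <;> simp [slCoord, slH]
    · rw [hT2.lieBracket_vectorField_eq (EventuallyEq.refl _ ξ₁)]
      refine key _ _ _ ?_
      rw [slBracket_T_left]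
      ext k; fin_cases k <;> simp [slCoord]
    · rw [hT2.lieBracket_vectorField_eq hP1]
      refine key _ _ _ ?_
      rw [slBracket_T_left]
      ext k; fin_cases k <;> simp [slCoord]
    · rw [(EventuallyEq.refl _ ξ₂).lieBracket_vectorField_eq hT2]
      refine key _ _ _ ?_
      rw [slBracket_T_right]
      ext k; fin_cases k <;> simp [slCoord]
  refine ⟨rowMat ξ₁ ξ₂, (isInvariantCoframe_of_brackets (h2 _) (h2 _) ?_ hbr).congr ?_⟩
  · intro h
    have := congrArg Matrix.det hprod.self_of_nhds
    rw [Matrix.det_mul, h, zero_mul, Matrix.det_one] at this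
    exact zero_ne_one this
  · filter_upwards [hprod] with z hz
    exact (Matrix.inv_eq_right_inv hz).symm

end FrameOfModel

section SeveralComplexVariables

variable {E F : Type*} [NormedAddCommGroup E] [NormedSpace ℂ E] [FiniteDimensional ℂ E]
  [NormedAddCommGroup F] [NormedSpace ℂ F] [FiniteDimensional ℂ F] {f : E → F} {U : Set E}

open MeasureTheory intervalIntegral in
/-- The derivatives of a holomorphic function of several variables are holomorphic. -/
theorem differentiableOn_fderiv_apply_complex (hU : IsOpen U) (hf : DifferentiableOn ℂ f U) (w : E) :
    DifferentiableOn ℂ (fun z => fderiv ℂ f z w) U := by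
  have hE := FiniteDimensional.proper ℂ E
  have hF := FiniteDimensional.complete ℂ F
  intro z₀ hz₀
  refine DifferentiableAt.differentiableWithinAt ?_
  obtain ⟨r, hr, hrU⟩ := Metric.isOpen_iff.1 hU z₀ hz₀
  have hdiff : ∀ y ∈ Metric.ball z₀ r, DifferentiableAt ℂ f y := fun y hy =>
    hf.differentiableAt (hU.mem_nhds (hrU hy))
  have hcont : ContinuousOn f U := hf.continuousOn
  -- bounds on a smaller ball
  obtain ⟨M, hM⟩ : ∃ M, ∀ y ∈ Metric.closedBall z₀ (r / 2), ‖f y‖ ≤ M := by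
    have hc : IsCompact (Metric.closedBall z₀ (r / 2)) := isCompact_closedBall _ _
    have := hc.exists_bound_of_continuousOn (hcont.mono
      ((Metric.closedBall_subset_ball (by linarith)).trans hrU))
    exact this
  have hM0 : 0 ≤ M := (norm_nonneg _).trans (hM z₀ (Metric.mem_closedBall_self (by linarith)))
  have hbound : ∀ y ∈ Metric.ball z₀ (r / 4), ‖fderiv ℂ f y‖ ≤ M / (r / 4) := by
    intro y hy
    refine ContinuousLinearMap.opNorm_le_bound _ (by positivity) fun v => ?_
    rcases eq_or_ne v 0 with rfl | hv
    · simp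
    have hv' : 0 < ‖v‖ := norm_pos_iff.2 hv
    have hin : ∀ ζ ∈ Metric.closedBall (0 : ℂ) (r / 4 / ‖v‖), y + ζ • v ∈ Metric.closedBall z₀ (r / 2) := by
      intro ζ hζ
      rw [mem_closedBall_zero_iff, le_div_iff₀ hv'] at hζ
      rw [Metric.mem_ball, dist_eq_norm] at hy
      rw [Metric.mem_closedBall, dist_eq_norm, add_sub_right_comm]
      refine (norm_add_le _ _).trans ?_
      rw [norm_smul]; linarith
    have hd : ∀ ζ ∈ Metric.closedBall (0 : ℂ) (r / 4 / ‖v‖),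
        HasDerivAt (fun ζ : ℂ => f (y + ζ • v)) (fderiv ℂ f (y + ζ • v) v) ζ := by
      intro ζ hζ
      have h1 := (hdiff _ (Metric.closedBall_subset_ball (by linarith) (hin ζ hζ))).hasFDerivAt
      have h2 : HasDerivAt (fun ζ : ℂ => y + ζ • v) v ζ := by
        simpa using ((hasDerivAt_id ζ).smul_const v).const_add y
      exact h1.comp_hasDerivAt ζ h2
    have hp : 0 < r / 4 / ‖v‖ := by positivity
    have h3 := Complex.norm_deriv_le_of_forall_mem_sphere_norm_le (c := 0) (C := M) hp
      (DifferentiableOn.diffContOnCl (f := fun ζ : ℂ => f (y + ζ • v)) (fun ζ hζ =>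
        (hd ζ (Metric.closure_ball_subset_closedBall hζ)).differentiableAt.differentiableWithinAt))
      (fun ζ hζ => hM _ (hin ζ (Metric.sphere_subset_closedBall hζ)))
    rw [(hd 0 (Metric.mem_closedBall_self hp.le)).deriv, zero_smul, add_zero] at h3
    calc _ ≤ _ := h3
      _ = _ := by field_simp
  -- it suffices to treat short directions
  wlog hw : ‖w‖ ≤ r / 16 generalizing w
  · have hw0 : 0 < ‖w‖ := lt_of_lt_of_le (by positivity) (not_le.1 hw).le
    have h := this (((r / 16 / ‖w‖ : ℝ) : ℂ) • w) (by
      rw [norm_smul, Complex.norm_real, Real.norm_of_nonneg (by positivity)]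
      field_simp; exact le_rfl)
    have h2 := h.const_smul ((‖w‖ / (r / 16) : ℝ) : ℂ)
    refine h2.congr_of_eventuallyEq (Eventually.of_forall fun z => ?_)
    simp only [map_smul, Pi.smul_apply, smul_smul, ← Complex.ofReal_mul]
    rw [show ‖w‖ / (r / 16) * (r / 16 / ‖w‖) = 1 by field_simp]
    simp
  have hin : ∀ y ∈ Metric.ball z₀ (r / 8), ∀ ζ ∈ Metric.closedBall (0 : ℂ) 1,
      y + ζ • w ∈ Metric.ball z₀ (r / 4) := by
    intro y hy ζ hζ
    rw [mem_closedBall_zero_iff] at hζ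
    rw [Metric.mem_ball, dist_eq_norm] at hy ⊢
    rw [add_sub_right_comm]
    refine (norm_add_le _ _).trans_lt ?_
    rw [norm_smul]
    have : ‖ζ‖ * ‖w‖ ≤ 1 * (r / 16) := by gcongr
    linarith
  have hsub : Metric.ball z₀ (r / 4) ⊆ Metric.ball z₀ r := Metric.ball_subset_ball (by linarith)
  have hcirc : ∀ θ : ℝ, circleMap 0 1 θ ∈ Metric.closedBall (0 : ℂ) 1 := fun θ => by
    simp
  -- the Cauchy integral formula
  set Φ : E → ℝ → F := fun z θ => deriv (circleMap 0 1) θ •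
    (1 / (circleMap 0 1 θ - 0) ^ 2) • f (z + circleMap 0 1 θ • w) with hΦ
  have hformula : ∀ z ∈ Metric.ball z₀ (r / 8),
      fderiv ℂ f z w = (2 * Real.pi * Complex.I : ℂ)⁻¹ • ∫ θ in 0..2 * Real.pi, Φ z θ := by
    intro z hz
    have hd : ∀ ζ ∈ Metric.closedBall (0 : ℂ) 1,
        HasDerivAt (fun ζ : ℂ => f (z + ζ • w)) (fderiv ℂ f (z + ζ • w) w) ζ := by
      intro ζ hζ
      have h1 := (hdiff _ (hsub (hin z hz ζ hζ))).hasFDerivAt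
      have h2 : HasDerivAt (fun ζ : ℂ => z + ζ • w) w ζ := by
        simpa using ((hasDerivAt_id ζ).smul_const w).const_add z
      exact h1.comp_hasDerivAt ζ h2
    have h1 := DifferentiableOn.deriv_eq_smul_circleIntegral (f := fun ζ : ℂ => f (z + ζ • w))
      one_pos (c := 0) fun ζ hζ => (hd ζ hζ).differentiableAt.differentiableWithinAt
    rw [(hd 0 (by simp)).deriv, zero_smul, add_zero] at h1
    rw [show (∫ θ in 0..2 * Real.pi, Φ z θ) = _ from h1, smul_smul, inv_mul_cancel₀, one_smul]
    simp [Real.pi_ne_zero]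
  borelize E
  borelize F
  have hmeas : ∀ z ∈ Metric.ball z₀ (r / 8), Continuous (Φ z) := by
    intro z hz
    have h1 : Continuous fun θ : ℝ => f (z + circleMap 0 1 θ • w) := by
      rw [continuous_iff_continuousAt]
      intro θ
      refine ContinuousAt.comp (f := fun θ => z + circleMap 0 1 θ • w)
        (hdiff _ (hsub (hin z hz _ (hcirc θ)))).continuousAt ?_
      have := continuous_circleMap 0 1
      fun_prop
    have h2 : Continuous fun θ => deriv (circleMap 0 1) θ := by
      simp only [deriv_circleMap]; have := continuous_circleMap 0 1; fun_prop
    refine h2.smul (Continuous.smul ?_ h1)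
    refine continuous_const.div ((continuous_circleMap 0 1).sub continuous_const |>.pow 2) fun θ => ?_
    simp [circleMap]
  have hb8 : Metric.ball z₀ (r / 8) ∈ 𝓝 z₀ := Metric.ball_mem_nhds _ (by positivity)
  have hz08 := mem_of_mem_nhds hb8
  have key := hasFDerivAt_integral_of_dominated_of_fderiv_le (μ := volume) (a := 0)
    (b := 2 * Real.pi) (𝕜 := ℂ) (F := Φ) (F' := fun z θ => deriv (circleMap 0 1) θ •
    (1 / (circleMap 0 1 θ - 0) ^ 2) • fderiv ℂ f (z + circleMap 0 1 θ • w)) (x₀ := z₀)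
    (bound := fun _ => M / (r / 4)) hb8 ?_ ?_ ?_ ?_ ?_ ?_
  · refine (key.differentiableAt.const_smul ((2 * Real.pi * Complex.I : ℂ)⁻¹)).congr_of_eventuallyEq ?_
    filter_upwards [hb8] with z hz using hformula z hz
  · filter_upwards [hb8] with z hz using (hmeas z hz).aestronglyMeasurable
  · exact (hmeas z₀ hz08).intervalIntegrable _ _
  · have h1 : Measurable fun θ : ℝ => fderiv ℂ f (z₀ + circleMap 0 1 θ • w) := by
      refine (measurable_fderiv ℂ f).comp ?_
      have := continuous_circleMap 0 1
      exact (by fun_prop : Continuous fun θ : ℝ => z₀ + circleMap 0 1 θ • w).measurable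
    have h2 : Continuous fun θ => deriv (circleMap 0 1) θ := by
      simp only [deriv_circleMap]; have := continuous_circleMap 0 1; fun_prop
    have h3 : Continuous fun θ => 1 / (circleMap 0 1 θ - 0) ^ 2 :=
      continuous_const.div ((continuous_circleMap 0 1).sub continuous_const |>.pow 2) fun θ => by
        simp [circleMap]
    exact h2.aestronglyMeasurable.smul (h3.aestronglyMeasurable.smul h1.aestronglyMeasurable)
  · refine Eventually.of_forall fun θ _ z hz => ?_
    rw [norm_smul, norm_smul]
    have e1 : ‖deriv (circleMap 0 1) θ‖ = 1 := by simp [deriv_circleMap]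
    have e2 : ‖1 / (circleMap 0 1 θ - 0) ^ 2‖ = 1 := by simp
    rw [e1, e2, one_mul, one_mul]
    exact hbound _ (hin z hz _ (hcirc θ))
  · simp
  · refine Eventually.of_forall fun θ _ z hz => ?_
    have h1 := (hdiff _ (hsub (hin z hz _ (hcirc θ)))).hasFDerivAt
    have h2 : HasFDerivAt (fun z => f (z + circleMap 0 1 θ • w))
        (fderiv ℂ f (z + circleMap 0 1 θ • w)) z := by
      have := h1.comp z ((hasFDerivAt_id z).add_const (circleMap 0 1 θ • w))
      rwa [ContinuousLinearMap.comp_id] at this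
    exact (h2.const_smul _).const_smul _

theorem contDiffOn_of_differentiableOn_complex (hU : IsOpen U) (hf : DifferentiableOn ℂ f U) :
    ContDiffOn ℂ ∞ f U := by
  rw [contDiffOn_infty]
  intro n
  induction n generalizing f with
  | zero => exact contDiffOn_zero.2 hf.continuousOn
  | succ n ih =>
    have : ((n + 1 : ℕ) : WithTop ℕ∞) = n + 1 := by push_cast; rfl
    rw [this, contDiffOn_succ_iff_fderiv_of_isOpen hU]
    refine ⟨hf, by simp, ?_⟩
    rw [contDiffOn_clm_apply]
    exact fun w => ih (differentiableOn_fderiv_apply_complex hU hf w)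

end SeveralComplexVariables

section WirtingerComp

variable {m n : ℕ} {F : Cn n → ℂ} {w : Cn m → Cn n} {ζ : Cn m} {i : Fin m}

lemma fderiv_comp_holo (hF : DifferentiableAt ℝ F (w ζ)) (hw : DifferentiableAt ℂ w ζ) (v : Cn m) :
    fderiv ℝ (fun ζ => F (w ζ)) ζ v = fderiv ℝ F (w ζ) (fderiv ℂ w ζ v) := by
  have h := hF.hasFDerivAt.comp ζ (hw.hasFDerivAt.restrictScalars ℝ)
  rw [show (fun ζ => F (w ζ)) = F ∘ w from rfl, h.fderiv]
  rfl

lemma dz_comp (hF : DifferentiableAt ℝ F (w ζ)) (hw : DifferentiableAt ℂ w ζ) :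
    dz i (fun ζ => F (w ζ)) ζ = ∑ k, fderiv ℂ w ζ (stdVec i) k * dz k F (w ζ) := by
  rw [sum_mul_dz, dz, fderiv_comp_holo hF hw, fderiv_comp_holo hF hw, map_smul]

lemma dzbar_comp (hF : DifferentiableAt ℝ F (w ζ)) (hw : DifferentiableAt ℂ w ζ) :
    dzbar i (fun ζ => F (w ζ)) ζ = ∑ k, conj (fderiv ℂ w ζ (stdVec i) k) * dzbar k F (w ζ) := by
  rw [sum_conj_mul_dzbar, dzbar, fderiv_comp_holo hF hw, fderiv_comp_holo hF hw, map_smul]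

lemma dz_of_differentiableAt {f : Cn m → ℂ} (hf : DifferentiableAt ℂ f ζ) :
    dz i f ζ = fderiv ℂ f ζ (stdVec i) := by
  rw [dz, hf.fderiv_restrictScalars ℝ]
  simp only [ContinuousLinearMap.coe_restrictScalars', map_smul, smul_eq_mul]
  linear_combination (-(fderiv ℂ f ζ (stdVec i)) / 2) * Complex.I_mul_I

lemma dzbar_of_differentiableAt {f : Cn m → ℂ} (hf : DifferentiableAt ℂ f ζ) :
    dzbar i f ζ = 0 := by
  rw [dzbar, hf.fderiv_restrictScalars ℝ]
  simp only [ContinuousLinearMap.coe_restrictScalars', map_smul, smul_eq_mul]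
  linear_combination ((fderiv ℂ f ζ (stdVec i)) / 2) * Complex.I_mul_I

lemma fderiv_ofReal {r : Cn m → ℝ} (hr : DifferentiableAt ℝ r ζ) (v : Cn m) :
    fderiv ℝ (fun ζ => (r ζ : ℂ)) ζ v = fderiv ℝ r ζ v := by
  have h := Complex.ofRealCLM.hasFDerivAt.comp ζ hr.hasFDerivAt
  rw [show (fun ζ => (r ζ : ℂ)) = Complex.ofRealCLM ∘ r from rfl, h.fderiv]
  rfl

lemma differentiableAt_ofReal {r : Cn m → ℝ} (hr : DifferentiableAt ℝ r ζ) :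
    DifferentiableAt ℝ (fun ζ => (r ζ : ℂ)) ζ :=
  Complex.ofRealCLM.differentiableAt.comp ζ hr

lemma contDiffAt_ofReal {r : Cn m → ℝ} {k : WithTop ℕ∞} (hr : ContDiffAt ℝ k r ζ) :
    ContDiffAt ℝ k (fun ζ => (r ζ : ℂ)) ζ :=
  Complex.ofRealCLM.contDiff.contDiffAt.comp ζ hr

lemma dzbar_log {r : Cn m → ℝ} (hr : DifferentiableAt ℝ r ζ) (h0 : r ζ ≠ 0) :
    dzbar i (fun ζ => ((Real.log (r ζ) : ℝ) : ℂ)) ζ = dzbar i (fun ζ => (r ζ : ℂ)) ζ / r ζ := by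
  simp only [dzbar, fderiv_ofReal hr, fderiv_ofReal (hr.log h0), fderiv.log hr h0,
    _root_.smul_apply, smul_eq_mul]
  push_cast
  field_simp

lemma dz_dzbar_add {f g : Cn m → ℂ} (hf : ContDiffAt ℝ 2 f ζ) (hg : ContDiffAt ℝ 2 g ζ) :
    dz i (dzbar i fun ζ => f ζ + g ζ) ζ = dz i (dzbar i f) ζ + dz i (dzbar i g) ζ := by
  have h : dzbar i (fun ζ => f ζ + g ζ) =ᶠ[𝓝 ζ] fun ζ => dzbar i f ζ + dzbar i g ζ := by
    filter_upwards [hf.eventually (by simp), hg.eventually (by simp)] with y h1 h2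
    exact dzbar_add (h1.differentiableAt two_ne_zero) (h2.differentiableAt two_ne_zero)
  rw [dz_congr h, dz_add (differentiableAt_dzbar hf) (differentiableAt_dzbar hg)]

lemma dz_conj_dz_div {α : Cn m → ℂ} (hα : ContDiffAt ℝ 2 α ζ) (h0 : α ζ ≠ 0) :
    dz i (fun y => conj (dz i α y / α y)) ζ =
      conj ((dz i (dzbar i α) ζ * α ζ - dz i α ζ * dzbar i α ζ) / α ζ ^ 2) := by
  have hd := hα.differentiableAt two_ne_zero
  have hdz := differentiableAt_dz (k := i) hα
  have hdi : DifferentiableAt ℝ (fun y => dz i α y / α y) ζ := by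
    simpa only [div_eq_mul_inv] using hdz.fun_mul (hd.fun_inv h0)
  rw [dz_conj hdi]
  have e : dzbar i (fun y => dz i α y) ζ = dzbar i (fun y => dz i α y / α y * α y) ζ := by
    refine dzbar_congr ?_
    filter_upwards [hd.continuousAt.eventually_ne h0] with y hy
    field_simp
  rw [dzbar_mul hdi hd] at e
  have e2 : dzbar i (fun y => dz i α y) ζ = dz i (dzbar i α) ζ := (dz_dzbar_comm hα).symm
  rw [e2] at e
  congr 1
  rw [e]
  field_simp
  ring

/-- The structure equations of a holomorphic curve give a metric of constant negative curvature. -/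
theorem dz_dzbar_log_normSq {α β : Cn m → ℂ} {lam : ℝ} (hα : ContDiffAt ℝ 2 α ζ)
    (hβ : DifferentiableAt ℝ β ζ) (h0 : α ζ ≠ 0)
    (h1 : ∀ᶠ y in 𝓝 ζ, dzbar i α y = Complex.I * conj (β y) * α y)
    (h2 : dzbar i β ζ = -(lam - Complex.I) * conj (α ζ) * α ζ) :
    dz i (dzbar i fun y => ((Real.log (Complex.normSq (α y)) : ℝ) : ℂ)) ζ =
      2 * Complex.normSq (α ζ) := by
  have hd := hα.differentiableAt two_ne_zero
  have hns : ∀ y, DifferentiableAt ℝ α y → DifferentiableAt ℝ (fun y => Complex.normSq (α y)) y := by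
    intro y hy
    simp only [Complex.normSq_apply]
    have a1 := Complex.reCLM.differentiableAt.comp y hy
    have a2 := Complex.imCLM.differentiableAt.comp y hy
    exact (a1.mul a1).add (a2.mul a2)
  have e1 : dzbar i (fun y => ((Real.log (Complex.normSq (α y)) : ℝ) : ℂ)) =ᶠ[𝓝 ζ]
      fun y => Complex.I * conj (β y) + conj (dz i α y / α y) := by
    filter_upwards [hα.eventually (by simp), h1, hd.continuousAt.eventually_ne h0] with y k1 k2 k3
    have k1' := k1.differentiableAt two_ne_zero
    have k4 : conj (α y) ≠ 0 := (map_ne_zero _).2 k3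
    rw [dzbar_log (hns y k1') (by simpa using k3)]
    have : (fun ζ => (Complex.normSq (α ζ) : ℂ)) = fun ζ => α ζ * conj (α ζ) :=
      funext fun ζ => (Complex.mul_conj _).symm
    have kc : DifferentiableAt ℝ (fun ζ => conj (α ζ)) y :=
      Complex.conjCLE.toContinuousLinearMap.differentiableAt.comp y k1'
    rw [this, dzbar_mul k1' kc, dzbar_conj k1', k2, ← Complex.mul_conj, map_div₀]
    field_simp
  have hcβ : DifferentiableAt ℝ (fun y => conj (β y)) ζ :=
    Complex.conjCLE.toContinuousLinearMap.differentiableAt.comp ζ hβ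
  have hIβ : DifferentiableAt ℝ (fun y => Complex.I * conj (β y)) ζ := hcβ.const_mul _
  have hq : DifferentiableAt ℝ (fun y => conj (dz i α y / α y)) ζ :=
    Complex.conjCLE.toContinuousLinearMap.differentiableAt.comp ζ
      (by simpa only [div_eq_mul_inv] using (differentiableAt_dz (k := i) hα).fun_mul (hd.fun_inv h0))
  have e3 : dz i (fun y => Complex.I * conj (β y)) ζ =
      (1 - Complex.I * lam) * (α ζ * conj (α ζ)) := by
    have := dz_mul (k := i) (differentiableAt_const Complex.I) hcβ
    rw [dz_const, zero_mul, zero_add, dz_conj hβ, h2] at this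
    rw [this]
    simp only [map_mul, map_neg, map_sub, Complex.conj_ofReal, Complex.conj_I, Complex.conj_conj]
    linear_combination (-(α ζ * conj (α ζ))) * Complex.I_mul_I
  have e4 : dz i (dzbar i α) ζ = (1 - Complex.I * lam) * (α ζ * conj (α ζ)) * α ζ
      + Complex.I * conj (β ζ) * dz i α ζ := by
    rw [dz_congr h1, dz_mul hIβ hd, e3]
  rw [dz_congr e1, dz_add hIβ hq, dz_conj_dz_div hα h0, e3, e4, h1.self_of_nhds]
  have k4 : conj (α ζ) ≠ 0 := (map_ne_zero _).2 h0
  rw [← Complex.mul_conj]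
  have : ((1 - Complex.I * lam) * (α ζ * conj (α ζ)) * α ζ + Complex.I * conj (β ζ) * dz i α ζ) * α ζ
      - dz i α ζ * (Complex.I * conj (β ζ) * α ζ) =
      (1 - Complex.I * lam) * (α ζ * conj (α ζ)) * α ζ ^ 2 := by ring
  rw [this, mul_div_cancel_right₀ _ (pow_ne_zero 2 h0)]
  simp only [map_mul, map_sub, map_one, Complex.conj_ofReal, Complex.conj_I, Complex.conj_conj]
  ring

lemma second_deriv_nonpos_of_isLocalMax {g : ℝ → ℝ} (hm : IsLocalMax g 0)
    (hc : ContinuousAt g 0) : deriv (deriv g) 0 ≤ 0 := by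
  by_contra h
  push Not at h
  have h1 := isLocalMin_of_deriv_deriv_pos h hm.deriv_eq_zero hc
  have h2 : g =ᶠ[𝓝 0] fun _ => g 0 := by
    filter_upwards [hm, h1] with y a b using le_antisymm a b
  have h3 : deriv g =ᶠ[𝓝 0] fun _ => 0 := by
    filter_upwards [h2.eventuallyEq_nhds] with y hy
    rw [hy.deriv_eq, deriv_const]
  rw [h3.deriv_eq, deriv_const] at h
  exact lt_irrefl _ h

lemma fderiv_fderiv_nonpos_of_isLocalMax {r : Cn m → ℝ} (hr : ContDiffAt ℝ 2 r ζ)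
    (hm : IsLocalMax r ζ) (v : Cn m) : fderiv ℝ (fun y => fderiv ℝ r y v) ζ v ≤ 0 := by
  have hl : ∀ t : ℝ, HasDerivAt (fun t : ℝ => ζ + t • v) v t := fun t => by
    simpa using ((hasDerivAt_id t).smul_const v).const_add ζ
  have hl0 : Tendsto (fun t : ℝ => ζ + t • v) (𝓝 0) (𝓝 ζ) := by
    have := (hl 0).continuousAt.tendsto; simpa using this
  have hdr : DifferentiableAt ℝ (fun y => fderiv ℝ r y v) ζ :=
    ((hr.fderiv_right (m := 1) (by norm_num)).differentiableAt (by norm_num)).clm_apply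
      (differentiableAt_const v)
  have h1 : deriv (fun t : ℝ => r (ζ + t • v)) =ᶠ[𝓝 0] fun t => fderiv ℝ r (ζ + t • v) v := by
    filter_upwards [hl0.eventually (hr.eventually (by simp))] with t ht
    exact ((ht.differentiableAt two_ne_zero).hasFDerivAt.comp_hasDerivAt t (hl t)).deriv
  have h2 : deriv (deriv (fun t : ℝ => r (ζ + t • v))) 0 =
      fderiv ℝ (fun y => fderiv ℝ r y v) ζ v := by
    rw [h1.deriv_eq]
    have hdr' : DifferentiableAt ℝ (fun y => fderiv ℝ r y v) (ζ + (0 : ℝ) • v) := by simpa using hdr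
    have := (hdr'.hasFDerivAt.comp_hasDerivAt (0 : ℝ) (hl 0)).deriv
    rw [zero_smul, add_zero] at this
    exact this
  rw [← h2]
  refine second_deriv_nonpos_of_isLocalMax ?_ ?_
  · have : ∀ᶠ t in 𝓝 (0 : ℝ), r (ζ + t • v) ≤ r ζ := hl0.eventually hm
    simpa [IsLocalMax, IsMaxFilter] using this
  · refine ContinuousAt.comp (f := fun t : ℝ => ζ + t • v) ?_ (hl 0).continuousAt
    simpa using hr.continuousAt

/-- At an interior maximum the Laplacian is nonpositive. -/
theorem dz_dzbar_re_nonpos_of_isLocalMax {r : Cn m → ℝ} (hr : ContDiffAt ℝ 2 r ζ)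
    (hm : IsLocalMax r ζ) : (dz i (dzbar i fun y => (r y : ℂ)) ζ).re ≤ 0 := by
  have hdr : ∀ v, DifferentiableAt ℝ (fun y => fderiv ℝ r y v) ζ := fun v =>
    ((hr.fderiv_right (m := 1) (by norm_num)).differentiableAt (by norm_num)).clm_apply
      (differentiableAt_const v)
  have h1 : dzbar i (fun y => (r y : ℂ)) =ᶠ[𝓝 ζ] fun y =>
      ((fderiv ℝ r y (stdVec i) : ℝ) : ℂ) * (1 / 2)
        + ((fderiv ℝ r y (Complex.I • stdVec i) : ℝ) : ℂ) * (Complex.I / 2) := by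
    filter_upwards [hr.eventually (by simp)] with y hy
    simp only [dzbar, fderiv_ofReal (hy.differentiableAt two_ne_zero)]
    ring
  have hA := differentiableAt_ofReal (hdr (stdVec i))
  have hB := differentiableAt_ofReal (hdr (Complex.I • stdVec i))
  rw [dz_congr h1, dz_add (hA.mul_const _) (hB.mul_const _), dz_mul hA (differentiableAt_const _),
    dz_mul hB (differentiableAt_const _), dz_const, dz_const]
  simp only [dz, fderiv_ofReal (hdr _)]
  have k1 := fderiv_fderiv_nonpos_of_isLocalMax hr hm (stdVec i)
  have k2 := fderiv_fderiv_nonpos_of_isLocalMax hr hm (Complex.I • stdVec i)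
  simp
  linarith

end WirtingerComp

section MFDerivCharts

variable {𝕜 : Type*} [NontriviallyNormedField 𝕜] {E F : Type*} [NormedAddCommGroup E]
  [NormedSpace 𝕜 E] [NormedAddCommGroup F] [NormedSpace 𝕜 F]
  {M N : Type*} [TopologicalSpace M] [ChartedSpace E M] [TopologicalSpace N] [ChartedSpace F N]
  {f : M → N} {x : M}

lemma mfderiv_apply_eq_fderiv (h : MDifferentiableAt 𝓘(𝕜, E) 𝓘(𝕜, F) f x) (v : E) :
    mfderiv 𝓘(𝕜, E) 𝓘(𝕜, F) f x v =
      fderiv 𝕜 (chartAt F (f x) ∘ f ∘ (chartAt E x).symm) (chartAt E x x) v := by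
  have h2 : fderivWithin 𝕜 (writtenInExtChartAt 𝓘(𝕜, E) 𝓘(𝕜, F) x f)
      (range 𝓘(𝕜, E)) (extChartAt 𝓘(𝕜, E) x x) =
      fderiv 𝕜 (chartAt F (f x) ∘ f ∘ (chartAt E x).symm) (chartAt E x x) := by
    simp only [mfld_simps, fderivWithin_univ, writtenInExtChartAt]
  exact congrFun (congrArg DFunLike.coe (h.mfderiv.trans h2)) v

lemma MDifferentiableAt.differentiableAt_charts [IsManifold 𝓘(𝕜, E) 1 M] [IsManifold 𝓘(𝕜, F) 1 N]
    {x₀ : M} {y₀ : N} {z : E} (hz : z ∈ (chartAt E x₀).target)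
    (hy : f ((chartAt E x₀).symm z) ∈ (chartAt F y₀).source)
    (h : MDifferentiableAt 𝓘(𝕜, E) 𝓘(𝕜, F) f ((chartAt E x₀).symm z)) :
    DifferentiableAt 𝕜 (chartAt F y₀ ∘ f ∘ (chartAt E x₀).symm) z := by
  have h1 : MDifferentiableAt 𝓘(𝕜, E) 𝓘(𝕜, E) (chartAt E x₀).symm z :=
    ((contMDiffOn_chart_symm (I := 𝓘(𝕜, E)) (n := 1) (x := x₀)).contMDiffAt
      ((chartAt E x₀).open_target.mem_nhds hz)).mdifferentiableAt (by simp)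
  have h2 : MDifferentiableAt 𝓘(𝕜, F) 𝓘(𝕜, F) (chartAt F y₀) (f ((chartAt E x₀).symm z)) :=
    ((contMDiffOn_chart (I := 𝓘(𝕜, F)) (n := 1) (x := y₀)).contMDiffAt
      ((chartAt F y₀).open_source.mem_nhds hy)).mdifferentiableAt (by simp)
  exact mdifferentiableAt_iff_differentiableAt.1 (h2.comp z (h.comp z h1))

end MFDerivCharts

section ComplexManifoldMaps

variable {m n : ℕ} {M N : Type*} [TopologicalSpace M] [ChartedSpace (Cn m) M]
  [IsManifold 𝓘(ℂ, Cn m) ω M] [TopologicalSpace N] [ChartedSpace (Cn n) N]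
  [IsManifold 𝓘(ℂ, Cn n) ω N] {f : M → N} {x : M}

variable (n N) in
lemma isManifold_complex_one : IsManifold 𝓘(ℂ, Cn n) 1 N := IsManifold.of_le (n := ω) le_top

lemma MDifferentiableAt.differentiableAt_charts_complex {x₀ : M} {y₀ : N} {z : Cn m}
    (hz : z ∈ (chartAt (Cn m) x₀).target)
    (hy : f ((chartAt (Cn m) x₀).symm z) ∈ (chartAt (Cn n) y₀).source)
    (h : MDifferentiableAt 𝓘(ℂ, Cn m) 𝓘(ℂ, Cn n) f ((chartAt (Cn m) x₀).symm z)) :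
    DifferentiableAt ℂ (chartAt (Cn n) y₀ ∘ f ∘ (chartAt (Cn m) x₀).symm) z := by
  have := isManifold_complex_one m M
  have := isManifold_complex_one n N
  exact h.differentiableAt_charts hz hy

lemma MDifferentiableAt.real (h : MDifferentiableAt 𝓘(ℂ, Cn m) 𝓘(ℂ, Cn n) f x) :
    MDifferentiableAt 𝓘(ℝ, Cn m) 𝓘(ℝ, Cn n) f x := by
  refine ⟨h.1, ?_⟩
  have := h.2
  simp only [mfld_simps, DifferentiableWithinAtProp, differentiableWithinAt_univ] at this ⊢
  exact this.restrictScalars ℝ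

lemma mfderiv_real_apply (h : MDifferentiableAt 𝓘(ℂ, Cn m) 𝓘(ℂ, Cn n) f x) (v : Cn m) :
    (mfderiv 𝓘(ℝ, Cn m) 𝓘(ℝ, Cn n) f x v : Cn n) = mfderiv 𝓘(ℂ, Cn m) 𝓘(ℂ, Cn n) f x v := by
  refine (mfderiv_apply_eq_fderiv h.real v).trans (Eq.trans ?_ (mfderiv_apply_eq_fderiv h v).symm)
  have hd : DifferentiableAt ℂ (chartAt (Cn n) (f x) ∘ f ∘ (chartAt (Cn m) x).symm)
      (chartAt (Cn m) x x) := by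
    refine MDifferentiableAt.differentiableAt_charts_complex (mem_chart_target _ _) ?_ ?_
    · rw [OpenPartialHomeomorph.left_inv _ (mem_chart_source _ _)]; exact mem_chart_source _ _
    · rwa [OpenPartialHomeomorph.left_inv _ (mem_chart_source _ _)]
  rw [hd.fderiv_restrictScalars ℝ]
  rfl

/-- The derivative of a map into a complex manifold, through the chart around `y₀`. -/
lemma mfderiv_apply_eq_chartVec {u : Cn m → N} {ζ : Cn m} {y₀ : N}
    (hu : MDifferentiableAt 𝓘(ℂ, Cn m) 𝓘(ℂ, Cn n) u ζ) (hy : u ζ ∈ (chartAt (Cn n) y₀).source)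
    (v : Cn m) :
    (mfderiv 𝓘(ℂ, Cn m) 𝓘(ℂ, Cn n) u ζ v : Cn n) =
      fderiv ℂ (chartAt (Cn n) (u ζ) ∘ (chartAt (Cn n) y₀).symm) (chartAt (Cn n) y₀ (u ζ))
        (fderiv ℂ (chartAt (Cn n) y₀ ∘ u) ζ v) := by
  refine (mfderiv_apply_eq_fderiv hu v).trans ?_
  have h1 : DifferentiableAt ℂ (chartAt (Cn n) y₀ ∘ u) ζ := by
    have := MDifferentiableAt.differentiableAt_charts_complex (x₀ := ζ) (y₀ := y₀) (z := ζ) (f := u)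
      (mem_univ ζ) hy hu
    exact this
  have h2 : DifferentiableAt ℂ (chartAt (Cn n) (u ζ) ∘ (chartAt (Cn n) y₀).symm)
      (chartAt (Cn n) y₀ (u ζ)) := by
    refine ((contDiffOn_chart_transition y₀ (u ζ)).contDiffAt
      ((OpenPartialHomeomorph.open_source _).mem_nhds ?_)).differentiableAt (by simp)
    simp [hy]
  have h3 : chartAt (Cn n) (u ζ) ∘ u ∘ (chartAt (Cn m) ζ).symm =ᶠ[𝓝 ζ]
      (chartAt (Cn n) (u ζ) ∘ (chartAt (Cn n) y₀).symm) ∘ (chartAt (Cn n) y₀ ∘ u) := by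
    filter_upwards [hu.continuousAt.eventually ((chartAt (Cn n) y₀).open_source.mem_nhds hy)]
      with y hy'
    show chartAt (Cn n) (u ζ) (u y) = chartAt (Cn n) (u ζ) ((chartAt (Cn n) y₀).symm (chartAt (Cn n) y₀ (u y)))
    rw [(chartAt (Cn n) y₀).left_inv hy']
  have h4 : chartAt (Cn m) ζ ζ = ζ := rfl
  rw [h4, h3.fderiv_eq, fderiv_comp ζ h2 h1]
  rfl

end ComplexManifoldMaps

section CurvesInFrame

/-- The components of the velocity of a curve in a coframe. -/
def curveCo (A : Cn 2 → Matrix (Fin 2) (Fin 2) ℂ) (w : Cn 1 → Cn 2) (ζ : Cn 1) : Fin 2 → ℂ :=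
  (fderiv ℂ w ζ (stdVec 0)).ofLp ᵥ* A (w ζ)

variable {lam : ℝ} {A Ξ : Cn 2 → Matrix (Fin 2) (Fin 2) ℂ} {w : Cn 1 → Cn 2} {ζ₀ : Cn 1}

lemma contDiffAt_of_eventually_differentiableAt {m n : ℕ} {w : Cn m → Cn n} {ζ₀ : Cn m}
    (hw : ∀ᶠ ζ in 𝓝 ζ₀, DifferentiableAt ℂ w ζ) : ContDiffAt ℂ ∞ w ζ₀ := by
  obtain ⟨U, hU, hUo, hζ⟩ := eventually_nhds_iff.1 hw
  exact (contDiffOn_of_differentiableOn_complex hUo fun y hy =>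
    (hU y hy).differentiableWithinAt).contDiffAt (hUo.mem_nhds hζ)

lemma ContDiffAt.coord {m n : ℕ} {k : WithTop ℕ∞} {w : Cn m → Cn n} {ζ₀ : Cn m}
    (h : ContDiffAt ℂ k w ζ₀) (j : Fin n) : ContDiffAt ℂ k (fun ζ => w ζ j) ζ₀ :=
  (EuclideanSpace.proj j : Cn n →L[ℂ] ℂ).contDiff.contDiffAt.comp ζ₀ h

lemma contDiffAt_curveCo (hA : IsInvariantCoframe lam A Ξ (w ζ₀))
    (hw : ∀ᶠ ζ in 𝓝 ζ₀, DifferentiableAt ℂ w ζ) (a : Fin 2) :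
    ContDiffAt ℝ ∞ (fun ζ => curveCo A w ζ a) ζ₀ := by
  have h1 := contDiffAt_of_eventually_differentiableAt hw
  have h2 : ContDiffAt ℂ ∞ (fun ζ => fderiv ℂ w ζ (stdVec 0)) ζ₀ :=
    (h1.fderiv_right (m := ∞) le_rfl).clm_apply contDiffAt_const
  have h3 : ∀ k, ContDiffAt ℝ ∞ (fun ζ => A (w ζ) k a) ζ₀ := fun k =>
    (hA.smooth k a).comp ζ₀ (h1.restrict_scalars ℝ)
  simp only [curveCo, Matrix.vecMul, dotProduct]
  exact ContDiffAt.sum fun k _ => ((h2.coord k).restrict_scalars ℝ).mul (h3 k)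

lemma dzbar_curveCo (hA : IsInvariantCoframe lam A Ξ (w ζ₀))
    (hw : ∀ᶠ ζ in 𝓝 ζ₀, DifferentiableAt ℂ w ζ) :
    ∀ᶠ ζ in 𝓝 ζ₀, dzbar 0 (fun ζ => curveCo A w ζ 0) ζ =
        Complex.I * conj (curveCo A w ζ 1) * curveCo A w ζ 0 ∧
      dzbar 0 (fun ζ => curveCo A w ζ 1) ζ =
        -(lam - Complex.I) * conj (curveCo A w ζ 0) * curveCo A w ζ 0 := by
  have hcont := hw.self_of_nhds.continuousAt
  have hsA : ∀ᶠ ζ in 𝓝 ζ₀, ∀ i j, DifferentiableAt ℝ (fun y => A y i j) (w ζ) := by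
    simp only [eventually_all]
    exact fun i j => hcont.eventually ((((hA.smooth i j).of_le two_le_infty).eventually
      (by simp)).mono fun y hy => hy.differentiableAt two_ne_zero)
  filter_upwards [hw.eventually_nhds, hw, hsA, hcont.eventually hA.dbar] with ζ k1 k2 k3 k4
  have h2 : ∀ k, DifferentiableAt ℂ (fun ζ => fderiv ℂ w ζ (stdVec 0) k) ζ := fun k =>
    ((((contDiffAt_of_eventually_differentiableAt k1).fderiv_right (m := ∞) le_rfl).clm_apply
      contDiffAt_const).coord k).differentiableAt (by simp)
  have h3 : ∀ i j, DifferentiableAt ℝ (fun ζ => A (w ζ) i j) ζ := fun i j =>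
    (k3 i j).comp ζ (k2.restrictScalars ℝ)
  have key : ∀ a, dzbar 0 (fun ζ => curveCo A w ζ a) ζ =
      -∑ b, conj (curveCo A w ζ b) * (curveCo A w ζ ᵥ* frameD lam b) a := by
    intro a
    have e1 : ∀ k, dzbar 0 (fun ζ => fderiv ℂ w ζ (stdVec 0) k * A (w ζ) k a) ζ =
        fderiv ℂ w ζ (stdVec 0) k *
          ∑ l, conj (fderiv ℂ w ζ (stdVec 0) l) * dzbar l (fun y => A y k a) (w ζ) := fun k => by
      rw [dzbar_mul ((h2 k).restrictScalars ℝ) (h3 k a), dzbar_of_differentiableAt (h2 k), zero_mul,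
        zero_add, dzbar_comp (k3 k a) k2]
    have e2 : ∀ l k, dzbar l (fun y => A y k a) (w ζ) =
        (-(∑ b, conj (A (w ζ) l b) • (A (w ζ) * frameD lam b))) k a := fun l k => by
      rw [← k4 l]; rfl
    simp only [curveCo, Matrix.vecMul, dotProduct, Fin.sum_univ_two]
    rw [dzbar_add (((h2 0).restrictScalars ℝ).fun_mul (h3 0 a))
      (((h2 1).restrictScalars ℝ).fun_mul (h3 1 a)), e1, e1]
    simp only [e2, Matrix.neg_apply, Matrix.add_apply, Matrix.smul_apply, Matrix.mul_apply,
      Fin.sum_univ_two, smul_eq_mul, map_add, map_mul]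
    ring
  rw [key, key]
  constructor <;> simp [frameD, Matrix.vecMul, dotProduct, Fin.sum_univ_two] <;> ring

theorem dz_dzbar_log_normSq_curveCo (hA : IsInvariantCoframe lam A Ξ (w ζ₀))
    (hw : ∀ᶠ ζ in 𝓝 ζ₀, DifferentiableAt ℂ w ζ) (h0 : curveCo A w ζ₀ 0 ≠ 0) :
    dz 0 (dzbar 0 fun ζ => ((Real.log (Complex.normSq (curveCo A w ζ 0)) : ℝ) : ℂ)) ζ₀ =
      2 * Complex.normSq (curveCo A w ζ₀ 0) :=
  dz_dzbar_log_normSq ((contDiffAt_curveCo hA hw 0).of_le two_le_infty)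
    ((contDiffAt_curveCo hA hw 1).differentiableAt (by simp)) h0
    ((dzbar_curveCo hA hw).mono fun _ h => h.1) (dzbar_curveCo hA hw).self_of_nhds.2

end CurvesInFrame

section CurvesInSurface

variable {X : Type*} [TopologicalSpace X] [ChartedSpace (Cn 2) X] [IsManifold 𝓘(ℂ, Cn 2) ω X]
  {lam : ℝ} {A : X → Matrix (Fin 2) (Fin 2) ℂ} {u : Cn 1 → X} {ζ ζ₀ : Cn 1} {x₀ : X}

/-- The components of the velocity of a holomorphic curve in a coframe. -/
def velCo (A : X → Matrix (Fin 2) (Fin 2) ℂ) (u : Cn 1 → X) (ζ : Cn 1) : Fin 2 → ℂ :=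
  coframe A (u ζ) (mfderiv 𝓘(ℂ, Cn 1) 𝓘(ℂ, Cn 2) u ζ (stdVec 0))

lemma velCo_eq_curveCo (hu : MDifferentiableAt 𝓘(ℂ, Cn 1) 𝓘(ℂ, Cn 2) u ζ)
    (hx : u ζ ∈ (chartAt (Cn 2) x₀).source) :
    velCo A u ζ = curveCo (coMat A x₀) (chartAt (Cn 2) x₀ ∘ u) ζ := by
  have hz := (chartAt (Cn 2) x₀).map_source hx
  have h1 := coframe_chartVec (A := A) hz (fderiv ℂ (chartAt (Cn 2) x₀ ∘ u) ζ (stdVec 0))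
  have h2 := (mfderiv_apply_eq_chartVec hu hx (stdVec 0))
  have h3 := chartVec_eq hz (fderiv ℂ (chartAt (Cn 2) x₀ ∘ u) ζ (stdVec 0))
  rw [(chartAt (Cn 2) x₀).left_inv hx] at h1 h3
  exact (congrArg (coframe A (u ζ)) (h2.trans h3.symm)).trans h1

lemma velCo_eventuallyEq (hu : ∀ᶠ ζ in 𝓝 ζ₀, MDifferentiableAt 𝓘(ℂ, Cn 1) 𝓘(ℂ, Cn 2) u ζ)
    (hx : u ζ₀ ∈ (chartAt (Cn 2) x₀).source) :
    velCo A u =ᶠ[𝓝 ζ₀] curveCo (coMat A x₀) (chartAt (Cn 2) x₀ ∘ u) := by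
  filter_upwards [hu, hu.self_of_nhds.continuousAt.eventually
    ((chartAt (Cn 2) x₀).open_source.mem_nhds hx)] with ζ h1 h2 using velCo_eq_curveCo h1 h2

lemma MDifferentiableAt.chart_comp {m n : ℕ} {N : Type*} [TopologicalSpace N]
    [ChartedSpace (Cn n) N] [IsManifold 𝓘(ℂ, Cn n) ω N] {u : Cn m → N} {ζ : Cn m} {y₀ : N}
    (hu : MDifferentiableAt 𝓘(ℂ, Cn m) 𝓘(ℂ, Cn n) u ζ) (hy : u ζ ∈ (chartAt (Cn n) y₀).source) :
    DifferentiableAt ℂ (chartAt (Cn n) y₀ ∘ u) ζ :=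
  MDifferentiableAt.differentiableAt_charts_complex (x₀ := ζ) (z := ζ) (f := u)
    (mem_univ ζ) hy hu

lemma eventually_differentiableAt_chart_comp {m n : ℕ} {N : Type*} [TopologicalSpace N]
    [ChartedSpace (Cn n) N] [IsManifold 𝓘(ℂ, Cn n) ω N] {u : Cn m → N} {ζ₀ : Cn m} {y₀ : N}
    (hu : ∀ᶠ ζ in 𝓝 ζ₀, MDifferentiableAt 𝓘(ℂ, Cn m) 𝓘(ℂ, Cn n) u ζ)
    (hx : u ζ₀ ∈ (chartAt (Cn n) y₀).source) :
    ∀ᶠ ζ in 𝓝 ζ₀, DifferentiableAt ℂ (chartAt (Cn n) y₀ ∘ u) ζ := by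
  filter_upwards [hu, hu.self_of_nhds.continuousAt.eventually
    ((chartAt (Cn n) y₀).open_source.mem_nhds hx)] with ζ h1 h2 using h1.chart_comp h2

lemma contDiffAt_velCo (hA : IsInvariantCoframeOn lam A)
    (hu : ∀ᶠ ζ in 𝓝 ζ₀, MDifferentiableAt 𝓘(ℂ, Cn 1) 𝓘(ℂ, Cn 2) u ζ) (a : Fin 2) :
    ContDiffAt ℝ ∞ (fun ζ => velCo A u ζ a) ζ₀ := by
  have hx := mem_chart_source (Cn 2) (u ζ₀)
  obtain ⟨Ξ, hΞ⟩ := hA (u ζ₀) _ (mem_chart_target (Cn 2) (u ζ₀))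
  refine (contDiffAt_curveCo (w := chartAt (Cn 2) (u ζ₀) ∘ u) hΞ
    (eventually_differentiableAt_chart_comp hu hx) a).congr_of_eventuallyEq ?_
  exact (velCo_eventuallyEq hu hx).mono fun ζ h => congrFun h a

theorem dz_dzbar_log_normSq_velCo (hA : IsInvariantCoframeOn lam A)
    (hu : ∀ᶠ ζ in 𝓝 ζ₀, MDifferentiableAt 𝓘(ℂ, Cn 1) 𝓘(ℂ, Cn 2) u ζ) (h0 : velCo A u ζ₀ 0 ≠ 0) :
    dz 0 (dzbar 0 fun ζ => ((Real.log (Complex.normSq (velCo A u ζ 0)) : ℝ) : ℂ)) ζ₀ =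
      2 * Complex.normSq (velCo A u ζ₀ 0) := by
  have hx := mem_chart_source (Cn 2) (u ζ₀)
  obtain ⟨Ξ, hΞ⟩ := hA (u ζ₀) _ (mem_chart_target (Cn 2) (u ζ₀))
  have he := velCo_eventuallyEq (A := A) hu hx
  have h1 := dz_dzbar_log_normSq_curveCo (w := chartAt (Cn 2) (u ζ₀) ∘ u) hΞ
    (eventually_differentiableAt_chart_comp hu hx) (by rwa [← he.self_of_nhds])
  rw [← he.self_of_nhds] at h1
  rw [← h1]
  refine dz_congr ?_
  filter_upwards [he.eventuallyEq_nhds] with ζ hζ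
  exact dzbar_congr (hζ.mono fun y hy => by simp only [hy])

lemma contDiffAt_normSq {m : ℕ} {α : Cn m → ℂ} {ζ : Cn m} {k : WithTop ℕ∞}
    (h : ContDiffAt ℝ k α ζ) : ContDiffAt ℝ k (fun y => Complex.normSq (α y)) ζ := by
  simp only [Complex.normSq_apply]
  have a1 := Complex.reCLM.contDiff.contDiffAt.comp ζ h
  have a2 := Complex.imCLM.contDiff.contDiffAt.comp ζ h
  exact (a1.mul a1).add (a2.mul a2)

lemma dz_dzbar_log_disc {c ζ : Cn 1} {r : ℝ} (h : 0 < r ^ 2 - Complex.normSq (ζ 0 - c 0)) :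
    dz 0 (dzbar 0 fun y : Cn 1 => ((Real.log (r ^ 2 - Complex.normSq (y 0 - c 0)) : ℝ) : ℂ)) ζ =
      -(r ^ 2 / (r ^ 2 - Complex.normSq (ζ 0 - c 0)) ^ 2 : ℝ) := by
  have hs : ∀ y : Cn 1, DifferentiableAt ℂ (fun y : Cn 1 => y 0 - c 0) y := fun y =>
    ((EuclideanSpace.proj 0 : Cn 1 →L[ℂ] ℂ).differentiableAt).sub_const _
  have hs' : ∀ y : Cn 1, DifferentiableAt ℝ (fun y : Cn 1 => y 0 - c 0) y := fun y =>
    (hs y).restrictScalars ℝ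
  have hcs : ∀ y : Cn 1, DifferentiableAt ℝ (fun y : Cn 1 => conj (y 0 - c 0)) y := fun y =>
    Complex.conjCLE.toContinuousLinearMap.differentiableAt.comp y (hs' y)
  have d1 : ∀ y, dz 0 (fun y : Cn 1 => y 0 - c 0) y = 1 := fun y => by
    rw [dz_of_differentiableAt (hs y), fderiv_sub_const,
      show (fun y : Cn 1 => y 0) = (EuclideanSpace.proj 0 : Cn 1 →L[ℂ] ℂ) from rfl,
      ContinuousLinearMap.fderiv]
    simp [stdVec]
  have d2 : ∀ y, dzbar 0 (fun y : Cn 1 => y 0 - c 0) y = 0 := fun y =>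
    dzbar_of_differentiableAt (hs y)
  have hn : ∀ y : Cn 1, DifferentiableAt ℝ (fun y : Cn 1 => r ^ 2 - Complex.normSq (y 0 - c 0)) y :=
    fun y => (contDiffAt_const.sub (contDiffAt_normSq (k := 1)
      ((contDiffAt_of_eventually_differentiableAt (n := 1) (w := fun y : Cn 1 => y - c)
        (Eventually.of_forall fun y => differentiableAt_id.sub_const c)).coord 0
          |>.restrict_scalars ℝ |>.of_le (le_trans (by norm_num) two_le_infty)))).differentiableAt
        one_ne_zero
  have e0 : (fun y : Cn 1 => ((r ^ 2 - Complex.normSq (y 0 - c 0) : ℝ) : ℂ)) =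
      fun y => (r : ℂ) ^ 2 + (-1) * ((y 0 - c 0) * conj (y 0 - c 0)) := by
    ext y; rw [Complex.mul_conj]; push_cast; ring
  have hsc : ∀ y : Cn 1, DifferentiableAt ℝ (fun y : Cn 1 => (-1) * ((y 0 - c 0) * conj (y 0 - c 0))) y :=
    fun y => (((hs' y).fun_mul (hcs y)).const_mul _)
  have f1 : ∀ y : Cn 1, dzbar 0 (fun y : Cn 1 => ((r ^ 2 - Complex.normSq (y 0 - c 0) : ℝ) : ℂ)) y =
      -(y 0 - c 0) := fun y => by
    rw [e0, dzbar_add (differentiableAt_const _) (hsc y), dzbar_const,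
      dzbar_mul (differentiableAt_const _) ((hs' y).fun_mul (hcs y)), dzbar_const,
      dzbar_mul (hs' y) (hcs y), d2, dzbar_conj (hs' y), d1]
    simp
  have f2 : ∀ y : Cn 1, dz 0 (fun y : Cn 1 => ((r ^ 2 - Complex.normSq (y 0 - c 0) : ℝ) : ℂ)) y =
      -conj (y 0 - c 0) := fun y => by
    rw [e0, dz_add (differentiableAt_const _) (hsc y), dz_const,
      dz_mul (differentiableAt_const _) ((hs' y).fun_mul (hcs y)), dz_const,
      dz_mul (hs' y) (hcs y), d1, dz_conj (hs' y), d2]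
    simp
  have e1 : dzbar 0 (fun y : Cn 1 => ((Real.log (r ^ 2 - Complex.normSq (y 0 - c 0)) : ℝ) : ℂ))
      =ᶠ[𝓝 ζ] fun y => -(y 0 - c 0) / ((r ^ 2 - Complex.normSq (y 0 - c 0) : ℝ) : ℂ) := by
    filter_upwards [(hn ζ).continuousAt.eventually (lt_mem_nhds h)] with y hy
    rw [dzbar_log (hn y) hy.ne', f1]
  rw [dz_congr e1]
  set N : Cn 1 → ℂ := fun y => ((r ^ 2 - Complex.normSq (y 0 - c 0) : ℝ) : ℂ) with hN
  have hN0 : N ζ ≠ 0 := by simp only [hN]; exact_mod_cast h.ne'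
  have hNd : DifferentiableAt ℝ N ζ := differentiableAt_ofReal (hn ζ)
  have hq : DifferentiableAt ℝ (fun y : Cn 1 => -(y 0 - c 0) / N y) ζ := by
    simpa only [div_eq_mul_inv] using (hs' ζ).fun_neg.fun_mul (hNd.fun_inv hN0)
  have e2 : dz 0 (fun y : Cn 1 => -(y 0 - c 0) / N y * N y) ζ = -1 := by
    have : (fun y : Cn 1 => -(y 0 - c 0) / N y * N y) =ᶠ[𝓝 ζ] fun y => (-1) * (y 0 - c 0) := by
      filter_upwards [hNd.continuousAt.eventually_ne hN0] with y hy
      field_simp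
    rw [dz_congr this, dz_mul (differentiableAt_const _) (hs' ζ), dz_const, d1]
    simp
  rw [dz_mul hq hNd, f2] at e2
  have e3 : N ζ = r ^ 2 - (ζ 0 - c 0) * conj (ζ 0 - c 0) := by
    rw [Complex.mul_conj]; simp only [hN]; push_cast; ring
  have hrhs : ((-(r ^ 2 / (r ^ 2 - Complex.normSq (ζ 0 - c 0)) ^ 2 : ℝ) : ℝ) : ℂ) =
      -((r : ℂ) ^ 2 / N ζ ^ 2) := by simp only [hN]; push_cast; ring
  refine Eq.trans ?_ (hrhs.symm.trans (by push_cast; rfl))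
  have e4 := congrArg (· * N ζ) e2
  simp only [add_mul] at e4
  have e5 : -(ζ 0 - c 0) / N ζ * -(starRingEnd ℂ) (ζ 0 - c 0) * N ζ =
    (ζ 0 - c 0) * conj (ζ 0 - c 0) := by field_simp
  rw [e5] at e4
  rw [← neg_div, eq_div_iff (pow_ne_zero 2 hN0)]
  linear_combination e4 - e3

/-- An Ahlfors-Schwarz lemma: an entire curve is tangent to the second vector of the frame. -/
theorem velCo_eq_zero_of_entire (hA : IsInvariantCoframeOn lam A)
    (hu : MDifferentiable 𝓘(ℂ, Cn 1) 𝓘(ℂ, Cn 2) u) (c : Cn 1) : velCo A u c 0 = 0 := by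
  by_contra hc
  set α : Cn 1 → ℂ := fun ζ => velCo A u ζ 0 with hα
  have hu' : ∀ ζ₀ : Cn 1, ∀ᶠ ζ in 𝓝 ζ₀, MDifferentiableAt 𝓘(ℂ, Cn 1) 𝓘(ℂ, Cn 2) u ζ :=
    fun ζ₀ => Eventually.of_forall fun ζ => hu ζ
  have hαs : ∀ ζ, ContDiffAt ℝ ∞ α ζ := fun ζ => contDiffAt_velCo hA (hu' ζ) 0
  have hnorm : ∀ ζ : Cn 1, ‖ζ - c‖ ^ 2 = Complex.normSq (ζ 0 - c 0) := fun ζ => by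
    rw [EuclideanSpace.norm_sq_eq]; simp [Complex.normSq_eq_norm_sq]
  have hDs : ∀ r : ℝ, ∀ ζ, ContDiffAt ℝ 2 (fun y : Cn 1 => r ^ 2 - Complex.normSq (y 0 - c 0)) ζ :=
    fun r ζ => contDiffAt_const.sub (contDiffAt_normSq
      ((contDiffAt_of_eventually_differentiableAt (n := 1) (w := fun y : Cn 1 => y - c)
        (Eventually.of_forall fun y => differentiableAt_id.sub_const c)).coord 0
          |>.restrict_scalars ℝ |>.of_le two_le_infty))
  have key : ∀ r : ℝ, 0 < r → r ^ 2 * Complex.normSq (α c) ≤ 1 := by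
    intro r hr
    set D : Cn 1 → ℝ := fun y => r ^ 2 - Complex.normSq (y 0 - c 0) with hD
    set q : Cn 1 → ℝ := fun y => D y ^ 2 * Complex.normSq (α y) with hq
    have hqc : Continuous q := by
      rw [continuous_iff_continuousAt]
      exact fun y => ((hDs r y).continuousAt.pow 2).mul
        (contDiffAt_normSq (hαs y)).continuousAt
    obtain ⟨ζ, hζ, hmax⟩ := (isCompact_closedBall c r).exists_isMaxOn
      ⟨c, Metric.mem_closedBall_self hr.le⟩ hqc.continuousOn
    have hDc : D c = r ^ 2 := by simp [hD]
    have hq0 : 0 < q c := by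
      simp only [hq, hDc]
      have := Complex.normSq_pos.2 hc
      positivity
    have hqζ : q c ≤ q ζ := hmax (Metric.mem_closedBall_self hr.le)
    have hqζ0 := hq0.trans_le hqζ
    have hD0 : D ζ ≠ 0 := by rintro h; simp [hq, h] at hqζ0
    have hα0 : α ζ ≠ 0 := by intro h; simp [hq, h] at hqζ0
    have hDpos : 0 < D ζ := by
      refine lt_of_le_of_ne ?_ hD0.symm
      rw [Metric.mem_closedBall, dist_eq_norm] at hζ
      simp only [hD, ← hnorm]
      have := norm_nonneg (ζ - c)
      nlinarith
    have hball : Metric.closedBall c r ∈ 𝓝 ζ := by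
      refine mem_of_superset (Metric.isOpen_ball.mem_nhds (?_ : ζ ∈ Metric.ball c r))
        Metric.ball_subset_closedBall
      rw [Metric.mem_ball, dist_eq_norm]
      simp only [hD, ← hnorm] at hDpos
      nlinarith [norm_nonneg (ζ - c)]
    have hlm : IsLocalMax q ζ := hmax.isLocalMax hball
    have hnp : 0 < Complex.normSq (α ζ) := Complex.normSq_pos.2 hα0
    have hlog : IsLocalMax (fun y => Real.log (D y) + (Real.log (D y)
        + Real.log (Complex.normSq (α y)))) ζ := by
      filter_upwards [hlm, (hDs r ζ).continuousAt.eventually (lt_mem_nhds hDpos),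
        (contDiffAt_normSq (hαs ζ)).continuousAt.eventually (lt_mem_nhds hnp)] with y h1 h2 h3
      have e : ∀ y, 0 < D y → 0 < Complex.normSq (α y) → Real.log (D y) + (Real.log (D y)
        + Real.log (Complex.normSq (α y))) = Real.log (q y) := fun y h2 h3 => by
        rw [hq]
        simp only
        rw [Real.log_mul (by positivity) h3.ne', Real.log_pow]; push_cast; ring
      rw [e y h2 h3, e ζ hDpos hnp]
      exact Real.log_le_log (by simp only [hq]; exact mul_pos (pow_pos h2 2) h3) h1
    have s1 : ContDiffAt ℝ 2 (fun y => Real.log (D y)) ζ := (hDs r ζ).log hD0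
    have s2 : ContDiffAt ℝ 2 (fun y => Real.log (Complex.normSq (α y))) ζ :=
      (contDiffAt_normSq ((hαs ζ).of_le two_le_infty)).log hnp.ne'
    have h1 := dz_dzbar_re_nonpos_of_isLocalMax (i := 0) (s1.add (s1.add s2)) hlog
    have h2 : dz 0 (dzbar 0 fun y => ((Real.log (D y) + (Real.log (D y)
        + Real.log (Complex.normSq (α y))) : ℝ) : ℂ)) ζ =
        -(r ^ 2 / D ζ ^ 2 : ℝ) + (-(r ^ 2 / D ζ ^ 2 : ℝ) + 2 * Complex.normSq (α ζ)) := by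
      simp only [Complex.ofReal_add]
      have c1 := contDiffAt_ofReal s1
      have c2 := contDiffAt_ofReal s2
      rw [dz_dzbar_add c1 (c1.add c2), dz_dzbar_add c1 c2, dz_dzbar_log_disc hDpos,
        dz_dzbar_log_normSq_velCo hA (hu' ζ) hα0]
    rw [h2] at h1
    have h3 : (-((r ^ 2 / D ζ ^ 2 : ℝ) : ℂ) + (-((r ^ 2 / D ζ ^ 2 : ℝ) : ℂ)
        + 2 * Complex.normSq (α ζ))).re = 2 * (Complex.normSq (α ζ) - r ^ 2 / D ζ ^ 2) := by
      have : (2 * (Complex.normSq (α ζ) : ℂ)).re = 2 * Complex.normSq (α ζ) := by simp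
      rw [Complex.add_re, Complex.add_re, this, Complex.neg_re, Complex.ofReal_re]
      ring
    rw [h3] at h1
    have h4 : Complex.normSq (α ζ) ≤ r ^ 2 / D ζ ^ 2 := by linarith
    rw [le_div_iff₀ (by positivity)] at h4
    have h5 : q c ≤ r ^ 2 := hqζ.trans (by simp only [hq]; linarith)
    simp only [hq, hDc] at h5
    have : 0 < r ^ 2 := by positivity
    nlinarith
  have hp : 0 < Complex.normSq (α c) := Complex.normSq_pos.2 hc
  have h6 := key (Real.sqrt (2 / Complex.normSq (α c))) (Real.sqrt_pos.2 (by positivity))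
  rw [Real.sq_sqrt (by positivity)] at h6
  have : 2 / Complex.normSq (α c) * Complex.normSq (α c) = 2 := div_mul_cancel₀ _ hp.ne'
  linarith

end CurvesInSurface

section InvariantForms

variable {X : Type*} [TopologicalSpace X] [ChartedSpace (Cn 2) X]
  {lam : ℝ} {A : X → Matrix (Fin 2) (Fin 2) ℂ} {B : Matrix (Fin 2) (Fin 2) ℂ}

/-- The real bilinear form with the matrix `B` in the coframe `A`, on vectors of the model space. -/
def frameForm (A : X → Matrix (Fin 2) (Fin 2) ℂ) (B : Matrix (Fin 2) (Fin 2) ℂ) (x : X)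
    (v w : Cn 2) : ℝ :=
  2 * (coframe A x v ⬝ᵥ (B *ᵥ star (coframe A x w))).re

lemma frameForm_smul_right (x : X) (c : ℂ) (v w : Cn 2) : frameForm A B x v (c • w) =
    2 * (conj c * (coframe A x v ⬝ᵥ (B *ᵥ star (coframe A x w)))).re := by
  rw [frameForm, coframe_smul, star_smul, mulVec_smul, dotProduct_smul, smul_eq_mul,
    starRingEnd_apply]

/-- `frameForm` as a bilinear map. -/
def frameFormL (A : X → Matrix (Fin 2) (Fin 2) ℂ) (B : Matrix (Fin 2) (Fin 2) ℂ) (x : X) :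
    Cn 2 →L[ℝ] Cn 2 →L[ℝ] ℝ :=
  LinearMap.toContinuousLinearMap
    ((LinearMap.toContinuousLinearMap (E := Cn 2) (F' := ℝ) (𝕜 := ℝ)).toLinearMap ∘ₗ
      LinearMap.mk₂ ℝ (frameForm A B x)
        (fun v v' w => by
          simp only [frameForm]; rw [coframe_add, add_dotProduct, Complex.add_re, mul_add])
        (fun c v w => by
          simp only [frameForm]
          rw [coframe_real_smul, smul_dotProduct, Complex.real_smul, Complex.re_ofReal_mul,
            smul_eq_mul]; ring)
        (fun v w w' => by
          simp only [frameForm]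
          rw [coframe_add, star_add, mulVec_add, dotProduct_add, Complex.add_re, mul_add])
        (fun c v w => by
          simp only [frameForm]
          rw [coframe_real_smul, star_smul, mulVec_smul, dotProduct_smul, star_trivial,
            Complex.real_smul, Complex.re_ofReal_mul, smul_eq_mul]; ring))

/-- The real bilinear form with the matrix `B` in the coframe `A`. -/
def invForm (A : X → Matrix (Fin 2) (Fin 2) ℂ) (B : Matrix (Fin 2) (Fin 2) ℂ) :
    BilinField 2 X := fun x => frameFormL A B x

lemma frameForm_symm (hB : B.IsHermitian) (x : X) (v w : Cn 2) :
    frameForm A B x v w = frameForm A B x w v := by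
  have e0 : star (B 0 0) = B 0 0 := hB.apply 0 0
  have e1 : star (B 1 1) = B 1 1 := hB.apply 1 1
  have e2 : star (B 0 1) = B 1 0 := hB.apply 1 0
  have f0 := congrArg Complex.im e0
  have f1 := congrArg Complex.im e1
  have f2 := congrArg Complex.im e2
  have f3 := congrArg Complex.re e2
  simp only [frameForm, dotProduct, mulVec, Fin.sum_univ_two, Pi.star_apply]
  simp at f0 f1 f2 f3 ⊢
  rw [← f2, ← f3, show (B 0 0).im = 0 by linarith, show (B 1 1).im = 0 by linarith]
  ring

lemma frameForm_I (x : X) (v w : Cn 2) :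
    frameForm A B x (Complex.I • v) (Complex.I • w) = frameForm A B x v w := by
  rw [frameForm, coframe_smul, coframe_smul, star_smul, mulVec_smul, dotProduct_smul,
    smul_dotProduct, smul_smul]
  simp [frameForm]

/-- `chartVec` with values in the model space. -/
def chartVecC {n : ℕ} {M : Type*} [TopologicalSpace M] [ChartedSpace (Cn n) M] (x₀ : M)
    (z v : Cn n) : Cn n := chartVec x₀ z v

lemma hcoeff_eq_of_apply {n : ℕ} {M : Type*} [TopologicalSpace M] [ChartedSpace (Cn n) M]
    (g : BilinField n M) (x₀ : M) (z : Cn n) (F : Cn n → Cn n → ℝ)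
    (hF : ∀ v w : Cn n, g ((chartAt (Cn n) x₀).symm z) v w = F v w) (i j : Fin n) :
    hcoeff g x₀ z i j = ((F (chartVecC x₀ z (stdVec i)) (chartVecC x₀ z (stdVec j)) : ℂ) +
      Complex.I * (F (chartVecC x₀ z (stdVec i)) (Complex.I • chartVecC x₀ z (stdVec j)) : ℂ)) / 2
    := by
  rw [← hF, ← hF]
  rfl

lemma hcoeff_invForm (x₀ : X) (z : Cn 2) :
    hcoeff (invForm A B) x₀ z = coMat A x₀ z * B * (coMat A x₀ z)ᴴ := by
  ext i j
  have e1 : ∀ i k, coMat A x₀ z i k =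
    coframe A ((chartAt (Cn 2) x₀).symm z) (chartVecC x₀ z (stdVec i)) k := fun _ _ => rfl
  have e2 : (coMat A x₀ z * B * (coMat A x₀ z)ᴴ) i j =
      coframe A ((chartAt (Cn 2) x₀).symm z) (chartVecC x₀ z (stdVec i)) ⬝ᵥ
        (B *ᵥ star (coframe A ((chartAt (Cn 2) x₀).symm z) (chartVecC x₀ z (stdVec j)))) := by
    simp only [Matrix.mul_apply, dotProduct, mulVec, Fin.sum_univ_two, Pi.star_apply, e1,
      conjTranspose_apply]
    ring
  rw [e2, hcoeff_eq_of_apply (invForm A B) x₀ z (frameForm A B _) (fun _ _ => rfl) i j,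
    frameForm_smul_right, frameForm]
  apply Complex.ext <;> simp

lemma contDiffAt_coMat (hA : IsInvariantCoframeOn lam A) {x₀ : X} {z : Cn 2}
    (hz : z ∈ (chartAt (Cn 2) x₀).target) (i j : Fin 2) :
    ContDiffAt ℝ ∞ (fun w => coMat A x₀ w i j) z :=
  (hA x₀ z hz).choose_spec.smooth i j

lemma isHermitianFormOn_invForm (hA : IsInvariantCoframeOn lam A) (hB : B.IsHermitian) (U : Set X) :
    IsHermitianFormOn (invForm A B) U where
  symm x _ v w := frameForm_symm hB x v w
  J_inv x _ v w := frameForm_I x v w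
  smooth x _ i j := by
    simp only [hcoeff_invForm, Matrix.mul_apply, Fin.sum_univ_two, conjTranspose_apply]
    have h := fun i j => contDiffAt_coMat hA (mem_chart_target (Cn 2) x) i j
    have h' : ∀ i j, ContDiffAt ℝ ∞ (fun w => star (coMat A x w i j)) (chartAt (Cn 2) x x) :=
      fun i j => Complex.conjCLE.contDiff.contDiffAt.comp _ (h i j)
    exact (((((h i 0).mul contDiffAt_const).add ((h i 1).mul contDiffAt_const)).mul (h' j 0)).add
      ((((h i 0).mul contDiffAt_const).add ((h i 1).mul contDiffAt_const)).mul (h' j 1)))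

lemma coframe_eq_zero {x : X} (hA : (A x).det ≠ 0) {v : Cn 2} (h : coframe A x v = 0) : v = 0 := by
  have h1 := Matrix.eq_zero_of_vecMul_eq_zero hA h
  ext k; exact congrFun h1 k

lemma isHermitian_hermMat (x y : ℝ) (z : ℂ) : (hermMat x y z).IsHermitian := by
  ext i j; fin_cases i <;> fin_cases j <;> simp [hermMat]

lemma frameForm_hermMat_self (x : X) (v : Cn 2) (a b : ℝ) (z : ℂ) :
    frameForm A (hermMat a b z) x v v = 2 * (a * Complex.normSq (coframe A x v 0) +
      b * Complex.normSq (coframe A x v 1) +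
      2 * (coframe A x v 0 * z * conj (coframe A x v 1)).re) := by
  simp [frameForm, dotProduct, mulVec, hermMat, Fin.sum_univ_two, Complex.normSq_apply]
  ring

lemma hermMat_form_identity (a b : ℝ) (z p q : ℂ) :
    b * (a * Complex.normSq p + b * Complex.normSq q + 2 * (p * z * conj q).re) =
      (a * b - Complex.normSq z) * Complex.normSq p + Complex.normSq (p * z + b * q) := by
  simp [Complex.normSq_apply]
  ring

lemma isHermitianMetricOn_invForm (hA : IsInvariantCoframeOn lam A) (hd : ∀ x, (A x).det ≠ 0)
    {a b : ℝ} {z : ℂ} (hb : 0 < b) (hab : 0 < a * b - Complex.normSq z) (U : Set X) :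
    IsHermitianMetricOn (invForm A (hermMat a b z)) U where
  toIsHermitianFormOn := isHermitianFormOn_invForm hA (isHermitian_hermMat a b z) U
  pos x _ v hv := by
    have h1 : invForm A (hermMat a b z) x v v = _ := frameForm_hermMat_self (A := A) x v a b z
    have h2 := hermMat_form_identity a b z (coframe A x v 0) (coframe A x v 1)
    refine h1.symm ▸ mul_pos two_pos (pos_of_mul_pos_right (a := b) ?_ hb.le)
    rw [h2]
    by_cases h0 : coframe A x v 0 = 0
    · have h3 : coframe A x v 1 ≠ 0 := fun h3 => hv (coframe_eq_zero (hd x) (by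
        ext k; fin_cases k; exacts [h0, h3]))
      rw [h0]
      have := Complex.normSq_pos.2 (mul_ne_zero (Complex.ofReal_ne_zero.2 hb.ne') h3)
      simpa using this
    · exact add_pos_of_pos_of_nonneg (mul_pos hab (Complex.normSq_pos.2 h0))
        (Complex.normSq_nonneg _)

end InvariantForms

section HomogeneousForms

variable {G : Type*} [TopologicalSpace G] [Group G] [ChartedSpace (EuclideanSpace ℝ (Fin 4)) G]
  [LieGroup (𝓡 4) ∞ G] {φ : GroupLieAlgebra (𝓡 4) G ≃ₗ[ℝ] SL2R}
  {X : Type*} [TopologicalSpace X] [ChartedSpace (Cn 2) X]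
  {lam : ℝ} {Γ : Subgroup G} {P : G → X}

lemma bilin_expand {n : ℕ} (f : Cn n →L[ℝ] Cn n →L[ℝ] ℝ)
    (hJ : ∀ v w, f (Complex.I • v) (Complex.I • w) = f v w) (c d : ℂ) (v w : Cn n) :
    f (c • v) (d • w) = 2 * (c * conj d * (((f v w : ℂ) + Complex.I * f v (Complex.I • w)) / 2)).re
    := by
  have e : ∀ (c : ℂ) (v : Cn n), c • v = c.re • v + c.im • (Complex.I • v) := fun c v => by
    ext k
    simp only [PiLp.add_apply, PiLp.smul_apply, smul_eq_mul, Complex.real_smul]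
    linear_combination -(v k) * Complex.re_add_im c
  have h1 : f (Complex.I • v) w = -f v (Complex.I • w) := by
    rw [← hJ v, smul_smul, Complex.I_mul_I, neg_one_smul, map_neg, neg_neg]
  conv_lhs => rw [e c v, e d w]
  simp only [map_add, map_smul, _root_.add_apply, _root_.smul_apply, smul_eq_mul, hJ, h1]
  simp
  ring

lemma frameForm_pushC (hP : IsQuotientModel lam φ Γ P) (a : G) (B : Matrix (Fin 2) (Fin 2) ℂ)
    (v w : GroupLieAlgebra (𝓡 4) G) :
    frameForm hP.coframeMat B (P a) (pushC P v a) (pushC P w a) =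
      2 * (slCoord lam (φ v) ⬝ᵥ (B *ᵥ star (slCoord lam (φ w)))).re := by
  have h : ∀ v, coframe hP.coframeMat (P a) (pushC P v a) = slCoord lam (φ v) :=
    hP.coframe_pushVec a
  rw [frameForm, h, h]

lemma isLocallyHomogeneous_invForm (hP : IsQuotientModel lam φ Γ P)
    (B : Matrix (Fin 2) (Fin 2) ℂ) : IsLocallyHomogeneous P (invForm hP.coframeMat B) :=
  fun v w a b => (frameForm_pushC hP a B v w).trans (frameForm_pushC hP b B v w).symm

lemma pushC_surjective (hP : IsQuotientModel lam φ Γ P) (a : G) (v : Cn 2) :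
    ∃ v', pushC P v' a = v := by
  obtain ⟨s, hs⟩ := slCoord_surjective lam (coframe hP.coframeMat (P a) v)
  refine ⟨φ.symm s, ?_⟩
  have h : coframe hP.coframeMat (P a) (pushC P (φ.symm s) a) = _ := hP.coframe_pushVec a _
  rw [LinearEquiv.apply_symm_apply, hs] at h
  refine sub_eq_zero.1 (coframe_eq_zero (hP.det_coframeMat_ne_zero (P a)) ?_)
  rw [sub_eq_add_neg, ← neg_one_smul ℂ, coframe_add, coframe_smul, h]
  simp

/-- A locally homogeneous Hermitian metric has constant coefficients in the frame. -/
theorem IsLocallyHomogeneous.exists_eq_invForm (hP : IsQuotientModel lam φ Γ P)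
    {g : BilinField 2 X} (hg : IsHermitianMetricOn g univ) (h : IsLocallyHomogeneous P g) :
    ∃ (x y : ℝ) (z : ℂ), 0 < y ∧ 0 < x * y - Complex.normSq z ∧
      g = invForm hP.coframeMat (hermMat x y z) := by
  let f : X → Cn 2 →L[ℝ] Cn 2 →L[ℝ] ℝ := g
  have hJ : ∀ x v w, f x (Complex.I • v) (Complex.I • w) = f x v w :=
    fun x v w => hg.J_inv x trivial v w
  have hs : ∀ x v w, f x v w = f x w v := fun x v w => hg.symm x trivial v w
  have hpos : ∀ x v, v ≠ 0 → 0 < f x v v := fun x v hv => hg.pos x trivial v hv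
  have hh : ∀ v w a b, f (P a) (pushC P v a) (pushC P w a) = f (P b) (pushC P v b) (pushC P w b) :=
    h
  let e : Fin 2 → GroupLieAlgebra (𝓡 4) G := ![φ.symm slH, φ.symm (slR - lam • slT)]
  let e' : Fin 2 → GroupLieAlgebra (𝓡 4) G := ![φ.symm slP, φ.symm slT]
  have he' : ∀ i a, pushC P (e' i) a = Complex.I • pushC P (e i) a := by
    intro i a
    fin_cases i
    · exact (hP.J_H a).symm
    · exact (hP.J_R a).symm
  let b : Fin 2 → Fin 2 → G → ℂ := fun i j a => ((f (P a) (pushC P (e i) a) (pushC P (e j) a) : ℂ) +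
    Complex.I * f (P a) (pushC P (e i) a) (Complex.I • pushC P (e j) a)) / 2
  have hb : ∀ i j a, b i j a = b i j 1 := fun i j a => by
    simp only [b, ← he']
    rw [hh _ _ a 1, hh _ _ a 1]
  have hIs : ∀ x v w, f x v (Complex.I • w) = -f x w (Complex.I • v) := fun x v w => by
    rw [← hJ x v, smul_smul, Complex.I_mul_I, neg_one_smul, map_neg, hs]
  have hbs : ∀ i j, conj (b i j 1) = b j i 1 := fun i j => by
    have h2 := hIs (P 1) (pushC P (e j) 1) (pushC P (e i) 1)
    simp only [b]
    rw [hs (P 1) (pushC P (e j) 1), h2]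
    apply Complex.ext <;> simp [Complex.conj_ofNat]
  have hform : g = invForm hP.coframeMat (hermMat (b 0 0 1).re (b 1 1 1).re (b 0 1 1)) := by
    have him : ∀ i, ((b i i 1).re : ℂ) = b i i 1 := fun i => Complex.conj_eq_iff_re.1 (hbs i i)
    funext x
    obtain ⟨a, rfl⟩ := hP.surj x
    show f (P a) = frameFormL _ _ _
    refine ContinuousLinearMap.ext fun v => ContinuousLinearMap.ext fun w => ?_
    obtain ⟨v, rfl⟩ := pushC_surjective hP a v
    obtain ⟨w, rfl⟩ := pushC_surjective hP a w
    refine Eq.trans ?_ (frameForm_pushC hP a _ v w).symm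
    rw [hP.pushVec_eq a v, hP.pushVec_eq a w]
    have key : ∀ i j (c d : ℂ), f (P a) (c • pushC P (e i) a) (d • pushC P (e j) a) =
        2 * (c * conj d * b i j 1).re := fun i j c d => by
      rw [bilin_expand _ (hJ _), ← hb i j a]
    have k00 := key 0 0
    have k01 := key 0 1
    have k10 := key 1 0
    have k11 := key 1 1
    simp only [e, Matrix.cons_val_zero, Matrix.cons_val_one] at k00 k01 k10 k11
    simp only [map_add, _root_.add_apply, k00, k01, k10, k11]
    simp only [hermMat, him, hbs, dotProduct, mulVec, Fin.sum_univ_two, Pi.star_apply,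
      RCLike.star_def]
    simp only [Matrix.of_apply, Matrix.cons_val_zero, Matrix.cons_val_one, Matrix.cons_val',
      Matrix.cons_val_fin_one]
    simp only [← mul_add, ← Complex.add_re]
    congr 2
    ring
  have hne : ∀ c : Fin 2 → ℂ, c ≠ 0 →
      0 < 2 * ((b 0 0 1).re * Complex.normSq (c 0) + (b 1 1 1).re * Complex.normSq (c 1) +
        2 * (c 0 * (b 0 1 1) * conj (c 1)).re) := by
    intro c hc
    obtain ⟨s, rfl⟩ := slCoord_surjective lam c
    have h1 : coframe hP.coframeMat (P 1) (pushC P (φ.symm s) 1) = _ := hP.coframe_pushVec 1 _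
    rw [LinearEquiv.apply_symm_apply] at h1
    rw [← h1, ← frameForm_hermMat_self]
    have h2 := hpos (P 1) (pushC P (φ.symm s) 1) (fun h0 => hc (by
      rw [← h1, h0]; exact Matrix.zero_vecMul _))
    rwa [show f = _ from hform] at h2
  have hy : 0 < (b 1 1 1).re := by simpa using hne ![0, 1] (by intro h; simpa using congrFun h 1)
  refine ⟨_, _, _, hy, ?_, hform⟩
  have h3 := hne ![(b 1 1 1).re, -(b 0 1 1)] (by
    intro h; exact hy.ne' (by simpa using congrFun h 0))
  have h4 := hermMat_form_identity (b 0 0 1).re (b 1 1 1).re (b 0 1 1) (b 1 1 1).re (-(b 0 1 1))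
  simp only [Matrix.cons_val_zero, Matrix.cons_val_one] at h3
  have h5 := mul_pos hy (pos_of_mul_pos_right h3 two_pos.le)
  rw [h4, show ((b 1 1 1).re : ℂ) * b 0 1 1 + ((b 1 1 1).re : ℂ) * -b 0 1 1 = 0 by ring] at h5
  simp only [map_zero, add_zero] at h5
  exact pos_of_mul_pos_left h5 (Complex.normSq_nonneg _)

end HomogeneousForms

section FlowSolutions

variable {G : Type*} [TopologicalSpace G] [Group G] [ChartedSpace (EuclideanSpace ℝ (Fin 4)) G]
  [LieGroup (𝓡 4) ∞ G] {φ : GroupLieAlgebra (𝓡 4) G ≃ₗ[ℝ] SL2R}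
  {X : Type*} [TopologicalSpace X] [ChartedSpace (Cn 2) X] [IsManifold 𝓘(ℂ, Cn 2) ω X]
  {lam : ℝ} {Γ : Subgroup G} {P : G → X} {A : X → Matrix (Fin 2) (Fin 2) ℂ}

lemma det_coMat_ne_zero (hA : IsInvariantCoframeOn lam A) {x₀ : X} {z : Cn 2}
    (hz : z ∈ (chartAt (Cn 2) x₀).target) : (coMat A x₀ z).det ≠ 0 := by
  obtain ⟨Ξ, hΞ⟩ := hA x₀ z hz
  intro h
  have := congrArg Matrix.det hΞ.inv.self_of_nhds
  simp [h] at this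

lemma hcfK_invForm (hA : IsInvariantCoframeOn lam A) {B : Matrix (Fin 2) (Fin 2) ℂ}
    (hB : B.det ≠ 0) (x : X) (i j : Fin 2) :
    hcfK (invForm A B) x i j (chartAt (Cn 2) x x) = (coMat A x (chartAt (Cn 2) x x) *
      frameK lam B * (coMat A x (chartAt (Cn 2) x x))ᴴ) i j := by
  obtain ⟨Ξ, hΞ⟩ := hA x _ (mem_chart_target (Cn 2) x)
  exact hcfK_frame hΞ hB (Eventually.of_forall fun z => hcoeff_invForm x z) i j

lemma det_hermMat (x y : ℝ) (z : ℂ) :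
    (hermMat x y z).det = ((x * y - Complex.normSq z : ℝ) : ℂ) := by
  simp [hermMat, Matrix.det_fin_two, Complex.mul_conj]

lemma hasDerivWithinAt_mul_mat {L R : Matrix (Fin 2) (Fin 2) ℂ} {F : ℝ → Matrix (Fin 2) (Fin 2) ℂ}
    {F' : Matrix (Fin 2) (Fin 2) ℂ} {s : Set ℝ} {t : ℝ}
    (h : ∀ i j, HasDerivWithinAt (fun t => F t i j) (F' i j) s t) (i j : Fin 2) :
    HasDerivWithinAt (fun t => (L * F t * R) i j) ((L * F' * R) i j) s t := by
  simp only [Matrix.mul_apply, Fin.sum_univ_two]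
  exact ((((h 0 0).const_mul _).add ((h 1 0).const_mul _)).mul_const _).add
    ((((h 0 1).const_mul _).add ((h 1 1).const_mul _)).mul_const _)

lemma neg_hermMat (x y : ℝ) (z : ℂ) : -hermMat x y z = hermMat (-x) (-y) (-z) := by
  ext i j; fin_cases i <;> fin_cases j <;> simp [hermMat]

lemma hasDerivWithinAt_hermMat {x y : ℝ → ℝ} {z : ℝ → ℂ} {x' y' : ℝ} {z' : ℂ} {s : Set ℝ} {t : ℝ} :
    (∀ i j, HasDerivWithinAt (fun t => hermMat (x t) (y t) (z t) i j) (hermMat x' y' z' i j) s t) ↔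
      HasDerivWithinAt x x' s t ∧ HasDerivWithinAt y y' s t ∧ HasDerivWithinAt z z' s t := by
  have hre : ∀ {f : ℝ → ℝ} {f' : ℝ}, HasDerivWithinAt (fun s => (f s : ℂ)) (f' : ℂ) s t →
      HasDerivWithinAt f f' s t := fun {f f'} hf => by
    have := Complex.reCLM.hasFDerivAt.comp_hasDerivWithinAt t hf
    simpa [Function.comp_def] using this
  refine ⟨fun h => ⟨hre (h 0 0), hre (h 1 1), h 0 1⟩, fun ⟨h1, h2, h3⟩ i j => ?_⟩
  fin_cases i <;> fin_cases j
  exacts [h1.ofReal_comp, h3, h3.star, h2.ofReal_comp]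

lemma isHCFSolution_invForm (hA : IsInvariantCoframeOn lam A) (hd : ∀ x, (A x).det ≠ 0)
    {x y : ℝ → ℝ} {z : ℝ → ℂ} (h : IsFlowSolution (1 + lam ^ 2) x y z) :
    IsHCFSolution fun t => invForm A (hermMat (x t) (y t) (z t)) where
  metric t ht := isHermitianMetricOn_invForm hA hd (h.pos_y t ht) (h.pos_det t ht) univ
  flow t ht p i j := by
    have hdet := (h.pos_det t ht).ne'
    rw [hcfK_invForm hA (by rw [det_hermMat]; exact_mod_cast hdet), frameK_hermMat _ _ _ _ hdet]
    simp only [hcoeff_invForm]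
    rw [← Matrix.neg_apply, ← Matrix.neg_mul, ← Matrix.mul_neg]
    rw [neg_hermMat]
    refine hasDerivWithinAt_mul_mat (hasDerivWithinAt_hermMat.2 ⟨?_, ?_, ?_⟩) i j
    · convert h.hx t ht using 1
      ring
    · exact h.hy t ht
    · exact h.hz t ht

theorem IsQuotientModel.exists_isLocallyHomogeneousHCF (hP : IsQuotientModel lam φ Γ P)
    (hφ : ∀ v w, φ ⁅v, w⁆ = slBracket (φ v) (φ w)) {g₀ : BilinField 2 X}
    (hg₀ : IsHermitianMetricOn g₀ univ) (h : IsLocallyHomogeneous P g₀) :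
    ∃ g, IsLocallyHomogeneousHCF P g₀ g := by
  obtain ⟨x₀, y₀, z₀, hy, hd, rfl⟩ := h.exists_eq_invForm hP hg₀
  obtain ⟨x, y, z, hs, rfl, rfl, rfl⟩ := exists_isFlowSolution (c := 1 + lam ^ 2)
    (le_add_of_nonneg_right (sq_nonneg lam)) hy hd
  exact ⟨_, isHCFSolution_invForm (hP.isInvariantCoframeOn hφ) hP.det_coframeMat_ne_zero hs,
    fun t _ => isLocallyHomogeneous_invForm hP _, rfl⟩

theorem IsQuotientModel.exists_isFlowSolution (hP : IsQuotientModel lam φ Γ P)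
    (hφ : ∀ v w, φ ⁅v, w⁆ = slBracket (φ v) (φ w)) {g₀ : BilinField 2 X}
    {g : ℝ → BilinField 2 X} (h : IsLocallyHomogeneousHCF P g₀ g) :
    ∃ x y z, IsFlowSolution (1 + lam ^ 2) x y z ∧
      ∀ t, 0 ≤ t → g t = invForm hP.coframeMat (hermMat (x t) (y t) (z t)) := by
  have hA := hP.isInvariantCoframeOn hφ
  have hex : ∀ t, ∃ (x y : ℝ) (z : ℂ), 0 ≤ t → 0 < y ∧ 0 < x * y - Complex.normSq z ∧
      g t = invForm hP.coframeMat (hermMat x y z) := fun t => by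
    by_cases ht : 0 ≤ t
    · obtain ⟨x, y, z, hxyz⟩ := (h.2.1 t ht).exists_eq_invForm hP (h.1.metric t ht)
      exact ⟨x, y, z, fun _ => hxyz⟩
    · exact ⟨0, 0, 0, fun h => absurd h ht⟩
  choose x y z hxyz using hex
  refine ⟨x, y, z, ?_, fun t ht => (hxyz t ht).2.2⟩
  obtain ⟨p⟩ : Nonempty X := ⟨P 1⟩
  set a := coMat hP.coframeMat p (chartAt (Cn 2) p p) with ha
  have hau : IsUnit a.det := isUnit_iff_ne_zero.2 (det_coMat_ne_zero hA (mem_chart_target (Cn 2) p))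
  have hau' : IsUnit aᴴ.det := by rw [Matrix.det_conjTranspose]; exact hau.star
  have hder : ∀ t, 0 ≤ t → ∀ i j, HasDerivWithinAt (fun s => hermMat (x s) (y s) (z s) i j)
      (-frameK lam (hermMat (x t) (y t) (z t)) i j) (Ici 0) t := by
    intro t ht i j
    have h1 : ∀ i j, HasDerivWithinAt (fun s => hcoeff (g s) p (chartAt (Cn 2) p p) i j)
        ((-(a * frameK lam (hermMat (x t) (y t) (z t)) * aᴴ)) i j) (Ici 0) t := fun i j => by
      have := h.1.flow t ht p i j
      rwa [(hxyz t ht).2.2, hcfK_invForm hA (by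
        rw [det_hermMat]; exact_mod_cast (hxyz t ht).2.1.ne')] at this
    have h2 := hasDerivWithinAt_mul_mat (L := a⁻¹) (R := aᴴ⁻¹)
      (F := fun s => hcoeff (g s) p (chartAt (Cn 2) p p)) h1 i j
    have e : ∀ M : Matrix (Fin 2) (Fin 2) ℂ, a⁻¹ * (a * M * aᴴ) * aᴴ⁻¹ = M := fun M => by
      rw [Matrix.mul_assoc a, Matrix.nonsing_inv_mul_cancel_left _ _ hau,
        Matrix.mul_nonsing_inv_cancel_right _ _ hau']
    rw [Matrix.mul_neg, Matrix.neg_mul, e] at h2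
    refine h2.congr (fun s hs => ?_) ?_
    · show _ = (a⁻¹ * hcoeff (g s) p (chartAt (Cn 2) p p) * aᴴ⁻¹) i j
      rw [(hxyz s hs).2.2, hcoeff_invForm, e]
    · show _ = (a⁻¹ * hcoeff (g t) p (chartAt (Cn 2) p p) * aᴴ⁻¹) i j
      rw [(hxyz t ht).2.2, hcoeff_invForm, e]
  have hder' := fun (t : ℝ) (ht : 0 ≤ t) => hasDerivWithinAt_hermMat.1 fun i j => by
    have := hder t ht i j
    rw [frameK_hermMat _ _ _ _ (hxyz t ht).2.1.ne', ← Matrix.neg_apply, neg_hermMat] at this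
    exact this
  refine ⟨fun t ht => (hxyz t ht).1, fun t ht => (hxyz t ht).2.1, fun t ht => ?_,
    fun t ht => (hder' t ht).2.1, fun t ht => (hder' t ht).2.2⟩
  convert (hder' t ht).1 using 1
  ring

end FlowSolutions

section Sard

open scoped NNReal

variable {F : Type*} [NormedAddCommGroup F] [NormedSpace ℂ F]

lemma holderOnWith_of_dist_le {X Y : Type*} [PseudoMetricSpace X] [PseudoMetricSpace Y] {f : X → Y}
    {C : ℝ≥0} {n : ℕ} {s : Set X} (h : ∀ x ∈ s, ∀ y ∈ s, dist (f x) (f y) ≤ C * dist x y ^ n) :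
    HolderOnWith C n f s := by
  intro x hx y hy
  rw [edist_dist, edist_dist]
  refine (ENNReal.ofReal_le_ofReal (h x hx y hy)).trans_eq ?_
  rw [ENNReal.ofReal_mul (NNReal.coe_nonneg C), ENNReal.ofReal_pow dist_nonneg,
    ENNReal.ofReal_coe_nnreal]
  simp

lemma norm_image_sub_le_pow {E : Type*} [NormedAddCommGroup E] [NormedSpace ℂ E] [NormedSpace ℝ E]
    [IsScalarTower ℝ ℂ E] {g : E → F} {s : Set E} {x : E} {C : ℝ} {n : ℕ} (hs : Convex ℝ s)
    (hx : x ∈ s) (hC : 0 ≤ C) (hg : ∀ y ∈ s, DifferentiableAt ℂ g y)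
    (h : ∀ y ∈ s, ‖fderiv ℂ g y‖ ≤ C * ‖y - x‖ ^ n) {y : E} (hy : y ∈ s) :
    ‖g y - g x‖ ≤ C * ‖y - x‖ ^ (n + 1) := by
  have h1 : Convex ℝ (s ∩ Metric.closedBall x ‖y - x‖) := hs.inter (convex_closedBall _ _)
  have h2 := h1.norm_image_sub_le_of_norm_fderiv_le (𝕜 := ℂ) (f := g) (C := C * ‖y - x‖ ^ n)
    (fun z hz => hg z hz.1) (fun z hz => (h z hz.1).trans (by
      have := hz.2
      rw [Metric.mem_closedBall, dist_eq_norm] at this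
      gcongr)) ⟨hx, Metric.mem_closedBall_self (norm_nonneg _)⟩
      ⟨hy, by rw [Metric.mem_closedBall, dist_eq_norm]⟩
  rwa [mul_assoc, ← pow_succ] at h2

lemma exists_ball_contDiffAt {f : Cn 2 → F} {n : ℕ} {a : Cn 2} (hf : ContDiffAt ℂ ∞ f a) :
    ∃ r > 0, (∀ y ∈ Metric.ball a r, ContDiffAt ℂ n f y) := by
  have : ContDiffAt ℂ n f a := hf.of_le (by exact_mod_cast le_top)
  have h := this.eventually (by simp)
  exact Metric.eventually_nhds_iff_ball.1 h

theorem dimH_image_degenerate_le {f : Cn 2 → F} {U : Set (Cn 2)}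
    (hf : ∀ x ∈ U, ContDiffAt ℂ ∞ f x) :
    dimH (f '' {x ∈ U | fderiv ℂ f x = 0 ∧ fderiv ℂ (fderiv ℂ f) x = 0}) ≤ 4 / 3 := by
  have hfin : dimH {x ∈ U | fderiv ℂ f x = 0 ∧ fderiv ℂ (fderiv ℂ f) x = 0} ≤ 4 := by
    refine (dimH_mono (subset_univ _)).trans ?_
    rw [Real.dimH_univ_eq_finrank]
    simp [finrank_real_of_complex]
  refine (dimH_image_le_of_locally_holder_on (r := 3) (by norm_num) fun a ha => ?_).trans
    (ENNReal.div_le_div_right hfin _)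
  have hfa := hf a ha.1
  obtain ⟨r₁, hr₁, h₁⟩ := exists_ball_contDiffAt (n := 3) hfa
  have h3 : ContDiffAt ℂ 1 (fderiv ℂ (fderiv ℂ f)) a :=
    ((hfa.fderiv_right (m := ∞) le_rfl).fderiv_right (m := ∞) le_rfl).of_le
      (by exact_mod_cast le_top)
  obtain ⟨C, t, ht, hC⟩ := h3.exists_lipschitzOnWith
  obtain ⟨r₂, hr₂, h₂⟩ := Metric.mem_nhds_iff.1 ht
  set s := Metric.ball a (min r₁ r₂) with hs
  have hconv : Convex ℝ s := convex_ball _ _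
  have hs1 : ∀ y ∈ s, ContDiffAt ℂ 3 f y := fun y hy =>
    h₁ y (Metric.ball_subset_ball (min_le_left _ _) hy)
  have hd1 : ∀ y ∈ s, ContDiffAt ℂ 2 (fderiv ℂ f) y := fun y hy =>
    (hs1 y hy).fderiv_right (by norm_num)
  refine ⟨C, _, inter_mem_nhdsWithin _ (Metric.ball_mem_nhds a (lt_min hr₁ hr₂)), ?_⟩
  refine holderOnWith_of_dist_le (n := 3) fun x hx y hy => ?_
  have hxs : x ∈ s := hx.2
  have e2 : ∀ y ∈ s, ‖fderiv ℂ (fderiv ℂ f) y‖ ≤ C * ‖y - x‖ ^ 1 := fun y hy => by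
    have := hC.norm_sub_le (h₂ (Metric.ball_subset_ball (min_le_right _ _) hy))
      (h₂ (Metric.ball_subset_ball (min_le_right _ _) hxs))
    rwa [hx.1.2.2, sub_zero, ← pow_one ‖y - x‖] at this
  have e1 : ∀ y ∈ s, ‖fderiv ℂ f y‖ ≤ C * ‖y - x‖ ^ 2 := fun y hy => by
    have := norm_image_sub_le_pow (n := 1) hconv hxs C.2
      (fun y hy => (hd1 y hy).differentiableAt (by norm_num)) e2 hy
    rwa [hx.1.2.1, sub_zero] at this
  have e0 := norm_image_sub_le_pow (n := 2) hconv hxs C.2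
    (fun y hy => (hs1 y hy).differentiableAt (by norm_num)) e1 hy.2
  rw [dist_comm, dist_eq_norm, dist_comm, dist_eq_norm]
  exact e0

/-- A map with injective strict derivative is locally antilipschitz. -/
lemma HasStrictFDerivAt.exists_norm_sub_le {E G : Type*} [NormedAddCommGroup E] [NormedSpace ℂ E]
    [FiniteDimensional ℂ E] [NormedAddCommGroup G] [NormedSpace ℂ G] {Φ : E → G} {Φ' : E →L[ℂ] G}
    {a : E} (h : HasStrictFDerivAt Φ Φ' a) (hinj : Function.Injective Φ') :
    ∃ K : ℝ≥0, ∃ s ∈ 𝓝 a, ∀ x ∈ s, ∀ y ∈ s, ‖x - y‖ ≤ K * ‖Φ x - Φ y‖ := by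
  obtain ⟨K, hK, hK'⟩ := Φ'.toLinearMap.exists_antilipschitzWith (LinearMap.ker_eq_bot.2 hinj)
  have hc : 0 < K⁻¹ / 2 := half_pos (inv_pos.2 hK)
  obtain ⟨s, hs, hs'⟩ := h.approximates_deriv_on_nhds (Or.inr hc)
  refine ⟨2 * K, s, hs, fun x hx y hy => ?_⟩
  have h1 : ‖Φ x - Φ y - Φ' (x - y)‖ ≤ ((K⁻¹ / 2 : ℝ≥0) : ℝ) * ‖x - y‖ := hs' x hx y hy
  have h2 : ‖x - y‖ ≤ K * ‖Φ' (x - y)‖ := by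
    have := hK'.le_mul_dist x y
    rwa [dist_eq_norm, dist_eq_norm, ← map_sub] at this
  have h3 : ‖Φ' (x - y)‖ ≤ ‖Φ x - Φ y‖ + ((K⁻¹ / 2 : ℝ≥0) : ℝ) * ‖x - y‖ := by
    have := norm_sub_norm_le (Φ' (x - y)) (Φ x - Φ y)
    rw [norm_sub_rev (Φ' (x - y))] at this
    linarith
  have hK0 : (0 : ℝ) < K := hK
  have h4 : (K : ℝ) * (((K⁻¹ / 2 : ℝ≥0) : ℝ) * ‖x - y‖) = ‖x - y‖ / 2 := by
    push_cast; field_simp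
  have h5 := mul_le_mul_of_nonneg_left h3 hK0.le
  rw [mul_add, h4] at h5
  push_cast
  linarith

theorem dimH_nondegenerate_le {f : Cn 2 → F} {U : Set (Cn 2)}
    (hf : ∀ x ∈ U, ContDiffAt ℂ ∞ f x) :
    dimH {x ∈ U | fderiv ℂ f x = 0 ∧ fderiv ℂ (fderiv ℂ f) x ≠ 0} ≤ 2 := by
  by_contra hlt
  obtain ⟨a, ha, hdim⟩ := exists_mem_nhdsWithin_lt_dimH_of_lt_dimH (not_le.1 hlt)
  have hstr : HasStrictFDerivAt (fderiv ℂ f) (fderiv ℂ (fderiv ℂ f) a) a :=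
    ((hf a ha.1).fderiv_right (m := ∞) le_rfl).hasStrictFDerivAt (by simp)
  obtain ⟨i, hi⟩ : ∃ i, fderiv ℂ (fderiv ℂ f) a (stdVec i) ≠ 0 := by
    by_contra h
    push Not at h
    refine ha.2.2 (ContinuousLinearMap.ext fun v => ?_)
    conv_lhs => rw [← sum_smul_stdVec v]
    simp [h]
  obtain ⟨j, hij, hj⟩ : ∃ j : Fin 2, i ≠ j ∧ ∀ k, k = i ∨ k = j := by
    fin_cases i
    · exact ⟨1, by decide, by decide⟩
    · exact ⟨0, by decide, by decide⟩
  let q : Cn 2 →L[ℂ] ℂ := EuclideanSpace.proj j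
  have hinj : Function.Injective ((fderiv ℂ (fderiv ℂ f) a).prod q) := by
    rw [injective_iff_map_eq_zero]
    intro v hv
    have h1 : fderiv ℂ (fderiv ℂ f) a v = 0 := congrArg Prod.fst hv
    have h2 : v j = 0 := congrArg Prod.snd hv
    have h3 : v = v i • stdVec i := by
      ext k
      rcases hj k with rfl | rfl
      · simp [stdVec]
      · simp [stdVec, h2, hij.symm]
    rw [h3, map_smul, smul_eq_zero_iff_left hi] at h1
    rw [h3, h1, zero_smul]
  obtain ⟨K, s, hs, hK⟩ := (hstr.prodMk q.hasStrictFDerivAt).exists_norm_sub_le hinj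
  set Z := {x ∈ U | fderiv ℂ f x = 0 ∧ fderiv ℂ (fderiv ℂ f) x ≠ 0} with hZ
  have hanti : ∀ x ∈ Z ∩ s, ∀ y ∈ Z ∩ s, ‖x - y‖ ≤ K * ‖q x - q y‖ := fun x hx y hy => by
    refine (hK x hx.2 y hy.2).trans_eq ?_
    rw [Prod.mk_sub_mk, hx.1.2.1, hy.1.2.1, sub_self, Prod.norm_mk, norm_zero,
      max_eq_right (norm_nonneg _)]
  have hq : InjOn q (Z ∩ s) := fun x hx y hy h => by
    have := hanti x hx y hy
    rw [h, sub_self, norm_zero, mul_zero] at this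
    exact sub_eq_zero.1 (norm_le_zero_iff.1 this)
  have hlip : LipschitzOnWith K (Function.invFunOn q (Z ∩ s)) (q '' (Z ∩ s)) := by
    refine LipschitzOnWith.of_dist_le_mul ?_
    rintro _ ⟨x, hx, rfl⟩ _ ⟨y, hy, rfl⟩
    rw [hq.leftInvOn_invFunOn hx, hq.leftInvOn_invFunOn hy, dist_eq_norm, dist_eq_norm]
    exact hanti x hx y hy
  have h1 := hlip.dimH_image_le
  rw [hq.leftInvOn_invFunOn.image_image] at h1
  refine absurd (hdim _ (inter_mem_nhdsWithin _ hs)) (not_lt.2 (h1.trans ?_))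
  refine (dimH_mono (subset_univ _)).trans ?_
  rw [Real.dimH_univ_eq_finrank]
  simp

/-- Sard's theorem for holomorphic functions of two variables. -/
theorem dimH_image_critical_le {f : Cn 2 → F} {U : Set (Cn 2)}
    (hf : ∀ x ∈ U, ContDiffAt ℂ ∞ f x) : dimH (f '' {x ∈ U | fderiv ℂ f x = 0}) ≤ 4 / 3 := by
  have hun : {x ∈ U | fderiv ℂ f x = 0} =
      {x ∈ U | fderiv ℂ f x = 0 ∧ fderiv ℂ (fderiv ℂ f) x = 0} ∪
      {x ∈ U | fderiv ℂ f x = 0 ∧ fderiv ℂ (fderiv ℂ f) x ≠ 0} := by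
    ext x; simp only [mem_ofPred_eq, mem_union]; tauto
  rw [hun, image_union, dimH_union]
  refine max_le (dimH_image_degenerate_le hf) ?_
  refine (dimH_image_le_of_locally_holder_on (r := 2) (by norm_num) fun a ha => ?_).trans
    ((ENNReal.div_le_div_right (dimH_nondegenerate_le hf) _).trans ?_)
  · have hfa := hf a ha.1
    obtain ⟨r₁, hr₁, h₁⟩ := exists_ball_contDiffAt (n := 2) hfa
    have h2 : ContDiffAt ℂ 1 (fderiv ℂ f) a :=
      (hfa.fderiv_right (m := ∞) le_rfl).of_le (by exact_mod_cast le_top)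
    obtain ⟨C, t, ht, hC⟩ := h2.exists_lipschitzOnWith
    obtain ⟨r₂, hr₂, h₂⟩ := Metric.mem_nhds_iff.1 ht
    set s := Metric.ball a (min r₁ r₂) with hs
    have hconv : Convex ℝ s := convex_ball _ _
    have hs1 : ∀ y ∈ s, ContDiffAt ℂ 2 f y := fun y hy =>
      h₁ y (Metric.ball_subset_ball (min_le_left _ _) hy)
    refine ⟨C, _, inter_mem_nhdsWithin _ (Metric.ball_mem_nhds a (lt_min hr₁ hr₂)), ?_⟩
    refine holderOnWith_of_dist_le (n := 2) fun x hx y hy => ?_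
    have e1 : ∀ y ∈ s, ‖fderiv ℂ f y‖ ≤ C * ‖y - x‖ ^ 1 := fun y hy => by
      have := hC.norm_sub_le (h₂ (Metric.ball_subset_ball (min_le_right _ _) hy))
        (h₂ (Metric.ball_subset_ball (min_le_right _ _) hx.2))
      rwa [hx.1.2.1, sub_zero, ← pow_one ‖y - x‖] at this
    have e0 := norm_image_sub_le_pow (n := 1) hconv hx.2 C.2
      (fun y hy => (hs1 y hy).differentiableAt (by norm_num)) e1 hy.2
    rw [dist_comm, dist_eq_norm, dist_comm, dist_eq_norm]
    exact e0
  · rw [show ((2 : ℝ≥0) : ℝ≥0∞) = 2 by norm_num, ENNReal.div_self (by norm_num) (by norm_num),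
      ENNReal.le_div_iff_mul_le (by simp) (by simp)]
    norm_num

end Sard

section ComplexLines

variable {E F : Type*} [NormedAddCommGroup E] [NormedSpace ℂ E] [NormedAddCommGroup F]
  [NormedSpace ℂ F] [CompleteSpace F] {f : E → F} {a : E} {r : ℝ}

lemma isOpen_line_preimage (z v : E) : IsOpen {t : ℂ | z + t • v ∈ Metric.ball a r} :=
  Metric.isOpen_ball.preimage (by fun_prop)

lemma analyticOnNhd_line (hf : DifferentiableOn ℂ f (Metric.ball a r)) (z v : E) :
    AnalyticOnNhd ℂ (fun t : ℂ => f (z + t • v)) {t : ℂ | z + t • v ∈ Metric.ball a r} := by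
  refine DifferentiableOn.analyticOnNhd (fun t ht => ?_) (isOpen_line_preimage z v)
  have h1 := hf.differentiableAt (Metric.isOpen_ball.mem_nhds ht)
  have h2 : DifferentiableAt ℂ (fun t : ℂ => z + t • v) t := by fun_prop
  exact (DifferentiableAt.comp t h1 h2).differentiableWithinAt

lemma eq_on_line (hf : DifferentiableOn ℂ f (Metric.ball a r)) {z v : E} {c : F}
    (h : ∀ᶠ t in 𝓝 (0 : ℂ), f (z + t • v) = c) (hz : z ∈ Metric.ball a r) {t : ℂ}
    (ht : z + t • v ∈ Metric.ball a r) : f (z + t • v) = c := by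
  have hconv : Convex ℝ {t : ℂ | z + t • v ∈ Metric.ball a r} := by
    intro s hs t ht p q hp hq hpq
    have : z + (p • s + q • t) • v = p • (z + s • v) + q • (z + t • v) := by
      have : z = p • z + q • z := by rw [← add_smul, hpq, one_smul]
      conv_lhs => rw [this]
      simp only [← Complex.coe_smul]
      module
    show z + (p • s + q • t) • v ∈ Metric.ball a r
    rw [this]
    exact convex_ball a r hs ht hp hq hpq
  exact (analyticOnNhd_line hf z v).eqOn_of_preconnected_of_eventuallyEq
    (analyticOnNhd_const (v := c)) hconv.isPreconnected (z₀ := 0) (by simpa using hz) h ht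

lemma eq_on_ball_of_eventually_eq (hf : DifferentiableOn ℂ f (Metric.ball a r)) {z : E} {c : F}
    (hz : z ∈ Metric.ball a r) (h : ∀ᶠ y in 𝓝 z, f y = c) {y : E} (hy : y ∈ Metric.ball a r) :
    f y = c := by
  have h1 : ∀ᶠ t in 𝓝 (0 : ℂ), f (z + t • (y - z)) = c := by
    have : Tendsto (fun t : ℂ => z + t • (y - z)) (𝓝 0) (𝓝 z) := by
      have : Continuous fun t : ℂ => z + t • (y - z) := by fun_prop
      simpa using this.tendsto 0
    exact this.eventually h
  have h2 := eq_on_line hf h1 hz (t := 1) (by simpa using hy)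
  simpa using h2

lemma exists_line_not_eventually_const (hr : 0 < r) (hf : DifferentiableOn ℂ f (Metric.ball a r))
    (h : ¬ ∀ᶠ y in 𝓝 a, f y = f a) {V : Set E} (hV : IsOpen V) (hne : V.Nonempty) :
    ∃ v ∈ V, ¬ ∀ᶠ t in 𝓝 (0 : ℂ), f (a + t • v) = f a := by
  by_contra hc
  push Not at hc
  obtain ⟨v, hv⟩ := hne
  have ha := Metric.mem_ball_self (x := a) hr
  obtain ⟨s, hs, hs0⟩ : ∃ s : ℝ, a + (s : ℂ) • v ∈ Metric.ball a r ∧ s ≠ 0 := by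
    have : Tendsto (fun s : ℝ => a + (s : ℂ) • v) (𝓝[≠] 0) (𝓝 a) := by
      have : Continuous fun s : ℝ => a + (s : ℂ) • v := by fun_prop
      simpa using (this.tendsto 0).mono_left nhdsWithin_le_nhds
    exact ((this.eventually (Metric.isOpen_ball.mem_nhds ha)).and
      self_mem_nhdsWithin).exists
  have hs0' : (s : ℂ) ≠ 0 := by exact_mod_cast hs0
  refine h ?_
  have h1 : ∀ᶠ y in 𝓝 (a + (s : ℂ) • v), f y = f a := by
    have hcont : Tendsto (fun y => (s : ℂ)⁻¹ • (y - a)) (𝓝 (a + (s : ℂ) • v)) (𝓝 v) := by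
      have : Continuous fun y => (s : ℂ)⁻¹ • (y - a) := by fun_prop
      have h2 := this.tendsto (a + (s : ℂ) • v)
      rwa [add_sub_cancel_left, smul_smul, inv_mul_cancel₀ hs0', one_smul] at h2
    filter_upwards [hcont.eventually (hV.mem_nhds hv), Metric.isOpen_ball.mem_nhds hs] with y h1 h2
    have e : a + (s : ℂ) • ((s : ℂ)⁻¹ • (y - a)) = y := by
      rw [smul_smul, mul_inv_cancel₀ hs0', one_smul]; abel
    have := eq_on_line hf (hc _ h1) ha (t := s) (by rwa [e])
    rwa [e] at this
  filter_upwards [Metric.isOpen_ball.mem_nhds ha] with y hy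
  exact eq_on_ball_of_eventually_eq hf hs h1 hy

lemma nhds_le_map_of_not_eventually_const {f : E → ℂ} (hr : 0 < r)
    (hf : DifferentiableOn ℂ f (Metric.ball a r)) (h : ¬ ∀ᶠ y in 𝓝 a, f y = f a) :
    𝓝 (f a) ≤ map f (𝓝 a) := by
  obtain ⟨v, -, hv⟩ := exists_line_not_eventually_const hr hf h isOpen_univ univ_nonempty
  have h0 : (0 : ℂ) ∈ {t : ℂ | a + t • v ∈ Metric.ball a r} := by
    simpa using Metric.mem_ball_self (x := a) hr
  have h1 := (analyticOnNhd_line hf a v 0 h0).eventually_constant_or_nhds_le_map_nhds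
  simp only [zero_smul, add_zero] at h1
  refine (h1.resolve_left hv).trans ?_
  have : Tendsto (fun t : ℂ => a + t • v) (𝓝 0) (𝓝 a) := by
    have : Continuous fun t : ℂ => a + t • v := by fun_prop
    simpa using this.tendsto 0
  rw [show (fun t : ℂ => f (a + t • v)) = f ∘ fun t : ℂ => a + t • v from rfl, ← Filter.map_map]
  exact map_mono this

end ComplexLines

section BasicFunction

variable {lam : ℝ} {A Ξ : Cn 2 → Matrix (Fin 2) (Fin 2) ℂ} {z₀ : Cn 2} {f h : Cn 2 → ℂ}

lemma IsInvariantCoframe.dzbar_apply_zero (hA : IsInvariantCoframe lam A Ξ z₀) :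
    ∀ᶠ z in 𝓝 z₀, ∀ l k, dzbar l (fun y => A y k 0) z = Complex.I * conj (A z l 1) * A z k 0 := by
  filter_upwards [hA.dbar] with z hz l k
  have := congrFun (congrFun (hz l) k) 0
  refine this.trans ?_
  simp [frameD, Matrix.mul_apply, Fin.sum_univ_two]
  ring

lemma IsInvariantCoframe.det_ne_zero (hA : IsInvariantCoframe lam A Ξ z₀) : (A z₀).det ≠ 0 := by
  intro h
  have := congrArg Matrix.det hA.inv.self_of_nhds
  simp [h] at this

lemma IsInvariantCoframe.eventually_smooth (hA : IsInvariantCoframe lam A Ξ z₀) :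
    ∀ᶠ z in 𝓝 z₀, ∀ i j, DifferentiableAt ℝ (fun y => A y i j) z := by
  simp only [eventually_all]
  exact fun i j => (((hA.smooth i j).of_le two_le_infty).eventually (by simp)).mono
    fun y hy => hy.differentiableAt two_ne_zero

/-- If `df = h θ₁`, the coefficient `h` is smooth. -/
lemma contDiffAt_coefficient (hA : IsInvariantCoframe lam A Ξ z₀)
    (hf : ∀ᶠ z in 𝓝 z₀, DifferentiableAt ℂ f z)
    (hh : ∀ᶠ z in 𝓝 z₀, ∀ k, fderiv ℂ f z (stdVec k) = A z k 0 * h z) : ContDiffAt ℝ ∞ h z₀ := by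
  obtain ⟨U, hU, hUo, hz⟩ := eventually_nhds_iff.1 hf
  have h1 : ContDiffAt ℂ ∞ f z₀ := (contDiffOn_of_differentiableOn_complex hUo fun y hy =>
    (hU y hy).differentiableWithinAt).contDiffAt (hUo.mem_nhds hz)
  have h2 : ∀ k, ContDiffAt ℝ ∞ (fun z => fderiv ℂ f z (stdVec k)) z₀ := fun k =>
    (((h1.fderiv_right (m := ∞) le_rfl).clm_apply contDiffAt_const)).restrict_scalars ℝ
  have h3 : ContDiffAt ℝ ∞ (fun z => ∑ k, Ξ z 0 k * fderiv ℂ f z (stdVec k)) z₀ :=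
    ContDiffAt.sum fun k _ => (hA.smoothInv 0 k).mul (h2 k)
  refine h3.congr_of_eventuallyEq ?_
  filter_upwards [hh, hA.inv] with z e1 e2
  simp only [e1]
  have e3 : Ξ z * A z = 1 := mul_eq_one_comm.1 e2
  have := congrFun (congrFun e3 0) 0
  simp only [Matrix.mul_apply, Fin.sum_univ_two, Matrix.one_apply_eq] at this
  rw [Fin.sum_univ_two]
  linear_combination -h z * this

lemma dzbar_coefficient (hA : IsInvariantCoframe lam A Ξ z₀)
    (hf : ∀ᶠ z in 𝓝 z₀, DifferentiableAt ℂ f z)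
    (hh : ∀ᶠ z in 𝓝 z₀, ∀ k, fderiv ℂ f z (stdVec k) = A z k 0 * h z) (l : Fin 2) :
    dzbar l h z₀ = -Complex.I * conj (A z₀ l 1) * h z₀ := by
  have hs := (contDiffAt_coefficient hA hf hh).differentiableAt (by simp)
  have key : ∀ k, A z₀ k 0 * (dzbar l h z₀ + Complex.I * conj (A z₀ l 1) * h z₀) = 0 := fun k => by
    have e1 : dzbar l (fun z => fderiv ℂ f z (stdVec k)) z₀ = 0 := by
      obtain ⟨U, hU, hUo, hz⟩ := eventually_nhds_iff.1 hf
      have h1 : ContDiffAt ℂ ∞ f z₀ := (contDiffOn_of_differentiableOn_complex hUo fun y hy =>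
        (hU y hy).differentiableWithinAt).contDiffAt (hUo.mem_nhds hz)
      exact dzbar_of_differentiableAt (((h1.fderiv_right (m := ∞) le_rfl).clm_apply
        contDiffAt_const).differentiableAt (by simp))
    rw [dzbar_congr (hh.mono fun z hz => hz k),
      dzbar_mul (hA.eventually_smooth.self_of_nhds k 0) hs,
      hA.dzbar_apply_zero.self_of_nhds] at e1
    linear_combination e1
  have hdet := hA.det_ne_zero
  rw [Matrix.det_fin_two] at hdet
  by_contra hne
  have h0 : ∀ k, A z₀ k 0 = 0 := fun k => (mul_eq_zero.1 (key k)).resolve_right fun h => hne (by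
    linear_combination h)
  exact hdet (by rw [h0, h0]; ring)

lemma dz_coefficient (hA : IsInvariantCoframe lam A Ξ z₀)
    (hf : ∀ᶠ z in 𝓝 z₀, DifferentiableAt ℂ f z)
    (hh : ∀ᶠ z in 𝓝 z₀, ∀ k, fderiv ℂ f z (stdVec k) = A z k 0 * h z) :
    dz 1 h z₀ * A z₀ 0 0 - dz 0 h z₀ * A z₀ 1 0 = -Complex.I * (A z₀).det * h z₀ := by
  have hs := (contDiffAt_coefficient hA hf hh).differentiableAt (by simp)
  obtain ⟨U, hU, hUo, hz⟩ := eventually_nhds_iff.1 hf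
  have h1 : ContDiffAt ℂ 2 f z₀ := ((contDiffOn_of_differentiableOn_complex hUo fun y hy =>
    (hU y hy).differentiableWithinAt).contDiffAt (hUo.mem_nhds hz)).of_le two_le_infty
  have hd : ∀ k, DifferentiableAt ℂ (fun z => fderiv ℂ f z (stdVec k)) z₀ := fun k =>
    ((h1.fderiv_right (m := 1) (by norm_num)).clm_apply contDiffAt_const).differentiableAt
      (by norm_num)
  have e1 : dz 1 (fun z => fderiv ℂ f z (stdVec 0)) z₀ =
      dz 0 (fun z => fderiv ℂ f z (stdVec 1)) z₀ := by
    have hsymm : IsSymmSndFDerivAt ℂ f z₀ := h1.isSymmSndFDerivAt (by simp)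
    have hd2 : DifferentiableAt ℂ (fderiv ℂ f) z₀ :=
      (h1.fderiv_right (m := 1) (by norm_num)).differentiableAt (by norm_num)
    rw [dz_of_differentiableAt (hd 0), dz_of_differentiableAt (hd 1),
      fderiv_clm_apply hd2 (differentiableAt_const _), fderiv_clm_apply hd2 (differentiableAt_const _)]
    simpa using hsymm.eq (stdVec 1) (stdVec 0)
  have hAs := hA.eventually_smooth.self_of_nhds
  rw [dz_congr (hh.mono fun z hz => hz 0), dz_congr (hh.mono fun z hz => hz 1),
    dz_mul (hAs 0 0) hs, dz_mul (hAs 1 0) hs] at e1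
  have ht := hA.torsion.self_of_nhds 0
  simp only [if_true] at ht
  linear_combination e1 + h z₀ * ht

/-- The derivative of the coefficient `h` of `df = h θ₁` in the direction of the second vector of
the frame. -/
theorem fderiv_coefficient (hA : IsInvariantCoframe lam A Ξ z₀)
    (hf : ∀ᶠ z in 𝓝 z₀, DifferentiableAt ℂ f z)
    (hh : ∀ᶠ z in 𝓝 z₀, ∀ k, fderiv ℂ f z (stdVec k) = A z k 0 * h z) {w : Cn 2}
    (hw : (w.ofLp ᵥ* A z₀) 0 = 0) :
    fderiv ℝ h z₀ w = -(2 * ((w.ofLp ᵥ* A z₀) 1).re * Complex.I) * h z₀ := by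
  have hdet := hA.det_ne_zero
  have hz := dz_coefficient hA hf hh
  have hzb := dzbar_coefficient hA hf hh
  have e0 : fderiv ℝ h z₀ w = ∑ k, w k * dz k h z₀ + ∑ k, conj (w k) * dzbar k h z₀ := by
    rw [sum_mul_dz, sum_conj_mul_dzbar]; ring
  rw [e0]
  simp only [Matrix.vecMul, dotProduct, Fin.sum_univ_two] at hw ⊢
  rw [hzb, hzb]
  have e1 : w 0 * dz 0 h z₀ + w 1 * dz 1 h z₀ =
      -Complex.I * (w 0 * A z₀ 0 1 + w 1 * A z₀ 1 1) * h z₀ := by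
    refine mul_left_cancel₀ hdet ?_
    rw [Matrix.det_fin_two] at hz ⊢
    linear_combination (w 0 * A z₀ 0 1 + w 1 * A z₀ 1 1) * hz +
      (A z₀ 1 1 * dz 0 h z₀ - A z₀ 0 1 * dz 1 h z₀) * hw
  have e2 : ∀ c : ℂ, (2 * c.re : ℂ) = c + conj c := fun c => by
    rw [Complex.add_conj]; push_cast; rfl
  rw [e2, map_add, map_mul, map_mul]
  linear_combination e1

end BasicFunction

section HolomorphicFunctions

variable {X : Type*} [TopologicalSpace X] [ChartedSpace (Cn 2) X]

/-- `φ` is holomorphic on `U`. -/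
def HolOn (φ : X → ℂ) (U : Set X) : Prop :=
  ∀ x₀ : X, ∀ z ∈ (chartAt (Cn 2) x₀).target, (chartAt (Cn 2) x₀).symm z ∈ U →
    DifferentiableAt ℂ (fun z => φ ((chartAt (Cn 2) x₀).symm z)) z

/-- The derivative of a holomorphic function. -/
def holDeriv (φ : X → ℂ) (x : X) (w : Cn 2) : ℂ :=
  fderiv ℂ (fun z => φ ((chartAt (Cn 2) x).symm z)) (chartAt (Cn 2) x x) w

variable {φ : X → ℂ} {U : Set X} {x₀ x : X} {z : Cn 2}

lemma HolOn.eventually_differentiableAt (h : HolOn φ U) (hU : IsOpen U)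
    (hz : z ∈ (chartAt (Cn 2) x₀).target) (hzU : (chartAt (Cn 2) x₀).symm z ∈ U) :
    ∀ᶠ z in 𝓝 z, DifferentiableAt ℂ (fun z => φ ((chartAt (Cn 2) x₀).symm z)) z := by
  filter_upwards [(chartAt (Cn 2) x₀).open_target.mem_nhds hz,
    ((chartAt (Cn 2) x₀).continuousAt_symm hz).eventually (hU.mem_nhds hzU)] with y h1 h2
    using h x₀ y h1 h2

lemma HolOn.contDiffAt (h : HolOn φ U) (hU : IsOpen U)
    (hz : z ∈ (chartAt (Cn 2) x₀).target) (hzU : (chartAt (Cn 2) x₀).symm z ∈ U) :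
    ContDiffAt ℂ ∞ (fun z => φ ((chartAt (Cn 2) x₀).symm z)) z := by
  obtain ⟨V, hV, hVo, hz⟩ := eventually_nhds_iff.1 (h.eventually_differentiableAt hU hz hzU)
  exact (contDiffOn_of_differentiableOn_complex hVo fun y hy =>
    (hV y hy).differentiableWithinAt).contDiffAt (hVo.mem_nhds hz)

lemma HolOn.holDeriv_chartVec [IsManifold 𝓘(ℂ, Cn 2) ω X] (h : HolOn φ U)
    (hz : z ∈ (chartAt (Cn 2) x₀).target) (hzU : (chartAt (Cn 2) x₀).symm z ∈ U) (v : Cn 2) :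
    holDeriv φ ((chartAt (Cn 2) x₀).symm z) (chartVecC x₀ z v) =
      fderiv ℂ (fun z => φ ((chartAt (Cn 2) x₀).symm z)) z v := by
  set x := (chartAt (Cn 2) x₀).symm z with hx
  have e1 : chartVecC x₀ z v = fderiv ℂ (chartAt (Cn 2) x ∘ (chartAt (Cn 2) x₀).symm) z v :=
    chartVec_eq hz v
  have hxx := mem_chart_source (Cn 2) x
  have hzx : chartAt (Cn 2) x x = (chartAt (Cn 2) x ∘ (chartAt (Cn 2) x₀).symm) z := by
    rw [Function.comp_apply, ← hx]
  have d1 : DifferentiableAt ℂ (chartAt (Cn 2) x ∘ (chartAt (Cn 2) x₀).symm) z := by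
    refine ((contDiffOn_chart_transition x₀ x).contDiffAt
      ((OpenPartialHomeomorph.open_source _).mem_nhds ?_)).differentiableAt (by simp)
    simp [hz, ← hx]
  have d2 := h x (chartAt (Cn 2) x x) (mem_chart_target _ x)
    (by rwa [(chartAt (Cn 2) x).left_inv hxx])
  have e2 : (fun z => φ ((chartAt (Cn 2) x₀).symm z)) =ᶠ[𝓝 z]
      (fun z => φ ((chartAt (Cn 2) x).symm z)) ∘ (chartAt (Cn 2) x ∘ (chartAt (Cn 2) x₀).symm) := by
    filter_upwards [((chartAt (Cn 2) x₀).continuousAt_symm hz).eventually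
      ((chartAt (Cn 2) x).open_source.mem_nhds hxx)] with y hy
    rw [Function.comp_apply, Function.comp_apply, (chartAt (Cn 2) x).left_inv hy]
  rw [e2.fderiv_eq, fderiv_comp z (by rwa [← hzx]) d1, ← hzx, e1]
  rfl

end HolomorphicFunctions

section Fibrations

variable {X : Type*} [TopologicalSpace X] [ChartedSpace (Cn 2) X] [IsManifold 𝓘(ℂ, Cn 2) ω X]
  {C : Type*} [TopologicalSpace C] [ChartedSpace (Cn 1) C] [IsManifold 𝓘(ℂ, Cn 1) ω C]
  {π : X → C} {x : X} {q : C}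

lemma Cn.one_ext {v w : Cn 1} (h : v 0 = w 0) : v = w := by
  ext k; rwa [Subsingleton.elim k 0]

lemma Cn.one_eq (v : Cn 1) : v = v 0 • stdVec 0 := Cn.one_ext (by simp [stdVec])

/-- The map `π` in the chart around `q`. -/
def chartFun (π : X → C) (q : C) (x : X) : ℂ := chartAt (Cn 1) q (π x) 0

/-- The domain of `chartFun`. -/
def chartDom (π : X → C) (q : C) : Set X := π ⁻¹' (chartAt (Cn 1) q).source

lemma mem_chartDom (π : X → C) (x : X) : x ∈ chartDom π (π x) := mem_chart_source (Cn 1) (π x)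

lemma isOpen_chartDom (hπ : MDifferentiable 𝓘(ℂ, Cn 2) 𝓘(ℂ, Cn 1) π) (q : C) :
    IsOpen (chartDom π q) :=
  (chartAt (Cn 1) q).open_source.preimage hπ.continuous

lemma chartFun_injOn {x y : X} (hx : x ∈ chartDom π q) (hy : y ∈ chartDom π q)
    (h : chartFun π q x = chartFun π q y) : π x = π y :=
  (chartAt (Cn 1) q).injOn hx hy (Cn.one_ext h)

lemma holOn_chartFun (hπ : MDifferentiable 𝓘(ℂ, Cn 2) 𝓘(ℂ, Cn 1) π) (q : C) :
    HolOn (chartFun π q) (chartDom π q) := fun _ z hz hzU =>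
  (EuclideanSpace.proj 0 : Cn 1 →L[ℂ] ℂ).differentiableAt.comp z
    (MDifferentiableAt.differentiableAt_charts_complex hz hzU (hπ _))

lemma mfderiv_apply_zero (hπ : MDifferentiable 𝓘(ℂ, Cn 2) 𝓘(ℂ, Cn 1) π) (x : X) (w : Cn 2) :
    (show Cn 1 from mfderiv 𝓘(ℂ, Cn 2) 𝓘(ℂ, Cn 1) π x w) 0 = holDeriv (chartFun π (π x)) x w := by
  have h := congrArg (fun v : Cn 1 => v 0) (mfderiv_apply_eq_fderiv (hπ x) w)
  refine h.trans ?_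
  have hx := mem_chart_source (Cn 2) x
  have hd : DifferentiableAt ℂ (chartAt (Cn 1) (π x) ∘ π ∘ (chartAt (Cn 2) x).symm)
      (chartAt (Cn 2) x x) := by
    refine MDifferentiableAt.differentiableAt_charts_complex (mem_chart_target _ x) ?_ (hπ _)
    rw [(chartAt (Cn 2) x).left_inv hx]; exact mem_chart_source _ _
  have h2 := ((EuclideanSpace.proj 0 : Cn 1 →L[ℂ] ℂ).hasFDerivAt.comp _ hd.hasFDerivAt).fderiv
  exact (congrFun (congrArg DFunLike.coe h2) w).symm

lemma mfderiv_eq_zero_iff (hπ : MDifferentiable 𝓘(ℂ, Cn 2) 𝓘(ℂ, Cn 1) π) (x : X) :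
    mfderiv 𝓘(ℂ, Cn 2) 𝓘(ℂ, Cn 1) π x = 0 ↔ ∀ w, holDeriv (chartFun π (π x)) x w = 0 := by
  constructor
  · intro h w
    rw [← mfderiv_apply_zero hπ]
    have := congrFun (congrArg DFunLike.coe h) w
    exact congrArg (fun v : Cn 1 => v 0) this
  · intro h
    refine ContinuousLinearMap.ext fun w => ?_
    exact Cn.one_ext ((mfderiv_apply_zero hπ x w).trans (h w))

/-- The derivative of the transition from the chart around `q` to the chart around `q'` at `p`. -/
def transDeriv (q q' p : C) : ℂ :=
  fderiv ℂ (chartAt (Cn 1) q' ∘ (chartAt (Cn 1) q).symm) (chartAt (Cn 1) q p) (stdVec 0) 0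

lemma differentiableAt_transition {q q' p : C} (hq : p ∈ (chartAt (Cn 1) q).source)
    (hq' : p ∈ (chartAt (Cn 1) q').source) :
    DifferentiableAt ℂ (chartAt (Cn 1) q' ∘ (chartAt (Cn 1) q).symm) (chartAt (Cn 1) q p) := by
  refine ((contDiffOn_chart_transition q q').contDiffAt
    ((OpenPartialHomeomorph.open_source _).mem_nhds ?_)).differentiableAt (by simp)
  simp [hq, hq']

lemma fderiv_transition {q q' p : C} (v : Cn 1) :
    fderiv ℂ (chartAt (Cn 1) q' ∘ (chartAt (Cn 1) q).symm) (chartAt (Cn 1) q p) v 0 =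
      transDeriv q q' p * v 0 := by
  conv_lhs => rw [Cn.one_eq v, map_smul]
  rw [transDeriv, PiLp.smul_apply, smul_eq_mul, mul_comm]

lemma holDeriv_chartFun_trans (hπ : MDifferentiable 𝓘(ℂ, Cn 2) 𝓘(ℂ, Cn 1) π) {q q' : C} {x : X}
    (hq : x ∈ chartDom π q) (hq' : x ∈ chartDom π q') (w : Cn 2) :
    holDeriv (chartFun π q') x w = transDeriv q q' (π x) * holDeriv (chartFun π q) x w := by
  have hx := mem_chart_source (Cn 2) x
  have hzx := (chartAt (Cn 2) x).left_inv hx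
  have hd : DifferentiableAt ℂ (chartAt (Cn 1) q ∘ π ∘ (chartAt (Cn 2) x).symm)
      (chartAt (Cn 2) x x) :=
    MDifferentiableAt.differentiableAt_charts_complex (mem_chart_target _ x) (by rwa [hzx]) (hπ _)
  have e : (fun z => chartFun π q' ((chartAt (Cn 2) x).symm z)) =ᶠ[𝓝 (chartAt (Cn 2) x x)]
      (EuclideanSpace.proj 0 : Cn 1 →L[ℂ] ℂ) ∘ ((chartAt (Cn 1) q' ∘ (chartAt (Cn 1) q).symm) ∘
        (chartAt (Cn 1) q ∘ π ∘ (chartAt (Cn 2) x).symm)) := by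
    filter_upwards [((chartAt (Cn 2) x).continuousAt_symm (mem_chart_target _ x)).eventually
      ((isOpen_chartDom hπ q).mem_nhds (by rwa [hzx]))] with y hy
    show chartAt (Cn 1) q' _ 0 = chartAt (Cn 1) q' ((chartAt (Cn 1) q).symm
      (chartAt (Cn 1) q (π ((chartAt (Cn 2) x).symm y)))) 0
    rw [(chartAt (Cn 1) q).left_inv hy]
  have hval : (chartAt (Cn 1) q ∘ π ∘ (chartAt (Cn 2) x).symm) (chartAt (Cn 2) x x) =
      chartAt (Cn 1) q (π x) := by simp [hzx]
  have d2 := differentiableAt_transition hq hq'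
  have h3 := ((EuclideanSpace.proj 0 : Cn 1 →L[ℂ] ℂ).hasFDerivAt.comp _
    ((hval ▸ d2.hasFDerivAt).comp _ hd.hasFDerivAt)).fderiv
  have h4 := ((EuclideanSpace.proj 0 : Cn 1 →L[ℂ] ℂ).hasFDerivAt.comp _ hd.hasFDerivAt).fderiv
  have h5 : holDeriv (chartFun π q) x w = fderiv ℂ (chartAt (Cn 1) q ∘ π ∘ (chartAt (Cn 2) x).symm)
      (chartAt (Cn 2) x x) w 0 := congrFun (congrArg DFunLike.coe h4) w
  rw [h5, ← fderiv_transition, holDeriv, e.fderiv_eq, h3]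
  simp only [hval]
  rfl

lemma transDeriv_ne_zero {q q' p : C} (hq : p ∈ (chartAt (Cn 1) q).source)
    (hq' : p ∈ (chartAt (Cn 1) q').source) : transDeriv q q' p ≠ 0 := by
  have e : (chartAt (Cn 1) q ∘ (chartAt (Cn 1) q').symm) ∘ (chartAt (Cn 1) q' ∘ (chartAt (Cn 1) q).symm)
      =ᶠ[𝓝 (chartAt (Cn 1) q p)] id := by
    have hp : chartAt (Cn 1) q p ∈ (chartAt (Cn 1) q).target := (chartAt (Cn 1) q).map_source hq
    filter_upwards [((chartAt (Cn 1) q).continuousAt_symm hp).eventually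
      ((chartAt (Cn 1) q').open_source.mem_nhds (by rwa [(chartAt (Cn 1) q).left_inv hq])),
      (chartAt (Cn 1) q).open_target.mem_nhds hp] with y hy hy'
    show chartAt (Cn 1) q ((chartAt (Cn 1) q').symm (chartAt (Cn 1) q' ((chartAt (Cn 1) q).symm y))) = y
    rw [(chartAt (Cn 1) q').left_inv hy, (chartAt (Cn 1) q).right_inv hy']
  have hval : (chartAt (Cn 1) q' ∘ (chartAt (Cn 1) q).symm) (chartAt (Cn 1) q p) =
      chartAt (Cn 1) q' p := by simp [hq]
  have h := ((hval ▸ (differentiableAt_transition hq' hq).hasFDerivAt).comp _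
    (differentiableAt_transition hq hq').hasFDerivAt).fderiv
  rw [e.fderiv_eq, fderiv_id] at h
  intro h0
  have h1 := congrArg (fun L : Cn 1 →L[ℂ] Cn 1 => L (stdVec 0) 0) h
  simp only [ContinuousLinearMap.comp_apply, hval] at h1
  rw [fderiv_transition] at h1
  rw [transDeriv] at h0
  rw [h0, mul_zero] at h1
  simp [stdVec] at h1

lemma isCritical_iff (hπ : MDifferentiable 𝓘(ℂ, Cn 2) 𝓘(ℂ, Cn 1) π) (hx : x ∈ chartDom π q) :
    mfderiv 𝓘(ℂ, Cn 2) 𝓘(ℂ, Cn 1) π x = 0 ↔ ∀ w, holDeriv (chartFun π q) x w = 0 := by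
  rw [mfderiv_eq_zero_iff hπ]
  refine forall_congr' fun w => ?_
  rw [holDeriv_chartFun_trans hπ hx (mem_chartDom π x), mul_eq_zero,
    or_iff_right (transDeriv_ne_zero hx (mem_chartDom π x))]

lemma fderiv_chartFun_eq_zero_iff (hπ : MDifferentiable 𝓘(ℂ, Cn 2) 𝓘(ℂ, Cn 1) π) {x₀ : X} {z : Cn 2}
    (hz : z ∈ (chartAt (Cn 2) x₀).target) (hzU : (chartAt (Cn 2) x₀).symm z ∈ chartDom π q) :
    fderiv ℂ (fun z => chartFun π q ((chartAt (Cn 2) x₀).symm z)) z = 0 ↔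
      mfderiv 𝓘(ℂ, Cn 2) 𝓘(ℂ, Cn 1) π ((chartAt (Cn 2) x₀).symm z) = 0 := by
  set x := (chartAt (Cn 2) x₀).symm z with hx
  have hxx := mem_chart_source (Cn 2) x
  have hsurj : ∀ w : Cn 2, ∃ v, chartVecC x₀ z v = w := by
    intro w
    have d1 : HasFDerivAt (chartAt (Cn 2) x ∘ (chartAt (Cn 2) x₀).symm) _ z :=
      (((contDiffOn_chart_transition x₀ x).contDiffAt
        ((OpenPartialHomeomorph.open_source _).mem_nhds (by simp [hz, ← hx]))).differentiableAt
          (by simp)).hasFDerivAt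
    have hval : (chartAt (Cn 2) x ∘ (chartAt (Cn 2) x₀).symm) z = chartAt (Cn 2) x x := by
      rw [Function.comp_apply, ← hx]
    have d2 : HasFDerivAt (chartAt (Cn 2) x₀ ∘ (chartAt (Cn 2) x).symm) _ (chartAt (Cn 2) x x) :=
      (((contDiffOn_chart_transition x x₀).contDiffAt
        ((OpenPartialHomeomorph.open_source _).mem_nhds (by
          simp [hx, (chartAt (Cn 2) x₀).map_target hz]))).differentiableAt
          (by simp)).hasFDerivAt
    have e : (chartAt (Cn 2) x ∘ (chartAt (Cn 2) x₀).symm) ∘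
        (chartAt (Cn 2) x₀ ∘ (chartAt (Cn 2) x).symm) =ᶠ[𝓝 (chartAt (Cn 2) x x)] id := by
      filter_upwards [((chartAt (Cn 2) x).continuousAt_symm (mem_chart_target _ x)).eventually
        ((chartAt (Cn 2) x₀).open_source.mem_nhds (by
          rw [(chartAt (Cn 2) x).left_inv hxx, hx]; exact (chartAt (Cn 2) x₀).map_target hz)),
        (chartAt (Cn 2) x).open_target.mem_nhds (mem_chart_target _ x)] with y hy hy'
      show chartAt (Cn 2) x ((chartAt (Cn 2) x₀).symm (chartAt (Cn 2) x₀ ((chartAt (Cn 2) x).symm y)))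
        = y
      rw [(chartAt (Cn 2) x₀).left_inv hy, (chartAt (Cn 2) x).right_inv hy']
    have hval2 : (chartAt (Cn 2) x₀ ∘ (chartAt (Cn 2) x).symm) (chartAt (Cn 2) x x) = z := by
      rw [Function.comp_apply, (chartAt (Cn 2) x).left_inv hxx, hx, (chartAt (Cn 2) x₀).right_inv hz]
    have h := (HasFDerivAt.comp (chartAt (Cn 2) x x) (by rwa [hval2]) d2).fderiv
    rw [e.fderiv_eq, fderiv_id] at h
    refine ⟨fderiv ℂ (chartAt (Cn 2) x₀ ∘ (chartAt (Cn 2) x).symm) (chartAt (Cn 2) x x) w, ?_⟩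
    have e1 : ∀ v, chartVecC x₀ z v = fderiv ℂ (chartAt (Cn 2) x ∘ (chartAt (Cn 2) x₀).symm) z v :=
      fun v => chartVec_eq hz v
    rw [e1]
    exact (congrFun (congrArg DFunLike.coe h) w).symm
  rw [isCritical_iff hπ hzU]
  have key := (holOn_chartFun hπ q).holDeriv_chartVec hz hzU
  constructor
  · intro h w
    obtain ⟨v, rfl⟩ := hsurj w
    rw [key, h]; rfl
  · intro h
    exact ContinuousLinearMap.ext fun v => (key v).symm.trans (h _)

lemma isClosed_critical (hπ : MDifferentiable 𝓘(ℂ, Cn 2) 𝓘(ℂ, Cn 1) π) :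
    IsClosed {x | mfderiv 𝓘(ℂ, Cn 2) 𝓘(ℂ, Cn 1) π x = 0} := by
  rw [← isOpen_compl_iff, isOpen_iff_mem_nhds]
  intro x hx
  have hxx := mem_chart_source (Cn 2) x
  have hl := (chartAt (Cn 2) x).left_inv hxx
  have hU : (chartAt (Cn 2) x).symm (chartAt (Cn 2) x x) ∈ chartDom π (π x) := by
    rw [hl]; exact mem_chartDom π x
  have h1 := ((holOn_chartFun hπ (π x)).contDiffAt (isOpen_chartDom hπ _) (mem_chart_target _ x)
    hU).fderiv_right (m := ∞) le_rfl
  have h2 : fderiv ℂ (fun z => chartFun π (π x) ((chartAt (Cn 2) x).symm z))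
      (chartAt (Cn 2) x x) ≠ 0 := by
    rw [Ne, fderiv_chartFun_eq_zero_iff hπ (mem_chart_target _ x) hU, hl]
    exact hx
  filter_upwards [((chartAt (Cn 2) x).continuousAt hxx).eventually
    (h1.continuousAt.eventually_ne h2), (chartAt (Cn 2) x).open_source.mem_nhds hxx,
    (isOpen_chartDom hπ (π x)).mem_nhds (mem_chartDom π x)] with y hy hys hyd
  rw [Ne, fderiv_chartFun_eq_zero_iff hπ ((chartAt (Cn 2) x).map_source hys)
    (by rwa [(chartAt (Cn 2) x).left_inv hys]), (chartAt (Cn 2) x).left_inv hys] at hy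
  exact hy

lemma critValues_eq_image (π : X → C) :
    critValues π = π '' {x | mfderiv 𝓘(ℂ, Cn 2) 𝓘(ℂ, Cn 1) π x = 0} := by
  ext p; constructor
  · rintro ⟨x, rfl, h⟩; exact ⟨x, h, rfl⟩
  · rintro ⟨x, h, rfl⟩; exact ⟨x, rfl, h⟩

lemma isClosed_critValues [CompactSpace X] [T2Space C]
    (hπ : MDifferentiable 𝓘(ℂ, Cn 2) 𝓘(ℂ, Cn 1) π) : IsClosed (critValues π) := by
  rw [critValues_eq_image]
  exact ((isClosed_critical hπ).isCompact.image hπ.continuous).isClosed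

/-- The critical values of a holomorphic map to a curve have empty interior. -/
theorem dense_compl_critValues [CompactSpace X]
    (hπ : MDifferentiable 𝓘(ℂ, Cn 2) 𝓘(ℂ, Cn 1) π) : Dense (critValues π)ᶜ := by
  rw [← interior_eq_empty_iff_dense_compl, ← not_nonempty_iff_eq_empty]
  rintro ⟨q, hq⟩
  obtain ⟨t, -, ht⟩ := isCompact_univ.elim_nhds_subcover (fun x : X => (chartAt (Cn 2) x).source)
    (fun x _ => (chartAt (Cn 2) x).open_source.mem_nhds (mem_chart_source _ x))
  let Uf : X → Set (Cn 2) := fun x =>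
    (chartAt (Cn 2) x).target ∩ (chartAt (Cn 2) x).symm ⁻¹' chartDom π q
  let ff : X → Cn 2 → ℂ := fun x z => chartFun π q ((chartAt (Cn 2) x).symm z)
  have hdim : dimH (⋃ x ∈ t, ff x '' {z ∈ Uf x | fderiv ℂ (ff x) z = 0}) ≤ 4 / 3 := by
    refine (dimH_bUnion t.countable_toSet _).trans_le ?_
    refine iSup₂_le fun x _ => dimH_image_critical_le fun z hz => ?_
    exact (holOn_chartFun hπ q).contDiffAt (isOpen_chartDom hπ q) hz.1 hz.2
  have hdense : Dense (⋃ x ∈ t, ff x '' {z ∈ Uf x | fderiv ℂ (ff x) z = 0})ᶜ := by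
    refine dense_compl_of_dimH_lt_finrank (E := ℂ) (hdim.trans_lt ?_)
    rw [Complex.finrank_real_complex, ENNReal.div_lt_iff (by simp) (by simp)]
    norm_num
  let ι : ℂ → Cn 1 := fun c => c • stdVec 0
  have hι : Continuous ι := by fun_prop
  let S : Set ℂ := ι ⁻¹' ((chartAt (Cn 1) q).target ∩
    (chartAt (Cn 1) q).symm ⁻¹' interior (critValues π))
  have hS : IsOpen S := ((chartAt (Cn 1) q).isOpen_inter_preimage_symm isOpen_interior).preimage hι
  have hSne : S.Nonempty := ⟨chartAt (Cn 1) q q 0, by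
    have h1 : ι (chartAt (Cn 1) q q 0) = chartAt (Cn 1) q q := (Cn.one_eq _).symm
    show ι (chartAt (Cn 1) q q 0) ∈ (chartAt (Cn 1) q).target ∩
      (chartAt (Cn 1) q).symm ⁻¹' interior (critValues π)
    rw [h1]
    exact ⟨mem_chart_target _ q, by
      show (chartAt (Cn 1) q).symm (chartAt (Cn 1) q q) ∈ interior (critValues π)
      rwa [(chartAt (Cn 1) q).left_inv (mem_chart_source _ q)]⟩⟩
  obtain ⟨c, hcS, hc⟩ := hdense.inter_open_nonempty S hS hSne
  refine hc ?_
  obtain ⟨x, hx, hcrit⟩ := interior_subset hcS.2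
  obtain ⟨x₀, hx₀t, hx₀⟩ := mem_iUnion₂.1 (ht (mem_univ x))
  have hl := (chartAt (Cn 2) x₀).left_inv hx₀
  have hxd : x ∈ chartDom π q := by
    show π x ∈ (chartAt (Cn 1) q).source
    rw [hx]; exact (chartAt (Cn 1) q).map_target hcS.1
  refine mem_iUnion₂.2 ⟨x₀, hx₀t, chartAt (Cn 2) x₀ x,
    ⟨⟨(chartAt (Cn 2) x₀).map_source hx₀, ?_⟩, ?_⟩, ?_⟩
  · show (chartAt (Cn 2) x₀).symm (chartAt (Cn 2) x₀ x) ∈ chartDom π q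
    rwa [hl]
  · exact (fderiv_chartFun_eq_zero_iff hπ ((chartAt (Cn 2) x₀).map_source hx₀)
      (by rwa [hl])).2 (by rwa [hl])
  · show chartFun π q ((chartAt (Cn 2) x₀).symm (chartAt (Cn 2) x₀ x)) = c
    rw [hl, chartFun, hx, (chartAt (Cn 1) q).right_inv hcS.1]
    simp [ι, stdVec]

/-- A chart ball on which `π` is given by a holomorphic function. -/
lemma exists_chart_ball (hπ : MDifferentiable 𝓘(ℂ, Cn 2) 𝓘(ℂ, Cn 1) π) (x : X) :
    ∃ r > 0, Metric.ball (chartAt (Cn 2) x x) r ⊆ (chartAt (Cn 2) x).target ∧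
      ∀ z ∈ Metric.ball (chartAt (Cn 2) x x) r, (chartAt (Cn 2) x).symm z ∈ chartDom π (π x) := by
  have h1 := (chartAt (Cn 2) x).open_target.mem_nhds (mem_chart_target (Cn 2) x)
  have h2 := ((chartAt (Cn 2) x).continuousAt_symm (mem_chart_target _ x)).eventually
      ((isOpen_chartDom hπ (π x)).mem_nhds (by
        rw [(chartAt (Cn 2) x).left_inv (mem_chart_source _ x)]; exact mem_chartDom π x))
  obtain ⟨r, hr, h⟩ := Metric.mem_nhds_iff.1 (inter_mem h1 h2)
  exact ⟨r, hr, fun z hz => (h hz).1, fun z hz => (h hz).2⟩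

lemma differentiableOn_chart_ball (hπ : MDifferentiable 𝓘(ℂ, Cn 2) 𝓘(ℂ, Cn 1) π) {r : ℝ}
    (h1 : Metric.ball (chartAt (Cn 2) x x) r ⊆ (chartAt (Cn 2) x).target)
    (h2 : ∀ z ∈ Metric.ball (chartAt (Cn 2) x x) r, (chartAt (Cn 2) x).symm z ∈ chartDom π (π x)) :
    DifferentiableOn ℂ (fun z => chartFun π (π x) ((chartAt (Cn 2) x).symm z))
      (Metric.ball (chartAt (Cn 2) x x) r) := fun z hz =>
  (holOn_chartFun hπ (π x) x z (h1 hz) (h2 z hz)).differentiableWithinAt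

lemma not_eventually_const [PreconnectedSpace X] (hπ : MDifferentiable 𝓘(ℂ, Cn 2) 𝓘(ℂ, Cn 1) π)
    (hs : Function.Surjective π) (x : X) :
    ¬ ∀ᶠ z in 𝓝 (chartAt (Cn 2) x x), chartFun π (π x) ((chartAt (Cn 2) x).symm z) =
      chartFun π (π x) ((chartAt (Cn 2) x).symm (chartAt (Cn 2) x x)) := by
  intro hc
  let N : Set X := {x | ∀ᶠ y in 𝓝 x, π y = π x}
  have hN : ∀ x : X, (∀ᶠ z in 𝓝 (chartAt (Cn 2) x x),
      chartFun π (π x) ((chartAt (Cn 2) x).symm z) = chartFun π (π x) x) → x ∈ N := by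
    intro x h
    have hxx := mem_chart_source (Cn 2) x
    filter_upwards [((chartAt (Cn 2) x).continuousAt hxx).eventually h,
      (chartAt (Cn 2) x).open_source.mem_nhds hxx,
      (isOpen_chartDom hπ (π x)).mem_nhds (mem_chartDom π x)] with y h1 h2 h3
    rw [(chartAt (Cn 2) x).left_inv h2] at h1
    exact chartFun_injOn h3 (mem_chartDom π x) h1
  have hxN : x ∈ N := hN x (by
    rwa [(chartAt (Cn 2) x).left_inv (mem_chart_source _ x)] at hc)
  have hopen : IsOpen N := by
    rw [isOpen_iff_mem_nhds]
    intro y hy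
    filter_upwards [hy.eventually_nhds, hy] with y' h1 h2
    filter_upwards [h1] with y'' h3
    rw [h3, h2]
  have hclosed : IsClosed N := by
    rw [← closure_subset_iff_isClosed]
    intro x hx
    have hxx := mem_chart_source (Cn 2) x
    obtain ⟨r, hr, h1, h2⟩ := exists_chart_ball hπ x
    obtain ⟨y, ⟨hyr, hys⟩, hy⟩ := mem_closure_iff_nhds.1 hx _ (inter_mem
      (((chartAt (Cn 2) x).continuousAt hxx).preimage_mem_nhds (Metric.ball_mem_nhds _ hr))
      ((chartAt (Cn 2) x).open_source.mem_nhds hxx))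
    have hyl := (chartAt (Cn 2) x).left_inv hys
    have h3 : ∀ᶠ z in 𝓝 (chartAt (Cn 2) x y),
        chartFun π (π x) ((chartAt (Cn 2) x).symm z) = chartFun π (π x) y := by
      have := (chartAt (Cn 2) x).continuousAt_symm ((chartAt (Cn 2) x).map_source hys)
      rw [ContinuousAt, hyl] at this
      filter_upwards [this.eventually hy] with z hz
      rw [chartFun, hz, chartFun]
    have h4 : ∀ z ∈ Metric.ball (chartAt (Cn 2) x x) r,
        chartFun π (π x) ((chartAt (Cn 2) x).symm z) = chartFun π (π x) y := fun z hz =>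
      eq_on_ball_of_eventually_eq (differentiableOn_chart_ball hπ h1 h2) hyr h3 hz
    refine hN x ?_
    have h5 := h4 _ (Metric.mem_ball_self hr)
    rw [(chartAt (Cn 2) x).left_inv hxx] at h5
    filter_upwards [Metric.ball_mem_nhds _ hr] with z hz
    rw [h4 z hz, h5]
  have huniv : N = univ := IsClopen.eq_univ ⟨hclosed, hopen⟩ ⟨x, hxN⟩
  have hloc : IsLocallyConstant π := (IsLocallyConstant.iff_eventually_eq π).2 fun y =>
    show y ∈ N by rw [huniv]; trivial
  have hconst : ∀ p : C, p = π x := fun p => by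
    obtain ⟨y, rfl⟩ := hs p
    exact hloc.apply_eq_of_preconnectedSpace y x
  have htgt := (chartAt (Cn 1) (π x)).open_target.mem_nhds (mem_chart_target (Cn 1) (π x))
  have htend : Tendsto (fun c : ℂ => chartAt (Cn 1) (π x) (π x) + c • stdVec 0) (𝓝[≠] 0)
      (𝓝 (chartAt (Cn 1) (π x) (π x))) := by
    have : Continuous fun c : ℂ => chartAt (Cn 1) (π x) (π x) + c • (stdVec 0 : Cn 1) := by fun_prop
    simpa using (this.tendsto 0).mono_left nhdsWithin_le_nhds
  obtain ⟨c, hc1, hc0⟩ := ((htend.eventually htgt).and self_mem_nhdsWithin).exists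
  have h6 := (chartAt (Cn 1) (π x)).right_inv hc1
  rw [hconst ((chartAt (Cn 1) (π x)).symm _)] at h6
  have h7 := congrArg (fun v : Cn 1 => v 0) h6
  simp [stdVec] at h7
  exact hc0 h7

theorem isOpenMap_of_holomorphic [PreconnectedSpace X]
    (hπ : MDifferentiable 𝓘(ℂ, Cn 2) 𝓘(ℂ, Cn 1) π) (hs : Function.Surjective π) :
    IsOpenMap π := by
  rw [isOpenMap_iff_nhds_le]
  intro x
  have hxx := mem_chart_source (Cn 2) x
  have hl := (chartAt (Cn 2) x).left_inv hxx
  obtain ⟨r, hr, h1, h2⟩ := exists_chart_ball hπ x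
  have h3 := nhds_le_map_of_not_eventually_const hr (differentiableOn_chart_ball hπ h1 h2)
    (not_eventually_const hπ hs x)
  intro V hV
  have hV' : π ⁻¹' V ∈ 𝓝 x := hV
  have hW : Metric.ball (chartAt (Cn 2) x x) r ∩ (chartAt (Cn 2) x).symm ⁻¹' (π ⁻¹' V) ∈
      𝓝 (chartAt (Cn 2) x x) := inter_mem (Metric.ball_mem_nhds _ hr)
    (((chartAt (Cn 2) x).continuousAt_symm (mem_chart_target _ x)).preimage_mem_nhds (by rwa [hl]))
  have h4 := h3 (image_mem_map hW)
  simp only [hl] at h4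
  have h5 : ContinuousAt (fun p => chartAt (Cn 1) (π x) p 0) (π x) :=
    (EuclideanSpace.proj 0 : Cn 1 →L[ℂ] ℂ).continuous.continuousAt.comp
      ((chartAt (Cn 1) (π x)).continuousAt (mem_chart_source _ _))
  filter_upwards [h5.preimage_mem_nhds h4,
    (chartAt (Cn 1) (π x)).open_source.mem_nhds (mem_chart_source _ _)] with p hp hps
  obtain ⟨z, ⟨hz1, hz2⟩, hz⟩ := hp
  have : π ((chartAt (Cn 2) x).symm z) = p :=
    (chartAt (Cn 1) (π x)).injOn (h2 z hz1) hps (Cn.one_ext hz)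
  rw [← this]
  exact hz2

theorem dense_regular [CompactSpace X] [PreconnectedSpace X]
    (hπ : MDifferentiable 𝓘(ℂ, Cn 2) 𝓘(ℂ, Cn 1) π) (hs : Function.Surjective π) :
    Dense (π ⁻¹' (critValues π)ᶜ) :=
  (dense_compl_critValues hπ).preimage (isOpenMap_of_holomorphic hπ hs)

end Fibrations

section VerticalDirections

variable {X : Type*} [TopologicalSpace X] [ChartedSpace (Cn 2) X] [IsManifold 𝓘(ℂ, Cn 2) ω X]
  {lam : ℝ} {A : X → Matrix (Fin 2) (Fin 2) ℂ} {φ : X → ℂ} {U : Set X} {x x₀ : X} {z : Cn 2}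

lemma HolOn.holDeriv_mfderiv {m : ℕ} (h : HolOn φ U) {u : Cn m → X} {ζ : Cn m}
    (hu : MDifferentiableAt 𝓘(ℂ, Cn m) 𝓘(ℂ, Cn 2) u ζ) (hx : u ζ ∈ U) (v : Cn m) :
    holDeriv φ (u ζ) (mfderiv 𝓘(ℂ, Cn m) 𝓘(ℂ, Cn 2) u ζ v) = fderiv ℂ (φ ∘ u) ζ v := by
  have hs := mem_chart_source (Cn 2) (u ζ)
  have hl := (chartAt (Cn 2) (u ζ)).left_inv hs
  have d1 := h (u ζ) _ (mem_chart_target (Cn 2) (u ζ)) (by rwa [hl])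
  have d2 := hu.chart_comp hs
  have e : φ ∘ u =ᶠ[𝓝 ζ] (fun z => φ ((chartAt (Cn 2) (u ζ)).symm z)) ∘
      (chartAt (Cn 2) (u ζ) ∘ u) := by
    filter_upwards [hu.continuousAt.eventually ((chartAt (Cn 2) (u ζ)).open_source.mem_nhds hs)]
      with y hy
    simp only [Function.comp_apply, (chartAt (Cn 2) (u ζ)).left_inv hy]
  have e1 : (mfderiv 𝓘(ℂ, Cn m) 𝓘(ℂ, Cn 2) u ζ v : Cn 2) =
      fderiv ℂ (chartAt (Cn 2) (u ζ) ∘ u) ζ v := mfderiv_apply_eq_fderiv hu v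
  rw [e.fderiv_eq, fderiv_comp ζ d1 d2]
  exact congrArg (holDeriv φ (u ζ)) e1

/-- The coefficient of `dφ` in the direction of the first vector of the frame. -/
def hCo (A : X → Matrix (Fin 2) (Fin 2) ℂ) (φ : X → ℂ) (x : X) : ℂ :=
  holDeriv φ x (WithLp.toLp 2 ((A x)⁻¹ 0))

/-- `φ` is holomorphic on the open set `U`, with differential a multiple of the first form of the
coframe. -/
structure IsBasic (A : X → Matrix (Fin 2) (Fin 2) ℂ) (φ : X → ℂ) (U : Set X) : Prop where
  isOpen : IsOpen U
  hol : HolOn φ U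
  eq_mul : ∀ x ∈ U, ∀ w, holDeriv φ x w = coframe A x w 0 * hCo A φ x

lemma holDeriv_smul (c : ℂ) (w : Cn 2) : holDeriv φ x (c • w) = c * holDeriv φ x w := by
  simp [holDeriv]

lemma holDeriv_sub (v w : Cn 2) : holDeriv φ x (v - w) = holDeriv φ x v - holDeriv φ x w := by
  simp [holDeriv]

lemma coframe_toLp_inv (hA : (A x).det ≠ 0) : coframe A x (WithLp.toLp 2 ((A x)⁻¹ 0)) = ![1, 0] := by
  have h : (A x)⁻¹ * A x = 1 := Matrix.nonsing_inv_mul _ hA.isUnit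
  ext k
  have h2 := congrFun (congrFun h 0) k
  rw [Matrix.mul_apply] at h2
  refine h2.trans ?_
  fin_cases k
  · exact Matrix.one_apply_eq 0
  · exact Matrix.one_apply_ne (by decide)

lemma coframe_sub (v w : Cn 2) : coframe A x (v - w) = coframe A x v - coframe A x w := by
  simp [coframe, Matrix.sub_vecMul]

lemma isBasic_of_vertical (hU : IsOpen U) (h : HolOn φ U) (hd : ∀ x, (A x).det ≠ 0)
    (h0 : ∀ x ∈ U, ∀ w, coframe A x w 0 = 0 → holDeriv φ x w = 0) : IsBasic A φ U where
  isOpen := hU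
  hol := h
  eq_mul x hx w := by
    have := h0 x hx (w - coframe A x w 0 • WithLp.toLp 2 ((A x)⁻¹ 0)) (by
      rw [coframe_sub, coframe_smul, coframe_toLp_inv (hd x)]; simp)
    rw [holDeriv_sub, holDeriv_smul, sub_eq_zero] at this
    exact this

namespace IsBasic

lemma fderiv_stdVec (h : IsBasic A φ U) (hz : z ∈ (chartAt (Cn 2) x₀).target)
    (hzU : (chartAt (Cn 2) x₀).symm z ∈ U) (k : Fin 2) :
    fderiv ℂ (fun z => φ ((chartAt (Cn 2) x₀).symm z)) z (stdVec k) =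
      coMat A x₀ z k 0 * hCo A φ ((chartAt (Cn 2) x₀).symm z) := by
  rw [← h.hol.holDeriv_chartVec hz hzU, h.eq_mul _ hzU]
  rfl

lemma eventually_fderiv_stdVec (h : IsBasic A φ U) (hz : z ∈ (chartAt (Cn 2) x₀).target)
    (hzU : (chartAt (Cn 2) x₀).symm z ∈ U) : ∀ᶠ z in 𝓝 z, ∀ k,
    fderiv ℂ (fun z => φ ((chartAt (Cn 2) x₀).symm z)) z (stdVec k) =
      coMat A x₀ z k 0 * hCo A φ ((chartAt (Cn 2) x₀).symm z) := by
  filter_upwards [(chartAt (Cn 2) x₀).open_target.mem_nhds hz,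
    ((chartAt (Cn 2) x₀).continuousAt_symm hz).eventually (h.isOpen.mem_nhds hzU)] with y h1 h2 k
    using h.fderiv_stdVec h1 h2 k

lemma contDiffAt_hCo (h : IsBasic A φ U) (hA : IsInvariantCoframeOn lam A)
    (hz : z ∈ (chartAt (Cn 2) x₀).target) (hzU : (chartAt (Cn 2) x₀).symm z ∈ U) :
    ContDiffAt ℝ ∞ (fun z => hCo A φ ((chartAt (Cn 2) x₀).symm z)) z := by
  obtain ⟨Ξ, hΞ⟩ := hA x₀ z hz
  exact contDiffAt_coefficient hΞ (h.hol.eventually_differentiableAt h.isOpen hz hzU)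
    (h.eventually_fderiv_stdVec hz hzU)

lemma continuousOn_hCo (h : IsBasic A φ U) (hA : IsInvariantCoframeOn lam A) :
    ContinuousOn (hCo A φ) U := by
  intro x hx
  have hs := mem_chart_source (Cn 2) x
  have hl := (chartAt (Cn 2) x).left_inv hs
  have h1 := (h.contDiffAt_hCo hA (mem_chart_target (Cn 2) x) (by rwa [hl])).continuousAt
  refine ((ContinuousAt.comp h1 ((chartAt (Cn 2) x).continuousAt hs)).congr ?_).continuousWithinAt
  filter_upwards [(chartAt (Cn 2) x).open_source.mem_nhds hs] with y hy
  simp [(chartAt (Cn 2) x).left_inv hy]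

lemma hasDerivAt_of_vertical (h : IsBasic A φ U) (hA : IsInvariantCoframeOn lam A)
    {c : ℝ → Cn 2} {t : ℝ} {w : Cn 2} (hc : HasDerivAt c w t)
    (hz : c t ∈ (chartAt (Cn 2) x₀).target) (hzU : (chartAt (Cn 2) x₀).symm (c t) ∈ U)
    (hw : (w.ofLp ᵥ* coMat A x₀ (c t)) 0 = 0) :
    HasDerivAt (fun s => φ ((chartAt (Cn 2) x₀).symm (c s))) 0 t ∧
      HasDerivAt (fun s => Complex.normSq (hCo A φ ((chartAt (Cn 2) x₀).symm (c s)))) 0 t := by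
  constructor
  · have d1 := (h.hol x₀ _ hz hzU).hasFDerivAt.restrictScalars ℝ
    have d2 := d1.comp_hasDerivAt t hc
    have e : fderiv ℂ (fun z => φ ((chartAt (Cn 2) x₀).symm z)) (c t) w = 0 := by
      have hw' : w = w 0 • stdVec 0 + w 1 • stdVec 1 := by
        ext k; fin_cases k <;> simp [stdVec]
      rw [hw', map_add, map_smul, map_smul, h.fderiv_stdVec hz hzU, h.fderiv_stdVec hz hzU]
      simp only [Matrix.vecMul, dotProduct, Fin.sum_univ_two] at hw
      simp only [smul_eq_mul]
      linear_combination hCo A φ ((chartAt (Cn 2) x₀).symm (c t)) * hw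
    exact d2.congr_deriv e
  · obtain ⟨Ξ, hΞ⟩ := hA x₀ _ hz
    have e := fderiv_coefficient hΞ (h.hol.eventually_differentiableAt h.isOpen hz hzU)
      (h.eventually_fderiv_stdVec hz hzU) hw
    have d1 := ((h.contDiffAt_hCo hA hz hzU).differentiableAt (by simp)).hasFDerivAt
    have d2 := d1.comp_hasDerivAt t hc
    rw [e] at d2
    set H := hCo A φ ((chartAt (Cn 2) x₀).symm (c t))
    set a := ((w.ofLp ᵥ* coMat A x₀ (c t)) 1).re
    have r1 := Complex.reCLM.hasFDerivAt.comp_hasDerivAt t d2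
    have r2 := Complex.imCLM.hasFDerivAt.comp_hasDerivAt t d2
    have r3 := (r1.mul r1).add (r2.mul r2)
    simp only [Complex.normSq_apply]
    refine r3.congr_deriv ?_
    simp [H]
    ring

end IsBasic

end VerticalDirections

section EllipticFibrations

variable {X : Type*} [TopologicalSpace X] [CompactSpace X] [PreconnectedSpace X]
  [ChartedSpace (Cn 2) X] [IsManifold 𝓘(ℂ, Cn 2) ω X]
  {C : Type*} [TopologicalSpace C] [T2Space C] [ChartedSpace (Cn 1) C] [IsManifold 𝓘(ℂ, Cn 1) ω C]
  {lam : ℝ} {A : X → Matrix (Fin 2) (Fin 2) ℂ} {π : X → C} {x : X} {q : C}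

/-- A uniformized regular fibre. -/
lemma IsEllipticFibration.exists_curve (hπ : IsEllipticFibration π) {p : C}
    (hp : p ∉ critValues π) : ∃ u : Cn 1 → X, MDifferentiable 𝓘(ℂ, Cn 1) 𝓘(ℂ, Cn 2) u ∧
      (∀ ζ, (mfderiv 𝓘(ℂ, Cn 1) 𝓘(ℂ, Cn 2) u ζ (stdVec 0) : Cn 2) ≠ 0) ∧ range u = π ⁻¹' {p} := by
  obtain ⟨Λ, -, -, u, hu, hu0, hr, -⟩ := hπ.elliptic p hp
  let pr : Cn 1 →L[ℂ] ℂ := EuclideanSpace.proj 0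
  have hpr : MDifferentiable 𝓘(ℂ, Cn 1) 𝓘(ℂ, ℂ) pr := pr.differentiable.mdifferentiable
  refine ⟨u ∘ pr, hu.comp hpr, fun ζ h => hu0 (ζ 0) ?_, ?_⟩
  · have e := mfderiv_comp ζ (hu (pr ζ)) (hpr ζ)
    have e2 : mfderiv 𝓘(ℂ, Cn 1) 𝓘(ℂ, ℂ) pr ζ = pr := by
      rw [mfderiv_eq_fderiv]; exact pr.fderiv
    have e3 : mfderiv 𝓘(ℂ, ℂ) 𝓘(ℂ, Cn 2) u (pr ζ) (1 : ℂ) = 0 := by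
      have e4 := congrFun (congrArg DFunLike.coe e) (stdVec 0)
      rw [e2] at e4
      have e5 : pr (stdVec 0) = 1 := by simp [pr, stdVec]
      have e6 : mfderiv 𝓘(ℂ, Cn 1) 𝓘(ℂ, Cn 2) (u ∘ pr) ζ (stdVec 0) =
        mfderiv 𝓘(ℂ, ℂ) 𝓘(ℂ, Cn 2) u (pr ζ) (pr (stdVec 0)) := e4
      rw [e5] at e6
      exact e6.symm.trans h
    have key : ∀ L : ℂ →L[ℂ] Cn 2, L 1 = 0 → L = 0 := fun L h => ContinuousLinearMap.ext_ring h
    exact key _ e3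
  · rw [← hr]
    refine Function.Surjective.range_comp (fun c => ⟨c • stdVec 0, ?_⟩) u
    simp [pr, stdVec]

lemma holDeriv_vertical_of_regular (hA : IsInvariantCoframeOn lam A) (hd : ∀ x, (A x).det ≠ 0)
    (hπ : IsEllipticFibration π) (hx : x ∈ chartDom π q) (hp : π x ∉ critValues π) {w : Cn 2}
    (hw : coframe A x w 0 = 0) : holDeriv (chartFun π q) x w = 0 := by
  obtain ⟨u, hu, hu0, hr⟩ := hπ.exists_curve hp
  obtain ⟨ζ, rfl⟩ : x ∈ range u := by rw [hr]; rfl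
  set V : Cn 2 := mfderiv 𝓘(ℂ, Cn 1) 𝓘(ℂ, Cn 2) u ζ (stdVec 0) with hV
  have h1 : coframe A (u ζ) V 0 = 0 := velCo_eq_zero_of_entire hA hu ζ
  have h2 : holDeriv (chartFun π q) (u ζ) V = 0 := by
    refine ((holOn_chartFun hπ.holo q).holDeriv_mfderiv (hu ζ) hx _).trans ?_
    have e : chartFun π q ∘ u = fun _ => chartFun π q (u ζ) := by
      ext y
      have : u y ∈ π ⁻¹' {π (u ζ)} := by rw [← hr]; exact ⟨y, rfl⟩
      have h : π (u y) = π (u ζ) := this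
      simp only [Function.comp_apply, chartFun, h]
    rw [e]; simp
  have h3 : coframe A (u ζ) V 1 ≠ 0 := fun h => hu0 ζ (coframe_eq_zero (hd _) (by
    ext k; fin_cases k
    · exact h1
    · exact h))
  have h4 : w - (coframe A (u ζ) w 1 / coframe A (u ζ) V 1) • V = 0 := by
    refine coframe_eq_zero (hd (u ζ)) ?_
    ext k
    rw [coframe_sub, coframe_smul]
    fin_cases k
    · simp [hw, h1]
    · simp [div_mul_cancel₀ _ h3]
  rw [sub_eq_zero.1 h4, holDeriv_smul, h2, mul_zero]

theorem isBasic_chartFun (hA : IsInvariantCoframeOn lam A) (hd : ∀ x, (A x).det ≠ 0)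
    (hπ : IsEllipticFibration π) (q : C) : IsBasic A (chartFun π q) (chartDom π q) := by
  refine isBasic_of_vertical (isOpen_chartDom hπ.holo q) (holOn_chartFun hπ.holo q) hd ?_
  intro x hx w hw
  have hs := mem_chart_source (Cn 2) x
  have hl := (chartAt (Cn 2) x).left_inv hs
  set f : Cn 2 → ℂ := fun z => chartFun π q ((chartAt (Cn 2) x).symm z) with hf
  set z₀ := chartAt (Cn 2) x x with hz₀
  have hz₀t : z₀ ∈ (chartAt (Cn 2) x).target := mem_chart_target (Cn 2) x
  have hzU : (chartAt (Cn 2) x).symm z₀ ∈ chartDom π q := by rwa [hl]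
  have hfd := ((holOn_chartFun hπ.holo q).contDiffAt (isOpen_chartDom hπ.holo q) hz₀t
    hzU).fderiv_right (m := ∞) le_rfl
  have hfc : ∀ v, ContinuousAt (fun z => fderiv ℂ f z v) z₀ := fun v =>
    (hfd.clm_apply contDiffAt_const).continuousAt
  have hAc : ∀ k, ContinuousAt (fun z => coMat A x z k 0) z₀ := fun k =>
    (contDiffAt_coMat hA hz₀t k 0).continuousAt
  have key : fderiv ℂ f z₀ (stdVec 0) * coMat A x z₀ 1 0 =
      fderiv ℂ f z₀ (stdVec 1) * coMat A x z₀ 0 0 := by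
    by_contra hne
    have h1 := (((hfc (stdVec 0)).mul (hAc 1)).sub ((hfc (stdVec 1)).mul (hAc 0))).eventually_ne
      (sub_ne_zero.2 hne)
    have h2 : ∀ᶠ y in 𝓝 x, fderiv ℂ f (chartAt (Cn 2) x y) (stdVec 0) *
        coMat A x (chartAt (Cn 2) x y) 1 0 - fderiv ℂ f (chartAt (Cn 2) x y) (stdVec 1) *
        coMat A x (chartAt (Cn 2) x y) 0 0 ≠ 0 := ((chartAt (Cn 2) x).continuousAt hs).eventually h1
    obtain ⟨y, ⟨⟨hy1, hys⟩, hyd⟩, hy⟩ := mem_closure_iff_nhds.1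
      (dense_regular hπ.holo hπ.surj x) _ (inter_mem (inter_mem h2
        ((chartAt (Cn 2) x).open_source.mem_nhds hs)) ((isOpen_chartDom hπ.holo q).mem_nhds hx))
    have hyl := (chartAt (Cn 2) x).left_inv hys
    have hyt := (chartAt (Cn 2) x).map_source hys
    set zy := chartAt (Cn 2) x y with hzy
    have hyU : (chartAt (Cn 2) x).symm zy ∈ chartDom π q := by rwa [hyl]
    let a : Cn 2 := coMat A x zy 1 0 • stdVec 0 - coMat A x zy 0 0 • stdVec 1
    have h3 : coframe A ((chartAt (Cn 2) x).symm zy) (chartVecC x zy a) 0 = 0 := by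
      have := congrFun (coframe_chartVec (A := A) hyt a) 0
      refine this.trans ?_
      simp [a, stdVec, Matrix.vecMul, dotProduct, Fin.sum_univ_two]
      ring
    have h4 := holDeriv_vertical_of_regular hA hd hπ hyU (by rw [hyl]; exact hy) h3
    rw [(holOn_chartFun hπ.holo q).holDeriv_chartVec hyt hyU] at h4
    apply hy1
    rw [← h4, map_sub, map_smul, map_smul]
    simp only [smul_eq_mul, hf]
    ring
  have hE : holDeriv (chartFun π q) x w = fderiv ℂ f z₀ w := rfl
  have hco : (w.ofLp ᵥ* coMat A x z₀) 0 = 0 := by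
    rw [← coframe_chartVec hz₀t w, chartVec_eq hz₀t w, hl]
    have : fderiv ℂ (chartAt (Cn 2) x ∘ (chartAt (Cn 2) x).symm) z₀ = ContinuousLinearMap.id ℂ _ := by
      rw [← fderiv_id (x := z₀)]
      refine Filter.EventuallyEq.fderiv_eq ?_
      filter_upwards [(chartAt (Cn 2) x).open_target.mem_nhds hz₀t] with y hy
      simp [(chartAt (Cn 2) x).right_inv hy]
    rw [this]; exact hw
  have hw' : w = w 0 • stdVec 0 + w 1 • stdVec 1 := by
    ext k; fin_cases k <;> simp [stdVec]
  have hdet := det_coMat_ne_zero hA hz₀t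
  rw [Matrix.det_fin_two] at hdet
  simp only [Matrix.vecMul, dotProduct, Fin.sum_univ_two] at hco
  rw [hE, hw', map_add, map_smul, map_smul]
  simp only [smul_eq_mul]
  by_cases h0 : coMat A x z₀ 0 0 = 0
  · have h1 : coMat A x z₀ 1 0 ≠ 0 := fun h1 => hdet (by rw [h0, h1]; ring)
    have hw1 : w 1 = 0 := by simpa [h0, h1] using hco
    have hf0 : fderiv ℂ f z₀ (stdVec 0) = 0 := by simpa [h0, h1] using key
    rw [hw1, hf0]; ring
  · apply mul_left_cancel₀ h0
    linear_combination (fderiv ℂ f z₀ (stdVec 0)) * hco - w 1 * key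

lemma isCritical_iff_hCo (hA : IsInvariantCoframeOn lam A) (hd : ∀ x, (A x).det ≠ 0)
    (hπ : IsEllipticFibration π) (hx : x ∈ chartDom π q) :
    mfderiv 𝓘(ℂ, Cn 2) 𝓘(ℂ, Cn 1) π x = 0 ↔ hCo A (chartFun π q) x = 0 := by
  rw [isCritical_iff hπ.holo hx]
  refine ⟨fun h => h _, fun h w => ?_⟩
  rw [(isBasic_chartFun hA hd hπ q).eq_mul x hx, h, mul_zero]

lemma hCo_ne_zero (hA : IsInvariantCoframeOn lam A) (hd : ∀ x, (A x).det ≠ 0)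
    (hπ : IsEllipticFibration π) (hx : x ∈ chartDom π q) (hp : π x ∉ critValues π) :
    hCo A (chartFun π q) x ≠ 0 := fun h =>
  hp ⟨x, rfl, (isCritical_iff_hCo hA hd hπ hx).2 h⟩

/-- The norm of the coefficient is constant along regular fibres. -/
theorem normSq_hCo_eq (hA : IsInvariantCoframeOn lam A) (hd : ∀ x, (A x).det ≠ 0)
    (hπ : IsEllipticFibration π) {y : X} (hx : x ∈ chartDom π q) (hp : π x ∉ critValues π)
    (h : π y = π x) :
    Complex.normSq (hCo A (chartFun π q) y) = Complex.normSq (hCo A (chartFun π q) x) := by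
  obtain ⟨u, hu, -, hr⟩ := hπ.exists_curve hp
  obtain ⟨ζ, rfl⟩ : x ∈ range u := by rw [hr]; rfl
  obtain ⟨η, rfl⟩ : y ∈ range u := by rw [hr]; exact h
  have hfib : ∀ y, π (u y) = π (u ζ) := fun y => by
    have : u y ∈ π ⁻¹' {π (u ζ)} := by rw [← hr]; exact ⟨y, rfl⟩
    exact this
  have hD : ∀ t : ℝ, HasDerivAt (fun s : ℝ =>
      Complex.normSq (hCo A (chartFun π q) (u (ζ + s • (η - ζ))))) 0 t := by
    intro t
    set ζt := ζ + t • (η - ζ) with hζt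
    have hs := mem_chart_source (Cn 2) (u ζt)
    have hl := (chartAt (Cn 2) (u ζt)).left_inv hs
    have d1 := ((hu ζt).chart_comp hs).hasFDerivAt.restrictScalars ℝ
    have d0 : HasDerivAt (fun s : ℝ => ζ + s • (η - ζ)) (η - ζ) t := by
      simpa using ((hasDerivAt_id t).smul_const (η - ζ)).const_add ζ
    have d2 := HasFDerivAt.comp_hasDerivAt (f := fun s : ℝ => ζ + s • (η - ζ)) t d1 d0
    have hvel : ((fderiv ℂ (chartAt (Cn 2) (u ζt) ∘ u) ζt (η - ζ)).ofLp ᵥ*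
        coMat A (u ζt) (chartAt (Cn 2) (u ζt) (u ζt))) 0 = 0 := by
      have e1 : (fderiv ℂ (chartAt (Cn 2) (u ζt) ∘ u) ζt (η - ζ)) =
          (η - ζ) 0 • fderiv ℂ (chartAt (Cn 2) (u ζt) ∘ u) ζt (stdVec 0) := by
        conv_lhs => rw [Cn.one_eq (η - ζ), map_smul]
      have e2 := congrFun (velCo_eq_curveCo (A := A) (hu ζt) hs) 0
      rw [velCo_eq_zero_of_entire hA hu] at e2
      rw [e1, WithLp.ofLp_smul, Matrix.smul_vecMul, Pi.smul_apply]
      exact (congrArg ((η - ζ) 0 • ·) e2.symm).trans (smul_zero _)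
    have := ((isBasic_chartFun hA hd hπ q).hasDerivAt_of_vertical hA (x₀ := u ζt) d2
      (mem_chart_target (Cn 2) _) (by
        show (chartAt (Cn 2) (u ζt)).symm (chartAt (Cn 2) (u ζt) (u ζt)) ∈ chartDom π q
        rw [hl]; show π _ ∈ (chartAt (Cn 1) q).source; rw [hfib]; exact hx) hvel).2
    refine this.congr_of_eventuallyEq ?_
    have hc : ContinuousAt (fun s : ℝ => u (ζ + s • (η - ζ))) t :=
      ContinuousAt.comp (f := fun s : ℝ => ζ + s • (η - ζ)) (hu _).continuousAt d0.continuousAt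
    filter_upwards [hc.eventually ((chartAt (Cn 2) (u ζt)).open_source.mem_nhds hs)] with s hs
    show _ = Complex.normSq (hCo A (chartFun π q) ((chartAt (Cn 2) (u ζt)).symm
      (chartAt (Cn 2) (u ζt) (u (ζ + s • (η - ζ))))))
    rw [(chartAt (Cn 2) (u ζt)).left_inv hs]
  have := is_const_of_deriv_eq_zero (fun t => (hD t).differentiableAt) (fun t => (hD t).deriv) 1 0
  simpa using this

end EllipticFibrations

section ChartCurves

variable {X : Type*} [TopologicalSpace X] [ChartedSpace (Cn 2) X] [IsManifold 𝓘(ℂ, Cn 2) ω X]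
  {x x₀ : X} {w : Cn 1 → Cn 2} {ζ : Cn 1}

lemma mdifferentiableAt_symm_comp (hw : DifferentiableAt ℂ w ζ)
    (hz : w ζ ∈ (chartAt (Cn 2) x₀).target) :
    MDifferentiableAt 𝓘(ℂ, Cn 1) 𝓘(ℂ, Cn 2) (fun ζ => (chartAt (Cn 2) x₀).symm (w ζ)) ζ := by
  have := isManifold_complex_one 2 X
  have h1 : MDifferentiableAt 𝓘(ℂ, Cn 2) 𝓘(ℂ, Cn 2) (chartAt (Cn 2) x₀).symm (w ζ) :=
    ((contMDiffOn_chart_symm (I := 𝓘(ℂ, Cn 2)) (n := 1) (x := x₀)).contMDiffAt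
      ((chartAt (Cn 2) x₀).open_target.mem_nhds hz)).mdifferentiableAt (by simp)
  exact h1.comp ζ hw.mdifferentiableAt

lemma mfderiv_symm_comp (hw : DifferentiableAt ℂ w ζ) (hz : w ζ ∈ (chartAt (Cn 2) x₀).target)
    (v : Cn 1) : (mfderiv 𝓘(ℂ, Cn 1) 𝓘(ℂ, Cn 2) (fun ζ => (chartAt (Cn 2) x₀).symm (w ζ)) ζ v : Cn 2) =
      chartVecC x₀ (w ζ) (fderiv ℂ w ζ v) := by
  refine (mfderiv_apply_eq_chartVec (mdifferentiableAt_symm_comp hw hz)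
    ((chartAt (Cn 2) x₀).map_target hz) v).trans ?_
  have e : chartAt (Cn 2) x₀ ∘ (fun ζ => (chartAt (Cn 2) x₀).symm (w ζ)) =ᶠ[𝓝 ζ] w := by
    filter_upwards [hw.continuousAt.eventually ((chartAt (Cn 2) x₀).open_target.mem_nhds hz)]
      with y hy using (chartAt (Cn 2) x₀).right_inv hy
  rw [e.fderiv_eq, (chartAt (Cn 2) x₀).right_inv hz]
  exact (chartVec_eq hz _).symm

lemma chartVecC_self (x : X) (v : Cn 2) : chartVecC x (chartAt (Cn 2) x x) v = v := by
  have hz₀t := mem_chart_target (Cn 2) x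
  refine (chartVec_eq hz₀t v).trans ?_
  rw [(chartAt (Cn 2) x).left_inv (mem_chart_source _ x)]
  have : fderiv ℂ (chartAt (Cn 2) x ∘ (chartAt (Cn 2) x).symm) (chartAt (Cn 2) x x) =
      ContinuousLinearMap.id ℂ _ := by
    rw [← fderiv_id (x := chartAt (Cn 2) x x)]
    refine Filter.EventuallyEq.fderiv_eq ?_
    filter_upwards [(chartAt (Cn 2) x).open_target.mem_nhds hz₀t] with y hy
    simp [(chartAt (Cn 2) x).right_inv hy]
  rw [this]; rfl

lemma coMat_self (A : X → Matrix (Fin 2) (Fin 2) ℂ) (x : X) (v : Cn 2) :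
    v.ofLp ᵥ* coMat A x (chartAt (Cn 2) x x) = coframe A x v := by
  have h := coframe_chartVec (A := A) (mem_chart_target (Cn 2) x) v
  rw [← h]
  have e : (chartVec x (chartAt (Cn 2) x x) v : Cn 2) = v := chartVecC_self x v
  rw [e, (chartAt (Cn 2) x).left_inv (mem_chart_source _ x)]

end ChartCurves

section LocalSections

variable {X : Type*} [TopologicalSpace X] [ChartedSpace (Cn 2) X] [IsManifold 𝓘(ℂ, Cn 2) ω X]
  {C : Type*} [TopologicalSpace C] [ChartedSpace (Cn 1) C] [IsManifold 𝓘(ℂ, Cn 1) ω C]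
  {A : X → Matrix (Fin 2) (Fin 2) ℂ} {π : X → C} {x : X} {q : C}

/-- A local section of a holomorphic map to a curve, in a given direction. -/
theorem exists_local_section (hπ : MDifferentiable 𝓘(ℂ, Cn 2) 𝓘(ℂ, Cn 1) π)
    (hx : x ∈ chartDom π q) {V : Cn 2} (hV : holDeriv (chartFun π q) x V ≠ 0) :
    ∃ s : Cn 1 → X, s (chartAt (Cn 1) q (π x)) = x ∧
      (∀ᶠ ζ in 𝓝 (chartAt (Cn 1) q (π x)), MDifferentiableAt 𝓘(ℂ, Cn 1) 𝓘(ℂ, Cn 2) s ζ ∧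
        s ζ ∈ chartDom π q ∧ chartAt (Cn 1) q (π (s ζ)) = ζ) ∧
      ∃ c : ℂ, (mfderiv 𝓘(ℂ, Cn 1) 𝓘(ℂ, Cn 2) s (chartAt (Cn 1) q (π x)) (stdVec 0) : Cn 2) =
        c • V := by
  have hs := mem_chart_source (Cn 2) x
  have hl := (chartAt (Cn 2) x).left_inv hs
  set z₀ := chartAt (Cn 2) x x with hz₀
  have hz₀t : z₀ ∈ (chartAt (Cn 2) x).target := mem_chart_target (Cn 2) x
  set p := chartAt (Cn 1) q (π x) with hp
  let f : Cn 2 → ℂ := fun z => chartFun π q ((chartAt (Cn 2) x).symm z)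
  have hf : ContDiffAt ℂ ∞ f z₀ := (holOn_chartFun hπ q).contDiffAt (isOpen_chartDom hπ q) hz₀t
    (by rwa [hl])
  let F : ℂ → ℂ := fun t => f (z₀ + t • V)
  have hF : ContDiffAt ℂ ∞ F 0 := by
    refine ContDiffAt.comp (0 : ℂ) (g := f) (f := fun t : ℂ => z₀ + t • V) ?_ (by fun_prop)
    simpa using hf
  have hF' : HasDerivAt F (holDeriv (chartFun π q) x V) 0 := by
    have d1 : HasFDerivAt f (fderiv ℂ f z₀) (z₀ + (0 : ℂ) • V) := by
      simpa using (hf.differentiableAt (by simp)).hasFDerivAt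
    have d2 : HasDerivAt (fun t : ℂ => z₀ + t • V) V 0 := by
      simpa using ((hasDerivAt_id (0 : ℂ)).smul_const V).const_add z₀
    exact d1.comp_hasDerivAt (0 : ℂ) d2
  let e : ℂ ≃L[ℂ] ℂ := ContinuousLinearEquiv.unitsEquivAut ℂ (Units.mk0 _ hV)
  have hFe : HasFDerivAt F (e : ℂ →L[ℂ] ℂ) 0 := by
    refine hF'.hasFDerivAt.congr_fderiv ?_
    ext; simp [e]
  have hn : (∞ : WithTop ℕ∞) ≠ 0 := by simp
  have hst := hF.hasStrictFDerivAt' hFe hn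
  have hF0 : F 0 = p 0 := by simp [F, f, hl, chartFun, hp]
  set Ginv := hF.localInverse hFe hn with hG
  have hG0 : Ginv (p 0) = 0 := by rw [← hF0]; exact hF.localInverse_apply_image hFe hn
  have hGs : ContDiffAt ℂ ∞ Ginv (p 0) := by rw [← hF0]; exact hF.to_localInverse hFe hn
  have hGr : ∀ᶠ t in 𝓝 (p 0), F (Ginv t) = t := by rw [← hF0]; exact hst.eventually_right_inverse
  let pr : Cn 1 →L[ℂ] ℂ := EuclideanSpace.proj 0
  have hpr : Tendsto pr (𝓝 p) (𝓝 (p 0)) := pr.continuous.tendsto p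
  let w : Cn 1 → Cn 2 := fun ζ => z₀ + Ginv (pr ζ) • V
  have hw0 : w p = z₀ := by
    show z₀ + Ginv (p 0) • V = z₀
    rw [hG0, zero_smul, add_zero]
  have hwd : ∀ᶠ ζ in 𝓝 p, HasFDerivAt w ((fderiv ℂ Ginv (pr ζ)).comp pr |>.smulRight V) ζ := by
    have : ∀ᶠ t in 𝓝 (p 0), DifferentiableAt ℂ Ginv t :=
      ((hGs.of_le two_le_infty).eventually (by simp)).mono
        fun t ht => ht.differentiableAt two_ne_zero
    filter_upwards [hpr.eventually this] with ζ hζ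
    exact ((hζ.hasFDerivAt.comp ζ pr.hasFDerivAt).smul_const V).const_add z₀
  have hwt : ∀ᶠ ζ in 𝓝 p, w ζ ∈ (chartAt (Cn 2) x).target ∧
      (chartAt (Cn 2) x).symm (w ζ) ∈ chartDom π q := by
    have hc := hwd.self_of_nhds.continuousAt
    rw [ContinuousAt, hw0] at hc
    filter_upwards [hc.eventually ((chartAt (Cn 2) x).open_target.mem_nhds hz₀t),
      hc.eventually (((chartAt (Cn 2) x).continuousAt_symm hz₀t).eventually
        ((isOpen_chartDom hπ q).mem_nhds (by rwa [hl])))] with ζ h1 h2 using ⟨h1, h2⟩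
  refine ⟨fun ζ => (chartAt (Cn 2) x).symm (w ζ), by simp only [hw0, hl], ?_, ?_⟩
  · filter_upwards [hwd, hwt, hpr.eventually hGr] with ζ h1 h2 h3
    exact ⟨mdifferentiableAt_symm_comp h1.differentiableAt h2.1, h2.2, Cn.one_ext h3⟩
  · refine ⟨fderiv ℂ Ginv (pr p) (pr (stdVec 0)), ?_⟩
    rw [mfderiv_symm_comp hwd.self_of_nhds.differentiableAt hwt.self_of_nhds.1, hw0,
      chartVecC_self, hwd.self_of_nhds.fderiv]
    rfl

end LocalSections

section KahlerEinstein

variable {X : Type*} [TopologicalSpace X] [CompactSpace X] [PreconnectedSpace X]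
  [ChartedSpace (Cn 2) X] [IsManifold 𝓘(ℂ, Cn 2) ω X]
  {C : Type*} [TopologicalSpace C] [T2Space C] [ChartedSpace (Cn 1) C] [IsManifold 𝓘(ℂ, Cn 1) ω C]
  {lam : ℝ} {A : X → Matrix (Fin 2) (Fin 2) ℂ} {π : X → C} {x : X} {q : C}

open Classical in
/-- The metric `4 |dφ / h|²` on the base curve, where `dφ = h θ₁`. -/
def gKEBase (A : X → Matrix (Fin 2) (Fin 2) ℂ) (π : X → C) (hs : Function.Surjective π) :
    BilinField 1 C := fun q =>
  let B : Cn 1 →L[ℝ] Cn 1 →L[ℝ] ℝ := if q ∈ critValues π then 0 else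
    (4 / Complex.normSq (hCo A (chartFun π q) (Function.surjInv hs q))) • innerSL ℝ
  B

lemma gKEBase_of_mem (hs : Function.Surjective π) (hq : q ∈ critValues π) (v w : Cn 1) :
    gKEBase A π hs q v w = 0 := by
  have : gKEBase A π hs q = (0 : Cn 1 →L[ℝ] Cn 1 →L[ℝ] ℝ) := if_pos hq
  rw [this]; rfl

lemma gKEBase_apply (hA : IsInvariantCoframeOn lam A) (hd : ∀ x, (A x).det ≠ 0)
    (hπ : IsEllipticFibration π) (hq : π x ∉ critValues π) (v w : Cn 1) :
    gKEBase A π hπ.surj (π x) v w =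
      4 / Complex.normSq (hCo A (chartFun π (π x)) x) * (v 0 * conj (w 0)).re := by
  have e : gKEBase A π hπ.surj (π x) = ((4 / Complex.normSq (hCo A (chartFun π (π x))
      (Function.surjInv hπ.surj (π x)))) • innerSL ℝ : Cn 1 →L[ℝ] Cn 1 →L[ℝ] ℝ) := if_neg hq
  rw [e, normSq_hCo_eq hA hd hπ (mem_chartDom π x) hq (Function.surjInv_eq hπ.surj (π x))]
  show 4 / Complex.normSq (hCo A (chartFun π (π x)) x) * inner ℝ v w = _
  rw [PiLp.inner_apply]
  simp [mul_comm]

lemma hCo_chartFun_trans (hπ : MDifferentiable 𝓘(ℂ, Cn 2) 𝓘(ℂ, Cn 1) π) {q q' : C}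
    (hq : x ∈ chartDom π q) (hq' : x ∈ chartDom π q') :
    hCo A (chartFun π q') x = transDeriv q q' (π x) * hCo A (chartFun π q) x :=
  holDeriv_chartFun_trans hπ hq hq' _

lemma hcoeff_conformal {g : BilinField 1 C} {c : ℝ} {z : Cn 1} (hz : z ∈ (chartAt (Cn 1) q).target)
    {p : C} (hp : p = (chartAt (Cn 1) q).symm z)
    (hg : ∀ v w : Cn 1, g p v w = c * (v 0 * conj (w 0)).re) (i j : Fin 1) :
    hcoeff g q z i j = ((c / 2 * Complex.normSq (transDeriv q p p) : ℝ) : ℂ) := by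
  subst hp
  rw [hcoeff_eq_of_apply _ q z (fun v w => c * (v 0 * conj (w 0)).re) hg]
  have e1 : ∀ k, chartVecC q z (stdVec k) 0 = transDeriv q ((chartAt (Cn 1) q).symm z)
      ((chartAt (Cn 1) q).symm z) := fun k => by
    have : chartVecC q z (stdVec k) = _ := chartVec_eq hz (stdVec k)
    rw [this, Subsingleton.elim k 0, transDeriv, (chartAt (Cn 1) q).right_inv hz]
  simp only [PiLp.smul_apply, e1, map_mul, smul_eq_mul, Complex.conj_I]
  set τ := transDeriv q ((chartAt (Cn 1) q).symm z) ((chartAt (Cn 1) q).symm z)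
  have e3 : (τ * conj τ).re = Complex.normSq τ := by rw [Complex.mul_conj, Complex.ofReal_re]
  have e4 : (τ * (-Complex.I * conj τ)).re = 0 := by
    simp; ring
  rw [e3, e4]
  push_cast
  ring

lemma hcoeff_gKEBase (hA : IsInvariantCoframeOn lam A) (hd : ∀ x, (A x).det ≠ 0)
    (hπ : IsEllipticFibration π) {z : Cn 1} (hz : z ∈ (chartAt (Cn 1) q).target)
    (hx : π x = (chartAt (Cn 1) q).symm z) (hp : π x ∉ critValues π) (i j : Fin 1) :
    hcoeff (gKEBase A π hπ.surj) q z i j =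
      ((2 / Complex.normSq (hCo A (chartFun π q) x) : ℝ) : ℂ) := by
  have hxd : x ∈ chartDom π q := by
    show π x ∈ (chartAt (Cn 1) q).source
    rw [hx]; exact (chartAt (Cn 1) q).map_target hz
  rw [hcoeff_conformal hz hx (fun v w => gKEBase_apply hA hd hπ hp v w),
    hCo_chartFun_trans (A := A) hπ.holo hxd (mem_chartDom π x), map_mul]
  have n1 := (Complex.normSq_pos.2 (hCo_ne_zero hA hd hπ hxd hp)).ne'
  have n2 := (Complex.normSq_pos.2 (transDeriv_ne_zero hxd (mem_chartDom π x))).ne'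
  congr 1
  field_simp
  norm_num

/-- The coefficient of the metric through a local section. -/
lemma velCo_section (hA : IsInvariantCoframeOn lam A) (hd : ∀ x, (A x).det ≠ 0)
    (hπ : IsEllipticFibration π) {s : Cn 1 → X} {ζ₀ : Cn 1}
    (h : ∀ᶠ ζ in 𝓝 ζ₀, MDifferentiableAt 𝓘(ℂ, Cn 1) 𝓘(ℂ, Cn 2) s ζ ∧
        s ζ ∈ chartDom π q ∧ chartAt (Cn 1) q (π (s ζ)) = ζ) :
    velCo A s ζ₀ 0 * hCo A (chartFun π q) (s ζ₀) = 1 := by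
  obtain ⟨h1, h2, -⟩ := h.self_of_nhds
  have e := (holOn_chartFun hπ.holo q).holDeriv_mfderiv h1 h2 (stdVec 0)
  have e2 : chartFun π q ∘ s =ᶠ[𝓝 ζ₀] (EuclideanSpace.proj 0 : Cn 1 →L[ℂ] ℂ) := by
    filter_upwards [h] with ζ hζ
    simp [chartFun, hζ.2.2]
  rw [e2.fderiv_eq, ContinuousLinearMap.fderiv] at e
  have e3 := (isBasic_chartFun hA hd hπ q).eq_mul _ h2
    (mfderiv 𝓘(ℂ, Cn 1) 𝓘(ℂ, Cn 2) s ζ₀ (stdVec 0) : Cn 2)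
  refine e3.symm.trans (e.trans ?_)
  simp [stdVec]

/-- Local sections through regular points, and the metric in terms of them. -/
lemma exists_section_hcoeff (hA : IsInvariantCoframeOn lam A) (hd : ∀ x, (A x).det ≠ 0)
    (hπ : IsEllipticFibration π) (hq : q ∉ critValues π) :
    ∃ s : Cn 1 → X, (∀ᶠ ζ in 𝓝 (chartAt (Cn 1) q q), MDifferentiableAt 𝓘(ℂ, Cn 1) 𝓘(ℂ, Cn 2) s ζ) ∧
      ∀ᶠ ζ in 𝓝 (chartAt (Cn 1) q q), velCo A s ζ 0 ≠ 0 ∧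
        ∀ i j, hcoeff (gKEBase A π hπ.surj) q ζ i j =
          ((2 * Complex.normSq (velCo A s ζ 0) : ℝ) : ℂ) := by
  obtain ⟨x, rfl⟩ := hπ.surj q
  obtain ⟨s, -, h2, -⟩ := exists_local_section hπ.holo (mem_chartDom π x)
    (hCo_ne_zero hA hd hπ (mem_chartDom π x) hq)
  refine ⟨s, h2.mono fun ζ h => h.1, ?_⟩
  filter_upwards [h2.eventually_nhds, (chartAt (Cn 1) (π x)).open_target.mem_nhds
    (mem_chart_target _ _), ((chartAt (Cn 1) (π x)).continuousAt_symm
      (mem_chart_target (Cn 1) (π x))).eventually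
      ((isClosed_critValues hπ.holo).isOpen_compl.mem_nhds (by
        rwa [(chartAt (Cn 1) (π x)).left_inv (mem_chart_source _ _)]))] with ζ h3 h4 h5
  have e := velCo_section hA hd hπ h3
  refine ⟨left_ne_zero_of_mul_eq_one e, fun i j => ?_⟩
  obtain ⟨-, k2, k3⟩ := h3.self_of_nhds
  have k4 : π (s ζ) = (chartAt (Cn 1) (π x)).symm ζ := by
    rw [← k3, (chartAt (Cn 1) (π x)).left_inv k2, k3]
  rw [hcoeff_gKEBase hA hd hπ h4 k4 (by rwa [k4])]
  congr 1
  have n := congrArg Complex.normSq e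
  rw [map_mul, map_one] at n
  rw [div_eq_iff (right_ne_zero_of_mul_eq_one n)]
  linear_combination -2 * n

/-- The derivative of `π`, with values in the model space. -/
def baseDeriv (π : X → C) (x : X) (v : Cn 2) : Cn 1 := mfderiv 𝓘(ℝ, Cn 2) 𝓘(ℝ, Cn 1) π x v

lemma baseDeriv_zero (hA : IsInvariantCoframeOn lam A) (hd : ∀ x, (A x).det ≠ 0)
    (hπ : IsEllipticFibration π) (v : Cn 2) :
    baseDeriv π x v 0 = coframe A x v 0 * hCo A (chartFun π (π x)) x :=
  (congrArg (fun v : Cn 1 => v 0) (mfderiv_real_apply (hπ.holo x) v)).trans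
    ((mfderiv_apply_zero hπ.holo x v).trans
      ((isBasic_chartFun hA hd hπ (π x)).eq_mul x (mem_chartDom π x) v))

/-- The pull-back of the metric of the base. -/
lemma frameForm_eq_gKEBase (hA : IsInvariantCoframeOn lam A) (hd : ∀ x, (A x).det ≠ 0)
    (hπ : IsEllipticFibration π) (hx : π x ∉ critValues π) (v w : Cn 2) :
    frameForm A (hermMat 2 0 0) x v w =
      gKEBase A π hπ.surj (π x) (baseDeriv π x v) (baseDeriv π x w) := by
  refine Eq.trans ?_ (gKEBase_apply hA hd hπ hx (baseDeriv π x v) (baseDeriv π x w)).symm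
  rw [baseDeriv_zero hA hd hπ, baseDeriv_zero hA hd hπ]
  have h0 := (Complex.normSq_pos.2 (hCo_ne_zero hA hd hπ (mem_chartDom π x) hx)).ne'
  set H := hCo A (chartFun π (π x)) x
  have e2 : coframe A x v 0 * H * conj (coframe A x w 0 * H) =
      (Complex.normSq H : ℂ) * (coframe A x v 0 * conj (coframe A x w 0)) := by
    rw [← Complex.mul_conj, map_mul]; ring
  rw [e2, Complex.re_ofReal_mul, div_mul_eq_mul_div, mul_left_comm,
    mul_div_cancel_left₀ _ h0]
  simp [frameForm, dotProduct, mulVec, hermMat, Fin.sum_univ_two]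
  ring

theorem isBaseKahlerEinstein_gKEBase (hA : IsInvariantCoframeOn lam A) (hd : ∀ x, (A x).det ≠ 0)
    (hπ : IsEllipticFibration π) : IsBaseKahlerEinstein π (gKEBase A π hπ.surj) where
  metric :=
    { symm := fun q hq v w => by
        obtain ⟨x, rfl⟩ := hπ.surj q
        refine (gKEBase_apply hA hd hπ hq v w).trans
          (Eq.trans ?_ (gKEBase_apply hA hd hπ hq w v).symm)
        congr 1
        simp; ring
      J_inv := fun q hq v w => by
        obtain ⟨x, rfl⟩ := hπ.surj q
        have key : ∀ v w : Cn 1, ((Complex.I • v) 0 * conj ((Complex.I • w) 0)).re =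
            (v 0 * conj (w 0)).re := fun v w => by simp
        let v' : Cn 1 := v
        let w' : Cn 1 := w
        exact (gKEBase_apply hA hd hπ hq (Complex.I • v') (Complex.I • w')).trans
          (Eq.trans (congrArg _ (key v' w')) (gKEBase_apply hA hd hπ hq v w).symm)
      smooth := fun q hq i j => by
        obtain ⟨s, h1, h2⟩ := exists_section_hcoeff hA hd hπ hq
        have h3 := Complex.ofRealCLM.contDiff.contDiffAt.comp _ (contDiffAt_const (c := (2 : ℝ)).mul
          (contDiffAt_normSq (contDiffAt_velCo hA h1 0)))
        exact h3.congr_of_eventuallyEq (h2.mono fun ζ h => h.2 i j)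
      pos := fun q hq v hv => by
        obtain ⟨x, rfl⟩ := hπ.surj q
        have e : gKEBase A π hπ.surj (π x) v v = _ := gKEBase_apply hA hd hπ hq v v
        rw [e, Complex.mul_conj, Complex.ofReal_re]
        have h1 := Complex.normSq_pos.2 (hCo_ne_zero hA hd hπ (mem_chartDom π x) hq)
        have h2 : (show Cn 1 from v) 0 ≠ 0 := fun h => hv (Cn.one_ext h)
        have h3 := Complex.normSq_pos.2 h2
        exact mul_pos (by positivity) h3 }
  einstein q hq i j := by
    obtain ⟨s, h1, h2⟩ := exists_section_hcoeff hA hd hπ hq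
    rw [Subsingleton.elim i 0, Subsingleton.elim j 0, h2.self_of_nhds.2, kahlerRic, neg_inj]
    have e : ∀ᶠ ζ in 𝓝 (chartAt (Cn 1) q q),
        ((Real.log (hcoeff (gKEBase A π hπ.surj) q ζ).det.re : ℝ) : ℂ) =
          (Real.log 2 : ℝ) + ((Real.log (Complex.normSq (velCo A s ζ 0)) : ℝ) : ℂ) := by
      filter_upwards [h2] with ζ hζ
      rw [Matrix.det_fin_one, hζ.2, Complex.ofReal_re, Real.log_mul two_ne_zero
        (Complex.normSq_pos.2 hζ.1).ne']
      push_cast; rfl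
    have e2 := e.eventually_nhds.mono fun ζ h => dzbar_congr (k := 0) h
    rw [dz_congr e2, dz_dzbar_add contDiffAt_const (contDiffAt_ofReal
      ((contDiffAt_normSq ((contDiffAt_velCo hA h1 0).of_le two_le_infty)).log
        (Complex.normSq_pos.2 h2.self_of_nhds.1).ne')),
      dz_dzbar_log_normSq_velCo hA h1 h2.self_of_nhds.1]
    have e3 : dz 0 (dzbar 0 fun _ : Cn 1 => ((Real.log 2 : ℝ) : ℂ)) (chartAt (Cn 1) q q) = 0 := by
      have : (dzbar 0 fun _ : Cn 1 => ((Real.log 2 : ℝ) : ℂ)) = fun _ => 0 := by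
        ext y; exact dzbar_const ..
      rw [this]; exact dz_const ..
    rw [e3, zero_add]; push_cast; rfl
  orbifold := by
    refine ⟨invForm A (hermMat 2 0 0), isHermitianFormOn_invForm hA (isHermitian_hermMat 2 0 0) univ,
      fun x h => ?_, fun x hx v w => ?_⟩
    · let V : Cn 2 := WithLp.toLp 2 ((A x)⁻¹ 0)
      have h1 : invForm A (hermMat 2 0 0) x V V = _ := frameForm_hermMat_self (A := A) x V 2 0 0
      rw [coframe_toLp_inv (hd x)] at h1
      have h2 : invForm A (hermMat 2 0 0) x V V = 0 := by rw [h]; rfl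
      rw [h2] at h1
      norm_num at h1
    · exact frameForm_eq_gKEBase hA hd hπ hx v w

end KahlerEinstein

section Laplacians

lemma dz_dzbar_comp {F : Cn 1 → ℂ} {w : Cn 1 → Cn 1} {ζ : Cn 1} (hF : ContDiffAt ℝ 2 F (w ζ))
    (hw : ∀ᶠ y in 𝓝 ζ, DifferentiableAt ℂ w y) :
    dz 0 (dzbar 0 fun y => F (w y)) ζ =
      Complex.normSq (fderiv ℂ w ζ (stdVec 0) 0) * dz 0 (dzbar 0 F) (w ζ) := by
  have hw0 := hw.self_of_nhds
  have e : dzbar 0 (fun y => F (w y)) =ᶠ[𝓝 ζ]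
      fun y => conj (fderiv ℂ w y (stdVec 0) 0) * dzbar 0 F (w y) := by
    filter_upwards [hw, hw0.continuousAt.eventually (hF.eventually (by simp))] with y h1 h2
    rw [dzbar_comp (h2.differentiableAt two_ne_zero) h1]
    simp
  have d1 : DifferentiableAt ℂ (fun y => fderiv ℂ w y (stdVec 0) 0) ζ :=
    ((((contDiffAt_of_eventually_differentiableAt hw).fderiv_right (m := ∞) le_rfl).clm_apply
      contDiffAt_const).coord 0).differentiableAt (by simp)
  have d2 := differentiableAt_dzbar (k := 0) hF
  have d3 : DifferentiableAt ℝ (fun y => dzbar 0 F (w y)) ζ := d2.comp ζ (hw0.restrictScalars ℝ)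
  have d4 : DifferentiableAt ℝ (fun y => conj (fderiv ℂ w y (stdVec 0) 0)) ζ :=
    Complex.conjCLE.toContinuousLinearMap.differentiableAt.comp ζ (d1.restrictScalars ℝ)
  rw [dz_congr e, dz_mul d4 d3, dz_conj (d1.restrictScalars ℝ), dzbar_of_differentiableAt d1,
    dz_comp d2 hw0, Complex.normSq_eq_conj_mul_self]
  simp
  ring

lemma contDiffAt_dz {m : ℕ} {f : Cn m → ℂ} {z : Cn m} (k : Fin m) (h : ContDiffAt ℝ ∞ f z) :
    ContDiffAt ℝ ∞ (dz k f) z := by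
  have h1 := fun v => (h.fderiv_right (m := ∞) le_rfl).clm_apply (contDiffAt_const (c := v))
  exact ((h1 _).sub (contDiffAt_const.mul (h1 _))).div_const 2

lemma contDiffAt_dzbar {m : ℕ} {f : Cn m → ℂ} {z : Cn m} (k : Fin m) (h : ContDiffAt ℝ ∞ f z) :
    ContDiffAt ℝ ∞ (dzbar k f) z := by
  have h1 := fun v => (h.fderiv_right (m := ∞) le_rfl).clm_apply (contDiffAt_const (c := v))
  exact ((h1 _).add (contDiffAt_const.mul (h1 _))).div_const 2

lemma dz_dzbar_zero {m : ℕ} (k : Fin m) (z : Cn m) :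
    dz k (dzbar k fun _ : Cn m => (0 : ℂ)) z = 0 := by
  have : (dzbar k fun _ : Cn m => (0 : ℂ)) = fun _ => 0 := by ext y; exact dzbar_const ..
  rw [this]; exact dz_const ..

lemma dz_dzbar_neg {m : ℕ} {f : Cn m → ℂ} {z : Cn m} (k : Fin m) (h : ContDiffAt ℝ 2 f z) :
    dz k (dzbar k fun y => -f y) z = -dz k (dzbar k f) z := by
  have := dz_dzbar_add (i := k) h h.neg
  simp only [add_neg_cancel, dz_dzbar_zero] at this
  linear_combination -this

lemma eq_of_frequently_eq {α β : Type*} [TopologicalSpace α] [TopologicalSpace β] [T2Space β]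
    {f g : α → β} {a : α} (hf : ContinuousAt f a) (hg : ContinuousAt g a)
    (h : ∃ᶠ y in 𝓝 a, f y = g y) : f a = g a := by
  by_contra hne
  exact h ((hf.prodMk hg).eventually (isClosed_diagonal.isOpen_compl.mem_nhds
    (show (f a, g a) ∈ (diagonal β)ᶜ from hne)))

end Laplacians

section FormsOnSurface

variable {X : Type*} [TopologicalSpace X] [ChartedSpace (Cn 2) X] [IsManifold 𝓘(ℂ, Cn 2) ω X]
  {lam : ℝ} {A : X → Matrix (Fin 2) (Fin 2) ℂ} {x₀ x : X} {z : Cn 2} {k : BilinField 2 X}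

lemma chartVecC_eq_sum (hz : z ∈ (chartAt (Cn 2) x₀).target) (a : Cn 2) :
    chartVecC x₀ z a = a 0 • chartVecC x₀ z (stdVec 0) + a 1 • chartVecC x₀ z (stdVec 1) := by
  have e : ∀ v, chartVecC x₀ z v = fderiv ℂ (chartAt (Cn 2) ((chartAt (Cn 2) x₀).symm z) ∘
      (chartAt (Cn 2) x₀).symm) z v := fun v => chartVec_eq hz v
  rw [e, e, e, ← map_smul, ← map_smul, ← map_add]
  congr 1
  ext i; fin_cases i <;> simp [stdVec]

lemma bilin_chartVecC (hJ : ∀ x v w, k x (cplxJ x v) (cplxJ x w) = k x v w)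
    (hz : z ∈ (chartAt (Cn 2) x₀).target) (a b : Cn 2) :
    k ((chartAt (Cn 2) x₀).symm z) (chartVecC x₀ z a) (chartVecC x₀ z b) =
      2 * (∑ i, ∑ j, a i * conj (b j) * hcoeff k x₀ z i j).re := by
  let f : Cn 2 →L[ℝ] Cn 2 →L[ℝ] ℝ := k ((chartAt (Cn 2) x₀).symm z)
  have hf : ∀ v w, f (Complex.I • v) (Complex.I • w) = f v w := fun v w => hJ _ v w
  have h := fun i j => hcoeff_eq_of_apply k x₀ z (fun v w => f v w) (fun _ _ => rfl) i j
  show f (chartVecC x₀ z a) (chartVecC x₀ z b) = _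
  rw [chartVecC_eq_sum hz a, chartVecC_eq_sum hz b]
  simp only [map_add, _root_.add_apply, bilin_expand f hf, Fin.sum_univ_two, h, Complex.add_re]
  ring

/-- The first vector of the frame. -/
def frameVec (A : X → Matrix (Fin 2) (Fin 2) ℂ) (x : X) : Cn 2 := WithLp.toLp 2 ((A x)⁻¹ 0)

lemma frameVec_symm (hA : IsInvariantCoframeOn lam A) (hd : ∀ x, (A x).det ≠ 0)
    (hz : z ∈ (chartAt (Cn 2) x₀).target) :
    frameVec A ((chartAt (Cn 2) x₀).symm z) =
      chartVecC x₀ z (WithLp.toLp 2 ((coMat A x₀ z)⁻¹ 0)) := by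
  refine sub_eq_zero.1 (coframe_eq_zero (hd ((chartAt (Cn 2) x₀).symm z)) ?_)
  rw [coframe_sub, sub_eq_zero, frameVec, coframe_toLp_inv (hd _)]
  refine Eq.trans ?_ (coframe_chartVec hz _).symm
  have h : (coMat A x₀ z)⁻¹ * coMat A x₀ z = 1 :=
    Matrix.nonsing_inv_mul _ (det_coMat_ne_zero hA hz).isUnit
  ext j
  have h2 := congrFun (congrFun h 0) j
  rw [Matrix.mul_apply] at h2
  refine Eq.trans ?_ h2.symm
  fin_cases j
  · exact (Matrix.one_apply_eq 0).symm
  · exact (Matrix.one_apply_ne (by decide)).symm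

/-- A quarter of the square norm of the first vector of the frame. -/
def frameNorm (A : X → Matrix (Fin 2) (Fin 2) ℂ) (k : BilinField 2 X) (x : X) : ℝ :=
  let f : Cn 2 →L[ℝ] Cn 2 →L[ℝ] ℝ := k x
  f (frameVec A x) (frameVec A x) / 4

lemma contDiffAt_frameNorm (hA : IsInvariantCoframeOn lam A) (hd : ∀ x, (A x).det ≠ 0)
    (hk : IsHermitianFormOn k univ) (x : X) :
    ContDiffAt ℝ ∞ (fun z => frameNorm A k ((chartAt (Cn 2) x).symm z)) (chartAt (Cn 2) x x) := by
  have hz := mem_chart_target (Cn 2) x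
  have hs : ∀ i, ContDiffAt ℝ ∞ (fun z => (coMat A x z)⁻¹ 0 i) (chartAt (Cn 2) x x) := fun i => by
    obtain ⟨Ξ, hΞ⟩ := hA x _ hz
    refine (hΞ.smoothInv 0 i).congr_of_eventuallyEq ?_
    filter_upwards [hΞ.inv] with z hz
    rw [Matrix.inv_eq_right_inv hz]
  have hs' : ∀ i, ContDiffAt ℝ ∞ (fun z => conj ((coMat A x z)⁻¹ 0 i)) (chartAt (Cn 2) x x) :=
    fun i => Complex.conjCLE.contDiff.contDiffAt.comp _ (hs i)
  have key : ContDiffAt ℝ ∞ (fun z => 2 * (∑ i, ∑ j, (coMat A x z)⁻¹ 0 i *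
      conj ((coMat A x z)⁻¹ 0 j) * hcoeff k x z i j).re / 4) (chartAt (Cn 2) x x) := by
    have s : ContDiffAt ℝ ∞ (fun z => ∑ i, ∑ j, (coMat A x z)⁻¹ 0 i *
        conj ((coMat A x z)⁻¹ 0 j) * hcoeff k x z i j) (chartAt (Cn 2) x x) :=
      ContDiffAt.sum fun i _ => ContDiffAt.sum fun j _ =>
        ((hs i).mul (hs' j)).mul (hk.smooth x trivial i j)
    exact ((contDiffAt_const (c := (2 : ℝ))).mul
      (Complex.reCLM.contDiff.contDiffAt.comp _ s)).div_const 4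
  refine key.congr_of_eventuallyEq ?_
  filter_upwards [(chartAt (Cn 2) x).open_target.mem_nhds hz] with z hz
  have := bilin_chartVecC (fun x v w => hk.J_inv x trivial v w) hz
    (WithLp.toLp 2 ((coMat A x z)⁻¹ 0)) (WithLp.toLp 2 ((coMat A x z)⁻¹ 0))
  show (show Cn 2 →L[ℝ] Cn 2 →L[ℝ] ℝ from k ((chartAt (Cn 2) x).symm z)) _ _ / 4 = _
  rw [frameVec_symm hA hd hz]
  exact congrArg (· / 4) this

lemma continuous_frameNorm (hA : IsInvariantCoframeOn lam A) (hd : ∀ x, (A x).det ≠ 0)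
    (hk : IsHermitianFormOn k univ) : Continuous (frameNorm A k) := by
  rw [continuous_iff_continuousAt]
  intro x
  have hs := mem_chart_source (Cn 2) x
  refine (ContinuousAt.comp (contDiffAt_frameNorm hA hd hk x).continuousAt
    ((chartAt (Cn 2) x).continuousAt hs)).congr ?_
  filter_upwards [(chartAt (Cn 2) x).open_source.mem_nhds hs] with y hy
  simp [(chartAt (Cn 2) x).left_inv hy]

end FormsOnSurface

section Uniqueness

variable {X : Type*} [TopologicalSpace X] [CompactSpace X] [PreconnectedSpace X]
  [ChartedSpace (Cn 2) X] [IsManifold 𝓘(ℂ, Cn 2) ω X]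
  {C : Type*} [TopologicalSpace C] [T2Space C] [ChartedSpace (Cn 1) C] [IsManifold 𝓘(ℂ, Cn 1) ω C]
  {lam : ℝ} {A : X → Matrix (Fin 2) (Fin 2) ℂ} {π : X → C} {x : X} {q : C}
  {h : BilinField 1 C} {k : BilinField 2 X}

/-- The norm of the standard vector of the chart. -/
def confFactor (h : BilinField 1 C) (q : C) : ℝ :=
  let f : Cn 1 →L[ℝ] Cn 1 →L[ℝ] ℝ := h q
  f (stdVec 0) (stdVec 0)

lemma eq_confFactor (hh : IsHermitianMetricOn h (critValues π)ᶜ) (hq : q ∉ critValues π)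
    (v w : Cn 1) : h q v w = confFactor h q * (v 0 * conj (w 0)).re := by
  let f : Cn 1 →L[ℝ] Cn 1 →L[ℝ] ℝ := h q
  have hJ : ∀ v w, f (Complex.I • v) (Complex.I • w) = f v w := fun v w => hh.J_inv q hq v w
  have hsy : ∀ v w, f v w = f w v := fun v w => hh.symm q hq v w
  have h0 : ∀ v, f v (Complex.I • v) = 0 := fun v => by
    have h1 := hJ v (Complex.I • v)
    rw [smul_smul, Complex.I_mul_I, neg_one_smul, map_neg, hsy] at h1
    linarith
  have hc : confFactor h q = f (stdVec 0) (stdVec 0) := rfl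
  show f v w = _
  rw [Cn.one_eq v, Cn.one_eq w, bilin_expand f hJ, h0, hc]
  simp only [PiLp.smul_apply, stdVec]
  simp
  ring

lemma confFactor_pos (hh : IsHermitianMetricOn h (critValues π)ᶜ) (hq : q ∉ critValues π) :
    0 < confFactor h q := by
  refine hh.pos q hq (stdVec 0 : Cn 1) fun h0 => ?_
  have : (stdVec 0 : Cn 1) 0 = 0 := congrArg (fun v : Cn 1 => v 0) h0
  simp [stdVec] at this

lemma frameNorm_regular (hA : IsInvariantCoframeOn lam A) (hd : ∀ x, (A x).det ≠ 0)
    (hπ : IsEllipticFibration π) (hh : IsHermitianMetricOn h (critValues π)ᶜ)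
    (hk : ∀ x, π x ∉ critValues π → ∀ v w : Cn 2, k x v w =
      h (π x) (baseDeriv π x v) (baseDeriv π x w)) (hx : π x ∉ critValues π) :
    frameNorm A k x = confFactor h (π x) * Complex.normSq (hCo A (chartFun π (π x)) x) / 4 := by
  have e : frameNorm A k x = h (π x) (baseDeriv π x (frameVec A x)) (baseDeriv π x (frameVec A x)) / 4
    := congrArg (· / 4) (hk x hx _ _)
  rw [e, eq_confFactor hh hx, baseDeriv_zero hA hd hπ, frameVec, coframe_toLp_inv (hd x)]
  simp only [Matrix.cons_val_zero, one_mul, Complex.mul_conj, Complex.ofReal_re]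

lemma bilin_regular (hA : IsInvariantCoframeOn lam A) (hd : ∀ x, (A x).det ≠ 0)
    (hπ : IsEllipticFibration π) (hh : IsHermitianMetricOn h (critValues π)ᶜ)
    (hk : ∀ x, π x ∉ critValues π → ∀ v w : Cn 2, k x v w =
      h (π x) (baseDeriv π x v) (baseDeriv π x w)) (hx : π x ∉ critValues π) (v w : Cn 2) :
    k x v w = 4 * frameNorm A k x * (coframe A x v 0 * conj (coframe A x w 0)).re := by
  rw [hk x hx, eq_confFactor hh hx, baseDeriv_zero hA hd hπ, baseDeriv_zero hA hd hπ,
    frameNorm_regular hA hd hπ hh hk hx]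
  set H := hCo A (chartFun π (π x)) x
  have e2 : coframe A x v 0 * H * conj (coframe A x w 0 * H) =
      (Complex.normSq H : ℂ) * (coframe A x v 0 * conj (coframe A x w 0)) := by
    rw [← Complex.mul_conj, map_mul]; ring
  rw [e2, Complex.re_ofReal_mul]
  ring

lemma frequently_regular (hπ : IsEllipticFibration π) (x : X) :
    ∃ᶠ z in 𝓝 (chartAt (Cn 2) x x), π ((chartAt (Cn 2) x).symm z) ∉ critValues π := by
  have hs := mem_chart_source (Cn 2) x
  have h1 : ∃ᶠ y in 𝓝 x, π y ∉ critValues π :=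
    mem_closure_iff_frequently.1 (dense_regular hπ.holo hπ.surj x)
  refine ((chartAt (Cn 2) x).continuousAt hs).tendsto.frequently
    ((h1.and_eventually ((chartAt (Cn 2) x).open_source.mem_nhds hs)).mono fun y hy => ?_)
  rw [(chartAt (Cn 2) x).left_inv hy.2]; exact hy.1

lemma frameNorm_pos (hA : IsInvariantCoframeOn lam A) (hd : ∀ x, (A x).det ≠ 0)
    (hπ : IsEllipticFibration π) (hh : IsHermitianMetricOn h (critValues π)ᶜ)
    (hkf : IsHermitianFormOn k univ) (hk0 : ∀ x, k x ≠ 0)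
    (hk : ∀ x, π x ∉ critValues π → ∀ v w : Cn 2, k x v w =
      h (π x) (baseDeriv π x v) (baseDeriv π x w)) (x : X) : 0 < frameNorm A k x := by
  have hc := continuous_frameNorm hA hd hkf
  have hreg : ∀ x, π x ∉ critValues π → 0 < frameNorm A k x := fun x hx => by
    rw [frameNorm_regular hA hd hπ hh hk hx]
    have := confFactor_pos hh hx
    have := Complex.normSq_pos.2 (hCo_ne_zero hA hd hπ (mem_chartDom π x) hx)
    positivity
  have hnn : 0 ≤ frameNorm A k x :=
    (isClosed_le continuous_const hc).closure_subset_iff.2 (fun y hy => (hreg y hy).le)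
      (dense_regular hπ.holo hπ.surj x)
  refine hnn.lt_of_ne fun h0 => hk0 x ?_
  have hz := mem_chart_target (Cn 2) x
  have hl := (chartAt (Cn 2) x).left_inv (mem_chart_source (Cn 2) x)
  have hcoef : ∀ i j, hcoeff k x (chartAt (Cn 2) x x) i j = 0 := fun i j => by
    have h1 := contDiffAt_coMat hA hz i 0
    have h2 := contDiffAt_coMat hA hz j 0
    have := eq_of_frequently_eq (hkf.smooth x trivial i j).continuousAt
      (g := fun z => 2 * (frameNorm A k ((chartAt (Cn 2) x).symm z) : ℂ) *
        (coMat A x z i 0 * conj (coMat A x z j 0)))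
      ((continuousAt_const.mul (Complex.continuous_ofReal.continuousAt.comp
        (contDiffAt_frameNorm hA hd hkf x).continuousAt)).mul
        (h1.continuousAt.mul (Complex.continuous_conj.continuousAt.comp h2.continuousAt)))
      ((frequently_regular hπ x).mono fun z hz => ?_)
    · rw [this, hl, ← h0]; simp
    · refine (hcoeff_eq_of_apply k x z _ (bilin_regular hA hd hπ hh hk hz) i j).trans ?_
      have e : ∀ i, coframe A ((chartAt (Cn 2) x).symm z) (chartVecC x z (stdVec i)) 0 =
        coMat A x z i 0 := fun _ => rfl
      simp only [coframe_smul, Pi.smul_apply, e, smul_eq_mul]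
      apply Complex.ext <;> simp <;> ring
  have key : ∀ v w : Cn 2, k x v w = 0 := fun v w => by
    have := bilin_chartVecC (fun x v w => hkf.J_inv x trivial v w) hz v w
    simp only [hcoef, mul_zero, Finset.sum_const_zero, Complex.zero_re, chartVecC_self] at this
    rwa [hl] at this
  exact ContinuousLinearMap.ext fun v => ContinuousLinearMap.ext fun w => key v w

/-- A holomorphic curve through `x` which is transversal to the fibration. -/
lemma exists_transversal_curve (hd : ∀ x, (A x).det ≠ 0)
    (hπ : IsEllipticFibration π) (x : X) :
    ∃ V : Cn 2, coframe A x V 0 ≠ 0 ∧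
      ∃ᶠ ζ in 𝓝 (0 : Cn 1), π ((chartAt (Cn 2) x).symm (chartAt (Cn 2) x x + ζ 0 • V)) ∉
        critValues π := by
  obtain ⟨r, hr, h1, h2⟩ := exists_chart_ball hπ.holo x
  have hf := differentiableOn_chart_ball hπ.holo h1 h2
  have hl := (chartAt (Cn 2) x).left_inv (mem_chart_source (Cn 2) x)
  have hcV : Continuous fun V : Cn 2 => coframe A x V 0 := by
    simp only [coframe, Matrix.vecMul, dotProduct]; fun_prop
  obtain ⟨V, hV, hne⟩ := exists_line_not_eventually_const hr hf
    (not_eventually_const hπ.holo hπ.surj x) (V := {V | coframe A x V 0 ≠ 0})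
    (isOpen_ne_fun hcV continuous_const) ⟨frameVec A x, by
      show coframe A x (frameVec A x) 0 ≠ 0
      rw [frameVec, coframe_toLp_inv (hd x)]; simp⟩
  refine ⟨V, hV, ?_⟩
  set z₀ := chartAt (Cn 2) x x with hz₀
  let F : ℂ → ℂ := fun t => chartFun π (π x) ((chartAt (Cn 2) x).symm (z₀ + t • V))
  have h0 : (0 : ℂ) ∈ {t : ℂ | z₀ + t • V ∈ Metric.ball z₀ r} := by
    simpa using Metric.mem_ball_self (x := z₀) hr
  have hF : AnalyticAt ℂ F 0 := analyticOnNhd_line hf z₀ V 0 h0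
  have hF0 : F 0 = chartFun π (π x) ((chartAt (Cn 2) x).symm z₀) := by simp [F]
  have hmap : 𝓝 (F 0) ≤ map F (𝓝 0) :=
    hF.eventually_constant_or_nhds_le_map_nhds.resolve_left (by rwa [hF0])
  have h3 : ∃ᶠ c in 𝓝 (F 0), (chartAt (Cn 1) (π x)).symm (c • stdVec 0) ∉ critValues π := by
    have h4 : ∃ᶠ p in 𝓝 (π x), p ∉ critValues π :=
      mem_closure_iff_frequently.1 (dense_compl_critValues hπ.holo (π x))
    have h5 : Tendsto (fun p => chartAt (Cn 1) (π x) p 0) (𝓝 (π x)) (𝓝 (F 0)) := by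
      rw [hF0, hl]
      exact (EuclideanSpace.proj 0 : Cn 1 →L[ℂ] ℂ).continuous.continuousAt.comp
        ((chartAt (Cn 1) (π x)).continuousAt (mem_chart_source _ _))
    refine h5.frequently ((h4.and_eventually ((chartAt (Cn 1) (π x)).open_source.mem_nhds
      (mem_chart_source _ _))).mono fun p hp => ?_)
    rw [← Cn.one_eq, (chartAt (Cn 1) (π x)).left_inv hp.2]
    exact hp.1
  have h6 : ∃ᶠ t in 𝓝 (0 : ℂ), (chartAt (Cn 1) (π x)).symm (F t • stdVec 0) ∉ critValues π :=
    frequently_map.1 (h3.filter_mono hmap)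
  have h7 : ∃ᶠ t in 𝓝 (0 : ℂ), π ((chartAt (Cn 2) x).symm (z₀ + t • V)) ∉ critValues π := by
    refine (h6.and_eventually ((isOpen_line_preimage z₀ V).mem_nhds h0)).mono fun t ht => ?_
    have := h2 _ ht.2
    have e : chartAt (Cn 1) (π x) (π ((chartAt (Cn 2) x).symm (z₀ + t • V))) = F t • stdVec 0 :=
      Cn.one_eq _
    rw [← (chartAt (Cn 1) (π x)).left_inv this, e]
    exact ht.1
  have h8 : Tendsto (fun t : ℂ => t • (stdVec 0 : Cn 1)) (𝓝 0) (𝓝 0) := by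
    have : Continuous fun t : ℂ => t • (stdVec 0 : Cn 1) := by fun_prop
    simpa using this.tendsto 0
  refine h8.frequently (h7.mono fun t ht => ?_)
  simpa [stdVec] using ht

lemma hcoeff_confFactor (hh : IsHermitianMetricOn h (critValues π)ᶜ) {ζ : Cn 1}
    (hζ : ζ ∈ (chartAt (Cn 1) q).target) (hp : (chartAt (Cn 1) q).symm ζ ∉ critValues π) (i j : Fin 1) :
    hcoeff h q ζ i j = ((confFactor h ((chartAt (Cn 1) q).symm ζ) / 2 * Complex.normSq
      (transDeriv q ((chartAt (Cn 1) q).symm ζ) ((chartAt (Cn 1) q).symm ζ)) : ℝ) : ℂ) :=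
  hcoeff_conformal hζ rfl (eq_confFactor hh hp) i j

lemma det_hcoeff_pos (hh : IsHermitianMetricOn h (critValues π)ᶜ) {ζ : Cn 1}
    (hζ : ζ ∈ (chartAt (Cn 1) q).target) (hp : (chartAt (Cn 1) q).symm ζ ∉ critValues π) :
    0 < (hcoeff h q ζ).det.re := by
  have ht := Complex.normSq_pos.2 (transDeriv_ne_zero ((chartAt (Cn 1) q).map_target hζ)
    (mem_chart_source (Cn 1) ((chartAt (Cn 1) q).symm ζ)))
  have := confFactor_pos hh hp
  rw [Matrix.det_fin_one, hcoeff_confFactor hh hζ hp, Complex.ofReal_re]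
  positivity

lemma frameNorm_eq_div (hA : IsInvariantCoframeOn lam A) (hd : ∀ x, (A x).det ≠ 0)
    (hπ : IsEllipticFibration π) (hh : IsHermitianMetricOn h (critValues π)ᶜ)
    (hk : ∀ x, π x ∉ critValues π → ∀ v w : Cn 2, k x v w =
      h (π x) (baseDeriv π x v) (baseDeriv π x w)) (hx : x ∈ chartDom π q)
    (hp : π x ∉ critValues π) :
    frameNorm A k x = (hcoeff h q (chartAt (Cn 1) q (π x))).det.re /
      (hcoeff (gKEBase A π hπ.surj) q (chartAt (Cn 1) q (π x))).det.re := by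
  have hz := (chartAt (Cn 1) q).map_source hx
  have hl := (chartAt (Cn 1) q).left_inv hx
  rw [Matrix.det_fin_one, Matrix.det_fin_one, hcoeff_confFactor hh hz (by rwa [hl]),
    hcoeff_gKEBase hA hd hπ hz hl.symm hp, hl, Complex.ofReal_re, Complex.ofReal_re,
    frameNorm_regular hA hd hπ hh hk hp, hCo_chartFun_trans (A := A) hπ.holo hx (mem_chartDom π x),
    map_mul]
  have n1 := (Complex.normSq_pos.2 (hCo_ne_zero hA hd hπ hx hp)).ne'
  field_simp
  norm_num

lemma contDiffAt_log_det (hh : IsHermitianMetricOn h (critValues π)ᶜ) (hq : q ∉ critValues π) :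
    ContDiffAt ℝ ∞ (fun ζ => Real.log (hcoeff h q ζ).det.re) (chartAt (Cn 1) q q) := by
  have h1 := det_hcoeff_pos hh (mem_chart_target (Cn 1) q)
    (by rwa [(chartAt (Cn 1) q).left_inv (mem_chart_source _ q)])
  simp only [Matrix.det_fin_one] at h1 ⊢
  exact (Complex.reCLM.contDiff.contDiffAt.comp _ (hh.smooth q hq 0 0)).log h1.ne'

lemma laplacian_log_frameNorm_regular (hA : IsInvariantCoframeOn lam A) (hd : ∀ x, (A x).det ≠ 0)
    (hπ : IsEllipticFibration π) (hh : IsBaseKahlerEinstein π h)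
    (hk : ∀ x, π x ∉ critValues π → ∀ v w : Cn 2, k x v w =
      h (π x) (baseDeriv π x v) (baseDeriv π x w)) {ℓ : Cn 1 → X} {ζ₀ : Cn 1}
    (hℓ : ∀ᶠ ζ in 𝓝 ζ₀, MDifferentiableAt 𝓘(ℂ, Cn 1) 𝓘(ℂ, Cn 2) ℓ ζ)
    (hp : π (ℓ ζ₀) ∉ critValues π) :
    dz 0 (dzbar 0 fun ζ => ((Real.log (frameNorm A k (ℓ ζ)) : ℝ) : ℂ)) ζ₀ =
      2 * (frameNorm A k (ℓ ζ₀) - 1) * Complex.normSq (velCo A ℓ ζ₀ 0) := by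
  set q := π (ℓ ζ₀) with hq
  have hgm := isBaseKahlerEinstein_gKEBase hA hd hπ
  set gK := gKEBase A π hπ.surj with hgK
  have hxd : ℓ ζ₀ ∈ chartDom π q := mem_chartDom π (ℓ ζ₀)
  let m : Cn 1 → Cn 1 := fun ζ => chartAt (Cn 1) q (π (ℓ ζ))
  have hu : ∀ᶠ ζ in 𝓝 ζ₀, MDifferentiableAt 𝓘(ℂ, Cn 1) 𝓘(ℂ, Cn 1) (π ∘ ℓ) ζ :=
    hℓ.mono fun ζ h => (hπ.holo (ℓ ζ)).comp ζ h
  have hm : ∀ᶠ ζ in 𝓝 ζ₀, DifferentiableAt ℂ m ζ :=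
    eventually_differentiableAt_chart_comp hu (mem_chart_source (Cn 1) q)
  have hcont := hu.self_of_nhds.continuousAt
  have hev : ∀ᶠ ζ in 𝓝 ζ₀, ℓ ζ ∈ chartDom π q ∧ π (ℓ ζ) ∉ critValues π :=
    hcont.eventually (inter_mem ((chartAt (Cn 1) q).open_source.mem_nhds (mem_chart_source _ q))
      ((isClosed_critValues hπ.holo).isOpen_compl.mem_nhds hp))
  set Lh : Cn 1 → ℝ := fun ζ => Real.log (hcoeff h q ζ).det.re
  set Lg : Cn 1 → ℝ := fun ζ => Real.log (hcoeff gK q ζ).det.re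
  have sh := contDiffAt_ofReal ((contDiffAt_log_det hh.metric hp).of_le two_le_infty)
  have sg := contDiffAt_ofReal ((contDiffAt_log_det hgm.metric hp).of_le two_le_infty)
  have e1 : (fun ζ => ((Real.log (frameNorm A k (ℓ ζ)) : ℝ) : ℂ)) =ᶠ[𝓝 ζ₀]
      fun ζ => (fun y => (Lh y : ℂ) + -(Lg y : ℂ)) (m ζ) := by
    filter_upwards [hev] with ζ hζ
    have hz := (chartAt (Cn 1) q).map_source hζ.1
    have hl := (chartAt (Cn 1) q).left_inv hζ.1
    rw [frameNorm_eq_div hA hd hπ hh.metric hk hζ.1 hζ.2, Real.log_div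
      (det_hcoeff_pos hh.metric hz (by rw [hl]; exact hζ.2)).ne'
      (det_hcoeff_pos hgm.metric hz (by rw [hl]; exact hζ.2)).ne']
    push_cast
    exact sub_eq_add_neg _ _
  have e2 := e1.eventuallyEq_nhds.mono fun ζ h => dzbar_congr (k := 0) h
  have k1 := hh.einstein q hp 0 0
  have k2 := hgm.einstein q hp 0 0
  rw [kahlerRic, neg_inj] at k1 k2
  rw [dz_congr e2, dz_dzbar_comp (F := fun y => (Lh y : ℂ) + -(Lg y : ℂ)) (sh.add sg.neg) hm,
    dz_dzbar_add sh sg.neg, dz_dzbar_neg _ sg]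
  have e3 : fderiv ℂ m ζ₀ (stdVec 0) 0 = velCo A ℓ ζ₀ 0 * hCo A (chartFun π q) (ℓ ζ₀) := by
    have e4 := (holOn_chartFun hπ.holo q).holDeriv_mfderiv hℓ.self_of_nhds hxd (stdVec 0)
    have e5 := (isBasic_chartFun hA hd hπ q).eq_mul _ hxd
      (mfderiv 𝓘(ℂ, Cn 1) 𝓘(ℂ, Cn 2) ℓ ζ₀ (stdVec 0) : Cn 2)
    have e6 : fderiv ℂ (chartFun π q ∘ ℓ) ζ₀ (stdVec 0) = fderiv ℂ m ζ₀ (stdVec 0) 0 := by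
      have := ((EuclideanSpace.proj 0 : Cn 1 →L[ℂ] ℂ).hasFDerivAt.comp ζ₀
        hm.self_of_nhds.hasFDerivAt).fderiv
      exact congrFun (congrArg DFunLike.coe this) (stdVec 0)
    exact e6.symm.trans (e4.symm.trans e5)
  have e7 := hcoeff_gKEBase hA hd hπ (mem_chart_target (Cn 1) q) (x := ℓ ζ₀)
    ((chartAt (Cn 1) q).left_inv (mem_chart_source _ q)).symm hp 0 0
  have e8 := frameNorm_eq_div hA hd hπ hh.metric hk hxd hp
  have e9 : hcoeff h q (chartAt (Cn 1) q q) 0 0 =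
      (((hcoeff h q (chartAt (Cn 1) q q)).det.re : ℝ) : ℂ) := by
    rw [Matrix.det_fin_one, hcoeff_confFactor hh.metric (mem_chart_target (Cn 1) q)
      (by rwa [(chartAt (Cn 1) q).left_inv (mem_chart_source _ q)]), Complex.ofReal_re]
  rw [k1, k2, e3, e7, e9, e8, map_mul]
  have e10 : (hcoeff gK q (chartAt (Cn 1) q (π (ℓ ζ₀)))).det.re =
      2 / Complex.normSq (hCo A (chartFun π q) (ℓ ζ₀)) := by
    rw [Matrix.det_fin_one]
    exact (congrArg Complex.re e7).trans (Complex.ofReal_re _)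
  rw [e10]
  have n1 : (Complex.normSq (hCo A (chartFun π q) (ℓ ζ₀)) : ℂ) ≠ 0 := by
    exact_mod_cast (Complex.normSq_pos.2 (hCo_ne_zero hA hd hπ hxd hp)).ne'
  push_cast
  field_simp
  rw [← hq]
  ring

/-- A holomorphic curve along which the Laplacian of the logarithm of `frameNorm` is known. -/
lemma exists_curve_laplacian (hA : IsInvariantCoframeOn lam A) (hd : ∀ x, (A x).det ≠ 0)
    (hπ : IsEllipticFibration π) (hh : IsBaseKahlerEinstein π h)
    (hkf : IsHermitianFormOn k univ) (hk0 : ∀ x, k x ≠ 0)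
    (hk : ∀ x, π x ∉ critValues π → ∀ v w : Cn 2, k x v w =
      h (π x) (baseDeriv π x v) (baseDeriv π x w)) (x : X) :
    ∃ ℓ : Cn 1 → X, ℓ 0 = x ∧ ContinuousAt ℓ 0 ∧
      ContDiffAt ℝ 2 (fun ζ => Real.log (frameNorm A k (ℓ ζ))) 0 ∧
      ∃ c : ℝ, 0 < c ∧ dz 0 (dzbar 0 fun ζ => ((Real.log (frameNorm A k (ℓ ζ)) : ℝ) : ℂ)) 0 =
        2 * (frameNorm A k x - 1) * c := by
  obtain ⟨V, hV, hfreq⟩ := exists_transversal_curve hd hπ x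
  have hl := (chartAt (Cn 2) x).left_inv (mem_chart_source (Cn 2) x)
  have hz₀t := mem_chart_target (Cn 2) x
  set z₀ := chartAt (Cn 2) x x with hz₀
  let w : Cn 1 → Cn 2 := fun ζ => z₀ + ζ 0 • V
  have hwd : ∀ ζ, HasFDerivAt w ((EuclideanSpace.proj 0 : Cn 1 →L[ℂ] ℂ).smulRight V) ζ := fun ζ =>
    ((EuclideanSpace.proj 0 : Cn 1 →L[ℂ] ℂ).hasFDerivAt.smul_const V).const_add z₀
  have hw0 : w 0 = z₀ := by simp [w]
  let ℓ : Cn 1 → X := fun ζ => (chartAt (Cn 2) x).symm (w ζ)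
  have hℓ0 : ℓ 0 = x := by simp only [ℓ, hw0, hl]
  have hwt : ∀ᶠ ζ in 𝓝 (0 : Cn 1), w ζ ∈ (chartAt (Cn 2) x).target :=
    (hwd 0).continuousAt.eventually ((chartAt (Cn 2) x).open_target.mem_nhds (by rwa [hw0]))
  have hℓ : ∀ᶠ ζ in 𝓝 (0 : Cn 1), MDifferentiableAt 𝓘(ℂ, Cn 1) 𝓘(ℂ, Cn 2) ℓ ζ :=
    hwt.mono fun ζ h => mdifferentiableAt_symm_comp (hwd ζ).differentiableAt h
  have hα : velCo A ℓ 0 0 ≠ 0 := by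
    have e : (mfderiv 𝓘(ℂ, Cn 1) 𝓘(ℂ, Cn 2) ℓ 0 (stdVec 0) : Cn 2) = V := by
      refine (mfderiv_symm_comp (hwd 0).differentiableAt hwt.self_of_nhds (stdVec 0)).trans ?_
      rw [(hwd 0).fderiv, hw0, chartVecC_self]
      show (stdVec 0 : Cn 1) 0 • V = V
      simp [stdVec]
    intro h0
    apply hV
    rw [← hℓ0, ← e]
    exact h0
  have hpos := frameNorm_pos hA hd hπ hh.metric hkf hk0 hk
  have hs : ContDiffAt ℝ ∞ (fun ζ => Real.log (frameNorm A k (ℓ ζ))) 0 := by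
    refine ContDiffAt.log ?_ (hpos _).ne'
    refine ContDiffAt.comp (0 : Cn 1) (g := fun z => frameNorm A k ((chartAt (Cn 2) x).symm z))
      (f := w) (by rw [hw0]; exact contDiffAt_frameNorm hA hd hkf x) ?_
    exact ((contDiffAt_of_eventually_differentiableAt (Eventually.of_forall fun ζ =>
      (hwd ζ).differentiableAt))).restrict_scalars ℝ
  refine ⟨ℓ, hℓ0, hℓ.self_of_nhds.continuousAt, hs.of_le two_le_infty,
    Complex.normSq (velCo A ℓ 0 0), Complex.normSq_pos.2 hα, ?_⟩
  have key := eq_of_frequently_eq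
    (contDiffAt_dz 0 (contDiffAt_dzbar 0 (contDiffAt_ofReal hs))).continuousAt
    (g := fun ζ => 2 * ((frameNorm A k (ℓ ζ) : ℂ) - 1) * (Complex.normSq (velCo A ℓ ζ 0) : ℂ))
    ((continuousAt_const.mul ((Complex.continuous_ofReal.continuousAt.comp
      ((continuous_frameNorm hA hd hkf).continuousAt.comp hℓ.self_of_nhds.continuousAt)).sub
        continuousAt_const)).mul (Complex.continuous_ofReal.continuousAt.comp
          (contDiffAt_normSq (contDiffAt_velCo hA hℓ 0)).continuousAt))
    ((hfreq.and_eventually hℓ.eventually_nhds).mono fun ζ hζ =>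
      laplacian_log_frameNorm_regular hA hd hπ hh hk hζ.2 hζ.1)
  rw [key, hℓ0]

theorem IsBaseKahlerEinstein.eq_gKEBase [Nonempty X] (hA : IsInvariantCoframeOn lam A)
    (hd : ∀ x, (A x).det ≠ 0) (hπ : IsEllipticFibration π) (hh : IsBaseKahlerEinstein π h) {p : C}
    (hp : p ∉ critValues π) : h p = gKEBase A π hπ.surj p := by
  obtain ⟨k, hkf, hk0, hk⟩ := hh.orbifold
  have hk : ∀ x, π x ∉ critValues π → ∀ v w : Cn 2, k x v w =
      h (π x) (baseDeriv π x v) (baseDeriv π x w) := fun x hx v w => hk x hx v w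
  have hc := continuous_frameNorm hA hd hkf
  have hpos := frameNorm_pos hA hd hπ hh.metric hkf hk0 hk
  have hle : ∀ x, frameNorm A k x ≤ 1 := by
    obtain ⟨x₁, -, hx₁⟩ := isCompact_univ.exists_isMaxOn univ_nonempty hc.continuousOn
    obtain ⟨ℓ, h0, hcl, hs, c, hc0, hL⟩ := exists_curve_laplacian hA hd hπ hh hkf hk0 hk x₁
    have hmax : IsLocalMax (fun ζ => Real.log (frameNorm A k (ℓ ζ))) 0 :=
      Eventually.of_forall fun ζ => Real.log_le_log (hpos _) (by rw [h0]; exact hx₁ trivial)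
    have h1 := dz_dzbar_re_nonpos_of_isLocalMax (i := 0) hs hmax
    rw [hL] at h1
    have h2 : 2 * (frameNorm A k x₁ - 1) * c ≤ 0 := by exact_mod_cast h1
    intro x
    have h3 : frameNorm A k x ≤ frameNorm A k x₁ := hx₁ trivial
    nlinarith
  have hge : ∀ x, 1 ≤ frameNorm A k x := by
    obtain ⟨x₁, -, hx₁⟩ := isCompact_univ.exists_isMinOn univ_nonempty hc.continuousOn
    obtain ⟨ℓ, h0, hcl, hs, c, hc0, hL⟩ := exists_curve_laplacian hA hd hπ hh hkf hk0 hk x₁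
    have hmax : IsLocalMax (fun ζ => -Real.log (frameNorm A k (ℓ ζ))) 0 :=
      Eventually.of_forall fun ζ => neg_le_neg
        (Real.log_le_log (hpos _) (by rw [h0]; exact hx₁ trivial))
    have h1 := dz_dzbar_re_nonpos_of_isLocalMax (i := 0) hs.neg hmax
    simp only [Complex.ofReal_neg] at h1
    rw [dz_dzbar_neg _ (contDiffAt_ofReal hs), hL] at h1
    have h2 : -(2 * (frameNorm A k x₁ - 1) * c) ≤ 0 := by exact_mod_cast h1
    intro x
    have h3 : frameNorm A k x₁ ≤ frameNorm A k x := hx₁ trivial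
    nlinarith
  obtain ⟨x, rfl⟩ := hπ.surj p
  have e := frameNorm_regular hA hd hπ hh.metric hk hp
  rw [le_antisymm (hle x) (hge x)] at e
  have n1 := (Complex.normSq_pos.2 (hCo_ne_zero hA hd hπ (mem_chartDom π x) hp)).ne'
  refine ContinuousLinearMap.ext fun v => ContinuousLinearMap.ext fun w => ?_
  refine (eq_confFactor hh.metric hp v w).trans
    (Eq.trans ?_ (gKEBase_apply hA hd hπ hp v w).symm)
  congr 1
  field_simp
  linarith

/-- The norm of the coefficient is constant along all fibres. -/
theorem normSq_hCo_fibre (hA : IsInvariantCoframeOn lam A) (hd : ∀ x, (A x).det ≠ 0)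
    (hπ : IsEllipticFibration π) {y : X} (hx : x ∈ chartDom π q) (h : π y = π x) :
    Complex.normSq (hCo A (chartFun π q) y) = Complex.normSq (hCo A (chartFun π q) x) := by
  by_contra hne
  have hy : y ∈ chartDom π q := by
    show π y ∈ (chartAt (Cn 1) q).source
    rw [h]; exact hx
  have hb := isBasic_chartFun hA hd hπ q
  have hc : ∀ x ∈ chartDom π q,
      ContinuousAt (fun x => Complex.normSq (hCo A (chartFun π q) x)) x := fun x hx =>
    Complex.continuous_normSq.continuousAt.comp ((hb.continuousOn_hCo hA).continuousAt
      (hb.isOpen.mem_nhds hx))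
  obtain ⟨S, T, hS, hT, hyS, hxT, hST⟩ := t2_separation hne
  have hopen := isOpenMap_of_holomorphic hπ.holo hπ.surj
  have h1 := hopen.image_mem_nhds (inter_mem ((hc y hy).preimage_mem_nhds (hS.mem_nhds hyS))
    (hb.isOpen.mem_nhds hy))
  have h2 := hopen.image_mem_nhds ((hc x hx).preimage_mem_nhds (hT.mem_nhds hxT))
  rw [h] at h1
  obtain ⟨p, ⟨⟨y', ⟨hy'S, hy'd⟩, hy'⟩, x', hx'T, hx'⟩, hp⟩ :=
    mem_closure_iff_nhds.1 (dense_compl_critValues hπ.holo (π x)) _ (inter_mem h1 h2)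
  have h3 := normSq_hCo_eq hA hd hπ hy'd (by rwa [hy']) (hx'.trans hy'.symm)
  exact hST.le_bot ⟨hy'S, show Complex.normSq (hCo A (chartFun π q) y') ∈ T by
    rw [← h3]; exact hx'T⟩

lemma eventually_notMem_critValues (hA : IsInvariantCoframeOn lam A) (hd : ∀ x, (A x).det ≠ 0)
    (hπ : IsEllipticFibration π) (p : C) : ∀ᶠ p' in 𝓝 p, p' = p ∨ p' ∉ critValues π := by
  by_cases hp : p ∈ critValues π
  swap
  · filter_upwards [(isClosed_critValues hπ.holo).isOpen_compl.mem_nhds hp] with p' h using Or.inr h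
  obtain ⟨x, rfl⟩ := hπ.surj p
  have hb := isBasic_chartFun hA hd hπ (π x)
  obtain ⟨V, hV, hfreq⟩ := exists_transversal_curve hd hπ x
  obtain ⟨r, hr, h1, h2⟩ := exists_chart_ball hπ.holo x
  have hf := differentiableOn_chart_ball hπ.holo h1 h2
  have hl := (chartAt (Cn 2) x).left_inv (mem_chart_source (Cn 2) x)
  have hz₀t := mem_chart_target (Cn 2) x
  set z₀ := chartAt (Cn 2) x x with hz₀
  let f : Cn 2 → ℂ := fun z => chartFun π (π x) ((chartAt (Cn 2) x).symm z)
  let F : ℂ → ℂ := fun t => f (z₀ + t • V)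
  have h0 : (0 : ℂ) ∈ {t : ℂ | z₀ + t • V ∈ Metric.ball z₀ r} := by
    simpa using Metric.mem_ball_self (x := z₀) hr
  have hball : ∀ᶠ t in 𝓝 (0 : ℂ), z₀ + t • V ∈ Metric.ball z₀ r := (isOpen_line_preimage (r := r) z₀ V |>.mem_nhds h0)
  have hF : AnalyticAt ℂ F 0 := analyticOnNhd_line hf z₀ V 0 h0
  have hF0 : F 0 = chartFun π (π x) x := by simp only [F, f, zero_smul, add_zero, hl]
  have hfreq' : ∃ᶠ t in 𝓝 (0 : ℂ), π ((chartAt (Cn 2) x).symm (z₀ + t • V)) ∉ critValues π := by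
    have : Tendsto (fun ζ : Cn 1 => ζ 0) (𝓝 0) (𝓝 0) :=
      (EuclideanSpace.proj 0 : Cn 1 →L[ℂ] ℂ).continuous.tendsto 0
    exact this.frequently hfreq
  have hnc : ¬ ∀ᶠ t in 𝓝 (0 : ℂ), F t = F 0 := fun hev => by
    obtain ⟨t, ht, ht1, ht2⟩ := (hfreq'.and_eventually (hev.and hball)).exists
    refine ht ?_
    rw [chartFun_injOn (h2 _ ht2) (mem_chartDom π x) (ht1.trans hF0)]
    exact hp
  have hmap : 𝓝 (F 0) ≤ map F (𝓝 0) :=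
    hF.eventually_constant_or_nhds_le_map_nhds.resolve_left hnc
  let a : ℂ → ℂ := fun t => V 0 * coMat A x (z₀ + t • V) 0 0 + V 1 * coMat A x (z₀ + t • V) 1 0
  have hderiv : ∀ t, z₀ + t • V ∈ Metric.ball z₀ r → deriv F t =
      a t * hCo A (chartFun π (π x)) ((chartAt (Cn 2) x).symm (z₀ + t • V)) := fun t ht => by
    have d1 : HasFDerivAt f (fderiv ℂ f (z₀ + t • V)) (z₀ + t • V) :=
      (hf.differentiableAt (Metric.isOpen_ball.mem_nhds ht)).hasFDerivAt
    have d2 : HasDerivAt (fun t : ℂ => z₀ + t • V) V t := by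
      simpa using ((hasDerivAt_id t).smul_const V).const_add z₀
    refine (d1.comp_hasDerivAt t d2).deriv.trans ?_
    have hw' : V = V 0 • stdVec 0 + V 1 • stdVec 1 := by
      ext k; fin_cases k <;> simp [stdVec]
    conv_lhs => rw [hw']
    rw [map_add, map_smul, map_smul, ← hw', hb.fderiv_stdVec (h1 ht) (h2 _ ht),
      hb.fderiv_stdVec (h1 ht) (h2 _ ht)]
    simp only [a, smul_eq_mul]
    ring
  have ha : ∀ᶠ t in 𝓝 (0 : ℂ), a t ≠ 0 := by
    have hline : ContinuousAt (fun t : ℂ => z₀ + t • V) 0 := by fun_prop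
    have hco : ∀ i, ContinuousAt (fun t : ℂ => coMat A x (z₀ + t • V) i 0) 0 := fun i =>
      ContinuousAt.comp (g := fun z => coMat A x z i 0) (f := fun t : ℂ => z₀ + t • V)
        (by simpa using (contDiffAt_coMat hA hz₀t i 0).continuousAt) hline
    refine ((continuousAt_const.mul (hco 0)).add (continuousAt_const.mul (hco 1))).eventually_ne ?_
    have e := congrFun (coMat_self A x V) 0
    simp only [Matrix.vecMul, dotProduct, Fin.sum_univ_two] at e
    show V 0 * coMat A x (z₀ + (0 : ℂ) • V) 0 0 + V 1 * coMat A x (z₀ + (0 : ℂ) • V) 1 0 ≠ 0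
    rw [zero_smul, add_zero, hz₀, e]
    exact hV
  have hiso : ∀ᶠ t in 𝓝[≠] (0 : ℂ), deriv F t ≠ 0 := by
    refine hF.deriv.eventually_eq_zero_or_eventually_ne_zero.resolve_left fun hev => ?_
    obtain ⟨t, ht, ht1, ht2, ht3⟩ := (hfreq'.and_eventually (hev.and (hball.and ha))).exists
    rw [hderiv t ht2] at ht1
    exact hCo_ne_zero hA hd hπ (h2 _ ht2) ht ((mul_eq_zero.1 ht1).resolve_left ht3)
  rw [eventually_nhdsWithin_iff] at hiso
  have himg := hmap (image_mem_map (inter_mem hiso hball))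
  have hcc : ContinuousAt (fun p => chartAt (Cn 1) (π x) p 0) (π x) :=
    (EuclideanSpace.proj 0 : Cn 1 →L[ℂ] ℂ).continuous.continuousAt.comp
      ((chartAt (Cn 1) (π x)).continuousAt (mem_chart_source _ _))
  rw [hF0] at himg
  filter_upwards [hcc.preimage_mem_nhds himg,
    (chartAt (Cn 1) (π x)).open_source.mem_nhds (mem_chart_source _ _)] with p' hp' hps
  obtain ⟨t, ⟨ht1, ht2⟩, ht⟩ := hp'
  have hpt : π ((chartAt (Cn 2) x).symm (z₀ + t • V)) = p' :=
    (chartAt (Cn 1) (π x)).injOn (h2 _ ht2) hps (Cn.one_ext ht)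
  by_cases ht0 : t = 0
  · left; rw [← hpt, ht0, zero_smul, add_zero, hl]
  · right
    rintro ⟨y, hy, hcrit⟩
    have hyd : y ∈ chartDom π (π x) := by
      show π y ∈ (chartAt (Cn 1) (π x)).source
      rw [hy]; exact hps
    have h3 := ht1 ht0
    rw [hderiv t ht2] at h3
    have h4 := normSq_hCo_fibre hA hd hπ (h2 _ ht2) (hy.trans hpt.symm)
    rw [(isCritical_iff_hCo hA hd hπ hyd).1 hcrit, map_zero] at h4
    exact h3 (by rw [Complex.normSq_eq_zero.1 h4.symm, mul_zero])

theorem finite_critValues (hA : IsInvariantCoframeOn lam A) (hd : ∀ x, (A x).det ≠ 0)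
    (hπ : IsEllipticFibration π) : (critValues π).Finite := by
  have hc : IsCompact (critValues π) := by
    rw [critValues_eq_image]
    exact (isClosed_critical hπ.holo).isCompact.image hπ.holo.continuous
  obtain ⟨t, -, ht⟩ := hc.elim_nhds_subcover (fun p => {p' | p' = p ∨ p' ∉ critValues π})
    fun p _ => eventually_notMem_critValues hA hd hπ p
  refine t.finite_toSet.subset fun p hp => ?_
  obtain ⟨p', hp', h⟩ := mem_iUnion₂.1 (ht hp)
  rcases h with h | h
  · rw [h]; exact hp'
  · exact absurd hp h

end Uniqueness

section RiemannianDistance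

variable {n : ℕ} {M : Type*} [TopologicalSpace M] [ChartedSpace (Cn n) M]
  {g : BilinField n M} {γ : ℝ → M} {a b c : ℝ} {x y z : M}

/-- The velocity of a curve. -/
def vel (γ : ℝ → M) (t : ℝ) : Cn n := mfderiv 𝓘(ℝ, ℝ) 𝓘(ℝ, Cn n) γ t (1 : ℝ)

/-- The square norm of a vector. -/
def sqNorm (g : BilinField n M) (x : M) (v : Cn n) : ℝ := g x v v

/-- The length of a curve. -/
def gLen (g : BilinField n M) (γ : ℝ → M) (a b : ℝ) : ℝ≥0∞ :=
  ∫⁻ t in Icc a b, ENNReal.ofReal (Real.sqrt (sqNorm g (γ t) (vel γ t)))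

/-- The norms on the tangent spaces. -/
abbrev tangentENorm (g : BilinField n M) (p : M) : ENorm (TangentSpace 𝓘(ℝ, Cn n) p) :=
  ⟨fun v => ENNReal.ofReal (Real.sqrt (g p v v))⟩

lemma enormSMulClass_tangentENorm (g : BilinField n M) (p : M) :
    letI := tangentENorm g p
    ENormSMulClass ℝ (TangentSpace 𝓘(ℝ, Cn n) p) := by
  let := tangentENorm g p
  refine ⟨fun r v => ?_⟩
  have key : ∀ (f : Cn n →L[ℝ] Cn n →L[ℝ] ℝ) (v : Cn n),
      ENNReal.ofReal (Real.sqrt (f (r • v) (r • v))) =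
        ‖r‖ₑ * ENNReal.ofReal (Real.sqrt (f v v)) := fun f v => by
    have e : f (r • v) (r • v) = r ^ 2 * f v v := by
      simp only [map_smul, _root_.smul_apply, smul_eq_mul]; ring
    rw [e, Real.sqrt_mul (sq_nonneg r), Real.sqrt_sq_eq_abs, ENNReal.ofReal_mul (abs_nonneg r),
      Real.enorm_eq_ofReal_abs]
  exact key (g p) v

lemma riemDist_le_gLen (hγ : ContMDiffOn 𝓘(ℝ, ℝ) 𝓘(ℝ, Cn n) 1 γ (Icc a b)) (hab : a ≤ b) :
    riemDist g (γ a) (γ b) ≤ gLen g γ a b := by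
  let := tangentENorm g
  have := enormSMulClass_tangentENorm g
  have h := Manifold.riemannianEDist_le_pathELength hγ rfl rfl hab
  rw [Manifold.pathELength_eq_lintegral_mfderiv_Icc] at h
  exact h

lemma exists_curve_of_riemDist_lt {r : ℝ≥0∞} (h : riemDist g x y < r) :
    ∃ γ : ℝ → M, γ 0 = x ∧ γ 1 = y ∧ ContMDiff 𝓘(ℝ, ℝ) 𝓘(ℝ, Cn n) 1 γ ∧ gLen g γ 0 1 < r := by
  let := tangentENorm g
  have := enormSMulClass_tangentENorm g
  obtain ⟨γ, h0, h1, hγ, hl, -⟩ :=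
    Manifold.exists_lt_locally_constant_of_riemannianEDist_lt h zero_lt_one
  rw [Manifold.pathELength_eq_lintegral_mfderiv_Icc] at hl
  exact ⟨γ, h0, h1, hγ, hl⟩

lemma riemDist_self : riemDist g x x = 0 := by
  let := tangentENorm g
  have := enormSMulClass_tangentENorm g
  exact Manifold.riemannianEDist_self

lemma riemDist_comm : riemDist g x y = riemDist g y x := by
  let := tangentENorm g
  have := enormSMulClass_tangentENorm g
  exact Manifold.riemannianEDist_comm

lemma riemDist_triangle : riemDist g x z ≤ riemDist g x y + riemDist g y z := by
  let := tangentENorm g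
  have := enormSMulClass_tangentENorm g
  exact Manifold.riemannianEDist_triangle

lemma gLen_add (h : a ≤ b) (h' : b ≤ c) : gLen g γ a b + gLen g γ b c = gLen g γ a c := by
  let := tangentENorm g
  have := Manifold.pathELength_add (I := 𝓘(ℝ, Cn n)) (γ := γ) h h'
  simp only [Manifold.pathELength_eq_lintegral_mfderiv_Icc] at this
  exact this

lemma gLen_le_of_le {K : ℝ} (h : ∀ t ∈ Icc a b, Real.sqrt (sqNorm g (γ t) (vel γ t)) ≤ K) :
    gLen g γ a b ≤ ENNReal.ofReal K * ENNReal.ofReal (b - a) := by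
  refine (MeasureTheory.setLIntegral_mono' measurableSet_Icc
    (g := fun _ => ENNReal.ofReal K) fun t ht => ENNReal.ofReal_le_ofReal (h t ht)).trans ?_
  rw [MeasureTheory.setLIntegral_const, Real.volume_Icc]

lemma vel_comp {m : ℕ} {N : Type*} [TopologicalSpace N] [ChartedSpace (Cn m) N] {f : M → N} {t : ℝ}
    (hf : MDifferentiableAt 𝓘(ℝ, Cn n) 𝓘(ℝ, Cn m) f (γ t))
    (hγ : MDifferentiableAt 𝓘(ℝ, ℝ) 𝓘(ℝ, Cn n) γ t) :
    vel (f ∘ γ) t = (mfderiv 𝓘(ℝ, Cn n) 𝓘(ℝ, Cn m) f (γ t) (vel γ t) : Cn m) :=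
  congrFun (congrArg DFunLike.coe (mfderiv_comp t hf hγ)) (1 : ℝ)

/-- A map which contracts the metrics contracts the distances. -/
theorem riemDist_map_le {m : ℕ} {N : Type*} [TopologicalSpace N] [ChartedSpace (Cn m) N]
    {h : BilinField m N} {f : M → N} (hf : ContMDiff 𝓘(ℝ, Cn n) 𝓘(ℝ, Cn m) 1 f) {K : ℝ}
    (hK : 0 < K) (hle : ∀ x (v : Cn n), Real.sqrt (sqNorm h (f x)
      (mfderiv 𝓘(ℝ, Cn n) 𝓘(ℝ, Cn m) f x v : Cn m)) ≤ K * Real.sqrt (sqNorm g x v)) :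
    riemDist h (f x) (f y) ≤ ENNReal.ofReal K * riemDist g x y := by
  by_contra! hlt
  have hK0 : ENNReal.ofReal K ≠ 0 := by simpa using hK
  rw [mul_comm, ← ENNReal.lt_div_iff_mul_lt (.inl hK0) (.inl ENNReal.ofReal_ne_top)] at hlt
  obtain ⟨γ, rfl, rfl, hγ, hl⟩ := exists_curve_of_riemDist_lt hlt
  rw [ENNReal.lt_div_iff_mul_lt (.inl hK0) (.inl ENNReal.ofReal_ne_top)] at hl
  refine absurd ((riemDist_le_gLen (g := h) (hf.comp hγ).contMDiffOn zero_le_one).trans ?_)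
    (not_le.2 hl)
  rw [mul_comm, gLen, gLen, ← MeasureTheory.lintegral_const_mul' _ _ ENNReal.ofReal_ne_top]
  refine MeasureTheory.lintegral_mono fun t => ?_
  rw [← ENNReal.ofReal_mul hK.le,
    vel_comp (hf.mdifferentiable one_ne_zero _) (hγ.mdifferentiable one_ne_zero _)]
  exact ENNReal.ofReal_le_ofReal (hle _ _)

/-- A comparison of metrics gives a comparison of the distances. -/
theorem riemDist_le_of_le {h : BilinField n M} {K : ℝ} (hK : 0 < K)
    (hle : ∀ x (v : Cn n), Real.sqrt (sqNorm h x v) ≤ K * Real.sqrt (sqNorm g x v)) :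
    riemDist h x y ≤ ENNReal.ofReal K * riemDist g x y := by
  refine riemDist_map_le (f := id) contMDiff_id hK fun x v => ?_
  rw [mfderiv_id]
  exact hle x v

end RiemannianDistance

section ContinuousInduction

variable {f : ℝ → ℝ} {μ : ℝ → ℝ → ℝ≥0∞} {k : ℝ≥0∞} {a b : ℝ}

/-- A function whose local growth is bounded by an additive interval function. -/
lemma ofReal_sub_le_of_local (hab : a ≤ b) (hf : ContinuousOn f (Icc a b))
    (hμ : ∀ r s t, r ≤ s → s ≤ t → μ r s + μ s t = μ r t)
    (h : ∀ t ∈ Ico a b, ∀ ε > 0, ∀ᶠ s in 𝓝[>] t,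
      ENNReal.ofReal (f s - f t) ≤ k * μ t s + ENNReal.ofReal (ε * (s - t))) :
    ENNReal.ofReal (f b - f a) ≤ k * μ a b := by
  have key : ∀ ε > 0, ENNReal.ofReal (f b - f a) ≤ k * μ a b + ENNReal.ofReal (ε * (b - a)) := by
    intro ε hε
    let R : ℝ → Prop := fun s =>
      ENNReal.ofReal (f s - f a) ≤ k * μ a s + ENNReal.ofReal (ε * (s - a))
    let T : Set ℝ := {s | s ∈ Icc a b ∧ ∀ r ∈ Icc a s, R r}
    have hRa : R a := by simp [R]
    have haT : a ∈ T := ⟨⟨le_rfl, hab⟩, fun r hr => by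
      rwa [le_antisymm hr.2 hr.1]⟩
    have hTb : BddAbove T := ⟨b, fun s hs => hs.1.2⟩
    set σ := sSup T with hσ
    have haσ : a ≤ σ := le_csSup hTb haT
    have hσb : σ ≤ b := csSup_le ⟨a, haT⟩ fun s hs => hs.1.2
    have hlt : ∀ r ∈ Ico a σ, R r := fun r hr => by
      obtain ⟨s, hs, hrs⟩ := exists_lt_of_lt_csSup ⟨a, haT⟩ hr.2
      exact hs.2 r ⟨hr.1, hrs.le⟩
    have hmono : ∀ r s, a ≤ r → r ≤ s → μ a r ≤ μ a s := fun r s h1 h2 => by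
      rw [← hμ a r s h1 h2]; exact le_self_add
    have hRσ : R σ := by
      rcases haσ.eq_or_lt with h0 | h0
      · rwa [← h0]
      have hc : Tendsto (fun s => ENNReal.ofReal (f s - f a)) (𝓝[<] σ)
          (𝓝 (ENNReal.ofReal (f σ - f a))) := by
        refine (ENNReal.continuous_ofReal.tendsto _).comp (Tendsto.sub_const ?_ _)
        refine (hf σ ⟨haσ, hσb⟩).mono_left (nhdsWithin_le_iff.2 ?_)
        filter_upwards [Ioo_mem_nhdsLT h0] with s hs using ⟨hs.1.le, hs.2.le.trans hσb⟩
      refine le_of_tendsto hc ?_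
      filter_upwards [Ioo_mem_nhdsLT h0] with s hs
      refine (hlt s ⟨hs.1.le, hs.2⟩).trans (add_le_add (mul_le_mul_right (hmono s σ hs.1.le hs.2.le) k)
        (ENNReal.ofReal_le_ofReal ?_))
      have := hs.2
      gcongr
    have hall : ∀ r ∈ Icc a σ, R r := fun r hr => by
      rcases hr.2.eq_or_lt with h0 | h0
      · rwa [h0]
      · exact hlt r ⟨hr.1, h0⟩
    rcases hσb.eq_or_lt with h0 | h0
    · rw [h0] at hRσ; exact hRσ
    exfalso
    obtain ⟨u, hu, hu'⟩ := mem_nhdsGT_iff_exists_Ioo_subset.1 (h σ ⟨haσ, h0⟩ ε hε)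
    obtain ⟨v, hv1, hv2⟩ := exists_between (lt_min (mem_Ioi.1 hu) h0)
    have hvT : v ∈ T := ⟨⟨haσ.trans hv1.le, hv2.le.trans (min_le_right _ _)⟩, fun r hr => by
      rcases le_or_gt r σ with h1 | h1
      · exact hall r ⟨hr.1, h1⟩
      have h2 : ENNReal.ofReal (f r - f σ) ≤ k * μ σ r + ENNReal.ofReal (ε * (r - σ)) :=
        hu' ⟨h1, hr.2.trans_lt (hv2.trans_le (min_le_left _ _))⟩
      have e1 : f r - f a = (f σ - f a) + (f r - f σ) := by ring
      have e2 : ε * (r - a) = ε * (σ - a) + ε * (r - σ) := by ring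
      show ENNReal.ofReal (f r - f a) ≤ k * μ a r + ENNReal.ofReal (ε * (r - a))
      rw [e1, e2, ← hμ a σ r haσ h1.le, mul_add, ENNReal.ofReal_add
        (mul_nonneg hε.le (sub_nonneg.2 haσ)) (mul_nonneg hε.le (sub_nonneg.2 h1.le)),
        add_add_add_comm]
      exact ENNReal.ofReal_add_le.trans (add_le_add hRσ h2)⟩
    exact absurd (le_csSup hTb hvT) (not_le.2 hv1)
  refine ENNReal.le_of_forall_pos_le_add fun ε hε _ => ?_
  refine (key (ε / (b - a + 1)) (by have := sub_nonneg.2 hab; positivity)).trans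
    (add_le_add le_rfl ?_)
  rw [ENNReal.ofReal_le_iff_le_toReal ENNReal.coe_ne_top, ENNReal.coe_toReal]
  have h0 := sub_nonneg.2 hab
  rw [div_mul_eq_mul_div, div_le_iff₀ (by positivity)]
  have : (0 : ℝ) ≤ ε := hε.le
  nlinarith

/-- Bounds along the parts of a curve avoiding finitely many points are bounds along the curve. -/
lemma ofReal_sub_le_of_avoid {Y : Type*} [TopologicalSpace Y] [T1Space Y] {F : Y → ℝ}
    (hF : Continuous F) {c : ℝ → Y} (hc : Continuous c)
    (hμ : ∀ r s t, r ≤ s → s ≤ t → μ r s + μ s t = μ r t) {E : Set Y} (hE : E.Finite)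
    (h : ∀ a b, a ≤ b → (∀ t ∈ Icc a b, c t ∉ E) →
      ENNReal.ofReal (F (c b) - F (c a)) ≤ k * μ a b) (hab : a ≤ b) :
    ENNReal.ofReal (F (c b) - F (c a)) ≤ k * μ a b := by
  have hFc : Continuous fun s => F (c s) := hF.comp hc
  suffices H : ∀ S : Set Y, S.Finite → ∀ a b, a ≤ b → (∀ t ∈ Icc a b, c t ∈ E → c t ∈ S) →
      ENNReal.ofReal (F (c b) - F (c a)) ≤ k * μ a b from H E hE a b hab fun _ _ h => h
  intro S hS
  induction S, hS using Set.Finite.induction_on with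
  | empty => exact fun a b hab hh => h a b hab fun t ht htE => (hh t ht htE).elim
  | @insert p S _ _ ih =>
    intro a b hab hh
    let Z : Set ℝ := {t | t ∈ Icc a b ∧ c t = p}
    have hZc : IsClosed Z := isClosed_Icc.inter (isClosed_singleton.preimage hc)
    have hZb : BddBelow Z := ⟨a, fun t ht => ht.1.1⟩
    have hZa : BddAbove Z := ⟨b, fun t ht => ht.1.2⟩
    rcases Z.eq_empty_or_nonempty with h0 | hne
    · refine ih a b hab fun t ht htE => ((mem_insert_iff.1 (hh t ht htE)).resolve_left fun hp => ?_)
      have : t ∈ Z := ⟨ht, hp⟩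
      rw [h0] at this; exact this
    have ha' := hZc.csInf_mem hne hZb
    have hb' := hZc.csSup_mem hne hZa
    set a' := sInf Z
    set b' := sSup Z
    have hab' : a' ≤ b' := csInf_le hZb hb'
    have hleft : ENNReal.ofReal (F (c a') - F (c a)) ≤ k * μ a a' := by
      rcases ha'.1.1.eq_or_lt with h0 | h0
      · rw [← h0]; simp
      refine le_of_tendsto (x := 𝓝[<] a') (f := fun s => ENNReal.ofReal (F (c s) - F (c a)))
        ((ENNReal.continuous_ofReal.comp (hFc.sub continuous_const)).continuousAt.mono_left
          nhdsWithin_le_nhds) ?_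
      filter_upwards [Ioo_mem_nhdsLT h0] with s hs
      refine (ih a s hs.1.le fun t ht htE => ?_).trans ?_
      · refine (mem_insert_iff.1 (hh t ⟨ht.1, ht.2.trans (hs.2.le.trans ha'.1.2)⟩ htE)).resolve_left
          fun hp => ?_
        exact absurd (csInf_le hZb (show t ∈ Z from
          ⟨⟨ht.1, ht.2.trans (hs.2.le.trans ha'.1.2)⟩, hp⟩)) (not_le.2 (ht.2.trans_lt hs.2))
      · refine mul_le_mul_right ?_ k
        rw [← hμ a s a' hs.1.le hs.2.le]; exact le_self_add
    have hright : ENNReal.ofReal (F (c b) - F (c b')) ≤ k * μ b' b := by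
      rcases hb'.1.2.eq_or_lt with h0 | h0
      · rw [h0]; simp
      refine le_of_tendsto (x := 𝓝[>] b') (f := fun s => ENNReal.ofReal (F (c b) - F (c s)))
        ((ENNReal.continuous_ofReal.comp (continuous_const.sub hFc)).continuousAt.mono_left
          nhdsWithin_le_nhds) ?_
      filter_upwards [Ioo_mem_nhdsGT h0] with s hs
      refine (ih s b hs.2.le fun t ht htE => ?_).trans ?_
      · refine (mem_insert_iff.1 (hh t ⟨hb'.1.1.trans (hs.1.le.trans ht.1), ht.2⟩ htE)).resolve_left
          fun hp => ?_
        exact absurd (le_csSup hZa (show t ∈ Z from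
          ⟨⟨hb'.1.1.trans (hs.1.le.trans ht.1), ht.2⟩, hp⟩)) (not_le.2 (hs.1.trans_le ht.1))
      · refine mul_le_mul_right ?_ k
        rw [← hμ b' s b hs.1.le hs.2.le]; exact le_add_self
    have e : F (c b) - F (c a) = (F (c a') - F (c a)) + (F (c b) - F (c b')) := by
      rw [ha'.2, hb'.2]; ring
    rw [e, ← hμ a a' b ha'.1.1 (hab'.trans hb'.1.2), ← hμ a' b' b hab' hb'.1.2]
    refine ENNReal.ofReal_add_le.trans ?_
    rw [mul_add, mul_add]
    exact add_le_add hleft (hright.trans le_add_self)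

end ContinuousInduction

section CurveLengths

variable {m n : ℕ} {M : Type*} [TopologicalSpace M] [ChartedSpace (Cn n) M] {N : Type*}
  [TopologicalSpace N] [ChartedSpace (Cn m) N] {g : BilinField n M} {h : BilinField m N}

lemma gLen_le_add {γ : ℝ → M} {c : ℝ → N} {a b k ε : ℝ} (hk : 0 ≤ k) (hε : 0 ≤ ε)
    (hle : ∀ t ∈ Icc a b, Real.sqrt (sqNorm g (γ t) (vel γ t)) ≤
      k * Real.sqrt (sqNorm h (c t) (vel c t)) + ε) :
    gLen g γ a b ≤ ENNReal.ofReal k * gLen h c a b + ENNReal.ofReal (ε * (b - a)) := by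
  rw [gLen, gLen, ← MeasureTheory.lintegral_const_mul' _ _ ENNReal.ofReal_ne_top,
    ENNReal.ofReal_mul hε, ← Real.volume_Icc, ← MeasureTheory.setLIntegral_const,
    ← MeasureTheory.lintegral_add_right _ measurable_const]
  refine MeasureTheory.setLIntegral_mono' measurableSet_Icc fun t ht => ?_
  rw [← ENNReal.ofReal_mul hk, ← ENNReal.ofReal_add (by positivity) hε]
  exact ENNReal.ofReal_le_ofReal (hle t ht)

end CurveLengths

section GromovHausdorff

universe u v

variable {X : Type u} {Y : Type v} {dX : X → X → ℝ≥0∞} {dY : Y → Y → ℝ≥0∞}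

/-- The pseudometric space of a finite distance. -/
abbrev pseudoMetricOf (dX : X → X → ℝ≥0∞) (h0 : ∀ x, dX x x = 0) (hc : ∀ x y, dX x y = dX y x)
    (ht : ∀ x y z, dX x z ≤ dX x y + dX y z) (hf : ∀ x y, dX x y ≠ ⊤) : PseudoMetricSpace X where
  dist x y := (dX x y).toReal
  dist_self x := by rw [h0, ENNReal.toReal_zero]
  dist_comm x y := by rw [hc]
  dist_triangle x y z := by
    rw [← ENNReal.toReal_add (hf _ _) (hf _ _)]
    exact ENNReal.toReal_mono (ENNReal.add_ne_top.2 ⟨hf _ _, hf _ _⟩) (ht x y z)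

/-- The Gromov-Hausdorff distance is at most half the distortion of a surjective map. -/
theorem ghEDist_le_of_surjective [Nonempty X] (h0 : ∀ x, dX x x = 0)
    (hc : ∀ x y, dX x y = dX y x) (ht : ∀ x y z, dX x z ≤ dX x y + dX y z)
    (hf : ∀ x y, dX x y ≠ ⊤) (h0' : ∀ x, dY x x = 0) (hc' : ∀ x y, dY x y = dY y x)
    (ht' : ∀ x y z, dY x z ≤ dY x y + dY y z) (hf' : ∀ x y, dY x y ≠ ⊤) {π : X → Y}
    (hπ : Function.Surjective π) {ε : ℝ} (hε : 0 < ε)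
    (h : ∀ x y, |(dX x y).toReal - (dY (π x) (π y)).toReal| ≤ 2 * ε) :
    ghEDist dX dY ≤ ENNReal.ofReal ε := by
  let _ : PseudoMetricSpace X := pseudoMetricOf dX h0 hc ht hf
  let _ : PseudoMetricSpace Y := pseudoMetricOf dY h0' hc' ht' hf'
  let Φ : X → SeparationQuotient X := SeparationQuotient.mk
  let Ψ : X → SeparationQuotient Y := fun x => SeparationQuotient.mk (π x)
  let _ : MetricSpace (SeparationQuotient X ⊕ SeparationQuotient Y) :=
    Metric.glueMetricApprox Φ Ψ ε hε fun p q => h p q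
  let i : X → SeparationQuotient X ⊕ SeparationQuotient Y := fun x => .inl (.mk x)
  let j : Y → SeparationQuotient X ⊕ SeparationQuotient Y := fun y => .inr (.mk y)
  have hij : ∀ x, edist (i x) (j (π x)) = ENNReal.ofReal ε := fun x => by
    rw [edist_dist]
    exact congrArg ENNReal.ofReal (Metric.glueDist_glued_points Φ Ψ ε x)
  refine le_trans (sInf_le ⟨_, inferInstance, i, j, fun x x' => ?_, fun y y' => ?_, rfl⟩)
    (Metric.hausdorffEDist_le_of_mem_edist ?_ ?_)
  · rw [edist_dist]
    exact ENNReal.ofReal_toReal (hf x x')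
  · rw [edist_dist]
    exact ENNReal.ofReal_toReal (hf' y y')
  · rintro _ ⟨x, rfl⟩
    exact ⟨_, ⟨π x, rfl⟩, (hij x).le⟩
  · rintro _ ⟨y, rfl⟩
    obtain ⟨x, rfl⟩ := hπ y
    exact ⟨_, ⟨x, rfl⟩, by rw [edist_comm]; exact (hij x).le⟩

end GromovHausdorff

section RealStructure

variable {m n : ℕ} {M : Type*} [TopologicalSpace M] [ChartedSpace (Cn m) M]
  [IsManifold 𝓘(ℂ, Cn m) ω M] {N : Type*} [TopologicalSpace N] [ChartedSpace (Cn n) N]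
  [IsManifold 𝓘(ℂ, Cn n) ω N]

variable (n N) in
/-- The real manifold underlying a complex manifold. -/
lemma isManifold_real_one : IsManifold 𝓘(ℝ, Cn n) 1 N :=
  have := isManifold_real n N
  IsManifold.of_le (n := ∞) (by exact_mod_cast le_top)

lemma contMDiffAt_real_of_holomorphic {f : M → N} {x : M}
    (h : ∀ᶠ y in 𝓝 x, MDifferentiableAt 𝓘(ℂ, Cn m) 𝓘(ℂ, Cn n) f y) :
    ContMDiffAt 𝓘(ℝ, Cn m) 𝓘(ℝ, Cn n) 1 f x := by
  have hc := h.self_of_nhds.continuousAt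
  rw [contMDiffAt_iff]
  refine ⟨hc, ?_⟩
  have hx := mem_chart_target (Cn m) x
  have hl := (chartAt (Cn m) x).left_inv (mem_chart_source (Cn m) x)
  have hs := (chartAt (Cn m) x).continuousAt_symm hx
  have h1 : ∀ᶠ z in 𝓝 (chartAt (Cn m) x x),
      DifferentiableAt ℂ (chartAt (Cn n) (f x) ∘ f ∘ (chartAt (Cn m) x).symm) z := by
    filter_upwards [(chartAt (Cn m) x).open_target.mem_nhds hx,
      hs.eventually (by rwa [hl]),
      hs.eventually (by
        rw [hl]; exact hc.eventually ((chartAt (Cn n) (f x)).open_source.mem_nhds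
          (mem_chart_source _ _)))] with z h1 h2 h3
      using MDifferentiableAt.differentiableAt_charts_complex h1 h3 h2
  have h2 := ((contDiffAt_of_eventually_differentiableAt h1).restrict_scalars ℝ).of_le
    (m := 1) (by exact_mod_cast le_top)
  simp only [mfld_simps, contDiffWithinAt_univ]
  exact h2

lemma vel_comp_of_holomorphic {f : M → N} {γ : ℝ → M} {t : ℝ}
    (h : MDifferentiableAt 𝓘(ℂ, Cn m) 𝓘(ℂ, Cn n) f (γ t))
    (hγ : MDifferentiableAt 𝓘(ℝ, ℝ) 𝓘(ℝ, Cn m) γ t) :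
    vel (f ∘ γ) t = (mfderiv 𝓘(ℂ, Cn m) 𝓘(ℂ, Cn n) f (γ t) (vel γ t) : Cn n) :=
  (vel_comp h.real hγ).trans (mfderiv_real_apply h _)

lemma vel_eq_deriv {w : ℝ → Cn n} {t : ℝ} : vel w t = deriv w t := by
  have h := congrFun (congrArg DFunLike.coe (mfderiv_eq_fderiv (𝕜 := ℝ) (f := w) (x := t))) (1 : ℝ)
  have h2 : fderiv ℝ w t 1 = deriv w t := fderiv_apply_one_eq_deriv
  exact h.trans h2

end RealStructure

section InvariantMetrics

variable {X : Type*} [TopologicalSpace X] [ChartedSpace (Cn 2) X] [IsManifold 𝓘(ℂ, Cn 2) ω X]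
  {lam : ℝ} {A : X → Matrix (Fin 2) (Fin 2) ℂ} {x y : X} {B : Matrix (Fin 2) (Fin 2) ℂ}

lemma sqNorm_invForm (v : Cn 2) : sqNorm (invForm A B) x v = frameForm A B x v v := rfl

/-- Nearby points have small distance. -/
theorem eventually_riemDist_invForm_le (hA : IsInvariantCoframeOn lam A) (x : X) {ε : ℝ}
    (hε : 0 < ε) : ∀ᶠ y in 𝓝 x, riemDist (invForm A B) x y ≤ ENNReal.ofReal ε := by
  set e := chartAt (Cn 2) x with he
  set z₀ := e x with hz₀
  have hz₀t : z₀ ∈ e.target := mem_chart_target (Cn 2) x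
  have hl : e.symm z₀ = x := e.left_inv (mem_chart_source (Cn 2) x)
  let Φ : Cn 2 × Cn 2 → ℝ := fun p =>
    Real.sqrt (2 * (p.2.ofLp ᵥ* coMat A x p.1 ⬝ᵥ (B *ᵥ star (p.2.ofLp ᵥ* coMat A x p.1))).re)
  have hΦ : ContinuousAt Φ (z₀, 0) := by
    have h1 : ∀ i j, ContinuousAt (fun p : Cn 2 × Cn 2 => coMat A x p.1 i j) (z₀, 0) :=
      fun i j => ContinuousAt.comp (f := Prod.fst) (g := fun z => coMat A x z i j)
        (contDiffAt_coMat hA hz₀t i j).continuousAt continuousAt_fst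
    have h2 : ∀ j, ContinuousAt (fun p : Cn 2 × Cn 2 => (p.2.ofLp ᵥ* coMat A x p.1) j) (z₀, 0) := by
      intro j
      simp only [Matrix.vecMul, dotProduct, Fin.sum_univ_two]
      have h3 : ∀ i, ContinuousAt (fun p : Cn 2 × Cn 2 => p.2 i) (z₀, 0) := fun i => by fun_prop
      exact ((h3 0).mul (h1 0 j)).add ((h3 1).mul (h1 1 j))
    refine Real.continuous_sqrt.continuousAt.comp (continuousAt_const.mul
      (Complex.continuous_re.continuousAt.comp ?_))
    simp only [dotProduct, Matrix.mulVec, Fin.sum_univ_two, Pi.star_apply]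
    exact ((h2 0).mul ((continuousAt_const.mul (h2 0).star).add
      (continuousAt_const.mul (h2 1).star))).add ((h2 1).mul
      ((continuousAt_const.mul (h2 0).star).add (continuousAt_const.mul (h2 1).star)))
  have hΦ0 : Φ (z₀, 0) = 0 := by simp [Φ]
  have hev : ∀ᶠ p in 𝓝 (z₀, (0 : Cn 2)), Φ p < ε := hΦ.eventually_lt continuousAt_const (by
    rw [hΦ0]; exact hε)
  obtain ⟨r, hr, hball⟩ := Metric.eventually_nhds_iff.1 hev
  obtain ⟨r', hr', ht⟩ := Metric.isOpen_iff.1 e.open_target z₀ hz₀t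
  filter_upwards [e.open_source.mem_nhds (mem_chart_source (Cn 2) x),
    (e.continuousAt (mem_chart_source (Cn 2) x)).eventually
      (Metric.ball_mem_nhds z₀ (lt_min hr hr'))] with y hy hyr
  let w : ℝ → Cn 2 := fun s => z₀ + s • (e y - z₀)
  have hw : ∀ s, HasDerivAt w (e y - z₀) s := fun s => by
    have h := ((hasDerivAt_id s).smul_const (e y - z₀)).const_add z₀
    rwa [one_smul] at h
  have hws : ContDiff ℝ 1 w := by fun_prop
  have hwr : ∀ s ∈ Icc (0 : ℝ) 1, dist (w s) z₀ < min r r' := fun s hs => by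
    have : dist (w s) z₀ = |s| * dist (e y) z₀ := by
      rw [dist_eq_norm, dist_eq_norm, ← Real.norm_eq_abs, ← norm_smul]; simp [w]
    rw [this, abs_of_nonneg hs.1]
    exact (mul_le_of_le_one_left dist_nonneg hs.2).trans_lt hyr
  have hwt : ∀ s ∈ Icc (0 : ℝ) 1, w s ∈ e.target := fun s hs =>
    ht ((hwr s hs).trans_le (min_le_right _ _))
  have := isManifold_real_one 2 X
  have hsymm : ∀ z ∈ e.target, ContMDiffAt 𝓘(ℝ, Cn 2) 𝓘(ℝ, Cn 2) 1 e.symm z := fun z hz =>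
    (contMDiffOn_chart_symm (I := 𝓘(ℝ, Cn 2)) (n := 1) (x := x)).contMDiffAt
      (e.open_target.mem_nhds hz)
  have hγ : ContMDiffOn 𝓘(ℝ, ℝ) 𝓘(ℝ, Cn 2) 1 (e.symm ∘ w) (Icc 0 1) := fun s hs =>
    ((hsymm _ (hwt s hs)).comp s hws.contMDiff.contMDiffAt).contMDiffWithinAt
  have hv : ∀ s ∈ Icc (0 : ℝ) 1, vel (e.symm ∘ w) s = chartVecC x (w s) (e y - z₀) := by
    intro s hs
    have h1 := vel_comp (γ := w) (f := e.symm)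
      ((hsymm _ (hwt s hs)).mdifferentiableAt one_ne_zero)
      (hws.contMDiff.mdifferentiable one_ne_zero s)
    rw [vel_eq_deriv, (hw s).deriv] at h1
    exact h1
  have h := riemDist_le_gLen (g := invForm A B) hγ zero_le_one
  have e0 : (e.symm ∘ w) 0 = x := by simp [w, hl]
  have e1 : (e.symm ∘ w) 1 = y := by simp [w, e.left_inv hy]
  rw [e0, e1] at h
  refine h.trans ((gLen_le_of_le (K := ε) fun s hs => ?_).trans (by simp))
  have e2 : Real.sqrt (sqNorm (invForm A B) ((e.symm ∘ w) s) (vel (e.symm ∘ w) s)) =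
      Φ (w s, e y - z₀) := by
    rw [hv s hs, sqNorm_invForm, frameForm]
    have h3 : coframe A ((e.symm ∘ w) s) (chartVecC x (w s) (e y - z₀)) = _ :=
      coframe_chartVec (A := A) (hwt s hs) (e y - z₀)
    rw [h3]
  rw [e2]
  refine (hball ?_).le
  rw [Prod.dist_eq, max_lt_iff]
  refine ⟨(hwr s hs).trans_le (min_le_left _ _), ?_⟩
  rw [dist_zero_right, ← dist_eq_norm]
  exact lt_of_lt_of_le hyr (min_le_left _ _)

/-- On a compact manifold the distances are bounded. -/
theorem exists_riemDist_invForm_le [CompactSpace X] [PreconnectedSpace X]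
    (hA : IsInvariantCoframeOn lam A) (B : Matrix (Fin 2) (Fin 2) ℂ) :
    ∃ D : ℝ, 0 ≤ D ∧ ∀ x y, riemDist (invForm A B) x y ≤ ENNReal.ofReal D := by
  have hfin : ∀ x y, riemDist (invForm A B) x y ≠ ⊤ := by
    intro x
    have hcl : IsClopen {y | riemDist (invForm A B) x y ≠ ⊤} := by
      have key : ∀ y, ∀ᶠ y' in 𝓝 y, riemDist (invForm A B) y y' ≠ ⊤ := fun y =>
        (eventually_riemDist_invForm_le hA y zero_lt_one).mono fun y' h =>
          ne_top_of_le_ne_top ENNReal.ofReal_ne_top h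
      constructor
      · rw [← isOpen_compl_iff, isOpen_iff_mem_nhds]
        intro y hy
        filter_upwards [key y] with y' h hy'
        refine hy (ne_top_of_le_ne_top (ENNReal.add_ne_top.2 ⟨hy', h⟩) ?_)
        rw [riemDist_comm (x := y) (y := y')]
        exact riemDist_triangle
      · rw [isOpen_iff_mem_nhds]
        intro y hy
        filter_upwards [key y] with y' h
        exact ne_top_of_le_ne_top (ENNReal.add_ne_top.2 ⟨hy, h⟩) riemDist_triangle
    intro y
    have := hcl.eq_univ ⟨x, by
      show riemDist (invForm A B) x x ≠ ⊤
      rw [riemDist_self]; exact ENNReal.zero_ne_top⟩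
    exact (eq_univ_iff_forall.1 this) y
  cases isEmpty_or_nonempty X with
  | inl h => exact ⟨0, le_rfl, fun x => h.elim x⟩
  | inr h =>
    obtain ⟨x₀⟩ := h
    obtain ⟨t, -, ht⟩ := isCompact_univ.elim_nhds_subcover
      (fun x : X => {y | riemDist (invForm A B) x y ≤ ENNReal.ofReal 1})
      (fun x _ => eventually_riemDist_invForm_le hA x zero_lt_one)
    let S : ℝ≥0∞ := ∑ x ∈ t, riemDist (invForm A B) x₀ x + 1
    have hS : S ≠ ⊤ := ENNReal.add_ne_top.2
      ⟨ENNReal.sum_ne_top.2 fun x _ => hfin x₀ x, ENNReal.one_ne_top⟩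
    have hb : ∀ y, riemDist (invForm A B) x₀ y ≤ S := fun y => by
      obtain ⟨x, hx, hy⟩ := mem_iUnion₂.1 (ht (mem_univ y))
      refine riemDist_triangle.trans (add_le_add (Finset.single_le_sum
        (f := fun x => riemDist (invForm A B) x₀ x) (fun _ _ => zero_le) hx) ?_)
      simpa using hy
    refine ⟨(S + S).toReal, ENNReal.toReal_nonneg, fun x y => ?_⟩
    rw [ENNReal.ofReal_toReal (ENNReal.add_ne_top.2 ⟨hS, hS⟩)]
    refine riemDist_triangle.trans (add_le_add ?_ (hb y))
    rw [riemDist_comm]; exact hb x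

lemma sqNorm_hermMat_identity {a b : ℝ} {z : ℂ} (hb : b ≠ 0) (v : Cn 2) :
    sqNorm (invForm A (hermMat a b z)) x v =
      2 * ((a - Complex.normSq z / b) * Complex.normSq (coframe A x v 0) +
        Complex.normSq (coframe A x v 0 * z + b * coframe A x v 1) / b) := by
  rw [sqNorm_invForm, frameForm_hermMat_self]
  have := hermMat_form_identity a b z (coframe A x v 0) (coframe A x v 1)
  field_simp
  linear_combination this

lemma sqNorm_hermMat_le {a b : ℝ} {z : ℂ} (ha : 0 ≤ a) (hb : 0 ≤ b) (v : Cn 2) :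
    sqNorm (invForm A (hermMat a b z)) x v ≤
      (a + b + ‖z‖) * sqNorm (invForm A (hermMat 1 1 0)) x v := by
  simp only [sqNorm_invForm, frameForm_hermMat_self]
  set p := coframe A x v 0
  set q := coframe A x v 1
  have h1 : (p * z * conj q).re ≤ ‖z‖ * (‖p‖ * ‖q‖) := by
    refine (Complex.re_le_norm _).trans (le_of_eq ?_)
    rw [norm_mul, norm_mul, RCLike.norm_conj]; ring
  simp only [Complex.normSq_eq_norm_sq, mul_zero, zero_mul, Complex.zero_re]
  nlinarith [mul_nonneg (norm_nonneg z) (sq_nonneg (‖p‖ - ‖q‖)), mul_nonneg ha (sq_nonneg ‖q‖),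
    mul_nonneg hb (sq_nonneg ‖p‖)]

lemma riemDist_hermMat_le {a b K : ℝ} {z : ℂ} (ha : 0 ≤ a) (hb : 0 ≤ b) (hK : 0 < K)
    (h : a + b + ‖z‖ ≤ K ^ 2) : riemDist (invForm A (hermMat a b z)) x y ≤
      ENNReal.ofReal K * riemDist (invForm A (hermMat 1 1 0)) x y := by
  refine riemDist_le_of_le hK fun x v => ?_
  have h0 : 0 ≤ sqNorm (invForm A (hermMat 1 1 0)) x v := by
    rw [sqNorm_invForm, frameForm_hermMat_self]
    simp only [mul_zero, zero_mul, Complex.zero_re]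
    have := Complex.normSq_nonneg (coframe A x v 0)
    have := Complex.normSq_nonneg (coframe A x v 1)
    linarith
  rw [← Real.sqrt_sq hK.le, ← Real.sqrt_mul (sq_nonneg K)]
  exact Real.sqrt_le_sqrt ((sqNorm_hermMat_le ha hb v).trans (mul_le_mul_of_nonneg_right h h0))

end InvariantMetrics

section Collapsing

variable {X : Type*} [TopologicalSpace X] [CompactSpace X] [PreconnectedSpace X]
  [ChartedSpace (Cn 2) X] [IsManifold 𝓘(ℂ, Cn 2) ω X]
  {C : Type*} [TopologicalSpace C] [T2Space C] [ChartedSpace (Cn 1) C] [IsManifold 𝓘(ℂ, Cn 1) ω C]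
  {lam : ℝ} {A : X → Matrix (Fin 2) (Fin 2) ℂ} {π : X → C} {x y : X}

lemma sqNorm_gKEBase_le (hA : IsInvariantCoframeOn lam A) (hd : ∀ x, (A x).det ≠ 0)
    (hπ : IsEllipticFibration π) (v : Cn 2) :
    sqNorm (gKEBase A π hπ.surj) (π x) (baseDeriv π x v) ≤ 4 * Complex.normSq (coframe A x v 0) := by
  by_cases hx : π x ∈ critValues π
  · rw [sqNorm, gKEBase_of_mem hπ.surj hx]
    have := Complex.normSq_nonneg (coframe A x v 0)
    linarith
  · rw [sqNorm, ← frameForm_eq_gKEBase hA hd hπ hx, frameForm_hermMat_self]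
    simp only [mul_zero, zero_mul, Complex.zero_re]
    linarith

lemma contMDiff_real_of_holomorphic (hπ : MDifferentiable 𝓘(ℂ, Cn 2) 𝓘(ℂ, Cn 1) π) :
    ContMDiff 𝓘(ℝ, Cn 2) 𝓘(ℝ, Cn 1) 1 π := fun _ =>
  contMDiffAt_real_of_holomorphic (Eventually.of_forall hπ)

/-- The projection to the base contracts distances. -/
theorem riemDist_gKEBase_le (hA : IsInvariantCoframeOn lam A) (hd : ∀ x, (A x).det ≠ 0)
    (hπ : IsEllipticFibration π) {a b : ℝ} {z : ℂ} (hb : 0 < b)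
    (hab : 0 < a - Complex.normSq z / b) : riemDist (gKEBase A π hπ.surj) (π x) (π y) ≤
      ENNReal.ofReal (Real.sqrt (2 / (a - Complex.normSq z / b))) *
        riemDist (invForm A (hermMat a b z)) x y := by
  refine riemDist_map_le (contMDiff_real_of_holomorphic hπ.holo) (by positivity) fun x v => ?_
  rw [← Real.sqrt_mul (by positivity)]
  refine Real.sqrt_le_sqrt ((sqNorm_gKEBase_le hA hd hπ v).trans ?_)
  rw [sqNorm_hermMat_identity hb.ne', mul_left_comm, ← mul_assoc, mul_add,
    show 2 * (2 / (a - Complex.normSq z / b)) * ((a - Complex.normSq z / b) *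
      Complex.normSq (coframe A x v 0)) = 4 * Complex.normSq (coframe A x v 0) by
        rw [← mul_assoc]; congr 1; rw [mul_assoc, div_mul_cancel₀ _ hab.ne']; norm_num]
  have := Complex.normSq_nonneg (coframe A x v 0 * z + b * coframe A x v 1)
  have h2 : 0 ≤ 2 * (2 / (a - Complex.normSq z / b)) *
    (Complex.normSq (coframe A x v 0 * z + b * coframe A x v 1) / b) := by positivity
  linarith

/-- The distances along a regular fibre. -/
lemma exists_riemDist_fibre_le (hA : IsInvariantCoframeOn lam A) (hπ : IsEllipticFibration π)
    (hx : π x ∉ critValues π) (hxy : π y = π x) : ∃ L : ℝ, 0 ≤ L ∧ ∀ (a b : ℝ) (z : ℂ), 0 ≤ b →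
      riemDist (invForm A (hermMat a b z)) x y ≤ ENNReal.ofReal (Real.sqrt (2 * b) * L) := by
  obtain ⟨u, hu, -, hr⟩ := hπ.exists_curve hx
  obtain ⟨ζ, rfl⟩ : x ∈ range u := by rw [hr]; rfl
  obtain ⟨η, rfl⟩ : y ∈ range u := by rw [hr]; exact hxy
  let w : ℝ → Cn 1 := fun s => ζ + s • (η - ζ)
  have hw : ∀ s, HasDerivAt w (η - ζ) s := fun s => by
    have h := ((hasDerivAt_id s).smul_const (η - ζ)).const_add ζ
    rwa [one_smul] at h
  have hws : ContDiff ℝ 1 w := by fun_prop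
  have hγ : ContMDiff 𝓘(ℝ, ℝ) 𝓘(ℝ, Cn 2) 1 (u ∘ w) := fun s =>
    (contMDiffAt_real_of_holomorphic (Eventually.of_forall hu)).comp s hws.contMDiff.contMDiffAt
  have hco : ∀ s, coframe A ((u ∘ w) s) (vel (u ∘ w) s) = (η - ζ) 0 • velCo A u (w s) := by
    intro s
    have h1 := vel_comp_of_holomorphic (γ := w) (t := s) (hu _)
      (hws.contMDiff.mdifferentiable one_ne_zero s)
    rw [vel_eq_deriv, (hw s).deriv] at h1
    have h2 : ∀ f : Cn 1 →L[ℂ] Cn 2, f (η - ζ) = (η - ζ) 0 • f (stdVec 0) := fun f => by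
      conv_lhs => rw [Cn.one_eq (η - ζ), map_smul]
    have h3 := h1.trans (h2 _)
    rw [h3, coframe_smul]; rfl
  have hv0 : ∀ s, velCo A u (w s) 0 = 0 := fun s => velCo_eq_zero_of_entire hA hu _
  have hcont : Continuous fun s => ‖velCo A u (w s) 1‖ :=
    continuous_norm.comp ((continuous_iff_continuousAt.2 fun c =>
      (contDiffAt_velCo hA (Eventually.of_forall hu) 1).continuousAt).comp hws.continuous)
  obtain ⟨L, hL⟩ := (isCompact_Icc (a := (0 : ℝ)) (b := 1)).exists_bound_of_continuousOn
    hcont.continuousOn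
  refine ⟨‖(η - ζ) 0‖ * |L|, by positivity, fun a b z hb => ?_⟩
  have h := riemDist_le_gLen (g := invForm A (hermMat a b z)) (a := 0) (b := 1)
    hγ.contMDiffOn zero_le_one
  have e0 : (u ∘ w) 0 = u ζ := by simp [w]
  have e1 : (u ∘ w) 1 = u η := by simp [w]
  rw [e0, e1] at h
  refine h.trans ((gLen_le_of_le (K := Real.sqrt (2 * b) * (‖(η - ζ) 0‖ * |L|))
    fun s hs => ?_).trans (by simp))
  rw [sqNorm_invForm, frameForm_hermMat_self, hco s]
  simp only [Pi.smul_apply, smul_eq_mul, hv0, mul_zero, zero_mul, Complex.zero_re, map_zero,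
    zero_add, add_zero]
  rw [← mul_assoc, Real.sqrt_mul (by positivity), Complex.normSq_eq_norm_sq,
    Real.sqrt_sq (norm_nonneg _), norm_mul]
  have := (hL s hs).trans (le_abs_self L)
  rw [norm_norm] at this
  gcongr

lemma isClosedMap_of_holomorphic (hπ : MDifferentiable 𝓘(ℂ, Cn 2) 𝓘(ℂ, Cn 1) π) :
    IsClosedMap π := hπ.continuous.isClosedMap

lemma exists_fibre_nhds (hA : IsInvariantCoframeOn lam A) (hπ : IsEllipticFibration π) (p : C)
    {δ : ℝ} (hδ : 0 < δ) : ∃ L : ℝ, 0 ≤ L ∧ ∀ᶠ q in 𝓝 p, ∀ (a b K : ℝ) (z : ℂ), 0 ≤ a → 0 ≤ b →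
      0 < K → a + b + ‖z‖ ≤ K ^ 2 → ∀ x y, π x = q → π y = q →
      riemDist (invForm A (hermMat a b z)) x y ≤
        ENNReal.ofReal (K * (4 * δ) + Real.sqrt (2 * b) * L) := by
  set g₁ := invForm A (hermMat 1 1 0) with hg₁
  have hF : IsCompact (π ⁻¹' {p}) := (isClosed_singleton.preimage hπ.holo.continuous).isCompact
  have hN : ∀ x, {y | riemDist g₁ x y ≤ ENNReal.ofReal δ} ∈ 𝓝 x := fun x =>
    eventually_riemDist_invForm_le hA x hδ
  obtain ⟨t, ht, hcov⟩ := hF.elim_nhds_subcover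
    (fun x => interior {y | riemDist g₁ x y ≤ ENNReal.ofReal δ})
    (fun x _ => interior_mem_nhds.2 (hN x))
  set U : X → Set X := fun x => interior {y | riemDist g₁ x y ≤ ENNReal.ofReal δ} with hU
  have hUs : ∀ i, U i ⊆ {y | riemDist g₁ i y ≤ ENNReal.ofReal δ} := fun _ => interior_subset
  have hW1 : ∀ᶠ q in 𝓝 p, π ⁻¹' {q} ⊆ ⋃ x ∈ t, U x := by
    have hop : IsOpen (⋃ x ∈ t, U x) := isOpen_biUnion fun _ _ => isOpen_interior
    have hc := isClosedMap_of_holomorphic hπ.holo _ hop.isClosed_compl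
    filter_upwards [hc.isOpen_compl.mem_nhds (x := p) (by
      rintro ⟨x, hx, hxp⟩; exact hx (hcov hxp))] with q hq x hx
    by_contra hxU
    exact hq ⟨x, hxU, hx⟩
  have hW2 : ∀ᶠ q in 𝓝 p, ∀ x ∈ t, ∃ y ∈ U x, π y = q := by
    rw [Filter.eventually_all_finset]
    intro x hx
    have hxp : π x = p := ht x hx
    have hxU : x ∈ U x := mem_interior_iff_mem_nhds.2 (hN x)
    rw [← hxp]
    exact (isOpenMap_of_holomorphic hπ.holo hπ.surj).image_mem_nhds (isOpen_interior.mem_nhds hxU)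
  obtain ⟨q₀, ⟨hq1, hq2⟩, hq₀⟩ : ∃ q₀, ((π ⁻¹' {q₀} ⊆ ⋃ x ∈ t, U x) ∧
      ∀ x ∈ t, ∃ y ∈ U x, π y = q₀) ∧ q₀ ∉ critValues π := by
    obtain ⟨q₀, h, h'⟩ := (dense_compl_critValues hπ.holo).inter_nhds_nonempty (hW1.and hW2)
    exact ⟨q₀, h', h⟩
  choose! c hcU hcq using hq2
  have hL : ∀ x y, ∃ L : ℝ, 0 ≤ L ∧ (x ∈ t → y ∈ t → ∀ (a b : ℝ) (z : ℂ), 0 ≤ b →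
      riemDist (invForm A (hermMat a b z)) (c x) (c y) ≤
        ENNReal.ofReal (Real.sqrt (2 * b) * L)) := by
    intro x y
    by_cases h : x ∈ t ∧ y ∈ t
    · obtain ⟨L, hL, h'⟩ := exists_riemDist_fibre_le (x := c x) (y := c y) hA hπ
        (by rwa [hcq x h.1]) (by rw [hcq x h.1, hcq y h.2])
      exact ⟨L, hL, fun _ _ => h'⟩
    · exact ⟨0, le_rfl, fun h1 h2 => absurd ⟨h1, h2⟩ h⟩
  choose L hL0 hL using hL
  refine ⟨∑ x ∈ t, ∑ y ∈ t, L x y, Finset.sum_nonneg fun _ _ => Finset.sum_nonneg fun _ _ =>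
    hL0 _ _, ?_⟩
  filter_upwards [hW1] with q hq a b K z ha hb hK h x y hx hy
  obtain ⟨i, hi, hxi⟩ := mem_iUnion₂.1 (hq hx)
  obtain ⟨j, hj, hyj⟩ := mem_iUnion₂.1 (hq hy)
  have hsm : ∀ i ∈ t, ∀ x ∈ U i, riemDist (invForm A (hermMat a b z)) x (c i) ≤
      ENNReal.ofReal (K * (2 * δ)) := fun i hi x hx => by
    refine (riemDist_hermMat_le ha hb hK h).trans ?_
    rw [ENNReal.ofReal_mul hK.le]
    refine mul_le_mul_right (riemDist_triangle (y := i) |>.trans ?_) _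
    have h1 : riemDist g₁ i x ≤ ENNReal.ofReal δ := hUs i hx
    have h2 : riemDist g₁ i (c i) ≤ ENNReal.ofReal δ := hUs i (hcU i hi)
    rw [riemDist_comm (x := x), two_mul, ENNReal.ofReal_add hδ.le hδ.le]
    exact add_le_add h1 h2
  have hLs : L i j ≤ ∑ x ∈ t, ∑ y ∈ t, L x y :=
    (Finset.single_le_sum (f := fun y => L i y) (fun _ _ => hL0 _ _) hj).trans
      (Finset.single_le_sum (f := fun x => ∑ y ∈ t, L x y)
        (fun _ _ => Finset.sum_nonneg fun _ _ => hL0 _ _) hi)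
  have h1 := hsm i hi x hxi
  have h2 := hL i j hi hj a b z hb
  have h3 := hsm j hj y hyj
  rw [riemDist_comm] at h3
  calc riemDist (invForm A (hermMat a b z)) x y
      ≤ riemDist (invForm A (hermMat a b z)) x (c i) +
        (riemDist (invForm A (hermMat a b z)) (c i) (c j) +
        riemDist (invForm A (hermMat a b z)) (c j) y) :=
        riemDist_triangle.trans (add_le_add le_rfl riemDist_triangle)
    _ ≤ ENNReal.ofReal (K * (2 * δ)) + (ENNReal.ofReal (Real.sqrt (2 * b) * L i j) +
        ENNReal.ofReal (K * (2 * δ))) := add_le_add h1 (add_le_add h2 h3)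
    _ = ENNReal.ofReal (K * (2 * δ) + (Real.sqrt (2 * b) * L i j + K * (2 * δ))) := by
      have := hL0 i j
      rw [ENNReal.ofReal_add (by positivity) (by positivity),
        ENNReal.ofReal_add (by positivity) (by positivity)]
    _ ≤ _ := by
      refine ENNReal.ofReal_le_ofReal ?_
      have := mul_le_mul_of_nonneg_left hLs (Real.sqrt_nonneg (2 * b))
      linarith

/-- The fibres collapse. -/
theorem exists_fibre_diam_le (hA : IsInvariantCoframeOn lam A) (hπ : IsEllipticFibration π)
    {ε K : ℝ} (hε : 0 < ε) (hK : 0 < K) : ∃ β > 0, ∀ (a b : ℝ) (z : ℂ), 0 ≤ a → 0 ≤ b → b ≤ β →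
      a + b + ‖z‖ ≤ K ^ 2 → ∀ x y, π x = π y →
      riemDist (invForm A (hermMat a b z)) x y ≤ ENNReal.ofReal ε := by
  have hC : CompactSpace C := ⟨by
    rw [← hπ.surj.range_eq]; exact isCompact_range hπ.holo.continuous⟩
  have hδ : 0 < ε / (8 * K) := by positivity
  choose L hL0 hL using fun p => exists_fibre_nhds hA hπ p hδ
  obtain ⟨t, -, ht⟩ := isCompact_univ.elim_nhds_subcover _ (fun p _ => hL p)
  set S := ∑ p ∈ t, L p with hS
  have hS0 : 0 ≤ S := Finset.sum_nonneg fun _ _ => hL0 _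
  refine ⟨(ε / (2 * (S + 1))) ^ 2 / 2, by positivity, fun a b z ha hb hbβ h x y hxy => ?_⟩
  obtain ⟨p, hp, hxp⟩ := mem_iUnion₂.1 (ht (mem_univ (π x)))
  refine (hxp a b K z ha hb hK h x y rfl hxy.symm).trans (ENNReal.ofReal_le_ofReal ?_)
  have h1 : Real.sqrt (2 * b) ≤ ε / (2 * (S + 1)) := by
    refine Real.sqrt_le_iff.2 ⟨by positivity, by linarith⟩
  have h2 : L p ≤ S + 1 := by
    have := Finset.single_le_sum (f := L) (fun _ _ => hL0 _) hp
    linarith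
  have h3 : Real.sqrt (2 * b) * L p ≤ ε / (2 * (S + 1)) * (S + 1) :=
    mul_le_mul h1 h2 (hL0 p) (by positivity)
  have h4 : ε / (2 * (S + 1)) * (S + 1) = ε / 2 := by field_simp
  have h5 : K * (4 * (ε / (8 * K))) = ε / 2 := by field_simp; norm_num
  linarith

lemma coframe_toLp_vecMul_inv (hA : (A x).det ≠ 0) (θ : Fin 2 → ℂ) :
    coframe A x (WithLp.toLp 2 (θ ᵥ* (A x)⁻¹)) = θ := by
  show (θ ᵥ* (A x)⁻¹) ᵥ* A x = θ
  rw [Matrix.vecMul_vecMul, Matrix.nonsing_inv_mul _ hA.isUnit, Matrix.vecMul_one]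

lemma sqNorm_gKEBase_eq (hA : IsInvariantCoframeOn lam A) (hd : ∀ x, (A x).det ≠ 0)
    (hπ : IsEllipticFibration π) (hx : π x ∉ critValues π) (v : Cn 2) :
    sqNorm (gKEBase A π hπ.surj) (π x) (baseDeriv π x v) = 4 * Complex.normSq (coframe A x v 0) := by
  rw [sqNorm, ← frameForm_eq_gKEBase hA hd hπ hx, frameForm_hermMat_self]
  simp only [mul_zero, zero_mul, Complex.zero_re]
  ring

lemma sqrt_sqNorm_hermMat_le {a b : ℝ} {z : ℂ} (hb : 0 < b) (hab : 0 ≤ a - Complex.normSq z / b)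
    (v : Cn 2) : Real.sqrt (sqNorm (invForm A (hermMat a b z)) x v) ≤
      Real.sqrt ((a - Complex.normSq z / b) / 2) *
        Real.sqrt (4 * Complex.normSq (coframe A x v 0)) +
      Real.sqrt (2 / b) * ‖coframe A x v 0 * z + b * coframe A x v 1‖ := by
  rw [sqNorm_hermMat_identity hb.ne', Complex.normSq_eq_norm_sq (_ + _), ← Real.sqrt_mul (by positivity)]
  have h0 := Complex.normSq_nonneg (coframe A x v 0)
  rw [Real.sqrt_le_left (by positivity), add_sq, Real.sq_sqrt (by positivity), mul_pow,
    Real.sq_sqrt (by positivity)]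
  have : 0 ≤ 2 * Real.sqrt ((a - Complex.normSq z / b) / 2 * (4 * Complex.normSq (coframe A x v 0)))
    * (Real.sqrt (2 / b) * ‖coframe A x v 0 * z + b * coframe A x v 1‖) := by positivity
  have e : 2 * ((a - Complex.normSq z / b) * Complex.normSq (coframe A x v 0) +
      ‖coframe A x v 0 * z + b * coframe A x v 1‖ ^ 2 / b) =
      (a - Complex.normSq z / b) / 2 * (4 * Complex.normSq (coframe A x v 0)) +
      2 / b * ‖coframe A x v 0 * z + b * coframe A x v 1‖ ^ 2 := by ring
  rw [e]; linarith

/-- A curve in the base has lifts which are almost horizontal near a given regular point. -/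
theorem exists_horizontal_lift (hA : IsInvariantCoframeOn lam A) (hd : ∀ x, (A x).det ≠ 0)
    (hπ : IsEllipticFibration π) {a b : ℝ} {z : ℂ} (hb : 0 < b)
    (hab : 0 ≤ a - Complex.normSq z / b) {c : ℝ → C} (hc : ContMDiff 𝓘(ℝ, ℝ) 𝓘(ℝ, Cn 1) 1 c)
    {t : ℝ} (hx : π x = c t) (hct : c t ∉ critValues π) {ε : ℝ} (hε : 0 < ε) :
    ∃ γ : ℝ → X, γ t = x ∧ ∀ᶠ τ in 𝓝 t, ContMDiffAt 𝓘(ℝ, ℝ) 𝓘(ℝ, Cn 2) 1 γ τ ∧ π (γ τ) = c τ ∧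
      Real.sqrt (sqNorm (invForm A (hermMat a b z)) (γ τ) (vel γ τ)) ≤
        Real.sqrt ((a - Complex.normSq z / b) / 2) *
          Real.sqrt (sqNorm (gKEBase A π hπ.surj) (c τ) (vel c τ)) + ε := by
  set e := chartAt (Cn 1) (c t) with he
  have hxd : x ∈ chartDom π (c t) := by rw [← hx]; exact mem_chartDom π x
  let V : Cn 2 := WithLp.toLp 2 (![1, -(z / b)] ᵥ* (A x)⁻¹)
  have hV : coframe A x V = ![1, -(z / b)] := coframe_toLp_vecMul_inv (hd x) _
  have hVh : holDeriv (chartFun π (c t)) x V ≠ 0 := by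
    rw [(isBasic_chartFun hA hd hπ (c t)).eq_mul x hxd, hV]
    simpa using hCo_ne_zero hA hd hπ hxd (by rwa [hx])
  obtain ⟨s, hs0, hs, k, hk⟩ := exists_local_section hπ.holo hxd hVh
  rw [hx, ← he] at hs0 hs hk
  let w : ℝ → Cn 1 := fun τ => e (c τ)
  have := isManifold_real_one 1 C
  have hce : ∀ᶠ τ in 𝓝 t, c τ ∈ e.source :=
    hc.continuous.continuousAt.eventually (e.open_source.mem_nhds (mem_chart_source _ _))
  have hwc : ∀ τ, c τ ∈ e.source → ContDiffAt ℝ 1 w τ := fun τ hτ => by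
    have h1 : ContMDiffAt 𝓘(ℝ, Cn 1) 𝓘(ℝ, Cn 1) 1 e (c τ) :=
      (contMDiffOn_chart (I := 𝓘(ℝ, Cn 1)) (n := 1) (x := c t)).contMDiffAt
        (e.open_source.mem_nhds hτ)
    exact contMDiffAt_iff_contDiffAt.1 (h1.comp τ hc.contMDiffAt)
  have hwt : ContDiffAt ℝ 1 w t := hwc t (mem_chart_source _ _)
  have hws : ∀ᶠ τ in 𝓝 t, ∀ᶠ ζ in 𝓝 (w τ), MDifferentiableAt 𝓘(ℂ, Cn 1) 𝓘(ℂ, Cn 2) s ζ ∧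
      s ζ ∈ chartDom π (c t) ∧ e (π (s ζ)) = ζ :=
    hwt.continuousAt.eventually hs.eventually_nhds
  have hco : ∀ τ, MDifferentiableAt 𝓘(ℂ, Cn 1) 𝓘(ℂ, Cn 2) s (w τ) → c τ ∈ e.source →
      coframe A ((s ∘ w) τ) (vel (s ∘ w) τ) = (fderiv ℝ w τ 1) 0 • velCo A s (w τ) := by
    intro τ h1 h2
    have h3 := vel_comp_of_holomorphic (γ := w) (t := τ) h1
      ((hwc τ h2).differentiableAt one_ne_zero).mdifferentiableAt
    rw [vel_eq_deriv, ← fderiv_apply_one_eq_deriv] at h3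
    have h4 : ∀ (f : Cn 1 →L[ℂ] Cn 2) (v : Cn 1), f v = v 0 • f (stdVec 0) := fun f v => by
      conv_lhs => rw [Cn.one_eq v, map_smul]
    have h5 := h3.trans (h4 _ _)
    rw [h5, coframe_smul]; rfl
  let E : ℝ → ℝ := fun τ => Real.sqrt (2 / b) * ‖(fderiv ℝ w τ 1) 0 * velCo A s (w τ) 0 * z +
    b * ((fderiv ℝ w τ 1) 0 * velCo A s (w τ) 1)‖
  have hEc : ContinuousAt E t := by
    have h1 : ContinuousAt (fun τ => fderiv ℝ w τ 1) t :=
      ((hwt.fderiv_right (m := 0) (by norm_num)).clm_apply contDiffAt_const).continuousAt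
    have h2 : ContinuousAt (fun τ => (fderiv ℝ w τ 1) 0) t :=
      (EuclideanSpace.proj 0 : Cn 1 →L[ℂ] ℂ).continuous.continuousAt.comp h1
    have h3 : ∀ i, ContinuousAt (fun τ => velCo A s (w τ) i) t := fun i =>
      ContinuousAt.comp (f := w) (g := fun ζ => velCo A s ζ i)
        (contDiffAt_velCo hA (hs.mono fun ζ h => h.1) i).continuousAt hwt.continuousAt
    exact continuousAt_const.mul (((h2.mul (h3 0)).mul continuousAt_const).add
      (continuousAt_const.mul (h2.mul (h3 1)))).norm
  have hE0 : E t = 0 := by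
    have h1 : velCo A s (w t) = k • ![1, -(z / b)] := by
      show coframe A (s (e (c t))) _ = _
      rw [hk, hs0, coframe_smul, hV]
    have hb' : (b : ℂ) ≠ 0 := by exact_mod_cast hb.ne'
    simp only [E, h1, Pi.smul_apply, smul_eq_mul, Matrix.cons_val_zero, Matrix.cons_val_one]
    have : (fderiv ℝ w t 1) 0 * (k * 1) * z + b * ((fderiv ℝ w t 1) 0 * (k * -(z / b))) = 0 := by
      field_simp; ring
    rw [this]; simp
  have hEe : ∀ᶠ τ in 𝓝 t, E τ < ε := hEc.eventually_lt continuousAt_const (by rwa [hE0])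
  refine ⟨s ∘ w, hs0, ?_⟩
  filter_upwards [hEe, hws.eventually_nhds, hce.eventually_nhds, hc.continuous.continuousAt.eventually
    ((isClosed_critValues hπ.holo).isOpen_compl.mem_nhds hct)] with τ h1 h2' h3' h4
  have h2 := h2'.self_of_nhds
  have h3 := h3'.self_of_nhds
  have hπs : ∀ᶠ τ in 𝓝 τ, (π ∘ (s ∘ w)) τ = c τ := by
    filter_upwards [h2', h3'] with τ h5 h6
    exact e.injOn h5.self_of_nhds.2.1 h6 h5.self_of_nhds.2.2
  have hsm : ContMDiffAt 𝓘(ℝ, ℝ) 𝓘(ℝ, Cn 2) 1 (s ∘ w) τ :=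
    (contMDiffAt_real_of_holomorphic (h2.mono fun ζ h => h.1)).comp τ (hwc τ h3).contMDiffAt
  refine ⟨hsm, hπs.self_of_nhds, ?_⟩
  have hvel : vel c τ = baseDeriv π ((s ∘ w) τ) (vel (s ∘ w) τ) := by
    have h5 := vel_comp (γ := s ∘ w) (f := π) (hπ.holo _).real (hsm.mdifferentiableAt one_ne_zero)
    have h8 : π ∘ (s ∘ w) =ᶠ[𝓝 τ] c := hπs
    have h9 : (mfderiv 𝓘(ℝ, ℝ) 𝓘(ℝ, Cn 1) (π ∘ (s ∘ w)) τ : ℝ →L[ℝ] Cn 1) =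
      mfderiv 𝓘(ℝ, ℝ) 𝓘(ℝ, Cn 1) c τ := h8.mfderiv_eq
    have h6 : vel (π ∘ (s ∘ w)) τ = vel c τ := congrFun (congrArg DFunLike.coe h9) (1 : ℝ)
    exact h6.symm.trans h5
  have hpt : π ((s ∘ w) τ) = c τ := hπs.self_of_nhds
  have h7 := sqNorm_gKEBase_eq hA hd hπ (x := (s ∘ w) τ) (by rwa [hpt]) (vel (s ∘ w) τ)
  rw [← hvel, hpt] at h7
  rw [h7]
  refine (sqrt_sqNorm_hermMat_le hb hab _).trans (add_le_add le_rfl ?_)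
  rw [hco τ h2.self_of_nhds.1 h3]
  simp only [Pi.smul_apply, smul_eq_mul]
  exact h1.le

lemma riemDist_invForm_ne_top (hA : IsInvariantCoframeOn lam A) (B : Matrix (Fin 2) (Fin 2) ℂ)
    (x y : X) : riemDist (invForm A B) x y ≠ ⊤ := by
  obtain ⟨D, -, hD⟩ := exists_riemDist_invForm_le hA B
  exact ne_top_of_le_ne_top ENNReal.ofReal_ne_top (hD x y)

lemma toReal_riemDist_triangle (hA : IsInvariantCoframeOn lam A) (B : Matrix (Fin 2) (Fin 2) ℂ)
    (x y z : X) : (riemDist (invForm A B) x z).toReal ≤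
      (riemDist (invForm A B) x y).toReal + (riemDist (invForm A B) y z).toReal := by
  have h := riemDist_invForm_ne_top hA B
  rw [← ENNReal.toReal_add (h _ _) (h _ _)]
  exact ENNReal.toReal_mono (ENNReal.add_ne_top.2 ⟨h _ _, h _ _⟩) riemDist_triangle

lemma continuous_toReal_riemDist (hA : IsInvariantCoframeOn lam A) (B : Matrix (Fin 2) (Fin 2) ℂ)
    (x : X) : Continuous fun y => (riemDist (invForm A B) x y).toReal := by
  refine continuous_iff_continuousAt.2 fun y => Metric.tendsto_nhds.2 fun ε hε => ?_
  filter_upwards [eventually_riemDist_invForm_le (B := B) hA y (half_pos hε)] with y' h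
  have h1 := toReal_riemDist_triangle hA B x y y'
  have h2 := toReal_riemDist_triangle hA B x y' y
  rw [riemDist_comm (x := y') (y := y)] at h2
  have h3 : (riemDist (invForm A B) y y').toReal ≤ ε / 2 :=
    ENNReal.toReal_le_of_le_ofReal (half_pos hε).le h
  rw [Real.dist_eq, abs_lt]
  constructor <;> linarith

/-- Points of a fibre minimizing a continuous function. -/
lemma exists_fibre_min {f : X → ℝ} (hf : Continuous f) (hπ : IsEllipticFibration π) :
    ∃ m : C → X, (∀ q, π (m q) = q) ∧ (∀ x, f (m (π x)) ≤ f x) ∧ Continuous fun q => f (m q) := by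
  have h : ∀ q, ∃ y, π y = q ∧ ∀ x, π x = q → f y ≤ f x := fun q => by
    obtain ⟨y, hy, h⟩ := ((isClosed_singleton (x := q)).preimage
      hπ.holo.continuous).isCompact.exists_isMinOn (hπ.connected q).nonempty hf.continuousOn
    exact ⟨y, hy, fun x hx => h hx⟩
  choose m hm hle using h
  refine ⟨m, hm, fun x => hle _ _ rfl, continuous_iff_lower_upperSemicontinuous.2 ⟨?_, ?_⟩⟩
  · refine lowerSemicontinuous_iff_isClosed_preimage.2 fun r => ?_
    have e : (fun q => f (m q)) ⁻¹' Iic r = π '' (f ⁻¹' Iic r) := by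
      ext q
      exact ⟨fun h => ⟨m q, h, hm q⟩, fun ⟨x, hx, hxq⟩ => (hle q x hxq).trans hx⟩
    rw [e]
    exact isClosedMap_of_holomorphic hπ.holo _ (isClosed_Iic.preimage hf)
  · refine upperSemicontinuous_iff_isOpen_preimage.2 fun r => ?_
    have e : (fun q => f (m q)) ⁻¹' Iio r = π '' (f ⁻¹' Iio r) := by
      ext q
      exact ⟨fun h => ⟨m q, h, hm q⟩, fun ⟨x, hx, hxq⟩ => (hle q x hxq).trans_lt hx⟩
    rw [e]
    exact isOpenMap_of_holomorphic hπ.holo hπ.surj _ (isOpen_Iio.preimage hf)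

/-- The distance to a fibre is at most the distance in the base. -/
theorem exists_riemDist_fibre_le_gKEBase (hA : IsInvariantCoframeOn lam A)
    (hd : ∀ x, (A x).det ≠ 0) (hπ : IsEllipticFibration π) {a b : ℝ} {z : ℂ} (hb : 0 < b)
    (hab : 0 < a - Complex.normSq z / b) (x : X) (q : C) :
    ∃ x', π x' = q ∧ riemDist (invForm A (hermMat a b z)) x x' ≤
      ENNReal.ofReal (Real.sqrt ((a - Complex.normSq z / b) / 2)) *
        riemDist (gKEBase A π hπ.surj) (π x) q := by
  set N := invForm A (hermMat a b z) with hN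
  set k := Real.sqrt ((a - Complex.normSq z / b) / 2) with hk
  have hk0 : 0 < k := by positivity
  obtain ⟨m, hm, hle, hF⟩ := exists_fibre_min (continuous_toReal_riemDist hA (hermMat a b z) x) hπ
  set F : C → ℝ := fun q => (riemDist N x (m q)).toReal with hFdef
  have hfin := riemDist_invForm_ne_top hA (hermMat a b z)
  refine ⟨m q, hm q, ?_⟩
  have hF0 : F (π x) = 0 := by
    refine le_antisymm ((hle x).trans ?_) ENNReal.toReal_nonneg
    rw [riemDist_self, ENNReal.toReal_zero]
  have main : ∀ c : ℝ → C, ContMDiff 𝓘(ℝ, ℝ) 𝓘(ℝ, Cn 1) 1 c → ∀ s t, s ≤ t →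
      ENNReal.ofReal (F (c t) - F (c s)) ≤ ENNReal.ofReal k * gLen (gKEBase A π hπ.surj) c s t := by
    intro c hc s t hst
    refine ofReal_sub_le_of_avoid hF hc.continuous (fun r s t h h' => gLen_add h h')
      (finite_critValues hA hd hπ) (fun s t hst hreg => ?_) hst
    refine ofReal_sub_le_of_local hst (hF.comp hc.continuous).continuousOn
      (fun r s t h h' => gLen_add h h') fun τ hτ ε hε => ?_
    obtain ⟨γ, hγ0, hγ⟩ := exists_horizontal_lift (a := a) (z := z) hA hd hπ hb hab.le hc
      (hm (c τ)) (hreg τ ⟨hτ.1, hτ.2.le⟩) hε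
    obtain ⟨r, hr, hball⟩ := Metric.eventually_nhds_iff.1 hγ
    filter_upwards [Ioo_mem_nhdsGT (show τ < τ + r by linarith)] with σ hσ
    have hI : ∀ u ∈ Icc τ σ, dist u τ < r := fun u hu => by
      rw [Real.dist_eq, abs_of_nonneg (by linarith [hu.1])]
      linarith [hu.2, hσ.2]
    have h1 := riemDist_le_gLen (g := N) (γ := γ) (a := τ) (b := σ)
      (fun u hu => (hball (hI u hu)).1.contMDiffWithinAt) hσ.1.le
    have h2 := gLen_le_add (g := N) (h := gKEBase A π hπ.surj) (γ := γ) (c := c) (a := τ) (b := σ)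
      hk0.le hε.le fun u hu => (hball (hI u hu)).2.2
    refine le_trans ?_ (h1.trans h2)
    have h3 : F (c σ) ≤ (riemDist N x (γ σ)).toReal := by
      have := hle (γ σ)
      rwa [(hball (hI σ ⟨hσ.1.le, le_rfl⟩)).2.1] at this
    have h4 := toReal_riemDist_triangle hA (hermMat a b z) x (γ τ) (γ σ)
    rw [ENNReal.ofReal_le_iff_le_toReal (hfin _ _)]
    have h5 : F (c τ) = (riemDist N x (γ τ)).toReal := by rw [hγ0]
    show F (c σ) - F (c τ) ≤ _
    rw [h5]
    linarith
  have hFq : riemDist N x (m q) = ENNReal.ofReal (F q) := (ENNReal.ofReal_toReal (hfin _ _)).symm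
  rw [hFq]
  by_contra! hlt
  have hK0 : ENNReal.ofReal k ≠ 0 := by simpa using hk0
  rw [mul_comm, ← ENNReal.lt_div_iff_mul_lt (.inl hK0) (.inl ENNReal.ofReal_ne_top)] at hlt
  obtain ⟨c, h0, rfl, hc, hl⟩ := exists_curve_of_riemDist_lt hlt
  rw [ENNReal.lt_div_iff_mul_lt (.inl hK0) (.inl ENNReal.ofReal_ne_top), mul_comm] at hl
  have := main c hc 0 1 zero_le_one
  rw [h0, hF0, sub_zero] at this
  exact absurd hl (not_lt.2 this)

/-- The distances of an invariant metric with short fibres, up to the fibres. -/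
theorem riemDist_invForm_le_gKEBase (hA : IsInvariantCoframeOn lam A)
    (hd : ∀ x, (A x).det ≠ 0) (hπ : IsEllipticFibration π) {a b δ : ℝ} {z : ℂ} (hb : 0 < b)
    (hab : 0 < a - Complex.normSq z / b)
    (hδ : ∀ x y, π x = π y → riemDist (invForm A (hermMat a b z)) x y ≤ ENNReal.ofReal δ)
    (x y : X) : riemDist (invForm A (hermMat a b z)) x y ≤
      ENNReal.ofReal (Real.sqrt ((a - Complex.normSq z / b) / 2)) *
        riemDist (gKEBase A π hπ.surj) (π x) (π y) + ENNReal.ofReal δ := by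
  obtain ⟨x', hx', h⟩ := exists_riemDist_fibre_le_gKEBase (a := a) (z := z) hA hd hπ hb hab x (π y)
  exact riemDist_triangle.trans (add_le_add h (hδ x' y hx'))

/-- The distances of the base are bounded. -/
theorem exists_riemDist_gKEBase_le (hA : IsInvariantCoframeOn lam A)
    (hd : ∀ x, (A x).det ≠ 0) (hπ : IsEllipticFibration π) : ∃ D : ℝ, 0 ≤ D ∧ ∀ p q,
      riemDist (gKEBase A π hπ.surj) p q ≤ ENNReal.ofReal D := by
  obtain ⟨D, hD, h⟩ := exists_riemDist_invForm_le hA (hermMat 1 1 0)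
  refine ⟨Real.sqrt (2 / (1 - Complex.normSq 0 / 1)) * D, by positivity, fun p q => ?_⟩
  obtain ⟨x, rfl⟩ := hπ.surj p
  obtain ⟨y, rfl⟩ := hπ.surj q
  refine (riemDist_gKEBase_le (a := 1) (z := 0) hA hd hπ one_pos (by simp)).trans ?_
  rw [ENNReal.ofReal_mul (Real.sqrt_nonneg _)]
  exact mul_le_mul_right (h x y) _

lemma smul_invForm (r a b : ℝ) (z : ℂ) :
    (fun x => r • invForm A (hermMat a b z) x) = invForm A (hermMat (r * a) (r * b) (r * z)) := by
  have h : ∀ x (v w : Cn 2), r * frameForm A (hermMat a b z) x v w =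
      frameForm A (hermMat (r * a) (r * b) (r * z)) x v w := fun x v w => by
    simp [frameForm, dotProduct, mulVec, hermMat, Fin.sum_univ_two]
    ring
  funext x
  refine ContinuousLinearMap.ext fun v => ContinuousLinearMap.ext fun w => ?_
  exact h x v w

/-- A family of invariant metrics with collapsing fibres converges to the base. -/
theorem tendsto_ghEDist_invForm [Nonempty X] {ι : Type*} {l : Filter ι}
    (hA : IsInvariantCoframeOn lam A) (hd : ∀ x, (A x).det ≠ 0) (hπ : IsEllipticFibration π)
    {a b : ι → ℝ} {z : ι → ℂ} (hb0 : ∀ᶠ t in l, 0 < b t) (ha : Tendsto a l (𝓝 2))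
    (hb : Tendsto b l (𝓝 0)) (hz : Tendsto z l (𝓝 0))
    (hκ : Tendsto (fun t => a t - Complex.normSq (z t) / b t) l (𝓝 2)) :
    Tendsto (fun t => ghEDist (riemDist (invForm A (hermMat (a t) (b t) (z t))))
      (riemDist (gKEBase A π hπ.surj))) l (𝓝 0) := by
  rw [ENNReal.tendsto_nhds_zero]
  intro η hη
  obtain ⟨r, hr0, hrη⟩ := ENNReal.lt_iff_exists_nnreal_btwn.1 hη
  have hr : (0 : ℝ) < r := by exact_mod_cast hr0
  obtain ⟨D, hD0, hD⟩ := exists_riemDist_gKEBase_le hA hd hπ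
  obtain ⟨β, hβ, hfib⟩ := exists_fibre_diam_le hA hπ hr (K := 2) two_pos
  have hk : Tendsto (fun t => |Real.sqrt ((a t - Complex.normSq (z t) / b t) / 2) - 1| * D) l
      (𝓝 0) := by
    have h1 := (Real.continuous_sqrt.tendsto _).comp (hκ.div_const 2)
    rw [div_self two_ne_zero, Real.sqrt_one] at h1
    simpa using ((h1.sub_const 1).abs).mul_const D
  have hs : Tendsto (fun t => a t + b t + ‖z t‖) l (𝓝 2) := by
    simpa using (ha.add hb).add hz.norm
  filter_upwards [hb0, ha.eventually (lt_mem_nhds (two_pos)), hb.eventually (gt_mem_nhds hβ),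
    hκ.eventually (lt_mem_nhds two_pos), hk.eventually (gt_mem_nhds hr),
    hs.eventually (gt_mem_nhds (show (2 : ℝ) < 2 ^ 2 by norm_num))] with t h1 h2 h3 h4 h5 h6
  refine le_trans (ghEDist_le_of_surjective (fun _ => riemDist_self) (fun _ _ => riemDist_comm)
    (fun _ _ _ => riemDist_triangle) (riemDist_invForm_ne_top hA _) (fun _ => riemDist_self)
    (fun _ _ => riemDist_comm) (fun _ _ _ => riemDist_triangle)
    (fun p q => ne_top_of_le_ne_top ENNReal.ofReal_ne_top (hD p q)) hπ.surj hr fun x y => ?_)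
    ((ENNReal.ofReal_coe_nnreal).le.trans hrη.le)
  set k := Real.sqrt ((a t - Complex.normSq (z t) / b t) / 2) with hkdef
  have hk0 : 0 < k := by positivity
  have hN := riemDist_invForm_ne_top hA (hermMat (a t) (b t) (z t)) x y
  have hC : riemDist (gKEBase A π hπ.surj) (π x) (π y) ≠ ⊤ :=
    ne_top_of_le_ne_top ENNReal.ofReal_ne_top (hD _ _)
  have hCD := ENNReal.toReal_le_of_le_ofReal hD0 (hD (π x) (π y))
  have hup := riemDist_invForm_le_gKEBase (a := a t) (z := z t) hA hd hπ h1 h4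
    (hfib (a t) (b t) (z t) h2.le h1.le h3.le h6.le) x y
  have hlo := riemDist_gKEBase_le (a := a t) (b := b t) (z := z t) (x := x) (y := y) hA hd hπ h1 h4
  have hup' := ENNReal.toReal_mono (ENNReal.add_ne_top.2
    ⟨ENNReal.mul_ne_top ENNReal.ofReal_ne_top hC, ENNReal.ofReal_ne_top⟩) hup
  rw [ENNReal.toReal_add (ENNReal.mul_ne_top ENNReal.ofReal_ne_top hC) ENNReal.ofReal_ne_top,
    ENNReal.toReal_mul, ENNReal.toReal_ofReal hk0.le, ENNReal.toReal_ofReal hr.le] at hup'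
  have hlo' := ENNReal.toReal_mono (ENNReal.mul_ne_top ENNReal.ofReal_ne_top hN) hlo
  rw [ENNReal.toReal_mul, ENNReal.toReal_ofReal (Real.sqrt_nonneg _), ← inv_div, Real.sqrt_inv,
    ← hkdef, inv_mul_eq_div, le_div_iff₀ hk0, mul_comm] at hlo'
  set dN := (riemDist (invForm A (hermMat (a t) (b t) (z t))) x y).toReal
  set dC := (riemDist (gKEBase A π hπ.surj) (π x) (π y)).toReal
  have hC0 : 0 ≤ dC := ENNReal.toReal_nonneg
  have h7 : |(k - 1) * dC| ≤ |k - 1| * D := by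
    rw [abs_mul, abs_of_nonneg hC0]; gcongr
  have h8 := abs_le.1 (h7.trans h5.le)
  rw [abs_le]
  constructor <;> linarith

end Collapsing

end

theorem mainTheorem5
    {G : Type*} [TopologicalSpace G] [Group G] [ChartedSpace (EuclideanSpace ℝ (Fin 4)) G]
    [LieGroup (𝓡 4) ∞ G] [SimplyConnectedSpace G]
    (φ : GroupLieAlgebra (𝓡 4) G ≃ₗ[ℝ] SL2R) (hφ : ∀ v w, φ ⁅v, w⁆ = slBracket (φ v) (φ w))
    {X : Type*} [TopologicalSpace X] [T2Space X] [CompactSpace X]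
    [ChartedSpace (Cn 2) X] [IsManifold 𝓘(ℂ, Cn 2) ω X]
    {C : Type*} [TopologicalSpace C] [T2Space C]
    [ChartedSpace (Cn 1) C] [IsManifold 𝓘(ℂ, Cn 1) ω C]
    (lam : ℝ) (Γ : Subgroup G) (P : G → X) (hP : IsQuotientModel lam φ Γ P)
    (π : X → C) (hπ : IsEllipticFibration π)
    (g₀ : BilinField 2 X) (hg₀ : IsHermitianMetricOn g₀ univ)
    (hg₀' : IsLocallyHomogeneous P g₀) :
    (∃ g, IsLocallyHomogeneousHCF P g₀ g) ∧
    ∃ gKE : BilinField 1 C, IsBaseKahlerEinstein π gKE ∧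
      (∀ h, IsBaseKahlerEinstein π h → ∀ p ∉ critValues π, h p = gKE p) ∧
      ∀ g, IsLocallyHomogeneousHCF P g₀ g →
        Tendsto (fun t : ℝ => ghEDist (riemDist fun x => (1 + t)⁻¹ • g t x) (riemDist gKE))
          atTop (𝓝 0) := by
  have hA := hP.isInvariantCoframeOn hφ
  have hd := hP.det_coframeMat_ne_zero
  have : PathConnectedSpace G := inferInstance
  have : PreconnectedSpace X :=
    hP.surj.denseRange.preconnectedSpace hP.smooth.contMDiff.continuous
  have : Nonempty X := ⟨P 1⟩
  refine ⟨hP.exists_isLocallyHomogeneousHCF hφ hg₀ hg₀', gKEBase hP.coframeMat π hπ.surj,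
    isBaseKahlerEinstein_gKEBase hA hd hπ, fun h hh p hp => hh.eq_gKEBase hA hd hπ hp,
    fun g hg => ?_⟩
  obtain ⟨x, y, z, hs, hg⟩ := hP.exists_isFlowSolution hφ hg
  obtain ⟨h1, h2, h3, h4⟩ := hs.tendsto (le_add_of_nonneg_right (sq_nonneg lam))
  have h5 : Tendsto (fun t => x t / (1 + t) - Complex.normSq (z t / (1 + t)) / (y t / (1 + t)))
      atTop (𝓝 2) := by
    refine h4.congr' ?_
    filter_upwards [eventually_ge_atTop (0 : ℝ)] with t ht
    have hy := hs.pos_y t ht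
    have ht' : 0 < 1 + t := by positivity
    have e : Complex.normSq (1 + (t : ℂ)) = (1 + t) ^ 2 := by
      rw [show (1 + (t : ℂ)) = ((1 + t : ℝ) : ℂ) by push_cast; rfl, Complex.normSq_ofReal]; ring
    rw [Complex.normSq_div, e]
    field_simp
  refine (tendsto_ghEDist_invForm hA hd hπ ?_ h1 h2 h3 h5).congr' ?_
  · filter_upwards [eventually_ge_atTop (0 : ℝ)] with t ht
    have hy := hs.pos_y t ht
    positivity
  · filter_upwards [eventually_ge_atTop (0 : ℝ)] with t ht
    have e1 : (((1 + t)⁻¹ : ℝ) : ℂ) * z t = z t / (1 + t) := by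
      push_cast; rw [div_eq_inv_mul]
    rw [hg t ht, smul_invForm, e1, ← div_eq_inv_mul, ← div_eq_inv_mul]
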